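/- **Setting.** Let $d\ge 1$, $\alpha\in(0,2)$, and let $m(dx)=M(x)\,dx$ on $\mathbb R^d$ with $M$ measurable and $0<M_0\le M\le\overline M<\infty$. Let $C:\mathbb R^d\times\mathbb R^d\to[0,\infty)$ be measurable and bounded. Let $X=(X_t,\mathbb P_x)$ be a Hunt process on $\mathbb R^d$ (possibly with finite lifetime; functions are extended by $0$ to the cemetery) with Lévy system $(N,H)$, $H_t=t$, $N(x,dy)=2C(x,y)|x-y|^{-(d+\alpha)}m(dy)$; that is, for every measurable $f:\mathbb R^d\times\mathbb R^d\to[0,\infty]$ vanishing on the diagonal, every $x\in\mathbb R^d$ and $t>0$, $$\mathbb E_x\Big[\sum_{0<s\le t}f(X_{s-},X_s)\Big]=\mathbb E_x\Big[\int_0^t\int_{\mathbb R^d}\frac{2C(X_s,y)f(X_s,y)}{|X_s-y|^{d+\alpha}}\,m(dy)\,ds\Big].$$ Assume that $X$ has a transition density $p(t,x,y)$ with respect to $m$ that is jointly continuous on $(0,\infty)\times\mathbb R^d\times\mathbb R^d$ and satisfies, for some constants $M_1,M_2>0$ and all $t>0$, $x,y\in\mathbb R^d$, $$M_1t^{-d/\alpha}\Big(1\wedge\frac{t^{1/\alpha}}{|x-y|}\Big)^{d+\alpha}\le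 p(t,x,y)\le M_2t^{-d/\alpha}\Big(1\wedge\frac{t^{1/\alpha}}{|x-y|}\Big)^{d+\alpha}$$ (the minimum being $1$ when $x=y$). Say that a measurable function $F$ on $\mathbb R^d\times\mathbb R^d$ belongs to $\mathbf J_{d,\alpha}$ if it is bounded, vanishes on the diagonal, and the function $V_F(y)=\int_{\mathbb R^d}|F(y,u)|\,|y-u|^{-(d+\alpha)}\,du$ satisfies $$\lim_{t\downarrow0}\ \sup_{x\in\mathbb R^d}\int_0^t\int_{\mathbb R^d}p(s,x,y)V_F(y)\,dy\,ds=0.$$ Let $F$ be such that both $F$ and $\widetilde F(x,y)=F(y,x)$ belong to $\mathbf J_{d,\alpha}$, and put $A_t=\sum_{0<s\le t}F(X_{s-},X_s)$. Define $q_0=p$ and, for $n\ge1$, $$q_n(t,x,z)=\sum_{i=1}^n\binom ni\int_0^t\int_{\mathbb R^d}p(s,x,w)\int_{\mathbb R^d}\frac{2C(w,y)F(w,y)^i}{|w-y|^{d+\alpha}}\,q_{n-i}(t-s,y,z)\,m(dy)\,m(dw)\,ds .$$ **Proposition 3.5.** For all $t>0$ and $x,z\in\mathbb R^d$ the integrals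 defining $q_n(t,x,z)$, $n\ge 1$, converge absolutely, and so does the series $$q(t,x,z)=\sum_{n=0}^\infty(-1)^n\frac{q_n(t,x,z)}{n!}.$$ Moreover: (i) for every bounded measurable $g:\mathbb R^d\to\mathbb R$, every $t>0$ and every $x\in\mathbb R^d$, the sum $A_t$ converges absolutely $\mathbb P_x$-a.s., both sides below are absolutely convergent, and $$\int_{\mathbb R^d}q(t,x,z)g(z)\,m(dz)=\mathbb E_x\big[e^{-A_t}g(X_t)\big];$$ (ii) for all $t,s>0$ and $x,z\in\mathbb R^d$, with an absolutely convergent integral, $$\int_{\mathbb R^d}q(t,x,y)\,q(s,y,z)\,m(dy)=q(t+s,x,z).$$ -/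

import Mathlib

open MeasureTheory Set Filter Topology
open scoped ENNReal NNReal

/-- The one-point compactification `E ∪ {∂}` carries its Borel `σ`-algebra. -/
instance onePointMeasurableSpace (E : Type*) [TopologicalSpace E] :
    MeasurableSpace (OnePoint E) := borel (OnePoint E)

instance onePointBorelSpace (E : Type*) [TopologicalSpace E] : BorelSpace (OnePoint E) := ⟨rfl⟩

/-- A Hunt process on the (locally compact) space `E`, defined on `Ω`, with cemetery `∂` the point
at infinity of the one-point compactification of `E`. (The strong Markov property is required under
`P x` for every starting point `x`; for general initial laws it follows by integration.) -/
structure HuntProcess (E : Type*) [TopologicalSpace E] (Ω : Type*) [mΩ : MeasurableSpace Ω] where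
  /-- the coordinates `X t` -/
  X : ℝ≥0 → Ω → OnePoint E
  /-- the law of the process started from `x` -/
  P : OnePoint E → Measure Ω
  /-- an admissible filtration -/
  filt : Filtration ℝ≥0 mΩ
  isProbabilityMeasure : ∀ x, IsProbabilityMeasure (P x)
  rightContinuous_filt : filt.IsRightContinuous
  adapted : ∀ t, Measurable[filt t] (X t)
  measurable_transition : ∀ t (B : Set (OnePoint E)), MeasurableSet B →
    Measurable fun x => P x (X t ⁻¹' B)
  start : ∀ x, ∀ᵐ ω ∂(P x), X 0 ω = x
  cemetery_absorbing : ∀ ω s t, s ≤ t → X s ω = OnePoint.infty → X t ω = OnePoint.infty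
  rightContinuous_path : ∀ ω t, ContinuousWithinAt (fun s => X s ω) (Ici t) t
  leftLimit_path : ∀ ω t, 0 < t → ∃ l, Tendsto (fun s => X s ω) (𝓝[<] t) (𝓝 l)
  strongMarkov : ∀ (x : OnePoint E) (τ : Ω → WithTop ℝ≥0) (hτ : IsStoppingTime filt τ)
    (A : Set Ω), MeasurableSet[hτ.measurableSpace] A →
    ∀ (s : ℝ≥0) (B : Set (OnePoint E)), MeasurableSet B →
      P x (A ∩ {ω | τ ω ≠ ⊤ ∧ X ((τ ω).untopD 0 + s) ω ∈ B}) =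
        ∫⁻ ω in A ∩ {ω | τ ω ≠ ⊤}, P (X ((τ ω).untopD 0) ω) (X s ⁻¹' B) ∂(P x)
  quasiLeftContinuous : ∀ (x : OnePoint E) (τ : ℕ → Ω → WithTop ℝ≥0) (σ : Ω → WithTop ℝ≥0),
    (∀ n, IsStoppingTime filt (τ n)) → (∀ ω, Monotone fun n => τ n ω) →
    (∀ ω, IsLUB (range fun n => τ n ω) (σ ω)) →
    ∀ᵐ ω ∂(P x), σ ω ≠ ⊤ →
      Tendsto (fun n => X ((τ n ω).untopD 0) ω) atTop (𝓝 (X ((σ ω).untopD 0) ω))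

/-- Extension of a function on `E` to `E ∪ {∂}` by zero at `∂`. -/
def extendZero {E R : Type*} [Zero R] (g : E → R) (x : OnePoint E) : R := x.elim 0 g

/-- Extension of a function on `E × E` to `(E ∪ {∂}) × (E ∪ {∂})` by zero. -/
def extendZero₂ {E R : Type*} [Zero R] (f : E → E → R) (x y : OnePoint E) : R :=
  x.elim 0 fun a => y.elim 0 fun b => f a b

/-- `∑_{0 < s ≤ t} f (X_{s-}, X_s)`, where jumps from or to the cemetery do not count. -/
noncomputable def jumpSum {E Ω : Type*} [TopologicalSpace E] [MeasurableSpace Ω]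
    {R : Type*} [AddCommMonoid R] [TopologicalSpace R]
    (Z : HuntProcess E Ω) (f : E → E → R) (t : ℝ≥0) (ω : Ω) : R :=
  ∑' s : Ioc (0 : ℝ≥0) t,
    extendZero₂ f (Function.leftLim (fun u => Z.X u ω) s.1) (Z.X s.1 ω)

/-- The reference measure `m(dx) = M(x) dx`. -/
noncomputable def refMeasure {d : ℕ} (M : EuclideanSpace ℝ (Fin d) → ℝ) :
    Measure (EuclideanSpace ℝ (Fin d)) :=
  volume.withDensity fun x => ENNReal.ofReal (M x)

/-- The jump intensity `2 C(x,y) / |x - y| ^ (d + α)` (with respect to `m`). -/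
noncomputable def jumpDensity {d : ℕ} (α : ℝ)
    (C : EuclideanSpace ℝ (Fin d) → EuclideanSpace ℝ (Fin d) → ℝ)
    (x y : EuclideanSpace ℝ (Fin d)) : ℝ :=
  2 * C x y / ‖x - y‖ ^ ((d : ℝ) + α)

/-- `Z` has the Lévy system `(N, H)` with `H t = t` and
`N(x,dy) = 2 C(x,y) |x - y| ^ (-(d + α)) m(dy)`. -/
def HasLevySystem {d : ℕ} {Ω : Type*} [MeasurableSpace Ω]
    (Z : HuntProcess (EuclideanSpace ℝ (Fin d)) Ω) (α : ℝ)
    (C : EuclideanSpace ℝ (Fin d) → EuclideanSpace ℝ (Fin d) → ℝ)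
    (m : Measure (EuclideanSpace ℝ (Fin d))) : Prop :=
  ∀ f : EuclideanSpace ℝ (Fin d) → EuclideanSpace ℝ (Fin d) → ℝ≥0∞,
    Measurable (Function.uncurry f) → (∀ x, f x x = 0) →
    ∀ (x : EuclideanSpace ℝ (Fin d)) (t : ℝ≥0), 0 < t →
      ∫⁻ ω, jumpSum Z f t ω ∂(Z.P x) =
        ∫⁻ ω, (∫⁻ s in Ioc (0 : ℝ) t,
          extendZero (fun w => ∫⁻ y, ENNReal.ofReal (jumpDensity α C w y) * f w y ∂m)
            (Z.X s.toNNReal ω)) ∂(Z.P x)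

/-- `p` is the transition density of `Z` with respect to `m`. -/
def HasTransitionDensity {d : ℕ} {Ω : Type*} [MeasurableSpace Ω]
    (Z : HuntProcess (EuclideanSpace ℝ (Fin d)) Ω)
    (m : Measure (EuclideanSpace ℝ (Fin d)))
    (p : ℝ → EuclideanSpace ℝ (Fin d) → EuclideanSpace ℝ (Fin d) → ℝ) : Prop :=
  ∀ (t : ℝ≥0), 0 < t → ∀ (x : EuclideanSpace ℝ (Fin d)) (B : Set (EuclideanSpace ℝ (Fin d))),
    MeasurableSet B →
      Z.P x {ω | ∃ y ∈ B, Z.X t ω = (y : OnePoint (EuclideanSpace ℝ (Fin d)))} =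
        ∫⁻ y in B, ENNReal.ofReal (p t x y) ∂m

/-- `t ^ (-d/α) * (1 ∧ t ^ (1/α) / |x - y|) ^ (d + α)`, where the minimum is `1` if `x = y`. -/
noncomputable def stableProfile {d : ℕ} (α t : ℝ) (x y : EuclideanSpace ℝ (Fin d)) : ℝ :=
  open Classical in
  t ^ (-((d : ℝ) / α)) *
    (if x = y then 1 else min 1 (t ^ (1 / α) / ‖x - y‖)) ^ ((d : ℝ) + α)

/-- Kato class (relative to `p`), for the absolute value `V` of a possibly infinite function. -/
def KatoClass {d : ℕ} (p : ℝ → EuclideanSpace ℝ (Fin d) → EuclideanSpace ℝ (Fin d) → ℝ)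
    (V : EuclideanSpace ℝ (Fin d) → ℝ≥0∞) : Prop :=
  Tendsto (fun t : ℝ => ⨆ x, ∫⁻ s in Ioc (0 : ℝ) t, ∫⁻ y, ENNReal.ofReal (p s x y) * V y)
    (𝓝[>] 0) (𝓝 0)

/-- The class `J_{d,α}`: measurable bounded functions on `ℝᵈ × ℝᵈ` vanishing on the diagonal such
that `x ↦ ∫ |F(x,y)| / |x - y| ^ (d + α) dy` is in the Kato class. -/
structure JClass {d : ℕ} (α : ℝ)
    (p : ℝ → EuclideanSpace ℝ (Fin d) → EuclideanSpace ℝ (Fin d) → ℝ)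
    (F : EuclideanSpace ℝ (Fin d) → EuclideanSpace ℝ (Fin d) → ℝ) : Prop where
  measurable : Measurable (Function.uncurry F)
  bounded : ∃ L, ∀ x y, |F x y| ≤ L
  diagonal : ∀ x, F x x = 0
  kato : KatoClass p fun x => ∫⁻ y, ENNReal.ofReal (|F x y| / ‖x - y‖ ^ ((d : ℝ) + α))

/-- The functions `q_n`: `q_0 = p`, and `q_n(t,x,z)` is the sum over `1 ≤ i ≤ n` of `C(n,i)` times
`∫_0^t ∫ p(s,x,w) ∫ 2 C(w,y) F(w,y)^i / |w - y|^(d+α) q_{n-i}(t-s,y,z) m(dy) m(dw) ds`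
(here written with `n + 1` for `n` and `i + 1` for `i`). -/
noncomputable def qTerm {d : ℕ} (α : ℝ)
    (C : EuclideanSpace ℝ (Fin d) → EuclideanSpace ℝ (Fin d) → ℝ)
    (m : Measure (EuclideanSpace ℝ (Fin d)))
    (p : ℝ → EuclideanSpace ℝ (Fin d) → EuclideanSpace ℝ (Fin d) → ℝ)
    (F : EuclideanSpace ℝ (Fin d) → EuclideanSpace ℝ (Fin d) → ℝ) :
    ℕ → ℝ → EuclideanSpace ℝ (Fin d) → EuclideanSpace ℝ (Fin d) → ℝ
  | 0 => p
  | n + 1 => fun t x z =>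
      ∑ i : Fin (n + 1), ((n + 1).choose (i.1 + 1) : ℝ) *
        ∫ s in (0 : ℝ)..t, ∫ w, p s x w *
          (∫ y, jumpDensity α C w y * F w y ^ (i.1 + 1) *
            qTerm α C m p F (n - i.1) (t - s) y z ∂m) ∂m
termination_by n => n
decreasing_by omega

theorem qTerm_zero {d : ℕ} (α : ℝ)
    (C : EuclideanSpace ℝ (Fin d) → EuclideanSpace ℝ (Fin d) → ℝ)
    (m : Measure (EuclideanSpace ℝ (Fin d)))
    (p : ℝ → EuclideanSpace ℝ (Fin d) → EuclideanSpace ℝ (Fin d) → ℝ)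
    (F : EuclideanSpace ℝ (Fin d) → EuclideanSpace ℝ (Fin d) → ℝ) :
    qTerm α C m p F 0 = p := by
  rw [qTerm]

theorem qTerm_of_pos {d : ℕ} (α : ℝ)
    (C : EuclideanSpace ℝ (Fin d) → EuclideanSpace ℝ (Fin d) → ℝ)
    (m : Measure (EuclideanSpace ℝ (Fin d)))
    (p : ℝ → EuclideanSpace ℝ (Fin d) → EuclideanSpace ℝ (Fin d) → ℝ)
    (F : EuclideanSpace ℝ (Fin d) → EuclideanSpace ℝ (Fin d) → ℝ)
    (n : ℕ) (hn : 1 ≤ n) (t : ℝ) (x z : EuclideanSpace ℝ (Fin d)) :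
    qTerm α C m p F n t x z =
      ∑ i ∈ Finset.Icc 1 n, (n.choose i : ℝ) *
        ∫ s in (0 : ℝ)..t, ∫ w, p s x w *
          (∫ y, jumpDensity α C w y * F w y ^ i *
            qTerm α C m p F (n - i) (t - s) y z ∂m) ∂m := by
  obtain ⟨n, rfl⟩ : ∃ k, n = k + 1 := ⟨n - 1, by omega⟩
  rw [qTerm, ← Finset.Ico_add_one_right_eq_Icc, Finset.sum_Ico_eq_sum_range, Finset.sum_range]
  refine Finset.sum_congr rfl fun i _ => ?_
  have h1 : 1 + i.1 = i.1 + 1 := by omega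
  have h2 : n + 1 - (i.1 + 1) = n - i.1 := by omega
  rw [h1, h2]

/-- The series `q(t,x,z) = ∑ (-1)^n q_n(t,x,z) / n!`. -/
noncomputable def qSeries {d : ℕ} (α : ℝ)
    (C : EuclideanSpace ℝ (Fin d) → EuclideanSpace ℝ (Fin d) → ℝ)
    (m : Measure (EuclideanSpace ℝ (Fin d)))
    (p : ℝ → EuclideanSpace ℝ (Fin d) → EuclideanSpace ℝ (Fin d) → ℝ)
    (F : EuclideanSpace ℝ (Fin d) → EuclideanSpace ℝ (Fin d) → ℝ)
    (t : ℝ) (x z : EuclideanSpace ℝ (Fin d)) : ℝ :=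
  ∑' n : ℕ, (-1 : ℝ) ^ n * qTerm α C m p F n t x z / (n.factorial : ℝ)

/-! The weight e^{-A_t} changes only at jumps, so along almost every path it telescopes: e^{-A_t} =
1 + Σ_{s<t} e^{-A_{s-}} (e^{-F(X_{s-},X_s)} - 1), because almost surely F does not charge a jump at
the fixed time t. Multiply by g(X_t) and take means. The Markov property and the Lévy system turn
the identity into the forward equation u_t(g) = P_t g(x) + ∫_0^t u_s(K P_{t-s} g) ds for u_t(g) =
E_x[e^{-A_t} g(X_t)]. Here K is the kernel with density j (e^{-F} - 1), and j is the jump intensity.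
The formal solution is the perturbation series of p by K. Expanding e^{-F} - 1 in powers of F and
collecting the terms of total degree n gives exactly (-1)^n q_n / n!. What has to be justified is
the convergence of the series, the uniqueness of the solution and the signs.

Signs. All interchanges are done in [0,∞], where Tonelli needs no integrability. Write e^{-F} - 1 =
a - b, where a and b sum the positive and the negative parts of the individual Taylor terms, so that
a + b = e^{|F|} - 1. Give every point one of two colours, and let jumps of density j a keep the
colour while jumps of density j b flip it. The coloured perturbation series is nonnegative, and q is
the part with unchanged colour minus the part with changed colour (`qTerm_eq`, `hasSum_qTerm`).

Convergence. The Kato conditions on F and on its transpose bound the expected jump rate over a short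
window by a small θ, from a fixed starting point and towards a fixed end point respectively. Cutting
at the midpoint of the time interval then gives geometric decay of the terms against the profile
t^{-d/α} (`IsKato.pertTerm_le`). Chapman–Kolmogorov for the series comes from sorting by the number
of jumps before the intermediate time (`pertTerm_ck`), and it carries the bounds to arbitrary times.

Uniqueness. Let h_s be the backward solution, one jump followed by the series applied to g.
Integrating the forward equation at time s against h_s produces the same quantity on both sides, and
once this is finite it cancels and leaves u_t(g) equal to the series (`lintegral_forward`). For
e^{-A} the finiteness is an exponential moment. The truncated weight min(e^{Σ|F|}, K) satisfies a
forward inequality, hence lies below the series for e^{|F|} - 1 uniformly in K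
(`lintegral_exp_le_pert`).

Compensation. The Lévy system is assumed only as an identity of means over (0,t] from a fixed point.
For continuous f vanishing near the diagonal, jump sums are limits of sums along a discrete
skeleton, which obey the Markov property. A monotone class argument then gives the conditional form
for all f (`isCompensated`). Left-continuous adapted weights are approximated by weights that are
constant on the blocks of a grid (`lintegral_wJump_mul`). -/

namespace JumpFK

set_option linter.unusedSectionVars false

/-! ### Perturbation series of space-time kernels in [0,∞]. -/

section

section Kernels

variable {T : Type*} [MeasurableSpace T]

/-- Composition of two integral kernels given by densities. -/
noncomputable def kcomp (ν : Measure T) (a b : T → T → ℝ≥0∞) (v w : T) : ℝ≥0∞ :=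
  ∫⁻ u, a v u * b u w ∂ν

variable {ν : Measure T}

theorem measurable_kcomp [SFinite ν] {a b : T → T → ℝ≥0∞}
    (ha : Measurable (Function.uncurry a)) (hb : Measurable (Function.uncurry b)) :
    Measurable (Function.uncurry (kcomp ν a b)) := by
  have h : Measurable (fun q : (T × T) × T => a q.1.1 q.2 * b q.2 q.1.2) :=
    (ha.comp (by fun_prop : Measurable fun q : (T × T) × T => (q.1.1, q.2))).mul
      (hb.comp (by fun_prop : Measurable fun q : (T × T) × T => (q.2, q.1.2)))
  exact h.lintegral_prod_right'

theorem kcomp_assoc [SFinite ν] {a b c : T → T → ℝ≥0∞}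
    (ha : Measurable (Function.uncurry a)) (hb : Measurable (Function.uncurry b))
    (hc : Measurable (Function.uncurry c)) :
    kcomp ν (kcomp ν a b) c = kcomp ν a (kcomp ν b c) := by
  funext v w
  have hav : Measurable (a v) := ha.of_uncurry_left
  have hcw : Measurable fun u => c u w := hc.of_uncurry_right
  have hbw (u : T) : Measurable fun u' => b u' u := hb.of_uncurry_right
  have hbv (u : T) : Measurable (b u) := hb.of_uncurry_left
  unfold kcomp
  have h1 : ∀ u, (∫⁻ u', a v u' * b u' u ∂ν) * c u w = ∫⁻ u', a v u' * b u' u * c u w ∂ν :=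
    fun u => (lintegral_mul_const _ (hav.mul (hbw u))).symm
  have h2 : ∀ u, a v u * (∫⁻ u', b u u' * c u' w ∂ν) = ∫⁻ u', a v u * b u u' * c u' w ∂ν := by
    intro u
    simp only [mul_assoc]
    exact (lintegral_const_mul _ ((hbv u).mul hcw)).symm
  simp only [h1, h2]
  refine lintegral_lintegral_swap (Measurable.aemeasurable ?_)
  exact ((hav.comp measurable_snd).mul (hb.comp measurable_swap)).mul (hcw.comp measurable_fst)

theorem kcomp_tsum_right {ι : Type*} [Countable ι] {a : T → T → ℝ≥0∞} {b : ι → T → T → ℝ≥0∞}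
    (ha : Measurable (Function.uncurry a)) (hb : ∀ i, Measurable (Function.uncurry (b i)))
    (v w : T) :
    kcomp ν a (fun x y => ∑' i, b i x y) v w = ∑' i, kcomp ν a (b i) v w := by
  unfold kcomp
  simp only [← ENNReal.tsum_mul_left]
  exact lintegral_tsum fun i =>
    ((ha.of_uncurry_left).mul ((hb i).of_uncurry_right)).aemeasurable

theorem kcomp_tsum_left {ι : Type*} [Countable ι] {a : ι → T → T → ℝ≥0∞} {b : T → T → ℝ≥0∞}
    (ha : ∀ i, Measurable (Function.uncurry (a i))) (hb : Measurable (Function.uncurry b))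
    (v w : T) :
    kcomp ν (fun x y => ∑' i, a i x y) b v w = ∑' i, kcomp ν (a i) b v w := by
  unfold kcomp
  simp only [← ENNReal.tsum_mul_right]
  exact lintegral_tsum fun i =>
    (((ha i).of_uncurry_left).mul (hb.of_uncurry_right)).aemeasurable

theorem kcomp_mono {a a' b b' : T → T → ℝ≥0∞} (ha : ∀ v w, a v w ≤ a' v w)
    (hb : ∀ v w, b v w ≤ b' v w) (v w : T) : kcomp ν a b v w ≤ kcomp ν a' b' v w :=
  lintegral_mono fun _ => mul_le_mul' (ha _ _) (hb _ _)

end Kernels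

section SpaceTime

variable {S : Type*} [MeasurableSpace S] (μ : Measure S)

/-- A kernel on space-time, followed by an instantaneous jump. -/
noncomputable def rmul (a : ℝ × S → ℝ × S → ℝ≥0∞) (κ : S → S → ℝ≥0∞) (v w : ℝ × S) : ℝ≥0∞ :=
  ∫⁻ u, a v (w.1, u) * κ u w.2 ∂μ

/-- A kernel on space-time, preceded by an instantaneous jump. -/
noncomputable def lmul (κ : S → S → ℝ≥0∞) (a : ℝ × S → ℝ × S → ℝ≥0∞) (v w : ℝ × S) : ℝ≥0∞ :=
  ∫⁻ u, κ v.2 u * a (v.1, u) w ∂μ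

/-- The `n`-th term of the perturbation series of `P` by jumps with density `κ`. -/
noncomputable def pertTerm (P : ℝ × S → ℝ × S → ℝ≥0∞) (κ : S → S → ℝ≥0∞) :
    ℕ → ℝ × S → ℝ × S → ℝ≥0∞
  | 0 => P
  | n + 1 => kcomp (volume.prod μ) (rmul μ P κ) (pertTerm P κ n)

/-- The perturbation series of `P` by jumps with density `κ`. -/
noncomputable def pert (P : ℝ × S → ℝ × S → ℝ≥0∞) (κ : S → S → ℝ≥0∞) (v w : ℝ × S) : ℝ≥0∞ :=
  ∑' n, pertTerm μ P κ n v w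

/-- A (time-inhomogeneous) transition density with respect to `μ`, of mass at most one. -/
structure IsTransition (P : ℝ × S → ℝ × S → ℝ≥0∞) : Prop where
  meas : Measurable (Function.uncurry P)
  causal : ∀ s t x z, t ≤ s → P (s, x) (t, z) = 0
  ck : ∀ s r t x z, s < r → r < t →
    P (s, x) (t, z) = ∫⁻ y, P (s, x) (r, y) * P (r, y) (t, z) ∂μ
  mass : ∀ s t x, ∫⁻ z, P (s, x) (t, z) ∂μ ≤ 1

variable {μ} [SFinite μ] {P : ℝ × S → ℝ × S → ℝ≥0∞} {κ : S → S → ℝ≥0∞}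

theorem measurable_rmul {a : ℝ × S → ℝ × S → ℝ≥0∞} (ha : Measurable (Function.uncurry a))
    (hκ : Measurable (Function.uncurry κ)) : Measurable (Function.uncurry (rmul μ a κ)) := by
  have h : Measurable (fun q : ((ℝ × S) × (ℝ × S)) × S =>
      a q.1.1 (q.1.2.1, q.2) * κ q.2 q.1.2.2) :=
    (ha.comp (by fun_prop :
      Measurable fun q : ((ℝ × S) × (ℝ × S)) × S => (q.1.1, (q.1.2.1, q.2)))).mul
      (hκ.comp (by fun_prop : Measurable fun q : ((ℝ × S) × (ℝ × S)) × S => (q.2, q.1.2.2)))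
  exact h.lintegral_prod_right'

theorem measurable_lmul {a : ℝ × S → ℝ × S → ℝ≥0∞} (ha : Measurable (Function.uncurry a))
    (hκ : Measurable (Function.uncurry κ)) : Measurable (Function.uncurry (lmul μ κ a)) := by
  have h : Measurable (fun q : ((ℝ × S) × (ℝ × S)) × S =>
      κ q.1.1.2 q.2 * a (q.1.1.1, q.2) q.1.2) :=
    (hκ.comp (by fun_prop : Measurable fun q : ((ℝ × S) × (ℝ × S)) × S => (q.1.1.2, q.2))).mul
      (ha.comp (by fun_prop :
        Measurable fun q : ((ℝ × S) × (ℝ × S)) × S => ((q.1.1.1, q.2), q.1.2)))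
  exact h.lintegral_prod_right'

/-- An instantaneous jump belongs to neither factor: it may be read as the end of `a` or as the
beginning of `b`. -/
theorem kcomp_rmul {a b : ℝ × S → ℝ × S → ℝ≥0∞} (ha : Measurable (Function.uncurry a))
    (hb : Measurable (Function.uncurry b)) (hκ : Measurable (Function.uncurry κ)) :
    kcomp (volume.prod μ) (rmul μ a κ) b = kcomp (volume.prod μ) a (lmul μ κ b) := by
  funext v w
  have h1 : Measurable fun u : ℝ × S => rmul μ a κ v u * b u w :=
    (measurable_rmul ha hκ).of_uncurry_left.mul hb.of_uncurry_right
  have h2 : Measurable fun u : ℝ × S => a v u * lmul μ κ b u w :=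
    ha.of_uncurry_left.mul (measurable_lmul hb hκ).of_uncurry_right
  have hav : Measurable (a v) := ha.of_uncurry_left
  have hbw : Measurable fun u => b u w := hb.of_uncurry_right
  unfold kcomp
  rw [lintegral_prod _ h1.aemeasurable, lintegral_prod _ h2.aemeasurable]
  refine lintegral_congr fun s => ?_
  have e1 : ∀ y, rmul μ a κ v (s, y) * b (s, y) w =
      ∫⁻ u, a v (s, u) * κ u y * b (s, y) w ∂μ := fun y =>
    (lintegral_mul_const _ ((hav.comp measurable_prodMk_left).mul hκ.of_uncurry_right)).symm
  have e2 : ∀ u, a v (s, u) * lmul μ κ b (s, u) w =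
      ∫⁻ y, a v (s, u) * κ u y * b (s, y) w ∂μ := by
    intro u
    simp only [mul_assoc]
    exact (lintegral_const_mul _
      (hκ.of_uncurry_left.mul (hbw.comp measurable_prodMk_left))).symm
  simp only [e1, e2]
  refine lintegral_lintegral_swap (Measurable.aemeasurable ?_)
  exact ((hav.comp (measurable_const.prodMk measurable_snd)).mul (hκ.comp measurable_swap)).mul
    (hbw.comp (measurable_const.prodMk measurable_fst))

theorem rmul_kcomp {a b : ℝ × S → ℝ × S → ℝ≥0∞} (ha : Measurable (Function.uncurry a))
    (hb : Measurable (Function.uncurry b)) (hκ : Measurable (Function.uncurry κ)) :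
    rmul μ (kcomp (volume.prod μ) a b) κ = kcomp (volume.prod μ) a (rmul μ b κ) := by
  funext v w
  obtain ⟨t, y⟩ := w
  have hav : Measurable (a v) := ha.of_uncurry_left
  have hκy : Measurable fun u => κ u y := hκ.of_uncurry_right
  have hbt : Measurable fun q : (ℝ × S) × S => b q.1 (t, q.2) :=
    hb.comp (by fun_prop : Measurable fun q : (ℝ × S) × S => (q.1, (t, q.2)))
  unfold rmul kcomp
  have e1 : ∀ u, (∫⁻ u', a v u' * b u' (t, u) ∂(volume.prod μ)) * κ u y =
      ∫⁻ u', a v u' * b u' (t, u) * κ u y ∂(volume.prod μ) := fun u =>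
    (lintegral_mul_const _ (hav.mul (hb.of_uncurry_right))).symm
  have e2 : ∀ u', a v u' * (∫⁻ u, b u' (t, u) * κ u y ∂μ) =
      ∫⁻ u, a v u' * b u' (t, u) * κ u y ∂μ := by
    intro u'
    simp only [mul_assoc]
    exact (lintegral_const_mul _ ((hbt.comp measurable_prodMk_left).mul hκy)).symm
  simp only [e1, e2]
  refine lintegral_lintegral_swap (Measurable.aemeasurable ?_)
  exact ((hav.comp measurable_snd).mul (hbt.comp measurable_swap)).mul (hκy.comp measurable_fst)

theorem rmul_tsum {ι : Type*} [Countable ι] {a : ι → ℝ × S → ℝ × S → ℝ≥0∞}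
    (ha : ∀ i, Measurable (Function.uncurry (a i))) (hκ : Measurable (Function.uncurry κ))
    (v w : ℝ × S) : rmul μ (fun x y => ∑' i, a i x y) κ v w = ∑' i, rmul μ (a i) κ v w := by
  unfold rmul
  simp only [← ENNReal.tsum_mul_right]
  exact lintegral_tsum fun i => (((ha i).of_uncurry_left.comp measurable_prodMk_left).mul
    hκ.of_uncurry_right).aemeasurable

theorem measurable_pertTerm (hP : IsTransition μ P) (hκ : Measurable (Function.uncurry κ)) (n : ℕ) :
    Measurable (Function.uncurry (pertTerm μ P κ n)) := by
  induction n with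
  | zero => exact hP.meas
  | succ n ih => exact measurable_kcomp (measurable_rmul hP.meas hκ) ih

theorem measurable_pert (hP : IsTransition μ P) (hκ : Measurable (Function.uncurry κ)) :
    Measurable (Function.uncurry (pert μ P κ)) :=
  Measurable.tsum fun n => measurable_pertTerm hP hκ n

/-- The recursion isolates the first jump; associativity lets the last one be isolated instead,
which the midpoint estimate and the mass estimate require. -/
theorem pertTerm_succ' (hP : IsTransition μ P) (hκ : Measurable (Function.uncurry κ)) (n : ℕ) :
    pertTerm μ P κ (n + 1) = kcomp (volume.prod μ) (pertTerm μ P κ n) (lmul μ κ P) := by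
  induction n with
  | zero => exact kcomp_rmul hP.meas hP.meas hκ
  | succ n ih =>
    conv_lhs => rw [pertTerm, ih, ← kcomp_assoc (measurable_rmul hP.meas hκ)
      (measurable_pertTerm hP hκ n) (measurable_lmul hP.meas hκ)]
    rfl

theorem rmul_causal {a : ℝ × S → ℝ × S → ℝ≥0∞}
    (ha : ∀ s t x z, t ≤ s → a (s, x) (t, z) = 0) (s t : ℝ) (x z : S) (h : t ≤ s) :
    rmul μ a κ (s, x) (t, z) = 0 := by
  simp [rmul, ha _ _ _ _ h]

theorem lmul_causal {a : ℝ × S → ℝ × S → ℝ≥0∞}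
    (ha : ∀ s t x z, t ≤ s → a (s, x) (t, z) = 0) (s t : ℝ) (x z : S) (h : t ≤ s) :
    lmul μ κ a (s, x) (t, z) = 0 := by
  simp [lmul, ha _ _ _ _ h]

theorem kcomp_causal {a b : ℝ × S → ℝ × S → ℝ≥0∞}
    (ha : ∀ s t x z, t ≤ s → a (s, x) (t, z) = 0) (hb : ∀ s t x z, t ≤ s → b (s, x) (t, z) = 0)
    (s t : ℝ) (x z : S) (h : t ≤ s) : kcomp (volume.prod μ) a b (s, x) (t, z) = 0 := by
  unfold kcomp
  rw [lintegral_eq_zero_of_ae_eq_zero]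
  refine Eventually.of_forall fun u => ?_
  obtain ⟨r, y⟩ := u
  rcases le_or_gt r s with h1 | h1
  · simp [ha _ _ _ _ h1]
  · simp [hb r t y z (h.trans h1.le)]

theorem pertTerm_causal (hP : IsTransition μ P) (n : ℕ) (s t : ℝ) (x z : S) (h : t ≤ s) :
    pertTerm μ P κ n (s, x) (t, z) = 0 := by
  induction n generalizing s t x z with
  | zero => exact hP.causal _ _ _ _ h
  | succ n ih => exact kcomp_causal (rmul_causal hP.causal) ih s t x z h

theorem pert_causal (hP : IsTransition μ P) (s t : ℝ) (x z : S) (h : t ≤ s) :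
    pert μ P κ (s, x) (t, z) = 0 := by
  simp [pert, pertTerm_causal hP _ _ _ _ _ h]

/-- Duhamel's formula at the first jump. In [0,∞] it is only a reindexing of the series, valid
before any convergence is known. -/
theorem pert_eq_left (hP : IsTransition μ P) (hκ : Measurable (Function.uncurry κ)) (v w : ℝ × S) :
    pert μ P κ v w = P v w + kcomp (volume.prod μ) (rmul μ P κ) (pert μ P κ) v w := by
  have h := kcomp_tsum_right (ν := volume.prod μ) (measurable_rmul (μ := μ) hP.meas hκ)
    (measurable_pertTerm hP hκ) v w
  change _ = P v w + kcomp _ _ (fun x y => ∑' n, pertTerm μ P κ n x y) v w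
  rw [h, pert, tsum_eq_zero_add' ENNReal.summable]
  rfl

theorem pert_eq_right (hP : IsTransition μ P) (hκ : Measurable (Function.uncurry κ)) (v w : ℝ × S) :
    pert μ P κ v w = P v w + kcomp (volume.prod μ) (pert μ P κ) (lmul μ κ P) v w := by
  have h := kcomp_tsum_left (ν := volume.prod μ) (measurable_pertTerm hP hκ)
    (measurable_lmul (μ := μ) hP.meas hκ) v w
  change _ = P v w + kcomp _ (fun x y => ∑' n, pertTerm μ P κ n x y) _ v w
  rw [h, pert, tsum_eq_zero_add' ENNReal.summable]
  simp only [pertTerm_succ' hP hκ]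
  rfl

end SpaceTime

end

/-! ### Chapman–Kolmogorov and Kato estimates for the perturbation series. -/

section

theorem tsum_antidiagonal (g : ℕ → ℕ → ℝ≥0∞) :
    ∑' n, ∑ k ∈ Finset.range (n + 1), g k (n - k) = ∑' k, ∑' l, g k l := by
  rw [← ENNReal.tsum_prod, ← Finset.HasAntidiagonal.sigmaAntidiagonalEquivProd.tsum_eq, ENNReal.tsum_sigma']
  refine tsum_congr fun n => ?_
  rw [tsum_fintype, ← Finset.Nat.sum_antidiagonal_eq_sum_range_succ (fun i j => g i j),
    ← Finset.sum_coe_sort]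
  rfl

section SpaceTime

variable {S : Type*} [MeasurableSpace S] {μ : Measure S} [SFinite μ]
  {P : ℝ × S → ℝ × S → ℝ≥0∞} {κ : S → S → ℝ≥0∞}

theorem measurable_fst_lt (r : ℝ) : MeasurableSet {u : ℝ × S | u.1 < r} :=
  measurableSet_lt measurable_fst measurable_const

theorem measurable_lt_fst (r : ℝ) : MeasurableSet {u : ℝ × S | r < u.1} :=
  measurableSet_lt measurable_const measurable_fst

theorem ae_fst_ne (r : ℝ) : ∀ᵐ u : ℝ × S ∂(volume.prod μ), u.1 ≠ r := by
  have : {u : ℝ × S | ¬ u.1 ≠ r} = ({r} : Set ℝ) ×ˢ univ := by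
    ext u; simp
  rw [ae_iff, this, Measure.prod_prod]
  simp

theorem lintegral_split (r : ℝ) {f : ℝ × S → ℝ≥0∞} :
    ∫⁻ u, f u ∂(volume.prod μ) =
      ∫⁻ u in {u | u.1 < r}, f u ∂(volume.prod μ) + ∫⁻ u in {u | r < u.1}, f u ∂(volume.prod μ) := by
  rw [← lintegral_add_compl f (measurable_fst_lt r)]
  congr 1
  refine setLIntegral_congr ?_
  filter_upwards [ae_fst_ne (μ := μ) r] with u hu
  refine propext ⟨fun h => ?_, fun h => ?_⟩
  · exact lt_of_le_of_ne (not_lt.1 h) (Ne.symm hu)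
  · exact not_lt.2 (le_of_lt h)

theorem setLIntegral_eq_of_zero {f : ℝ × S → ℝ≥0∞} {A : Set (ℝ × S)} (hA : MeasurableSet A)
    (h : ∀ u, u ∉ A → f u = 0) :
    ∫⁻ u in A, f u ∂(volume.prod μ) = ∫⁻ u, f u ∂(volume.prod μ) := by
  rw [← lintegral_indicator hA]
  refine lintegral_congr fun u => ?_
  by_cases hu : u ∈ A
  · simp [hu]
  · simp [hu, h u hu]

theorem rmul_ck (hP : IsTransition μ P) (hκ : Measurable (Function.uncurry κ))
    (s r t : ℝ) (x z : S) (hsr : s < r) (hrt : r < t) :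
    rmul μ P κ (s, x) (t, z) = ∫⁻ y, P (s, x) (r, y) * rmul μ P κ (r, y) (t, z) ∂μ := by
  have hPm := hP.meas
  have h1 : Measurable fun y => P (s, x) (r, y) := hPm.comp (by fun_prop :
    Measurable fun y : S => (((s, x) : ℝ × S), ((r, y) : ℝ × S)))
  have h2 : Measurable fun q : S × S => P (r, q.2) (t, q.1) := hPm.comp (by fun_prop :
    Measurable fun q : S × S => (((r, q.2) : ℝ × S), ((t, q.1) : ℝ × S)))
  have h3 : Measurable fun u => κ u z := hκ.of_uncurry_right
  have e1 : ∀ u, P (s, x) (t, u) * κ u z =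
      ∫⁻ y, P (s, x) (r, y) * P (r, y) (t, u) * κ u z ∂μ := by
    intro u
    rw [hP.ck s r t x u hsr hrt]
    exact (lintegral_mul_const _ (h1.mul (h2.comp measurable_prodMk_left))).symm
  have e2 : ∀ y, P (s, x) (r, y) * (∫⁻ u, P (r, y) (t, u) * κ u z ∂μ) =
      ∫⁻ u, P (s, x) (r, y) * P (r, y) (t, u) * κ u z ∂μ := by
    intro y
    simp only [mul_assoc]
    exact (lintegral_const_mul _ ((h2.comp measurable_prodMk_right).mul h3)).symm
  unfold rmul
  simp only [e1, e2]
  exact lintegral_lintegral_swap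
    (((h1.comp measurable_snd).mul h2).mul (h3.comp measurable_fst)).aemeasurable

/-- The index k counts the jumps before time r. If the first jump comes before r, the induction
hypothesis applies from there on; if it comes after r, then k = 0 and the identity is
Chapman–Kolmogorov for `P` on the stretch before that jump. -/
theorem pertTerm_ck (hP : IsTransition μ P) (hκ : Measurable (Function.uncurry κ)) (n : ℕ)
    (s r t : ℝ) (x z : S) (hsr : s < r) (hrt : r < t) :
    pertTerm μ P κ n (s, x) (t, z) = ∑ k ∈ Finset.range (n + 1),
      ∫⁻ y, pertTerm μ P κ k (s, x) (r, y) * pertTerm μ P κ (n - k) (r, y) (t, z) ∂μ := by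
  induction n generalizing s x with
  | zero => simpa [pertTerm] using hP.ck s r t x z hsr hrt
  | succ n ih =>
    have hR := measurable_pertTerm (μ := μ) hP hκ
    have hPK := measurable_rmul (μ := μ) hP.meas hκ
    have hRt (k : ℕ) : Measurable fun y => pertTerm μ P κ k (r, y) (t, z) :=
      (hR k).of_uncurry_right.comp measurable_prodMk_left
    have hRr (k : ℕ) : Measurable fun q : (ℝ × S) × S => pertTerm μ P κ k q.1 (r, q.2) :=
      (hR k).comp (by fun_prop : Measurable fun q : (ℝ × S) × S => (q.1, ((r, q.2) : ℝ × S)))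
    rw [Finset.sum_range_succ']
    change ∫⁻ u, rmul μ P κ (s, x) u * pertTerm μ P κ n u (t, z) ∂(volume.prod μ) = _
    -- Split by the time of the first jump; the slice at time r is null.
    rw [lintegral_split r]
    congr 1
    · have e1 : ∫⁻ u in {u | u.1 < r}, rmul μ P κ (s, x) u * pertTerm μ P κ n u (t, z)
          ∂(volume.prod μ) = ∫⁻ u in {u | u.1 < r}, ∑ k ∈ Finset.range (n + 1),
            ∫⁻ y, rmul μ P κ (s, x) u * (pertTerm μ P κ k u (r, y) *
              pertTerm μ P κ (n - k) (r, y) (t, z)) ∂μ ∂(volume.prod μ) := by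
        refine setLIntegral_congr_fun (measurable_fst_lt r) fun u hu => ?_
        obtain ⟨a, b⟩ := u
        rw [ih a b hu, Finset.mul_sum]
        refine Finset.sum_congr rfl fun k _ => ?_
        exact (lintegral_const_mul _
          (((hRr k).comp measurable_prodMk_left).mul (hRt _))).symm
      rw [e1, lintegral_finsetSum]
      · refine Finset.sum_congr rfl fun k hk => ?_
        have hk' : n + 1 - (k + 1) = n - k := by omega
        rw [lintegral_lintegral_swap, hk']
        · refine lintegral_congr fun y => ?_
          simp only [← mul_assoc]
          rw [lintegral_mul_const _ (by exact hPK.of_uncurry_left.mul (hR k).of_uncurry_right),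
            setLIntegral_eq_of_zero (measurable_fst_lt r)]
          · rfl
          · rintro ⟨a, b⟩ hu
            rw [pertTerm_causal hP k a r b y (not_lt.1 hu), mul_zero]
        · exact ((hPK.of_uncurry_left.comp measurable_fst).mul
            ((hRr k).mul ((hRt _).comp measurable_snd))).aemeasurable
      · intro k _
        exact ((hPK.of_uncurry_left.comp measurable_fst).mul
            ((hRr k).mul ((hRt _).comp measurable_snd))).lintegral_prod_right'
    · have hPr : Measurable fun y => P (s, x) (r, y) :=
        hP.meas.of_uncurry_left.comp measurable_prodMk_left
      have hPK' : Measurable fun q : (ℝ × S) × S => rmul μ P κ (r, q.2) q.1 :=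
        hPK.comp (by fun_prop : Measurable fun q : (ℝ × S) × S => (((r, q.2) : ℝ × S), q.1))
      have hRw : Measurable fun u => pertTerm μ P κ n u (t, z) := (hR n).of_uncurry_right
      have e1 : ∫⁻ u in {u | r < u.1}, rmul μ P κ (s, x) u * pertTerm μ P κ n u (t, z)
          ∂(volume.prod μ) = ∫⁻ u in {u | r < u.1},
            ∫⁻ y, P (s, x) (r, y) * rmul μ P κ (r, y) u * pertTerm μ P κ n u (t, z) ∂μ
              ∂(volume.prod μ) := by
        refine setLIntegral_congr_fun (measurable_lt_fst r) fun u hu => ?_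
        obtain ⟨a, b⟩ := u
        rw [rmul_ck hP hκ s r a x b hsr hu, lintegral_mul_const]
        exact hPr.mul (hPK'.comp measurable_prodMk_left)
      rw [e1, lintegral_lintegral_swap]
      · refine lintegral_congr fun y => ?_
        simp only [mul_assoc]
        rw [lintegral_const_mul _ (by exact (hPK'.comp measurable_prodMk_right).mul hRw),
            setLIntegral_eq_of_zero (measurable_lt_fst r)]
        · rfl
        · rintro ⟨a, b⟩ hu
          rw [rmul_causal hP.causal r a y b (not_lt.1 hu), zero_mul]
      · exact (((hPr.comp measurable_snd).mul hPK').mul (hRw.comp measurable_fst)).aemeasurable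

/-- The product of the two series, summed along antidiagonals, is termwise `pertTerm_ck`. -/
theorem pert_ck (hP : IsTransition μ P) (hκ : Measurable (Function.uncurry κ))
    (s r t : ℝ) (x z : S) (hsr : s < r) (hrt : r < t) :
    pert μ P κ (s, x) (t, z) = ∫⁻ y, pert μ P κ (s, x) (r, y) * pert μ P κ (r, y) (t, z) ∂μ := by
  have hR := measurable_pertTerm (μ := μ) hP hκ
  have h1 (k : ℕ) : Measurable fun y => pertTerm μ P κ k (r, y) (t, z) :=
    (hR k).of_uncurry_right.comp measurable_prodMk_left
  have h2 (k : ℕ) : Measurable fun y => pertTerm μ P κ k (s, x) (r, y) :=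
    (hR k).of_uncurry_left.comp measurable_prodMk_left
  simp only [pert, ← ENNReal.tsum_mul_right]
  simp only [← ENNReal.tsum_mul_left]
  rw [lintegral_tsum fun k => by exact (Measurable.tsum fun l => (h2 k).mul (h1 l)).aemeasurable]
  simp only [pertTerm_ck hP hκ _ s r t x z hsr hrt]
  rw [tsum_antidiagonal fun k l =>
    ∫⁻ y, pertTerm μ P κ k (s, x) (r, y) * pertTerm μ P κ l (r, y) (t, z) ∂μ]
  exact tsum_congr fun k => (lintegral_tsum fun l => ((h2 k).mul (h1 l)).aemeasurable).symm

/-- The hypotheses under which the perturbation series converges. -/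
structure IsKato (μ : Measure S) (P : ℝ × S → ℝ × S → ℝ≥0∞) (κ : S → S → ℝ≥0∞)
    (t₀ : ℝ) (θ B D : ℝ≥0∞) (ρ : ℝ → ℝ≥0∞) : Prop where
  pos : 0 < t₀
  left : ∀ s t x, t ≤ s + t₀ →
    ∫⁻ w in {w | w.1 < t}, rmul μ P κ (s, x) w ∂(volume.prod μ) ≤ θ
  right : ∀ s t z, t ≤ s + t₀ →
    ∫⁻ w in {w | s < w.1}, lmul μ κ P w (t, z) ∂(volume.prod μ) ≤ θ
  bound : ∀ s t x z, s < t → P (s, x) (t, z) ≤ B * ρ (t - s)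
  anti : ∀ a b, 0 < a → a ≤ b → ρ b ≤ ρ a
  half : ∀ a, 0 < a → ρ (a / 2) ≤ D * ρ a
  fin : ∀ a, 0 < a → B * ρ a ≠ ∞
  small : θ ≤ 1 / 4
  small' : D * θ ≤ 1 / 4

variable {t₀ : ℝ} {θ B D : ℝ≥0∞} {ρ : ℝ → ℝ≥0∞}

theorem rmul_pertTerm_succ (hP : IsTransition μ P) (hκ : Measurable (Function.uncurry κ)) (n : ℕ) :
    rmul μ (pertTerm μ P κ (n + 1)) κ =
      kcomp (volume.prod μ) (rmul μ P κ) (rmul μ (pertTerm μ P κ n) κ) :=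
  rmul_kcomp (measurable_rmul hP.meas hκ) (measurable_pertTerm hP hκ n) hκ

/-- The bound `hK.left` is uniform in the starting point, so every further jump contributes one more
factor θ; starting later only shortens the window. -/
theorem IsKato.left_pertTerm (hK : IsKato μ P κ t₀ θ B D ρ) (hP : IsTransition μ P)
    (hκ : Measurable (Function.uncurry κ)) (n : ℕ) (s t : ℝ) (x : S) (h : t ≤ s + t₀) :
    ∫⁻ w in {w | w.1 < t}, rmul μ (pertTerm μ P κ n) κ (s, x) w ∂(volume.prod μ) ≤ θ ^ (n + 1) := by
  have hPK := measurable_rmul (μ := μ) hP.meas hκ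
  induction n generalizing s x with
  | zero => simpa [pertTerm] using hK.left s t x h
  | succ n ih =>
    have hn := measurable_rmul (μ := μ) (measurable_pertTerm (μ := μ) hP hκ n) hκ
    rw [rmul_pertTerm_succ hP hκ]
    unfold kcomp
    rw [lintegral_lintegral_swap]
    · calc _ ≤ ∫⁻ u, {u : ℝ × S | u.1 < t}.indicator (rmul μ P κ (s, x)) u * θ ^ (n + 1)
            ∂(volume.prod μ) := by
            refine lintegral_mono fun u => ?_
            rw [lintegral_const_mul _ hn.of_uncurry_left]
            obtain ⟨a, b⟩ := u
            rcases le_or_gt a s with h1 | h1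
            · simp [rmul_causal hP.causal s a x b h1]
            by_cases h2 : a < t
            · rw [indicator_of_mem (by exact h2)]
              gcongr
              exact ih a b (by linarith)
            · rw [setLIntegral_congr_fun (measurable_fst_lt t) (g := fun _ => 0)]
              · simp
              · rintro ⟨c, e⟩ hc
                exact rmul_causal (pertTerm_causal hP n) a c b e
                  (by have : c < t := hc; linarith)
        _ ≤ θ * θ ^ (n + 1) := by
            rw [lintegral_mul_const _ (hPK.of_uncurry_left.indicator (measurable_fst_lt t)),
              lintegral_indicator (measurable_fst_lt t)]
            gcongr
            exact hK.left s t x h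
        _ = θ ^ (n + 1 + 1) := by ring
    · exact ((hPK.of_uncurry_left.comp measurable_snd).mul (hn.comp measurable_swap)).aemeasurable

/-- The jump rate integrated along the motion equals the total mass of the arrivals, whatever the
target of the jump is. -/
theorem lintegral_mul_lintegral_eq_rmul {a : ℝ × S → ℝ × S → ℝ≥0∞}
    (ha : Measurable (Function.uncurry a))
    (hκ : Measurable (Function.uncurry κ)) (v : ℝ × S) (t : ℝ) :
    ∫⁻ w in {w | w.1 < t}, a v w * (∫⁻ y, κ w.2 y ∂μ) ∂(volume.prod μ) =
      ∫⁻ w in {w | w.1 < t}, rmul μ a κ v w ∂(volume.prod μ) := by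
  have h1 : {w : ℝ × S | w.1 < t} = Iio t ×ˢ univ := by ext; simp
  have hav : Measurable (a v) := ha.of_uncurry_left
  have hκ1 : Measurable fun w => ∫⁻ y, κ w y ∂μ := hκ.lintegral_prod_right'
  rw [h1, ← Measure.prod_restrict, Measure.restrict_univ,
    lintegral_prod _ (by exact (hav.mul (hκ1.comp measurable_snd)).aemeasurable),
    lintegral_prod _ ((measurable_rmul ha hκ).of_uncurry_left).aemeasurable]
  refine lintegral_congr fun s => ?_
  unfold rmul
  rw [lintegral_lintegral_swap]
  · refine lintegral_congr fun u => ?_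
    exact (lintegral_const_mul _ hκ.of_uncurry_left).symm
  · exact ((hav.comp (measurable_const.prodMk measurable_snd)).mul
      (hκ.comp measurable_swap)).aemeasurable

/-- Cut at the midpoint according to the time of the last jump. If it comes early, the final stretch
of `P` lasts at least half the time and is bounded pointwise by B D ρ(t - s), while the jumps have
total mass θ^(n+1). If it comes late, the induction bound holds up to that jump with the same loss
D, and `hK.right` supplies θ. Each case costs at most (1/4)(1/2)^n, which is where the two smallness
conditions on θ come from. -/
theorem IsKato.pertTerm_le (hK : IsKato μ P κ t₀ θ B D ρ) (hP : IsTransition μ P)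
    (hκ : Measurable (Function.uncurry κ)) (n : ℕ) (s t : ℝ) (x z : S) (hst : s < t)
    (h : t ≤ s + t₀) :
    pertTerm μ P κ n (s, x) (t, z) ≤ B * ρ (t - s) * (1 / 2) ^ n := by
  induction n generalizing s t x z with
  | zero => simpa [pertTerm] using hK.bound s t x z hst
  | succ n ih =>
    have hn := measurable_pertTerm (μ := μ) hP hκ n
    have hKP := measurable_lmul (μ := μ) hP.meas hκ
    have hκ1 : Measurable fun w => ∫⁻ y, κ w y ∂μ := hκ.lintegral_prod_right'
    set m : ℝ := (s + t) / 2 with hm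
    have hsm : s < m := by rw [hm]; linarith
    have hmt : m < t := by rw [hm]; linarith
    have hρ (a : ℝ) (ha : (t - s) / 2 ≤ a) : ρ a ≤ D * ρ (t - s) :=
      (hK.anti _ _ (by linarith) ha).trans (hK.half _ (by linarith))
    rw [pertTerm_succ' hP hκ, kcomp, lintegral_split m]
    have e1 : ∫⁻ u in {u | u.1 < m}, pertTerm μ P κ n (s, x) u * lmul μ κ P u (t, z)
        ∂(volume.prod μ) ≤ B * (D * ρ (t - s)) * θ ^ (n + 1) := by
      calc _ ≤ ∫⁻ u in {u | u.1 < m}, B * (D * ρ (t - s)) *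
            (pertTerm μ P κ n (s, x) u * ∫⁻ y, κ u.2 y ∂μ) ∂(volume.prod μ) := by
            refine setLIntegral_mono' (measurable_fst_lt m) fun u hu => ?_
            rw [mul_left_comm]
            gcongr
            rw [lmul, ← lintegral_const_mul _ hκ.of_uncurry_left]
            refine lintegral_mono fun y => ?_
            rw [mul_comm]
            gcongr
            have hu' : u.1 < m := hu
            exact (hK.bound u.1 t y z (hu'.trans hmt)).trans
              (by gcongr; exact hρ _ (by rw [hm] at hu'; linarith))
        _ ≤ _ := by
            rw [lintegral_const_mul _ (by exact hn.of_uncurry_left.mul (hκ1.comp measurable_snd)),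
              lintegral_mul_lintegral_eq_rmul hn hκ]
            gcongr
            exact hK.left_pertTerm hP hκ n s m x (by linarith)
    have e2 : ∫⁻ u in {u | m < u.1}, pertTerm μ P κ n (s, x) u * lmul μ κ P u (t, z)
        ∂(volume.prod μ) ≤ B * (D * ρ (t - s)) * (1 / 2) ^ n * θ := by
      calc _ ≤ ∫⁻ u in {u | m < u.1}, B * (D * ρ (t - s)) * (1 / 2) ^ n *
            lmul μ κ P u (t, z) ∂(volume.prod μ) := by
            refine setLIntegral_mono' (measurable_lt_fst m) fun u hu => ?_
            obtain ⟨a, b⟩ := u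
            have hu' : m < a := hu
            rcases le_or_gt t a with h1 | h1
            · simp [lmul_causal hP.causal a t b z h1]
            gcongr
            refine (ih s a x b (hsm.trans hu') (by linarith)).trans ?_
            gcongr
            exact hρ _ (by rw [hm] at hu'; linarith)
        _ ≤ _ := by
            rw [lintegral_const_mul _ hKP.of_uncurry_right]
            gcongr
            exact hK.right m t z (by linarith)
    calc _ ≤ B * (D * ρ (t - s)) * θ ^ (n + 1) + B * (D * ρ (t - s)) * (1 / 2) ^ n * θ :=
          add_le_add e1 e2
      _ = B * ρ (t - s) * ((D * θ) * θ ^ n + (D * θ) * (1 / 2) ^ n) := by ring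
      _ ≤ B * ρ (t - s) * (1 / 4 * (1 / 2) ^ n + 1 / 4 * (1 / 2) ^ n) := by
          have h1 := hK.small'
          have h2 : θ ≤ 1 / 2 := hK.small.trans (by
            rw [one_div, one_div]; exact ENNReal.inv_le_inv.2 (by norm_num))
          gcongr
      _ = B * ρ (t - s) * (1 / 2) ^ (n + 1) := by
          rw [← add_mul, pow_succ, mul_comm ((1 / 2 : ℝ≥0∞) ^ n)]
          congr 2
          have : (1 / 4 : ℝ≥0∞) = 1 / 2 / 2 := by
            rw [one_div, one_div, div_eq_mul_inv, ← ENNReal.mul_inv (by simp) (by simp)]; norm_num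
          rw [this, ENNReal.add_halves]

theorem IsKato.pert_le (hK : IsKato μ P κ t₀ θ B D ρ) (hP : IsTransition μ P)
    (hκ : Measurable (Function.uncurry κ)) (s t : ℝ) (x z : S) (hst : s < t) (h : t ≤ s + t₀) :
    pert μ P κ (s, x) (t, z) ≤ B * ρ (t - s) * 2 := by
  calc _ ≤ ∑' n : ℕ, B * ρ (t - s) * (1 / 2) ^ n :=
        ENNReal.tsum_le_tsum fun n => hK.pertTerm_le hP hκ n s t x z hst h
    _ = _ := by
      rw [ENNReal.tsum_mul_left, ENNReal.tsum_geometric, one_div, ENNReal.one_sub_inv_two, inv_inv]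

/-- The expected total jump rate before time `t`. -/
noncomputable def jumpMass (μ : Measure S) (P : ℝ × S → ℝ × S → ℝ≥0∞) (κ : S → S → ℝ≥0∞)
    (v : ℝ × S) (t : ℝ) : ℝ≥0∞ :=
  ∫⁻ w in {w | w.1 < t}, rmul μ (pert μ P κ) κ v w ∂(volume.prod μ)

/-- After the last jump the motion follows `P`, whose mass is at most one; integrating the final
point away leaves the mass of the jumps. -/
theorem pert_mass_le (hP : IsTransition μ P) (hκ : Measurable (Function.uncurry κ))
    (s t : ℝ) (x : S) :
    ∫⁻ z, pert μ P κ (s, x) (t, z) ∂μ ≤ 1 + jumpMass μ P κ (s, x) t := by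
  have hR := measurable_pert (μ := μ) hP hκ
  have hRK := measurable_rmul (μ := μ) hR hκ
  have hPt : Measurable fun z => P (s, x) (t, z) :=
    hP.meas.of_uncurry_left.comp measurable_prodMk_left
  have hPq : Measurable fun q : S × (ℝ × S) => P q.2 (t, q.1) :=
    hP.meas.comp (by fun_prop : Measurable fun q : S × (ℝ × S) => (q.2, ((t, q.1) : ℝ × S)))
  simp only [pert_eq_right hP hκ (s, x)]
  rw [lintegral_add_left hPt]
  refine add_le_add (hP.mass s t x) ?_
  rw [← kcomp_rmul hR hP.meas hκ]
  unfold kcomp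
  rw [lintegral_lintegral_swap]
  · rw [jumpMass, ← lintegral_indicator (measurable_fst_lt t)]
    refine lintegral_mono fun u => ?_
    rw [lintegral_const_mul _ (by exact hPq.comp measurable_prodMk_right)]
    obtain ⟨a, b⟩ := u
    by_cases h : a < t
    · rw [indicator_of_mem (by exact h)]
      exact mul_le_of_le_one_right' (hP.mass a t b)
    · simp [hP.causal a t b _ (not_lt.1 h)]
  · exact ((hRK.of_uncurry_left.comp measurable_snd).mul hPq).aemeasurable

/-- Jumps after time r start afresh from the position at r, by Chapman–Kolmogorov for the series. -/
theorem jumpMass_le (hP : IsTransition μ P) (hκ : Measurable (Function.uncurry κ))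
    (s r t : ℝ) (x : S) (hsr : s < r) :
    jumpMass μ P κ (s, x) t ≤ jumpMass μ P κ (s, x) r +
      ∫⁻ y, pert μ P κ (s, x) (r, y) * jumpMass μ P κ (r, y) t ∂μ := by
  have hR := measurable_pert (μ := μ) hP hκ
  have hRK := measurable_rmul (μ := μ) hR hκ
  have hRr : Measurable fun y => pert μ P κ (s, x) (r, y) :=
    hR.of_uncurry_left.comp measurable_prodMk_left
  have hck : ∀ u : ℝ × S, r < u.1 → rmul μ (pert μ P κ) κ (s, x) u =
      ∫⁻ y, pert μ P κ (s, x) (r, y) * rmul μ (pert μ P κ) κ (r, y) u ∂μ := by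
    rintro ⟨a, b⟩ (ha : r < a)
    have h2 : Measurable fun q : S × S => pert μ P κ (r, q.2) (a, q.1) := hR.comp (by fun_prop :
      Measurable fun q : S × S => (((r, q.2) : ℝ × S), ((a, q.1) : ℝ × S)))
    have h3 : Measurable fun u => κ u b := hκ.of_uncurry_right
    have e1 : ∀ u, pert μ P κ (s, x) (a, u) * κ u b =
        ∫⁻ y, pert μ P κ (s, x) (r, y) * pert μ P κ (r, y) (a, u) * κ u b ∂μ := by
      intro u
      rw [pert_ck hP hκ s r a x u hsr ha]
      exact (lintegral_mul_const _ (hRr.mul (h2.comp measurable_prodMk_left))).symm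
    have e2 : ∀ y, pert μ P κ (s, x) (r, y) * (∫⁻ u, pert μ P κ (r, y) (a, u) * κ u b ∂μ) =
        ∫⁻ u, pert μ P κ (s, x) (r, y) * pert μ P κ (r, y) (a, u) * κ u b ∂μ := by
      intro y
      simp only [mul_assoc]
      exact (lintegral_const_mul _ ((h2.comp measurable_prodMk_right).mul h3)).symm
    unfold rmul
    simp only [e1, e2]
    exact lintegral_lintegral_swap
      (((hRr.comp measurable_snd).mul h2).mul (h3.comp measurable_fst)).aemeasurable
  have hRKr : Measurable fun q : (ℝ × S) × S => rmul μ (pert μ P κ) κ (r, q.2) q.1 :=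
    hRK.comp (by fun_prop : Measurable fun q : (ℝ × S) × S => (((r, q.2) : ℝ × S), q.1))
  unfold jumpMass
  rw [← lintegral_indicator (measurable_fst_lt t), lintegral_split r]
  refine add_le_add ?_ ?_
  · exact lintegral_mono fun u => indicator_le_self _ _ _
  · have e2 : ∀ y, pert μ P κ (s, x) (r, y) * ∫⁻ w in {w | w.1 < t},
        rmul μ (pert μ P κ) κ (r, y) w ∂(volume.prod μ) = ∫⁻ w in {w | w.1 < t},
          pert μ P κ (s, x) (r, y) * rmul μ (pert μ P κ) κ (r, y) w ∂(volume.prod μ) :=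
      fun y => (lintegral_const_mul _ hRK.of_uncurry_left).symm
    simp only [e2]
    rw [lintegral_lintegral_swap]
    · rw [← lintegral_indicator (measurable_fst_lt t), ← lintegral_indicator (measurable_lt_fst r)]
      refine lintegral_mono fun u => ?_
      by_cases h1 : r < u.1
      · rw [indicator_of_mem (by exact h1)]
        by_cases h2 : u.1 < t
        · rw [indicator_of_mem (by exact h2), indicator_of_mem (by exact h2), hck u h1]
        · rw [indicator_of_notMem (by exact h2)]; exact zero_le
      · rw [indicator_of_notMem (by exact h1)]; exact zero_le
    · exact ((hRr.comp measurable_fst).mul (hRKr.comp measurable_swap)).aemeasurable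

theorem IsKato.jumpMass_bounded (hK : IsKato μ P κ t₀ θ B D ρ) (hP : IsTransition μ P)
    (hκ : Measurable (Function.uncurry κ)) (N : ℕ) :
    ∃ C : ℝ≥0∞, C ≠ ∞ ∧ ∀ s t x, t ≤ s + N * t₀ → jumpMass μ P κ (s, x) t ≤ C := by
  have hR := measurable_pertTerm (μ := μ) hP hκ
  -- On one window the terms are dominated by (1/2)^(n+1), whose sum is 1.
  have hone : ∀ s t x, t ≤ s + t₀ → jumpMass μ P κ (s, x) t ≤ 1 := by
    intro s t x h
    have h4 : (1 / 4 : ℝ≥0∞) ≤ 1 / 2 := by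
      rw [one_div, one_div]; exact ENNReal.inv_le_inv.2 (by norm_num)
    calc jumpMass μ P κ (s, x) t
        = ∫⁻ w in {w | w.1 < t}, ∑' n, rmul μ (pertTerm μ P κ n) κ (s, x) w ∂(volume.prod μ) :=
          lintegral_congr fun w => rmul_tsum hR hκ _ _
      _ = ∑' n, ∫⁻ w in {w | w.1 < t}, rmul μ (pertTerm μ P κ n) κ (s, x) w ∂(volume.prod μ) :=
          lintegral_tsum fun n => (measurable_rmul (hR n) hκ).of_uncurry_left.aemeasurable
      _ ≤ ∑' n : ℕ, (1 / 2) * (1 / 2) ^ n := by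
          refine ENNReal.tsum_le_tsum fun n => (hK.left_pertTerm hP hκ n s t x h).trans ?_
          rw [pow_succ']
          have := hK.small.trans h4
          gcongr
      _ = 1 := by
          rw [ENNReal.tsum_mul_left, ENNReal.tsum_geometric, one_div, ENNReal.one_sub_inv_two,
            inv_inv, ENNReal.inv_mul_cancel (by simp) (by simp)]
  induction N with
  | zero => exact ⟨1, by simp, fun s t x h => hone s t x (by have := hK.pos; simp at h; linarith)⟩
  | succ N ih =>
    obtain ⟨C, hC, hCb⟩ := ih
    -- The summand 1 is the window up to s + t₀. The factor 2 bounds the mass of the series at s +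
    -- t₀, by `pert_mass_le` and the bound 1 on that window.
    refine ⟨1 + 2 * C, by finiteness, fun s t x h => ?_⟩
    have hs : s < s + t₀ := by linarith [hK.pos]
    refine (jumpMass_le hP hκ s (s + t₀) t x hs).trans ?_
    refine add_le_add (hone _ _ _ le_rfl) ?_
    calc _ ≤ ∫⁻ y, pert μ P κ (s, x) (s + t₀, y) * C ∂μ := by
          refine lintegral_mono fun y => ?_
          gcongr
          exact hCb _ _ _ (by push_cast at h; linarith)
      _ = (∫⁻ y, pert μ P κ (s, x) (s + t₀, y) ∂μ) * C :=
          lintegral_mul_const _ ((measurable_pert hP hκ).of_uncurry_left.comp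
            measurable_prodMk_left)
      _ ≤ 2 * C := by
          gcongr
          refine (pert_mass_le hP hκ s (s + t₀) x).trans ?_
          calc _ ≤ (1 : ℝ≥0∞) + 1 := by gcongr; exact hone _ _ _ le_rfl
            _ = 2 := one_add_one_eq_two

theorem IsKato.exists_jumpMass_le (hK : IsKato μ P κ t₀ θ B D ρ) (hP : IsTransition μ P)
    (hκ : Measurable (Function.uncurry κ)) (τ : ℝ) :
    ∃ C : ℝ≥0∞, C ≠ ∞ ∧ ∀ s t x, t ≤ s + τ → jumpMass μ P κ (s, x) t ≤ C := by
  obtain ⟨N, hN⟩ := exists_nat_gt (τ / t₀)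
  obtain ⟨C, hC, h⟩ := hK.jumpMass_bounded hP hκ N
  refine ⟨C, hC, fun s t x hst => h s t x ?_⟩
  have := (div_lt_iff₀ hK.pos).1 hN
  linarith

theorem IsKato.exists_mass_le (hK : IsKato μ P κ t₀ θ B D ρ) (hP : IsTransition μ P)
    (hκ : Measurable (Function.uncurry κ)) (τ : ℝ) :
    ∃ C : ℝ≥0∞, C ≠ ∞ ∧ ∀ s t x, t ≤ s + τ → ∫⁻ z, pert μ P κ (s, x) (t, z) ∂μ ≤ C := by
  obtain ⟨C, hC, h⟩ := hK.exists_jumpMass_le hP hκ τ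
  exact ⟨1 + C, by finiteness, fun s t x hst =>
    (pert_mass_le hP hκ s t x).trans (by gcongr; exact h s t x hst)⟩

/-- The pointwise bound is available only on short windows, so it is used on the last stretch of
length τ alone. On the time before, a finite mass suffices. -/
theorem IsKato.pert_ne_top (hK : IsKato μ P κ t₀ θ B D ρ) (hP : IsTransition μ P)
    (hκ : Measurable (Function.uncurry κ)) (v w : ℝ × S) : pert μ P κ v w ≠ ∞ := by
  obtain ⟨s, x⟩ := v
  obtain ⟨t, z⟩ := w
  rcases le_or_gt t s with h | h
  · simp [pert_causal hP s t x z h]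
  set τ := min (t₀) ((t - s) / 2) with hτ
  have hτ0 : 0 < τ := lt_min hK.pos (by linarith)
  have hτ1 : τ ≤ t₀ := min_le_left _ _
  have hτ2 : τ ≤ (t - s) / 2 := min_le_right _ _
  obtain ⟨C, hC, hm⟩ := hK.exists_mass_le hP hκ (t - τ - s)
  rw [pert_ck hP hκ s (t - τ) t x z (by linarith) (by linarith)]
  refine ne_top_of_le_ne_top (b := C * (B * ρ τ * 2))
    (ENNReal.mul_ne_top hC (ENNReal.mul_ne_top (hK.fin τ hτ0) (by simp))) ?_
  calc _ ≤ ∫⁻ y, pert μ P κ (s, x) (t - τ, y) * (B * ρ τ * 2) ∂μ := by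
        refine lintegral_mono fun y => ?_
        gcongr
        have := hK.pert_le hP hκ (t - τ) t y z (by linarith) (by linarith)
        rwa [sub_sub_cancel] at this
    _ = _ := lintegral_mul_const _ ((measurable_pert hP hκ).of_uncurry_left.comp
            measurable_prodMk_left)
    _ ≤ _ := by
        gcongr
        exact hm _ _ _ (by linarith)

end SpaceTime

end

/-! ### Backward solution, and comparison with the forward equation by duality. -/

section

section SpaceTime

variable {S : Type*} [MeasurableSpace S] {μ : Measure S} [SFinite μ]
  {P : ℝ × S → ℝ × S → ℝ≥0∞} {κ : S → S → ℝ≥0∞}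

theorem lmul_kcomp {a b : ℝ × S → ℝ × S → ℝ≥0∞} (ha : Measurable (Function.uncurry a))
    (hb : Measurable (Function.uncurry b)) (hκ : Measurable (Function.uncurry κ)) :
    lmul μ κ (kcomp (volume.prod μ) a b) = kcomp (volume.prod μ) (lmul μ κ a) b := by
  funext v w
  obtain ⟨s, x⟩ := v
  have hbw : Measurable fun u => b u w := hb.of_uncurry_right
  have hκx : Measurable (κ x) := hκ.of_uncurry_left
  have has : Measurable fun q : S × (ℝ × S) => a (s, q.1) q.2 :=
    ha.comp (by fun_prop : Measurable fun q : S × (ℝ × S) => (((s, q.1) : ℝ × S), q.2))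
  unfold lmul kcomp
  have e1 : ∀ u, κ x u * (∫⁻ u', a (s, u) u' * b u' w ∂(volume.prod μ)) =
      ∫⁻ u', κ x u * a (s, u) u' * b u' w ∂(volume.prod μ) := by
    intro u
    simp only [mul_assoc]
    exact (lintegral_const_mul _ ((has.comp measurable_prodMk_left).mul hbw)).symm
  have e2 : ∀ u', (∫⁻ u, κ x u * a (s, u) u' ∂μ) * b u' w =
      ∫⁻ u, κ x u * a (s, u) u' * b u' w ∂μ := fun u' =>
    (lintegral_mul_const _ (hκx.mul (has.comp measurable_prodMk_right))).symm
  simp only [e1, e2]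
  exact lintegral_lintegral_swap
    (((hκx.comp measurable_fst).mul has).mul (hbw.comp measurable_snd)).aemeasurable

/-- The action of a space-time kernel on a function at a fixed final time. -/
noncomputable def gact (μ : Measure S) (a : ℝ × S → ℝ × S → ℝ≥0∞) (t : ℝ) (g : S → ℝ≥0∞)
    (v : ℝ × S) : ℝ≥0∞ :=
  ∫⁻ z, a v (t, z) * g z ∂μ

theorem measurable_gact {a : ℝ × S → ℝ × S → ℝ≥0∞} (ha : Measurable (Function.uncurry a))
    {g : S → ℝ≥0∞} (hg : Measurable g) (t : ℝ) : Measurable (gact μ a t g) := by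
  have : Measurable fun q : (ℝ × S) × S => a q.1 (t, q.2) * g q.2 :=
    (ha.comp (by fun_prop : Measurable fun q : (ℝ × S) × S => (q.1, ((t, q.2) : ℝ × S)))).mul
      (hg.comp measurable_snd)
  exact this.lintegral_prod_right'

theorem gact_kcomp {a b : ℝ × S → ℝ × S → ℝ≥0∞} (ha : Measurable (Function.uncurry a))
    (hb : Measurable (Function.uncurry b)) {g : S → ℝ≥0∞} (hg : Measurable g) (t : ℝ)
    (v : ℝ × S) :
    gact μ (kcomp (volume.prod μ) a b) t g v =
      ∫⁻ w, a v w * gact μ b t g w ∂(volume.prod μ) := by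
  have hav : Measurable (a v) := ha.of_uncurry_left
  have hbt : Measurable fun q : (ℝ × S) × S => b q.1 (t, q.2) :=
    hb.comp (by fun_prop : Measurable fun q : (ℝ × S) × S => (q.1, ((t, q.2) : ℝ × S)))
  unfold gact kcomp
  have e1 : ∀ z, (∫⁻ u, a v u * b u (t, z) ∂(volume.prod μ)) * g z =
      ∫⁻ u, a v u * b u (t, z) * g z ∂(volume.prod μ) := fun z =>
    (lintegral_mul_const _ (hav.mul (hbt.comp measurable_prodMk_right))).symm
  have e2 : ∀ u, a v u * (∫⁻ z, b u (t, z) * g z ∂μ) = ∫⁻ z, a v u * b u (t, z) * g z ∂μ := by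
    intro u
    simp only [mul_assoc]
    exact (lintegral_const_mul _ ((hbt.comp measurable_prodMk_left).mul hg)).symm
  simp only [e1, e2]
  exact lintegral_lintegral_swap (((hav.comp measurable_snd).mul (hbt.comp measurable_swap)).mul
    (hg.comp measurable_fst)).aemeasurable

/-- The function h = `gact (lmul κ (pert P κ)) t g`, one jump followed by the whole series, solves
the backward equation h = κPg + (κP)h. It is the test function of the duality argument. -/
theorem gact_lmul_pert (hP : IsTransition μ P) (hκ : Measurable (Function.uncurry κ))
    {g : S → ℝ≥0∞} (hg : Measurable g) (t : ℝ) (v : ℝ × S) :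
    gact μ (lmul μ κ (pert μ P κ)) t g v = gact μ (lmul μ κ P) t g v +
      ∫⁻ w, lmul μ κ P v w * gact μ (lmul μ κ (pert μ P κ)) t g w ∂(volume.prod μ) := by
  have hR := measurable_pert (μ := μ) hP hκ
  rw [← gact_kcomp (measurable_lmul hP.meas hκ) (measurable_lmul hR hκ) hg,
    ← lmul_kcomp hP.meas (measurable_lmul hR hκ) hκ, ← kcomp_rmul hP.meas hR hκ]
  unfold gact
  have hm : Measurable fun z => lmul μ κ P v (t, z) :=
    (measurable_lmul hP.meas hκ).of_uncurry_left.comp measurable_prodMk_left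
  rw [← lintegral_add_left (by exact hm.mul hg)]
  refine lintegral_congr fun z => ?_
  rw [← add_mul]
  congr 1
  unfold lmul
  have hm' : Measurable fun u => P (v.1, u) (t, z) :=
    hP.meas.of_uncurry_right.comp measurable_prodMk_left
  rw [← lintegral_add_left (by exact hκ.of_uncurry_left.mul hm')]
  refine lintegral_congr fun u => ?_
  rw [← mul_add, pert_eq_left hP hκ]

theorem gact_pert (hP : IsTransition μ P) (hκ : Measurable (Function.uncurry κ))
    {g : S → ℝ≥0∞} (hg : Measurable g) (t : ℝ) (v : ℝ × S) :
    gact μ (pert μ P κ) t g v = gact μ P t g v +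
      ∫⁻ w, P v w * gact μ (lmul μ κ (pert μ P κ)) t g w ∂(volume.prod μ) := by
  have hR := measurable_pert (μ := μ) hP hκ
  rw [← gact_kcomp hP.meas (measurable_lmul hR hκ) hg, ← kcomp_rmul hP.meas hR hκ]
  unfold gact
  have hm : Measurable fun z => P v (t, z) :=
    hP.meas.of_uncurry_left.comp measurable_prodMk_left
  rw [← lintegral_add_left (by exact hm.mul hg)]
  refine lintegral_congr fun z => ?_
  rw [← add_mul, pert_eq_left hP hκ]

open ProbabilityTheory in
/-- The forward map of the perturbation equation, applied to the row `v` and integrated against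
the backward solution. -/
theorem lintegral_forward (hP : IsTransition μ P) (hκ : Measurable (Function.uncurry κ))
    (v : Kernel ℝ S) [IsSFiniteKernel v] (x : S) {g : S → ℝ≥0∞} (hg : Measurable g) (t : ℝ) :
    (∫⁻ s in Ioi (0 : ℝ), (gact μ P s (fun z => gact μ (lmul μ κ (pert μ P κ)) t g (s, z)) (0, x) +
      ∫⁻ r in Ioi (0 : ℝ), ∫⁻ w, gact μ (lmul μ κ P) s
        (fun z => gact μ (lmul μ κ (pert μ P κ)) t g (s, z)) (r, w) ∂(v r))) +
      (gact μ P t g (0, x) + ∫⁻ r in Ioi (0 : ℝ), ∫⁻ w, gact μ (lmul μ κ P) t g (r, w) ∂(v r)) =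
    gact μ (pert μ P κ) t g (0, x) +
      ∫⁻ r in Ioi (0 : ℝ), ∫⁻ w, gact μ (lmul μ κ (pert μ P κ)) t g (r, w) ∂(v r) := by
  have hR := measurable_pert (μ := μ) hP hκ
  have hKP := measurable_lmul (μ := μ) hP.meas hκ
  have hKR := measurable_lmul (μ := μ) hR hκ
  set h := gact μ (lmul μ κ (pert μ P κ)) t g with hh
  have hhm : Measurable h := measurable_gact hKR hg t
  -- By causality the kernel started at a nonnegative time vanishes at all times s ≤ 0, so the
  -- integral over s > 0 is already the full space-time integral.
  have hz (v' : ℝ × S) (a : ℝ × S → ℝ × S → ℝ≥0∞) (ha : Measurable (Function.uncurry a))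
      (ha0 : ∀ s t x z, t ≤ s → a (s, x) (t, z) = 0) (h0 : 0 ≤ v'.1) :
      ∫⁻ s in Ioi (0 : ℝ), gact μ a s (fun z => h (s, z)) v' =
        ∫⁻ w, a v' w * h w ∂(volume.prod μ) := by
    rw [lintegral_prod _ (by exact (ha.of_uncurry_left.mul hhm).aemeasurable),
      ← lintegral_indicator measurableSet_Ioi]
    refine lintegral_congr fun s => ?_
    by_cases hs : s ∈ Ioi (0 : ℝ)
    · rw [indicator_of_mem hs]; rfl
    · rw [indicator_of_notMem hs]
      have : s ≤ v'.1 := (not_lt.1 hs).trans h0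
      obtain ⟨c, e⟩ := v'
      simp [ha0 c s e _ this]
  have hm1 : Measurable fun s => gact μ P s (fun z => h (s, z)) (0, x) := by
    have : Measurable fun q : ℝ × S => P (0, x) q * h q := hP.meas.of_uncurry_left.mul hhm
    exact this.lintegral_prod_right'
  have hm2 : Measurable fun q : (ℝ × ℝ) × S =>
      gact μ (lmul μ κ P) q.1.1 (fun z => h (q.1.1, z)) (q.1.2, q.2) := by
    have : Measurable fun q : ((ℝ × ℝ) × S) × S =>
        lmul μ κ P (q.1.1.2, q.1.2) (q.1.1.1, q.2) * h (q.1.1.1, q.2) :=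
      (hKP.comp (by fun_prop : Measurable fun q : ((ℝ × ℝ) × S) × S =>
        (((q.1.1.2, q.1.2) : ℝ × S), ((q.1.1.1, q.2) : ℝ × S)))).mul
        (hhm.comp (by fun_prop))
    exact this.lintegral_prod_right'
  have hm3 : Measurable fun q : ℝ × ℝ => ∫⁻ w,
      gact μ (lmul μ κ P) q.1 (fun z => h (q.1, z)) (q.2, w) ∂(v q.2) := by
    exact Measurable.lintegral_kernel_prod_right (κ := v.comap (Prod.snd : ℝ × ℝ → ℝ)
      measurable_snd) (f := fun (q : ℝ × ℝ) w =>
        gact μ (lmul μ κ P) q.1 (fun z => h (q.1, z)) (q.2, w)) hm2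
  rw [lintegral_add_left hm1, hz (0, x) P hP.meas hP.causal le_rfl, lintegral_lintegral_swap
    hm3.aemeasurable, gact_pert hP hκ hg, ← hh]
  have e3 : ∀ r ∈ Ioi (0 : ℝ), ∫⁻ w, h (r, w) ∂(v r) = ∫⁻ w, gact μ (lmul μ κ P) t g (r, w) ∂(v r) +
      ∫⁻ s in Ioi (0 : ℝ), ∫⁻ w, gact μ (lmul μ κ P) s (fun z => h (s, z)) (r, w) ∂(v r) := by
    intro r hr
    rw [lintegral_lintegral_swap, ← lintegral_add_left]
    · refine lintegral_congr fun w => ?_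
      rw [hz (r, w) _ hKP (lmul_causal hP.causal) (le_of_lt hr), hh]
      exact gact_lmul_pert hP hκ hg t (r, w)
    · exact (measurable_gact hKP hg t).comp measurable_prodMk_left
    · exact (hm2.comp (by fun_prop : Measurable fun q : ℝ × S => ((q.1, r), q.2))).aemeasurable
  rw [setLIntegral_congr_fun measurableSet_Ioi e3, lintegral_add_left]
  · ring
  · exact Measurable.lintegral_kernel_prod_right (κ := v)
      (f := fun r w => gact μ (lmul μ κ P) t g (r, w)) (measurable_gact hKP hg t)

variable {t₀ : ℝ} {θ B D : ℝ≥0∞} {ρ : ℝ → ℝ≥0∞}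

open ProbabilityTheory in
-- Before time t the backward solution is at most the jump rate times a uniform bound for the mass
-- of the series, and from t on it vanishes. Finiteness thus reduces to the integrated jump rate
-- along the row.
theorem IsKato.lintegral_backward_ne_top (hK : IsKato μ P κ t₀ θ B D ρ) (hP : IsTransition μ P)
    (hκ : Measurable (Function.uncurry κ)) (v : Kernel ℝ S) {g : S → ℝ≥0∞} (hg1 : ∀ z, g z ≤ 1)
    (t : ℝ) (hfin : ∫⁻ r in Ioo (0 : ℝ) t, ∫⁻ w, ∫⁻ y, κ w y ∂μ ∂(v r) ≠ ∞) :
    ∫⁻ r in Ioi (0 : ℝ), ∫⁻ w, gact μ (lmul μ κ (pert μ P κ)) t g (r, w) ∂(v r) ≠ ∞ := by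
  have hR := measurable_pert (μ := μ) hP hκ
  have hKR := measurable_lmul (μ := μ) hR hκ
  obtain ⟨C, hC, hm⟩ := hK.exists_mass_le hP hκ t
  refine ne_top_of_le_ne_top (ENNReal.mul_ne_top hfin hC) ?_
  have hκ1 : Measurable fun w => ∫⁻ y, κ w y ∂μ := hκ.lintegral_prod_right'
  have key : ∀ r w, 0 < r → r < t →
      gact μ (lmul μ κ (pert μ P κ)) t g (r, w) ≤ (∫⁻ y, κ w y ∂μ) * C := by
    intro r w hr hrt
    have hRt : Measurable fun q : S × S => pert μ P κ (r, q.2) (t, q.1) := hR.comp (by fun_prop :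
      Measurable fun q : S × S => (((r, q.2) : ℝ × S), ((t, q.1) : ℝ × S)))
    calc _ ≤ ∫⁻ z, lmul μ κ (pert μ P κ) (r, w) (t, z) ∂μ :=
          lintegral_mono fun z => mul_le_of_le_one_right' (hg1 z)
      _ = ∫⁻ u, κ w u * ∫⁻ z, pert μ P κ (r, u) (t, z) ∂μ ∂μ := by
          unfold lmul
          rw [lintegral_lintegral_swap]
          · refine lintegral_congr fun u => ?_
            exact lintegral_const_mul _ (hRt.comp measurable_prodMk_right)
          · exact ((hκ.of_uncurry_left.comp measurable_snd).mul hRt).aemeasurable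
      _ ≤ ∫⁻ u, κ w u * C ∂μ := by
          refine lintegral_mono fun u => ?_
          gcongr
          exact hm r t u (by linarith)
      _ = _ := lintegral_mul_const _ hκ.of_uncurry_left
  calc _ ≤ ∫⁻ r in Ioi (0 : ℝ), (Ioo (0 : ℝ) t).indicator
        (fun r => (∫⁻ w, ∫⁻ y, κ w y ∂μ ∂(v r)) * C) r := by
        refine setLIntegral_mono' measurableSet_Ioi fun r (hr : 0 < r) => ?_
        by_cases hrt : r < t
        · rw [indicator_of_mem (show r ∈ Ioo 0 t from ⟨hr, hrt⟩), ← lintegral_mul_const _ hκ1]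
          exact lintegral_mono fun w => key r w hr hrt
        · have h0 : ∀ w, gact μ (lmul μ κ (pert μ P κ)) t g (r, w) = 0 := by
            intro w
            simp [gact, lmul_causal (pert_causal hP) r t w _ (not_lt.1 hrt)]
          simp [h0]
    _ ≤ ∫⁻ r, (Ioo (0 : ℝ) t).indicator
        (fun r => (∫⁻ w, ∫⁻ y, κ w y ∂μ ∂(v r)) * C) r := setLIntegral_le_lintegral _ _
    _ = ∫⁻ r in Ioo 0 t, (∫⁻ w, ∫⁻ y, κ w y ∂μ ∂(v r)) * C := lintegral_indicator measurableSet_Ioo _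
    _ = _ := lintegral_mul_const' _ _ hC

open ProbabilityTheory in
/-- A subsolution of the forward equation lies below the perturbation series. -/
theorem IsKato.lintegral_le_of_forward_le (hK : IsKato μ P κ t₀ θ B D ρ) (hP : IsTransition μ P)
    (hκ : Measurable (Function.uncurry κ)) (v : Kernel ℝ S) [IsSFiniteKernel v] (x : S)
    (hv : ∀ t : ℝ, 0 < t → ∀ h : S → ℝ≥0∞, Measurable h → ∫⁻ w, h w ∂(v t) ≤
      gact μ P t h (0, x) + ∫⁻ r in Ioi (0 : ℝ), ∫⁻ w, gact μ (lmul μ κ P) t h (r, w) ∂(v r))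
    {g : S → ℝ≥0∞} (hg : Measurable g) (hg1 : ∀ z, g z ≤ 1) (t : ℝ) (ht : 0 < t)
    (hfin : ∫⁻ r in Ioo (0 : ℝ) t, ∫⁻ w, ∫⁻ y, κ w y ∂μ ∂(v r) ≠ ∞) :
    ∫⁻ w, g w ∂(v t) ≤ gact μ (pert μ P κ) t g (0, x) := by
  have hKR := measurable_lmul (μ := μ) (measurable_pert (μ := μ) hP hκ) hκ
  have hA := hK.lintegral_backward_ne_top hP hκ v hg1 t hfin
  have hF := lintegral_forward hP hκ v x hg t
  set A := ∫⁻ r in Ioi (0 : ℝ), ∫⁻ w, gact μ (lmul μ κ (pert μ P κ)) t g (r, w) ∂(v r)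
  refine (hv t ht g hg).trans ?_
  -- The forward inequality is integrated in time against the backward solution. The common quantity
  -- A appears on both sides and cancels because it is finite.
  refine (ENNReal.add_le_add_iff_left hA).1 ?_
  rw [add_comm A (gact μ (pert μ P κ) t g (0, x)), ← hF]
  refine add_le_add_left (setLIntegral_mono' measurableSet_Ioi fun s hs => ?_) _
  exact hv s hs _ ((measurable_gact hKR hg t).comp measurable_prodMk_left)

open ProbabilityTheory in
/-- Solutions of the forward equation with a correction term `c`. -/
theorem IsKato.lintegral_eq_of_forward_eq (hK : IsKato μ P κ t₀ θ B D ρ) (hP : IsTransition μ P)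
    (hκ : Measurable (Function.uncurry κ)) (v : Kernel ℝ S) [IsSFiniteKernel v] (x : S)
    (c : ℝ × S → ℝ≥0∞)
    (hv : ∀ t : ℝ, 0 < t → ∀ h : S → ℝ≥0∞, Measurable h →
      ∫⁻ w, h w ∂(v t) + ∫⁻ z, c (t, z) * h z ∂μ =
      gact μ P t h (0, x) + ∫⁻ r in Ioi (0 : ℝ), ∫⁻ w, gact μ (lmul μ κ P) t h (r, w) ∂(v r))
    {g : S → ℝ≥0∞} (hg : Measurable g) (hg1 : ∀ z, g z ≤ 1) (t : ℝ) (ht : 0 < t)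
    (hfin : ∫⁻ r in Ioo (0 : ℝ) t, ∫⁻ w, ∫⁻ y, κ w y ∂μ ∂(v r) ≠ ∞) :
    ∫⁻ w, g w ∂(v t) + (∫⁻ z, c (t, z) * g z ∂μ +
      ∫⁻ s in Ioi (0 : ℝ), ∫⁻ z, c (s, z) * gact μ (lmul μ κ (pert μ P κ)) t g (s, z) ∂μ) =
      gact μ (pert μ P κ) t g (0, x) := by
  have hKR := measurable_lmul (μ := μ) (measurable_pert (μ := μ) hP hκ) hκ
  have hA := hK.lintegral_backward_ne_top hP hκ v hg1 t hfin
  have hF := lintegral_forward hP hκ v x hg t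
  have hhm := measurable_gact (μ := μ) hKR hg t
  rw [← hv t ht g hg, setLIntegral_congr_fun measurableSet_Ioi fun s (hs : 0 < s) => (hv s hs
    (fun z => gact μ (lmul μ κ (pert μ P κ)) t g (s, z)) (hhm.comp measurable_prodMk_left)).symm,
    lintegral_add_left (Measurable.lintegral_kernel_prod_right (κ := v)
      (f := fun r w => gact μ (lmul μ κ (pert μ P κ)) t g (r, w)) hhm)] at hF
  rw [← ENNReal.add_right_inj hA, add_comm _ (gact μ (pert μ P κ) t g (0, x)), ← hF]
  ring

end SpaceTime

/-! ### Regrouping the series when the jump density is itself a series. -/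

section Expansion

variable {S : Type*} [MeasurableSpace S] (μ : Measure S)

/-- The expansion of the perturbation series when the jump density is itself a series:
`expTerm n` collects the terms of total order `n`, where `κ i` has order `i + 1`. -/
noncomputable def expTerm (P : ℝ × S → ℝ × S → ℝ≥0∞) (κ : ℕ → S → S → ℝ≥0∞) :
    ℕ → ℝ × S → ℝ × S → ℝ≥0∞
  | 0 => P
  | n + 1 => fun v w => ∑ i : Fin (n + 1),
      kcomp (volume.prod μ) (rmul μ P (κ i)) (expTerm P κ (n - i)) v w
termination_by n => n
decreasing_by omega

variable {μ} [SFinite μ] {P : ℝ × S → ℝ × S → ℝ≥0∞} {κ : ℕ → S → S → ℝ≥0∞}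

theorem expTerm_zero : expTerm μ P κ 0 = P := by rw [expTerm]

theorem expTerm_succ (n : ℕ) (v w : ℝ × S) : expTerm μ P κ (n + 1) v w =
    ∑ i ∈ Finset.range (n + 1),
      kcomp (volume.prod μ) (rmul μ P (κ i)) (expTerm μ P κ (n - i)) v w := by
  rw [expTerm, Finset.sum_range]

theorem measurable_expTerm (hP : IsTransition μ P) (hκ : ∀ i, Measurable (Function.uncurry (κ i)))
    (n : ℕ) : Measurable (Function.uncurry (expTerm μ P κ n)) := by
  induction n using Nat.strong_induction_on with
  | _ n ih =>
    cases n with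
    | zero => rw [expTerm_zero]; exact hP.meas
    | succ n =>
      have : Function.uncurry (expTerm μ P κ (n + 1)) = fun q => ∑ i ∈ Finset.range (n + 1),
          Function.uncurry (kcomp (volume.prod μ) (rmul μ P (κ i)) (expTerm μ P κ (n - i))) q := by
        ext q; exact expTerm_succ n q.1 q.2
      rw [this]
      exact Finset.measurable_fun_sum _ fun i _ => measurable_kcomp (measurable_rmul hP.meas (hκ i))
        (ih _ (by omega))

theorem rmul_tsum_right {ι : Type*} [Countable ι] {κ : ι → S → S → ℝ≥0∞} (hP : IsTransition μ P)
    (hκ : ∀ i, Measurable (Function.uncurry (κ i))) (v w : ℝ × S) :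
    rmul μ P (fun x y => ∑' i, κ i x y) v w = ∑' i, rmul μ P (κ i) v w := by
  unfold rmul
  simp only [← ENNReal.tsum_mul_left]
  exact lintegral_tsum fun i => ((hP.meas.of_uncurry_left.comp measurable_prodMk_left).mul
    (hκ i).of_uncurry_right).aemeasurable

theorem tsum_kcomp_tsum (hP : IsTransition μ P) (hκ : ∀ i, Measurable (Function.uncurry (κ i)))
    {b : ℕ → ℝ × S → ℝ × S → ℝ≥0∞} (hb : ∀ i, Measurable (Function.uncurry (b i)))
    (v w : ℝ × S) :
    ∑' i, ∑' l, kcomp (volume.prod μ) (rmul μ P (κ i)) (b l) v w =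
      kcomp (volume.prod μ) (rmul μ P fun x y => ∑' i, κ i x y) (fun x y => ∑' l, b l x y) v w := by
  have h1 : rmul μ P (fun x y => ∑' i, κ i x y) = fun v w => ∑' i, rmul μ P (κ i) v w := by
    funext v w; exact rmul_tsum_right hP hκ v w
  rw [h1, kcomp_tsum_left (fun i => measurable_rmul hP.meas (hκ i))
    (by exact Measurable.tsum hb)]
  exact tsum_congr fun i => (kcomp_tsum_right (measurable_rmul hP.meas (hκ i)) hb v w).symm

/-- Both sides solve u = P + (Pκ)u with κ = Σ κᵢ. Convergence being unknown, the two inequalities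
are proved on partial sums: those of each series are dominated, by induction on their length,
through the equation satisfied by the other. -/
theorem tsum_expTerm (hP : IsTransition μ P) (hκ : ∀ i, Measurable (Function.uncurry (κ i)))
    (v w : ℝ × S) :
    ∑' n, expTerm μ P κ n v w = pert μ P (fun x y => ∑' i, κ i x y) v w := by
  have hσ := measurable_expTerm (μ := μ) hP hκ
  have hκs : Measurable (Function.uncurry fun x y => ∑' i, κ i x y) := Measurable.tsum hκ
  apply le_antisymm
  · rw [ENNReal.tsum_eq_iSup_nat]
    refine iSup_le fun N => ?_
    induction N generalizing v w with
    | zero => simp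
    | succ N ih =>
      rw [Finset.sum_range_succ', expTerm_zero, pert_eq_left hP hκs, add_comm]
      gcongr
      -- Only orders below N occur on the left. Replacing the later terms by zero lets the full
      -- Cauchy product be summed while the induction hypothesis still bounds the total.
      set b : ℕ → ℝ × S → ℝ × S → ℝ≥0∞ := fun l => if l < N then expTerm μ P κ l else 0 with hb
      have hbm : ∀ l, Measurable (Function.uncurry (b l)) := by
        intro l
        by_cases hl : l < N
        · simpa [hb, hl] using hσ l
        · rw [show b l = 0 by simp [hb, hl]]
          exact measurable_const
      calc ∑ k ∈ Finset.range N, expTerm μ P κ (k + 1) v w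
          ≤ ∑ k ∈ Finset.range N, ∑ i ∈ Finset.range (k + 1),
              kcomp (volume.prod μ) (rmul μ P (κ i)) (b (k - i)) v w := by
            refine Finset.sum_le_sum fun k hk => ?_
            rw [expTerm_succ]
            refine Finset.sum_le_sum fun i _ => ?_
            have : k - i < N := lt_of_le_of_lt (Nat.sub_le _ _) (Finset.mem_range.1 hk)
            simp [hb, this]
        _ ≤ ∑' k, ∑ i ∈ Finset.range (k + 1),
              kcomp (volume.prod μ) (rmul μ P (κ i)) (b (k - i)) v w := ENNReal.sum_le_tsum _
        _ = kcomp (volume.prod μ) (rmul μ P fun x y => ∑' i, κ i x y)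
              (fun x y => ∑' l, b l x y) v w := by
            rw [tsum_antidiagonal fun i l => kcomp (volume.prod μ) (rmul μ P (κ i)) (b l) v w,
              tsum_kcomp_tsum hP hκ hbm]
        _ ≤ _ := by
            refine kcomp_mono (fun _ _ => le_rfl) (fun x y => ?_) v w
            refine le_trans (le_of_eq ?_) (ih x y)
            rw [tsum_eq_sum (s := Finset.range N)]
            · refine Finset.sum_congr rfl fun l hl => ?_
              simp [hb, Finset.mem_range.1 hl]
            · intro l hl
              simp [hb, Finset.mem_range.not.1 hl]
  · have hT : ∀ v w, ∑' n, expTerm μ P κ n v w = P v w + kcomp (volume.prod μ)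
        (rmul μ P fun x y => ∑' i, κ i x y) (fun x y => ∑' n, expTerm μ P κ n x y) v w := by
      intro v w
      rw [tsum_eq_zero_add' ENNReal.summable, expTerm_zero]
      congr 1
      simp only [expTerm_succ]
      rw [tsum_antidiagonal fun i l =>
        kcomp (volume.prod μ) (rmul μ P (κ i)) (expTerm μ P κ l) v w, tsum_kcomp_tsum hP hκ hσ]
    rw [pert, ENNReal.tsum_eq_iSup_nat]
    refine iSup_le fun N => ?_
    induction N generalizing v w with
    | zero => simp
    | succ N ih =>
      rw [Finset.sum_range_succ', hT, add_comm]
      refine add_le_add le_rfl ?_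
      have h2 : ∑ k ∈ Finset.range N, pertTerm μ P (fun x y => ∑' i, κ i x y) (k + 1) v w =
          kcomp (volume.prod μ) (rmul μ P fun x y => ∑' i, κ i x y)
            (fun x y => ∑ k ∈ Finset.range N, pertTerm μ P (fun x y => ∑' i, κ i x y) k x y) v w := by
        unfold kcomp
        simp only [Finset.mul_sum]
        rw [lintegral_finsetSum _ fun k _ => by
          exact (measurable_rmul hP.meas hκs).of_uncurry_left.mul
            (measurable_pertTerm hP hκs k).of_uncurry_right]
        rfl
      rw [h2]
      exact kcomp_mono (fun _ _ => le_rfl) ih v w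

end Expansion

section Symmetry

variable {S : Type*} [MeasurableSpace S] {μ : Measure S} [SFinite μ]
  {P : ℝ × S → ℝ × S → ℝ≥0∞} {κ : S → S → ℝ≥0∞}

/-- The perturbation series inherits the symmetries of `P` and `κ`. -/
theorem pertTerm_symm (e : S ≃ᵐ S) (he : MeasurePreserving e μ μ)
    (hPe : ∀ s t x z, P (s, e x) (t, e z) = P (s, x) (t, z))
    (hκe : ∀ x y, κ (e x) (e y) = κ x y) (n : ℕ) (s t : ℝ) (x z : S) :
    pertTerm μ P κ n (s, e x) (t, e z) = pertTerm μ P κ n (s, x) (t, z) := by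
  induction n generalizing s x with
  | zero => exact hPe s t x z
  | succ n ih =>
    have hrm : ∀ (r : ℝ) (y : S), rmul μ P κ (s, e x) (r, e y) = rmul μ P κ (s, x) (r, y) := by
      intro r y
      unfold rmul
      rw [← he.lintegral_comp_emb e.measurableEmbedding]
      simp only [hPe, hκe]
    have hprod : MeasurePreserving (Prod.map id e : ℝ × S → ℝ × S) (volume.prod μ)
        (volume.prod μ) := (MeasurePreserving.id volume).prod he
    have hemb : MeasurableEmbedding (Prod.map id e : ℝ × S → ℝ × S) :=
      MeasurableEmbedding.id.prodMap e.measurableEmbedding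
    change ∫⁻ u, rmul μ P κ (s, e x) u * pertTerm μ P κ n u (t, e z) ∂(volume.prod μ) =
      ∫⁻ u, rmul μ P κ (s, x) u * pertTerm μ P κ n u (t, z) ∂(volume.prod μ)
    rw [← hprod.lintegral_comp_emb hemb]
    refine lintegral_congr fun u => ?_
    obtain ⟨r, y⟩ := u
    simp only [Prod.map_apply, id, hrm, ih]

theorem pert_symm (e : S ≃ᵐ S) (he : MeasurePreserving e μ μ)
    (hPe : ∀ s t x z, P (s, e x) (t, e z) = P (s, x) (t, z))
    (hκe : ∀ x y, κ (e x) (e y) = κ x y) (s t : ℝ) (x z : S) :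
    pert μ P κ (s, e x) (t, e z) = pert μ P κ (s, x) (t, z) :=
  tsum_congr fun n => pertTerm_symm e he hPe hκe n s t x z

end Symmetry

end

/-! ### Jumps of càdlàg paths and Riemann sums. -/

section

section Grid

/-- The `k`-th point of the division of `[a, a + T]` into `N + 1` equal parts. -/
noncomputable def grid (a T : ℝ≥0) (N k : ℕ) : ℝ≥0 := a + k * (T / (N + 1))

/-- The index of the block `(grid k, grid (k + 1)]` that contains `s`. -/
noncomputable def gridIdx (a T : ℝ≥0) (N : ℕ) (s : ℝ≥0) : ℕ := ⌈(s - a) / (T / (N + 1))⌉₊ - 1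

variable {a T : ℝ≥0} {N : ℕ}

theorem grid_zero : grid a T N 0 = a := by simp [grid]

theorem grid_last : grid a T N (N + 1) = a + T := by
  have : ((N : ℝ≥0) + 1) ≠ 0 := by positivity
  simp only [grid, Nat.cast_add, Nat.cast_one]
  rw [mul_div_cancel₀ _ this]

theorem grid_succ (k : ℕ) : grid a T N (k + 1) = grid a T N k + T / (N + 1) := by
  simp only [grid]; push_cast; ring

theorem grid_mono : Monotone (grid a T N) := by
  refine monotone_nat_of_le_succ fun k => ?_
  rw [grid_succ]
  exact le_self_add

theorem le_grid (k : ℕ) : a ≤ grid a T N k := by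
  simpa [grid_zero] using grid_mono (a := a) (T := T) (N := N) (Nat.zero_le k)

theorem grid_le {k : ℕ} (hk : k ≤ N + 1) : grid a T N k ≤ a + T := by
  simpa [grid_last] using grid_mono (a := a) (T := T) (N := N) hk

/-- Blocks are open on the left and closed on the right, hence the ceiling in `gridIdx`; the `- 1`
is there because block k ends at grid point k + 1. -/
theorem mem_block_iff (hT : 0 < T) {s : ℝ≥0} (hs : a < s) {k : ℕ} :
    s ∈ Ioc (grid a T N k) (grid a T N (k + 1)) ↔ k = gridIdx a T N s := by
  have hδ : 0 < T / ((N : ℝ≥0) + 1) := by positivity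
  obtain ⟨u, rfl⟩ := exists_add_of_le hs.le
  have hu : 0 < u := by simpa using hs
  have hpos : 0 < u / (T / ((N : ℝ≥0) + 1)) := by positivity
  have hc : 0 < ⌈u / (T / ((N : ℝ≥0) + 1))⌉₊ := Nat.ceil_pos.2 hpos
  simp only [gridIdx, grid, mem_Ioc, add_tsub_cancel_left]
  rw [add_lt_add_iff_left, add_le_add_iff_left, ← lt_div_iff₀ hδ, ← div_le_iff₀ hδ]
  have := Nat.ceil_eq_iff (a := u / (T / ((N : ℝ≥0) + 1))) (n := k + 1) (by simp)
  simp only [Nat.add_sub_cancel] at this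
  rw [← this]
  omega

theorem gridIdx_lt (hT : 0 < T) {s : ℝ≥0} (hs : s ∈ Ioc a (a + T)) : gridIdx a T N s < N + 1 := by
  have h := (mem_block_iff (N := N) hT hs.1).2 rfl
  by_contra hcon
  push Not at hcon
  have h1 := grid_mono (a := a) (T := T) (N := N) hcon
  rw [grid_last] at h1
  exact absurd (h1.trans_lt h.1) (not_lt.2 hs.2)

theorem tendsto_gridStep (T : ℝ≥0) :
    Tendsto (fun N : ℕ => T / ((N : ℝ≥0) + 1)) atTop (𝓝 0) := by
  rw [← NNReal.tendsto_coe]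
  push_cast
  have := (tendsto_one_div_add_atTop_nhds_zero_nat (𝕜 := ℝ)).const_mul (T : ℝ)
  simpa [div_eq_mul_inv] using this

/-- The left end of the block of s is strictly below s, so the path there tends to its left limit.
The right end is at least s, so there right-continuity applies. -/
theorem tendsto_grid_left (hT : 0 < T) {s : ℝ≥0} (hs : a < s) :
    Tendsto (fun N => grid a T N (gridIdx a T N s)) atTop (𝓝[<] s) := by
  refine tendsto_nhdsWithin_iff.2 ⟨?_, Eventually.of_forall fun N =>
    ((mem_block_iff (N := N) hT hs).2 rfl).1⟩
  have h1 : Tendsto (fun N : ℕ => s - T / ((N : ℝ≥0) + 1)) atTop (𝓝 s) := by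
    simpa using (tendsto_const_nhds (x := s)).sub (tendsto_gridStep T)
  refine tendsto_of_tendsto_of_tendsto_of_le_of_le h1 tendsto_const_nhds (fun N => ?_) fun N => ?_
  · have := ((mem_block_iff (N := N) hT hs).2 rfl).2
    rw [grid_succ] at this
    exact tsub_le_iff_right.2 this
  · exact ((mem_block_iff (N := N) hT hs).2 rfl).1.le

theorem tendsto_grid_right (hT : 0 < T) {s : ℝ≥0} (hs : a < s) :
    Tendsto (fun N => grid a T N (gridIdx a T N s + 1)) atTop (𝓝[≥] s) := by
  refine tendsto_nhdsWithin_iff.2 ⟨?_, Eventually.of_forall fun N =>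
    ((mem_block_iff (N := N) hT hs).2 rfl).2⟩
  simp only [grid_succ]
  simpa using ((tendsto_grid_left hT hs).mono_right nhdsWithin_le_nhds).add (tendsto_gridStep T)

end Grid

section Cadlag

variable {K : Type*} [TopologicalSpace K] [T2Space K]

theorem tendsto_leftLim_of_exists {x : ℝ≥0 → K} {s : ℝ≥0} (hs : 0 < s)
    (h : ∃ l, Tendsto x (𝓝[<] s) (𝓝 l)) : Tendsto x (𝓝[<] s) (𝓝 (Function.leftLim x s)) := by
  obtain ⟨l, hl⟩ := h
  have : (𝓝[<] s).NeBot := nhdsLT_neBot_of_exists_lt ⟨0, hs⟩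
  rwa [leftLim_eq_of_tendsto hl]

/-- If `f` is supported on an open set and vanishes near the diagonal, a càdlàg path has finitely
many jumps where `f` does not vanish, and `f` vanishes on short intervals that avoid them. -/
theorem exists_finset_jumps {x : ℝ≥0 → K} (hr : ∀ t, ContinuousWithinAt x (Ici t) t)
    (hl : ∀ t, 0 < t → ∃ l, Tendsto x (𝓝[<] t) (𝓝 l)) {f : K → K → ℝ≥0∞}
    (hf : IsOpen {q : K × K | f q.1 q.2 ≠ 0})
    (hf0 : ∀ l, ∀ᶠ q in 𝓝 (l, l), Function.uncurry f q = 0) (a T : ℝ≥0) :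
    ∃ J : Finset ℝ≥0, (∀ s ∈ J, s ∈ Ioc a (a + T)) ∧
      (∀ t ∈ Ioc a (a + T), t ∉ J → f (Function.leftLim x t) (x t) = 0) ∧
      ∃ δ : ℝ, 0 < δ ∧ ∀ u v : ℝ≥0, a ≤ u → u ≤ v → v ≤ a + T → dist v u < δ →
        (∀ s ∈ J, s ∉ Ioc u v) → f (x u) (x v) = 0 := by
  classical
  -- Two times close to s and on the same side of it have values close to one common limit, where f
  -- vanishes near the diagonal.
  have hη : ∀ s : ℝ≥0, ∃ η > 0, ∀ u ∈ Metric.ball s η, ∀ v ∈ Metric.ball s η,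
      ((u < s ∧ v < s) ∨ (s ≤ u ∧ s ≤ v)) → f (x u) (x v) = 0 := by
    intro s
    have h1 : ∃ η > 0, ∀ u ∈ Metric.ball s η, ∀ v ∈ Metric.ball s η,
        s ≤ u → s ≤ v → f (x u) (x v) = 0 := by
      have h := ((hr s).prodMap (hr s)).eventually (hf0 (x s))
      rw [nhdsWithin_prod_eq] at h
      obtain ⟨t, ht, h⟩ := eventually_prod_self_iff'.1 h
      obtain ⟨η, hη, hsub⟩ := Metric.mem_nhdsWithin_iff.1 ht
      exact ⟨η, hη, fun u hu v hv hsu hsv => h u (hsub ⟨hu, hsu⟩) v (hsub ⟨hv, hsv⟩)⟩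
    have h2 : ∃ η > 0, ∀ u ∈ Metric.ball s η, ∀ v ∈ Metric.ball s η,
        u < s → v < s → f (x u) (x v) = 0 := by
      rcases eq_or_lt_of_le (zero_le (a := s)) with rfl | hs
      · exact ⟨1, one_pos, fun u _ v _ hu => absurd hu not_lt_zero⟩
      obtain ⟨l, hls⟩ := hl s hs
      have h := (hls.prodMap hls).eventually (by rw [← nhds_prod_eq]; exact hf0 l)
      obtain ⟨t, ht, h⟩ := eventually_prod_self_iff'.1 h
      obtain ⟨η, hη, hsub⟩ := Metric.mem_nhdsWithin_iff.1 ht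
      exact ⟨η, hη, fun u hu v hv hsu hsv => h u (hsub ⟨hu, hsu⟩) v (hsub ⟨hv, hsv⟩)⟩
    obtain ⟨η₁, hη₁, h1⟩ := h1
    obtain ⟨η₂, hη₂, h2⟩ := h2
    refine ⟨min η₁ η₂, lt_min hη₁ hη₂, fun u hu v hv huv => ?_⟩
    rcases huv with ⟨hu', hv'⟩ | ⟨hu', hv'⟩
    · exact h2 u (Metric.ball_subset_ball (min_le_right _ _) hu) v
        (Metric.ball_subset_ball (min_le_right _ _) hv) hu' hv'
    · exact h1 u (Metric.ball_subset_ball (min_le_left _ _) hu) v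
        (Metric.ball_subset_ball (min_le_left _ _) hv) hu' hv'
  choose η hη0 hη using hη
  obtain ⟨J, hJ⟩ := (isCompact_Icc (a := a) (b := a + T)).elim_finite_subcover
    (fun s => Metric.ball s (η s)) (fun s => Metric.isOpen_ball)
    (fun s _ => mem_iUnion.2 ⟨s, Metric.mem_ball_self (hη0 s)⟩)
  -- With a Lebesgue number δ, a pair u ≤ v at distance below δ lies in the ball of a single centre
  -- s. If s is not in (u, v], both times are on the same side of s. The finitely many centres are
  -- thus the only candidates for relevant jumps.
  obtain ⟨δ, hδ, hleb⟩ := lebesgue_number_lemma_of_metric (s := Icc a (a + T))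
    (c := fun s : J => Metric.ball (s : ℝ≥0) (η s)) isCompact_Icc (fun s => Metric.isOpen_ball)
    (by simpa [iUnion_subtype] using hJ)
  have key : ∀ u v : ℝ≥0, a ≤ u → u ≤ v → v ≤ a + T → dist v u < δ → (∀ s ∈ J, s ∉ Ioc u v) →
      f (x u) (x v) = 0 := by
    intro u v hau huv hv hd hno
    obtain ⟨⟨s, hs⟩, hsub⟩ := hleb u ⟨hau, huv.trans hv⟩
    refine hη s u (hsub (Metric.mem_ball_self hδ)) v (hsub hd) ?_
    by_cases h : u < s
    · left
      exact ⟨h, lt_of_not_ge fun h' => hno s hs ⟨h, h'⟩⟩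
    · right
      exact ⟨not_lt.1 h, (not_lt.1 h).trans huv⟩
  set J' := J.filter (· ∈ Ioc a (a + T)) with hJ'
  have hzero : ∀ t ∈ Ioc a (a + T), t ∉ J → f (Function.leftLim x t) (x t) = 0 := by
    intro t ht htJ
    have ht0 : 0 < t := (zero_le (a := a)).trans_lt ht.1
    have : (𝓝[<] t).NeBot := nhdsLT_neBot_of_exists_lt ⟨0, ht0⟩
    -- The support of f is open, so a nonzero value at (left limit, x t) would persist at (x u, x t)
    -- for u just below t, against `key`.
    by_contra hne
    have e0 : ∀ᶠ u in 𝓝[<] t, f (x u) (x t) ≠ 0 :=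
      ((tendsto_leftLim_of_exists ht0 (hl t ht0)).prodMk_nhds tendsto_const_nhds).eventually
        (hf.mem_nhds hne)
    have e1 : ∀ᶠ u in 𝓝[<] t, a < u := nhdsWithin_le_nhds (lt_mem_nhds ht.1)
    have e2 : ∀ᶠ u in 𝓝[<] t, dist t u < δ := by
      have := nhdsWithin_le_nhds (s := Iio t) (Metric.ball_mem_nhds t hδ)
      filter_upwards [this] with u hu
      rwa [dist_comm]
    have e3 : ∀ᶠ u in 𝓝[<] t, ∀ s ∈ J, s ∉ Ioc u t := by
      rw [Filter.eventually_all_finset]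
      intro s hs
      rcases lt_trichotomy s t with h | h | h
      · filter_upwards [nhdsWithin_le_nhds (lt_mem_nhds h)] with u hu hsu
        exact lt_asymm hu hsu.1
      · exact absurd (h ▸ hs) htJ
      · exact Eventually.of_forall fun u hsu => not_lt.2 hsu.2 h
    obtain ⟨u, h0, h1, h2, h3, h4⟩ :=
      (e0.and (e1.and (e2.and (e3.and self_mem_nhdsWithin)))).exists
    exact h0 (key u t h1.le (le_of_lt h4) ht.2 h2 h3)
  refine ⟨J', fun s hs => (Finset.mem_filter.1 hs).2, fun t ht htJ => hzero t ht fun h' =>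
    htJ (Finset.mem_filter.2 ⟨h', ht⟩), δ, hδ, fun u v hau huv hv hd hno => key u v hau huv hv hd
      fun s hs hsuv => hno s (Finset.mem_filter.2 ⟨hs, hau.trans_lt hsuv.1, hsuv.2.trans hv⟩) hsuv⟩

theorem tsum_jumps_eq_sum {x : ℝ≥0 → K} {f : K → K → ℝ≥0∞} {I : Set ℝ≥0} {J : Finset ℝ≥0}
    (hJ : ∀ s ∈ J, s ∈ I) (hzero : ∀ t ∈ I, t ∉ J → f (Function.leftLim x t) (x t) = 0) :
    ∑' s, I.indicator (fun s => f (Function.leftLim x s) (x s)) s =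
      ∑ s ∈ J, f (Function.leftLim x s) (x s) := by
  rw [tsum_eq_sum (s := J)]
  · exact Finset.sum_congr rfl fun s hs => indicator_of_mem (hJ s hs) _
  · intro s hs
    by_cases h : s ∈ I
    · rw [indicator_of_mem h]
      exact hzero s h hs
    · rw [indicator_of_notMem h]

/-- The sum of `f` over the jumps of a càdlàg path is a limit of Riemann sums, if `f` is continuous
and vanishes near the diagonal. -/
theorem tendsto_sum_grid {x : ℝ≥0 → K} (hr : ∀ t, ContinuousWithinAt x (Ici t) t)
    (hl : ∀ t, 0 < t → ∃ l, Tendsto x (𝓝[<] t) (𝓝 l)) {f : K → K → ℝ≥0∞}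
    (hf : Continuous (Function.uncurry f)) (hf0 : ∀ l, ∀ᶠ q in 𝓝 (l, l), Function.uncurry f q = 0)
    (a : ℝ≥0) {T : ℝ≥0} (hT : 0 < T) :
    Tendsto (fun N => ∑ k ∈ Finset.range (N + 1), f (x (grid a T N k)) (x (grid a T N (k + 1))))
      atTop (𝓝 (∑' s, (Ioc a (a + T)).indicator (fun s => f (Function.leftLim x s) (x s)) s)) := by
  classical
  obtain ⟨J', hJ', hzero, δ, hδ, key⟩ := exists_finset_jumps hr hl
    (isOpen_ne_fun hf continuous_const) hf0 a T
  rw [tsum_jumps_eq_sum hJ' hzero]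
  have hterm : Tendsto (fun N => ∑ s ∈ J', f (x (grid a T N (gridIdx a T N s)))
      (x (grid a T N (gridIdx a T N s + 1)))) atTop
      (𝓝 (∑ s ∈ J', f (Function.leftLim x s) (x s))) := by
    refine tendsto_finsetSum _ fun s hs => ?_
    have hs' := (hJ' s hs)
    have hs0 : 0 < s := (zero_le (a := a)).trans_lt hs'.1
    exact (hf.tendsto _).comp (((tendsto_leftLim_of_exists hs0 (hl s hs0)).comp
      (tendsto_grid_left hT hs'.1)).prodMk_nhds ((hr s).tendsto.comp (tendsto_grid_right hT hs'.1)))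
  refine hterm.congr' ?_
  -- Once the mesh is smaller than all gaps, no block contains two points of J'. When it is also
  -- below δ, blocks without such a point contribute zero.
  have hinj : ∀ᶠ N in atTop, ∀ s ∈ J', ∀ s' ∈ J', gridIdx a T N s = gridIdx a T N s' → s = s' := by
    rw [Filter.eventually_all_finset]
    intro s hs
    rw [Filter.eventually_all_finset]
    intro s' hs'
    by_cases h : s = s'
    · exact Eventually.of_forall fun _ _ => h
    have hd : 0 < nndist s s' := pos_iff_ne_zero.2 (nndist_eq_zero.not.2 h)
    filter_upwards [(tendsto_gridStep T).eventually (gt_mem_nhds hd)] with N hN heq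
    have b1 := (mem_block_iff (N := N) hT (hJ' s hs).1).2 rfl
    have b2 := (mem_block_iff (N := N) hT (hJ' s' hs').1).2 heq
    rw [grid_succ] at b1 b2
    exfalso
    rw [NNReal.nndist_eq] at hN
    rcases lt_max_iff.1 hN with h' | h'
    · exact absurd (lt_tsub_iff_left.1 h') (not_lt.2 (b1.2.trans (by gcongr; exact b2.1.le)))
    · exact absurd (lt_tsub_iff_left.1 h') (not_lt.2 (b2.2.trans (by gcongr; exact b1.1.le)))
  have hmesh : ∀ᶠ N : ℕ in atTop, ((T / ((N : ℝ≥0) + 1) : ℝ≥0) : ℝ) < δ := by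
    have : Tendsto (fun N : ℕ => ((T / ((N : ℝ≥0) + 1) : ℝ≥0) : ℝ)) atTop (𝓝 ((0 : ℝ≥0) : ℝ)) :=
      NNReal.tendsto_coe.2 (tendsto_gridStep T)
    exact this.eventually (gt_mem_nhds (by simpa using hδ))
  filter_upwards [hinj, hmesh] with N hinj hmesh
  have himg : J'.image (gridIdx a T N) ⊆ Finset.range (N + 1) := by
    intro k hk
    obtain ⟨s, hs, rfl⟩ := Finset.mem_image.1 hk
    exact Finset.mem_range.2 (gridIdx_lt hT (hJ' s hs))
  rw [← Finset.sum_subset himg]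
  · exact (Finset.sum_image (s := J') (g := gridIdx a T N)
      (f := fun k => f (x (grid a T N k)) (x (grid a T N (k + 1)))) hinj).symm
  · intro k hk hkJ
    refine key _ _ (le_grid k) (grid_mono k.le_succ) (grid_le (Finset.mem_range.1 hk)) ?_ ?_
    · rw [NNReal.dist_eq, grid_succ, NNReal.coe_add, add_sub_cancel_left,
        abs_of_nonneg (NNReal.coe_nonneg _)]
      exact hmesh
    · intro s hs hmem
      have h1 : s ∈ Ioc a (a + T) :=
        ⟨(le_grid k).trans_lt hmem.1, hmem.2.trans (grid_le (Finset.mem_range.1 hk))⟩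
      exact hkJ (Finset.mem_image.2 ⟨s, hs,
        ((mem_block_iff hT h1.1).1 hmem).symm⟩)

end Cadlag

end

/-! ### The Markov property for sums along a skeleton. -/

section

open ProbabilityTheory

section Markov

variable {E Ω : Type*} [TopologicalSpace E] [mΩ : MeasurableSpace Ω] (Z : HuntProcess E Ω)

instance (x : OnePoint E) : IsProbabilityMeasure (Z.P x) := Z.isProbabilityMeasure x

theorem measurable_X (t : ℝ≥0) : Measurable (Z.X t) := (Z.adapted t).mono (Z.filt.le t) le_rfl

/-- The transition kernels of a Hunt process. -/
noncomputable def transKernel (t : ℝ≥0) : Kernel (OnePoint E) (OnePoint E) where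
  toFun x := (Z.P x).map (Z.X t)
  measurable' := Measure.measurable_of_measurable_coe _ fun B hB => by
    simp only [Measure.map_apply (measurable_X Z t) hB]
    exact Z.measurable_transition t B hB

theorem transKernel_apply (t : ℝ≥0) (x : OnePoint E) :
    transKernel Z t x = (Z.P x).map (Z.X t) := rfl

instance (t : ℝ≥0) : IsMarkovKernel (transKernel Z t) :=
  ⟨fun _ => Measure.isProbabilityMeasure_map (measurable_X Z t).aemeasurable⟩

theorem markov_set (x : OnePoint E) (a s : ℝ≥0) {A : Set Ω} (hA : MeasurableSet[Z.filt a] A)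
    {B : Set (OnePoint E)} (hB : MeasurableSet B) :
    Z.P x (A ∩ Z.X (a + s) ⁻¹' B) = ∫⁻ ω in A, transKernel Z s (Z.X a ω) B ∂(Z.P x) := by
  have h := Z.strongMarkov x (fun _ => (a : WithTop ℝ≥0)) (isStoppingTime_const _ a) A
    (by rwa [IsStoppingTime.measurableSpace_const]) s B hB
  simp only [WithTop.untopD_coe, ne_eq, WithTop.coe_ne_top, not_false_eq_true, true_and,
    ofPred_true, inter_univ] at h
  rw [show Z.X (a + s) ⁻¹' B = {ω | Z.X (a + s) ω ∈ B} from rfl, h]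
  simp only [transKernel_apply, Measure.map_apply (measurable_X Z s) hB]

/-- The Markov property at a fixed time, with a parameter from the past. -/
theorem lintegral_markov (x : OnePoint E) (a s : ℝ≥0) {Y : Type*} [MeasurableSpace Y] {y : Ω → Y}
    (hy : Measurable[Z.filt a] y) {G : Y → OnePoint E → OnePoint E → ℝ≥0∞}
    (hG : Measurable fun q : (Y × OnePoint E) × OnePoint E => G q.1.1 q.1.2 q.2) :
    ∫⁻ ω, G (y ω) (Z.X a ω) (Z.X (a + s) ω) ∂(Z.P x) =
      ∫⁻ ω, ∫⁻ z, G (y ω) (Z.X a ω) z ∂(transKernel Z s (Z.X a ω)) ∂(Z.P x) := by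
  have hy' : Measurable y := hy.mono (Z.filt.le a) le_rfl
  have h1 : Measurable fun ω => (y ω, Z.X a ω) := hy'.prodMk (measurable_X Z a)
  have h1f : Measurable[Z.filt a] fun ω => (y ω, Z.X a ω) :=
    Measurable.prodMk hy (Z.adapted a)
  -- The two joint laws agree on rectangles, where the claim is the Markov property for sets.
  have key : (Z.P x).map (fun ω => ((y ω, Z.X a ω), Z.X (a + s) ω)) =
      (Z.P x).map (fun ω => (y ω, Z.X a ω)) ⊗ₘ Kernel.prodMkLeft Y (transKernel Z s) := by
    have : IsProbabilityMeasure ((Z.P x).map (fun ω => ((y ω, Z.X a ω), Z.X (a + s) ω))) :=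
      Measure.isProbabilityMeasure_map (h1.prodMk (measurable_X Z _)).aemeasurable
    have : IsProbabilityMeasure ((Z.P x).map (fun ω => (y ω, Z.X a ω))) :=
      Measure.isProbabilityMeasure_map h1.aemeasurable
    refine Measure.ext_prod fun {A B} hA hB => ?_
    rw [Measure.map_apply (h1.prodMk (measurable_X Z _)) (hA.prod hB),
      Measure.compProd_apply_prod hA hB, setLIntegral_map hA (by
        exact (Kernel.measurable_coe _ hB)) h1]
    exact markov_set Z x a s (h1f hA) hB
  have e1 : ∫⁻ ω, G (y ω) (Z.X a ω) (Z.X (a + s) ω) ∂(Z.P x) =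
      ∫⁻ q, G q.1.1 q.1.2 q.2 ∂((Z.P x).map (fun ω => ((y ω, Z.X a ω), Z.X (a + s) ω))) :=
    (lintegral_map hG (h1.prodMk (measurable_X Z _))).symm
  rw [e1, key, Measure.lintegral_compProd hG, lintegral_map (by
    exact hG.lintegral_kernel_prod_right' (κ := Kernel.prodMkLeft Y (transKernel Z s))) h1]
  rfl

theorem lintegral_transKernel (x : OnePoint E) (t : ℝ≥0) {h : OnePoint E → ℝ≥0∞}
    (hh : Measurable h) :
    ∫⁻ z, h z ∂(transKernel Z t x) = ∫⁻ ω, h (Z.X t ω) ∂(Z.P x) :=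
  lintegral_map hh (measurable_X Z t)

theorem lintegral_markov' (x : OnePoint E) (a s : ℝ≥0) {W : Ω → ℝ≥0∞}
    (hW : Measurable[Z.filt a] W) {h : OnePoint E → ℝ≥0∞} (hh : Measurable h) :
    ∫⁻ ω, W ω * h (Z.X (a + s) ω) ∂(Z.P x) =
      ∫⁻ ω, W ω * ∫⁻ z, h z ∂(transKernel Z s (Z.X a ω)) ∂(Z.P x) := by
  have := lintegral_markov Z x a s hW (G := fun w _ z => w * h z)
    ((measurable_fst.comp measurable_fst).mul (hh.comp measurable_snd))
  rw [this]
  refine lintegral_congr fun ω => ?_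
  exact lintegral_const_mul _ hh

/-- Riemann sums along the skeleton of the process. -/
noncomputable def skelSum (f : OnePoint E → OnePoint E → ℝ≥0∞) (δ a : ℝ≥0) (N : ℕ) (ω : Ω) :
    ℝ≥0∞ :=
  ∑ k ∈ Finset.range N, f (Z.X (a + k * δ) ω) (Z.X (a + (k + 1 : ℕ) * δ) ω)

/-- The expectation of `h (σ + skelSum)` as a function of the starting point. -/
noncomputable def skelExp (f : OnePoint E → OnePoint E → ℝ≥0∞) (δ : ℝ≥0) (h : ℝ≥0∞ → ℝ≥0∞) :
    ℕ → OnePoint E → ℝ≥0∞ → ℝ≥0∞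
  | 0 => fun _ σ => h σ
  | N + 1 => fun y σ => ∫⁻ z, skelExp f δ h N z (σ + f y z) ∂(transKernel Z δ y)

variable {f : OnePoint E → OnePoint E → ℝ≥0∞} (hf : Measurable (Function.uncurry f))
include hf

theorem measurable_skelExp (δ : ℝ≥0) {h : ℝ≥0∞ → ℝ≥0∞} (hh : Measurable h) (N : ℕ) :
    Measurable (Function.uncurry (skelExp Z f δ h N)) := by
  induction N with
  | zero => exact hh.comp measurable_snd
  | succ N ih =>
    have h1 : Measurable fun q : (OnePoint E × ℝ≥0∞) × OnePoint E =>
        skelExp Z f δ h N q.2 (q.1.2 + f q.1.1 q.2) :=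
      ih.comp (measurable_snd.prodMk (measurable_fst.snd.add
        (hf.comp (measurable_fst.fst.prodMk measurable_snd))))
    exact h1.lintegral_kernel_prod_right' (κ := (transKernel Z δ).comap
      (Prod.fst : OnePoint E × ℝ≥0∞ → OnePoint E) measurable_fst)

theorem measurable_skelSum (δ a : ℝ≥0) (N : ℕ) :
    Measurable[Z.filt (a + N * δ)] (skelSum Z f δ a N) := by
  refine Finset.measurable_fun_sum _ fun k hk => ?_
  have hk' : k + 1 ≤ N := Finset.mem_range.1 hk
  have h1 : Measurable[Z.filt (a + N * δ)] (Z.X (a + k * δ)) :=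
    (Z.adapted _).mono (Z.filt.mono (by gcongr; exact (Nat.le_succ k).trans hk')) le_rfl
  have h2 : Measurable[Z.filt (a + N * δ)] (Z.X (a + (k + 1 : ℕ) * δ)) :=
    (Z.adapted _).mono (Z.filt.mono (by gcongr)) le_rfl
  exact hf.comp (Measurable.prodMk h1 h2)

/-- The sum accumulated so far is carried along as Y. This lets the induction apply the hypothesis
from a + δ on, with the first increment absorbed in Y, and then condition on the information at time
a. -/
theorem lintegral_skelSum_add (δ : ℝ≥0) {h : ℝ≥0∞ → ℝ≥0∞} (hh : Measurable h) (N : ℕ)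
    (x : OnePoint E) (a : ℝ≥0) {W Y : Ω → ℝ≥0∞} (hW : Measurable[Z.filt a] W)
    (hY : Measurable[Z.filt a] Y) :
    ∫⁻ ω, W ω * h (Y ω + skelSum Z f δ a N ω) ∂(Z.P x) =
      ∫⁻ ω, W ω * skelExp Z f δ h N (Z.X a ω) (Y ω) ∂(Z.P x) := by
  induction N generalizing a W Y with
  | zero => simp [skelSum, skelExp]
  | succ N ih =>
    have hmono : Z.filt a ≤ Z.filt (a + δ) := Z.filt.mono le_self_add
    have hXa : Measurable[Z.filt (a + δ)] (Z.X a) := (Z.adapted a).mono hmono le_rfl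
    have hf1 : Measurable[Z.filt (a + δ)] fun ω => f (Z.X a ω) (Z.X (a + δ) ω) :=
      hf.comp (Measurable.prodMk hXa (Z.adapted _))
    have hs : ∀ ω, Y ω + skelSum Z f δ a (N + 1) ω =
        (Y ω + f (Z.X a ω) (Z.X (a + δ) ω)) + skelSum Z f δ (a + δ) N ω := by
      intro ω
      unfold skelSum
      rw [Finset.sum_range_succ', add_assoc, add_comm (∑ k ∈ _, _)]
      congr 2
      · simp
      · refine Finset.sum_congr rfl fun k _ => ?_
        rw [show a + ((k + 1 : ℕ) : ℝ≥0) * δ = a + δ + k * δ by push_cast; ring,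
          show a + ((k + 1 + 1 : ℕ) : ℝ≥0) * δ = a + δ + (k + 1 : ℕ) * δ by push_cast; ring]
    simp only [hs]
    rw [ih (a + δ) (W := W) (Y := fun ω => Y ω + f (Z.X a ω) (Z.X (a + δ) ω))
      (hW.mono hmono le_rfl) ((hY.mono hmono le_rfl).add hf1)]
    have hm := measurable_skelExp Z hf δ hh N
    have := lintegral_markov Z x a δ (y := fun ω => (W ω, Y ω))
      (Measurable.prodMk hW hY)
      (G := fun p y z => p.1 * skelExp Z f δ h N z (p.2 + f y z))
      ((measurable_fst.fst.fst).mul (hm.comp (measurable_snd.prodMk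
        (measurable_fst.fst.snd.add (hf.comp (measurable_fst.snd.prodMk measurable_snd))))))
    rw [this]
    refine lintegral_congr fun ω => ?_
    have hm2 : Measurable fun z => skelExp Z f δ h N z (Y ω + f (Z.X a ω) z) :=
      hm.comp (measurable_id.prodMk (measurable_const.add
        (hf.comp (measurable_const.prodMk measurable_id))))
    rw [lintegral_const_mul _ hm2]
    rfl

/-- A substitute for path shifts, which the notion of process used here does not include: given the
past up to a, the skeleton sum after a has the law of the skeleton sum from 0 started at X_a. -/
theorem lintegral_skelSum (δ : ℝ≥0) {h : ℝ≥0∞ → ℝ≥0∞} (hh : Measurable h) (N : ℕ)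
    (x : OnePoint E) (a : ℝ≥0) {W : Ω → ℝ≥0∞} (hW : Measurable[Z.filt a] W) :
    ∫⁻ ω, W ω * h (skelSum Z f δ a N ω) ∂(Z.P x) =
      ∫⁻ ω, W ω * ∫⁻ ω', h (skelSum Z f δ 0 N ω') ∂(Z.P (Z.X a ω)) ∂(Z.P x) := by
  have h0 : ∀ y, ∫⁻ ω', h (skelSum Z f δ 0 N ω') ∂(Z.P y) = skelExp Z f δ h N y 0 := by
    intro y
    have := lintegral_skelSum_add Z hf δ hh N y 0 (W := fun _ => 1) (Y := fun _ => 0)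
      measurable_const measurable_const
    simp only [one_mul, zero_add] at this
    rw [this]
    calc _ = ∫⁻ ω, skelExp Z f δ h N y 0 ∂(Z.P y) := by
          refine lintegral_congr_ae ?_
          filter_upwards [Z.start y] with ω hω
          rw [hω]
      _ = _ := by simp
  simp only [h0]
  have := lintegral_skelSum_add Z hf δ hh N x a (Y := fun _ => 0) hW measurable_const
  simpa using this

end Markov

end

/-! ### Extension to the cemetery, and sums over jumps. -/

section

open ProbabilityTheory

/-- The Euclidean space of dimension `d`. -/
abbrev Eu (d : ℕ) := EuclideanSpace ℝ (Fin d)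

variable {d : ℕ}

-- The compactification of Euclidean space is a sphere. Metrizability is what makes pointwise limits
-- of measurable maps into it measurable.
instance : TopologicalSpace.MetrizableSpace (OnePoint (Eu d)) :=
  (onePointEquivSphereOfFinrankEq (ι := Fin (d + 1)) (V := Eu d)
    (by simp)).isEmbedding.metrizableSpace

section ExtendZero

theorem measurableEmbedding_coe : MeasurableEmbedding ((↑) : Eu d → OnePoint (Eu d)) :=
  OnePoint.isOpenEmbedding_coe.measurableEmbedding

@[simp] theorem extendZero_coe {R : Type*} [Zero R] (g : Eu d → R) (x : Eu d) :
    extendZero g (x : OnePoint (Eu d)) = g x := rfl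

@[simp] theorem extendZero_infty {R : Type*} [Zero R] (g : Eu d → R) :
    extendZero g (OnePoint.infty : OnePoint (Eu d)) = 0 := rfl

@[simp] theorem extendZero₂_coe {R : Type*} [Zero R] (f : Eu d → Eu d → R) (x y : Eu d) :
    extendZero₂ f (x : OnePoint (Eu d)) (y : OnePoint (Eu d)) = f x y := rfl

@[simp] theorem extendZero₂_infty_left {R : Type*} [Zero R] (f : Eu d → Eu d → R)
    (y : OnePoint (Eu d)) : extendZero₂ f OnePoint.infty y = 0 := rfl

@[simp] theorem extendZero₂_infty_right {R : Type*} [Zero R] (f : Eu d → Eu d → R)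
    (x : OnePoint (Eu d)) : extendZero₂ f x OnePoint.infty = 0 := by
  induction x using OnePoint.rec <;> rfl

theorem measurable_extendZero {R : Type*} [Zero R] [MeasurableSpace R] {g : Eu d → R}
    (hg : Measurable g) : Measurable (extendZero g) := by
  have h := measurableEmbedding_coe.measurable_extend (g := g) (g' := fun _ => (0 : R)) hg
    measurable_const
  convert h using 1
  ext x
  induction x using OnePoint.rec with
  | infty =>
    rw [Function.extend_apply']
    · rfl
    · rintro ⟨a, ha⟩
      exact OnePoint.coe_ne_infty a ha
  | coe x => rw [measurableEmbedding_coe.injective.extend_apply]; rfl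

theorem measurable_extendZero₂ {R : Type*} [Zero R] [MeasurableSpace R] {f : Eu d → Eu d → R}
    (hf : Measurable (Function.uncurry f)) : Measurable (Function.uncurry (extendZero₂ f)) := by
  have he : MeasurableEmbedding (Prod.map ((↑) : Eu d → OnePoint (Eu d))
      ((↑) : Eu d → OnePoint (Eu d))) := measurableEmbedding_coe.prodMap measurableEmbedding_coe
  have h := he.measurable_extend (g := Function.uncurry f) (g' := fun _ => (0 : R)) hf
    measurable_const
  convert h using 1
  ext q
  obtain ⟨x, y⟩ := q
  by_cases hq : ∃ p, Prod.map ((↑) : Eu d → OnePoint (Eu d)) ((↑) : Eu d → OnePoint (Eu d)) p =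
      (x, y)
  · obtain ⟨p, hp⟩ := hq
    rw [← hp, he.injective.extend_apply]
    rfl
  · rw [Function.extend_apply' _ _ _ hq]
    induction x using OnePoint.rec with
    | infty => rfl
    | coe x =>
      induction y using OnePoint.rec with
      | infty => rfl
      | coe y => exact absurd ⟨(x, y), rfl⟩ hq

/-- Pairs of points in the ball of radius `n + 1` at distance more than `1 / (n + 1)`. -/
def offDiag (d n : ℕ) : Set (Eu d × Eu d) :=
  {q | ‖q.1‖ < n + 1 ∧ ‖q.2‖ < n + 1 ∧ 1 / ((n : ℝ) + 1) < dist q.1 q.2}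

theorem isOpen_offDiag (n : ℕ) : IsOpen (offDiag d n) :=
  (isOpen_lt continuous_fst.norm continuous_const).inter
    ((isOpen_lt continuous_snd.norm continuous_const).inter
      (isOpen_lt continuous_const (continuous_fst.dist continuous_snd)))

theorem offDiag_mono {n n' : ℕ} (h : n ≤ n') : offDiag d n ⊆ offDiag d n' := by
  rintro q ⟨h1, h2, h3⟩
  have hn : (n : ℝ) ≤ n' := by exact_mod_cast h
  refine ⟨by linarith, by linarith, lt_of_le_of_lt ?_ h3⟩
  gcongr

theorem exists_mem_offDiag {x y : Eu d} (h : x ≠ y) : ∃ n, (x, y) ∈ offDiag d n := by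
  obtain ⟨n1, h1⟩ := exists_nat_gt ‖x‖
  obtain ⟨n2, h2⟩ := exists_nat_gt ‖y‖
  obtain ⟨n3, h3⟩ := exists_nat_one_div_lt (dist_pos.2 h)
  have a1 : (n1 : ℝ) ≤ (max n1 (max n2 n3) : ℕ) := by exact_mod_cast le_max_left _ _
  have a2 : (n2 : ℝ) ≤ (max n1 (max n2 n3) : ℕ) := by
    exact_mod_cast (le_max_left _ _).trans (le_max_right _ _)
  have a3 : (n3 : ℝ) ≤ (max n1 (max n2 n3) : ℕ) := by
    exact_mod_cast (le_max_right _ _).trans (le_max_right _ _)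
  refine ⟨max n1 (max n2 n3), by simp only; linarith, by simp only; linarith,
    lt_of_le_of_lt ?_ h3⟩
  gcongr

variable {f : Eu d → Eu d → ℝ≥0∞} {n : ℕ} (hf0 : ∀ x y, (x, y) ∉ offDiag d n → f x y = 0)
include hf0

/-- The support of f is bounded in both variables, so the extension by zero vanishes near the
cemetery and no continuity is lost there. -/
theorem extendZero₂_eventually_infty :
    ∀ᶠ x in 𝓝 (OnePoint.infty : OnePoint (Eu d)), ∀ y, extendZero₂ f x y = 0 ∧
      extendZero₂ f y x = 0 := by
  have hopen : IsOpen (((↑) '' Metric.closedBall (0 : Eu d) (n + 1))ᶜ : Set (OnePoint (Eu d))) :=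
    OnePoint.isOpen_compl_image_coe.2 ⟨Metric.isClosed_closedBall, isCompact_closedBall _ _⟩
  filter_upwards [hopen.mem_nhds (by
    rintro ⟨a, -, ha⟩
    exact OnePoint.coe_ne_infty a ha)] with x hx y
  induction x using OnePoint.rec with
  | infty => simp
  | coe x =>
    have hx' : ¬ ‖x‖ < n + 1 := by
      intro h
      exact hx ⟨x, by simpa using h.le, rfl⟩
    induction y using OnePoint.rec with
    | infty => simp
    | coe y => exact ⟨hf0 _ _ fun h => hx' h.1, hf0 _ _ fun h => hx' h.2.1⟩

theorem extendZero₂_eventually_diag (l : OnePoint (Eu d)) :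
    ∀ᶠ q in 𝓝 (l, l), Function.uncurry (extendZero₂ f) q = 0 := by
  induction l using OnePoint.rec with
  | infty =>
    rw [nhds_prod_eq]
    filter_upwards [(extendZero₂_eventually_infty hf0).prod_inl _] with q hq
    exact (hq q.2).1
  | coe l =>
    have hε : (0 : ℝ) < 1 / (n + 1) / 2 := by positivity
    have hU : ((↑) '' Metric.ball l (1 / (n + 1) / 2) : Set (OnePoint (Eu d))) ∈
        𝓝 (l : OnePoint (Eu d)) :=
      OnePoint.isOpenEmbedding_coe.image_mem_nhds.2 (Metric.ball_mem_nhds l hε)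
    filter_upwards [prod_mem_nhds hU hU] with q hq
    obtain ⟨x, y⟩ := q
    obtain ⟨⟨a, ha, rfl⟩, ⟨b, hb, rfl⟩⟩ := hq
    refine hf0 a b fun h => ?_
    have h1 := h.2.2
    have h2 : dist a b ≤ dist a l + dist b l := dist_triangle_right _ _ _
    rw [Metric.mem_ball] at ha hb
    simp only at h1
    linarith

theorem isOpen_extendZero₂_ne (hf : IsOpen {q : Eu d × Eu d | f q.1 q.2 ≠ 0}) :
    IsOpen {q : OnePoint (Eu d) × OnePoint (Eu d) | extendZero₂ f q.1 q.2 ≠ 0} := by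
  have he := (OnePoint.isOpenEmbedding_coe (X := Eu d)).prodMap
    (OnePoint.isOpenEmbedding_coe (X := Eu d))
  convert he.isOpenMap _ hf using 1
  ext ⟨x, y⟩
  constructor
  · intro h
    induction x using OnePoint.rec with
    | infty => exact absurd rfl h
    | coe x =>
      induction y using OnePoint.rec with
      | infty => exact absurd rfl h
      | coe y => exact ⟨(x, y), h, rfl⟩
  · rintro ⟨⟨a, b⟩, h, hab⟩
    obtain ⟨rfl, rfl⟩ := Prod.mk.injEq _ _ _ _ ▸ hab
    exact h

theorem continuous_extendZero₂ (hf : Continuous (Function.uncurry f)) :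
    Continuous (Function.uncurry (extendZero₂ f)) := by
  have he := (OnePoint.isOpenEmbedding_coe (X := Eu d)).prodMap
    (OnePoint.isOpenEmbedding_coe (X := Eu d))
  rw [continuous_iff_continuousAt]
  rintro ⟨x, y⟩
  induction x using OnePoint.rec with
  | infty =>
    refine (continuousAt_const (y := (0 : ℝ≥0∞))).congr ?_
    rw [nhds_prod_eq]
    filter_upwards [(extendZero₂_eventually_infty hf0).prod_inl _] with q hq
    exact (hq q.2).1.symm
  | coe x =>
    induction y using OnePoint.rec with
    | infty =>
      refine (continuousAt_const (y := (0 : ℝ≥0∞))).congr ?_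
      rw [nhds_prod_eq]
      filter_upwards [(extendZero₂_eventually_infty hf0).prod_inr _] with q hq
      exact (hq q.1).2.symm
    | coe y =>
      have := (he.continuousAt_iff (x := (x, y)) (g := Function.uncurry (extendZero₂ f))).1
      exact this hf.continuousAt

end ExtendZero

section JumpOn

variable {Ω : Type*} [mΩ : MeasurableSpace Ω] (Z : HuntProcess (Eu d) Ω)

/-- The value of a function `f` at the jump (if any) at time `s`, zero if the cemetery is involved. -/
noncomputable def jumpAt {R : Type*} [Zero R] (f : Eu d → Eu d → R) (ω : Ω) (s : ℝ≥0) : R :=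
  extendZero₂ f (Function.leftLim (fun u => Z.X u ω) s) (Z.X s ω)

/-- The sum of `f` over the jumps at times in `I`. -/
noncomputable def jumpOn (f : Eu d → Eu d → ℝ≥0∞) (I : Set ℝ≥0) (ω : Ω) : ℝ≥0∞ :=
  ∑' s, I.indicator (jumpAt Z f ω) s

theorem jumpSum_eq_jumpOn (f : Eu d → Eu d → ℝ≥0∞) (t : ℝ≥0) (ω : Ω) :
    jumpSum Z f t ω = jumpOn Z f (Ioc 0 t) ω := tsum_subtype (Ioc 0 t) (jumpAt Z f ω)

/-- Joint right-continuity gives joint measurability. -/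
theorem measurable_uncurry_X : Measurable fun q : ℝ≥0 × Ω => Z.X q.1 q.2 := by
  -- This is a grid point strictly above s at distance at most 1/(N+1), so right-continuity gives X
  -- at r N s → X at s.
  let r : ℕ → ℝ≥0 → ℝ≥0 := fun N s => (⌊s * (N + 1)⌋₊ + 1 : ℕ) / (N + 1)
  have hr : ∀ N, Measurable fun q : ℝ≥0 × Ω => Z.X (r N q.1) q.2 := by
    intro N
    have h1 : Measurable (Function.uncurry fun (k : ℕ) (ω : Ω) =>
        Z.X (((k + 1 : ℕ) : ℝ≥0) / ((N : ℝ≥0) + 1)) ω) :=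
      measurable_from_prod_countable_right fun k =>
        measurable_X Z (((k + 1 : ℕ) : ℝ≥0) / ((N : ℝ≥0) + 1))
    have h2 : Measurable fun q : ℝ≥0 × Ω => (⌊q.1 * ((N : ℝ≥0) + 1)⌋₊, q.2) :=
      (Nat.measurable_floor.comp (measurable_fst.mul_const _)).prodMk measurable_snd
    have h3 := h1.comp h2
    exact h3
  refine measurable_of_tendsto_metrizable hr (tendsto_pi_nhds.2 fun q => ?_)
  have hge : ∀ N, q.1 ≤ r N q.1 := by
    intro N
    have hN : (0 : ℝ≥0) < N + 1 := by positivity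
    rw [le_div_iff₀ hN]
    push_cast
    exact (Nat.lt_floor_add_one _).le
  have hle : ∀ N : ℕ, r N q.1 ≤ q.1 + 1 / ((N : ℝ≥0) + 1) := by
    intro N
    have hN : (0 : ℝ≥0) < N + 1 := by positivity
    rw [div_le_iff₀ hN, add_mul, one_div, inv_mul_cancel₀ hN.ne']
    push_cast
    gcongr
    exact Nat.floor_le zero_le
  have ht : Tendsto (fun N => r N q.1) atTop (𝓝[≥] q.1) := by
    refine tendsto_nhdsWithin_iff.2 ⟨?_, Eventually.of_forall hge⟩
    refine tendsto_of_tendsto_of_tendsto_of_le_of_le tendsto_const_nhds ?_ hge hle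
    simpa using (tendsto_const_nhds (x := q.1)).add (tendsto_gridStep 1)
  exact (Z.rightContinuous_path q.2 q.1).tendsto.comp ht

variable {f g : Eu d → Eu d → ℝ≥0∞} {I : Set ℝ≥0} {ω : Ω}

theorem jumpAt_mono {f g : Eu d → Eu d → ℝ≥0∞} (h : ∀ x y, f x y ≤ g x y) (ω : Ω) (s : ℝ≥0) :
    jumpAt Z f ω s ≤ jumpAt Z g ω s := by
  unfold jumpAt
  generalize Function.leftLim (fun u => Z.X u ω) s = x
  generalize Z.X s ω = y
  induction x using OnePoint.rec with
  | infty => simp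
  | coe x => induction y using OnePoint.rec <;> simp [h]

theorem jumpAt_add (f g : Eu d → Eu d → ℝ≥0∞) (ω : Ω) (s : ℝ≥0) :
    jumpAt Z (fun x y => f x y + g x y) ω s = jumpAt Z f ω s + jumpAt Z g ω s := by
  unfold jumpAt
  generalize Function.leftLim (fun u => Z.X u ω) s = x
  generalize Z.X s ω = y
  induction x using OnePoint.rec with
  | infty => simp
  | coe x => induction y using OnePoint.rec <;> simp

theorem jumpAt_const_mul (c : ℝ≥0∞) (f : Eu d → Eu d → ℝ≥0∞) (ω : Ω) (s : ℝ≥0) :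
    jumpAt Z (fun x y => c * f x y) ω s = c * jumpAt Z f ω s := by
  unfold jumpAt
  generalize Function.leftLim (fun u => Z.X u ω) s = x
  generalize Z.X s ω = y
  induction x using OnePoint.rec with
  | infty => simp
  | coe x => induction y using OnePoint.rec <;> simp

theorem jumpAt_iSup (f : ℕ → Eu d → Eu d → ℝ≥0∞) (ω : Ω) (s : ℝ≥0) :
    jumpAt Z (fun x y => ⨆ i, f i x y) ω s = ⨆ i, jumpAt Z (f i) ω s := by
  unfold jumpAt
  generalize Function.leftLim (fun u => Z.X u ω) s = x
  generalize Z.X s ω = y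
  induction x using OnePoint.rec with
  | infty => simp
  | coe x => induction y using OnePoint.rec <;> simp

theorem jumpOn_add (f g : Eu d → Eu d → ℝ≥0∞) (I : Set ℝ≥0) (ω : Ω) :
    jumpOn Z (fun x y => f x y + g x y) I ω = jumpOn Z f I ω + jumpOn Z g I ω := by
  unfold jumpOn
  rw [← ENNReal.tsum_add]
  refine tsum_congr fun s => ?_
  by_cases hs : s ∈ I
  · simp [indicator_of_mem hs, jumpAt_add]
  · simp [indicator_of_notMem hs]

theorem jumpOn_const_mul (c : ℝ≥0∞) (f : Eu d → Eu d → ℝ≥0∞) (I : Set ℝ≥0) (ω : Ω) :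
    jumpOn Z (fun x y => c * f x y) I ω = c * jumpOn Z f I ω := by
  unfold jumpOn
  rw [← ENNReal.tsum_mul_left]
  refine tsum_congr fun s => ?_
  by_cases hs : s ∈ I
  · simp [indicator_of_mem hs, jumpAt_const_mul]
  · simp [indicator_of_notMem hs]

theorem jumpOn_mono (h : ∀ x y, f x y ≤ g x y) (I : Set ℝ≥0) (ω : Ω) :
    jumpOn Z f I ω ≤ jumpOn Z g I ω :=
  ENNReal.tsum_le_tsum fun s => indicator_le_indicator (jumpAt_mono Z h ω s)

theorem jumpOn_mono_set {I I' : Set ℝ≥0} (h : I ⊆ I') (f : Eu d → Eu d → ℝ≥0∞) (ω : Ω) :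
    jumpOn Z f I ω ≤ jumpOn Z f I' ω :=
  ENNReal.tsum_le_tsum fun s => indicator_le_indicator_of_subset h (fun _ => zero_le) s

theorem tsum_iSup_of_monotone {α : Type*} {f : ℕ → α → ℝ≥0∞} (hf : Monotone f) :
    ∑' a, ⨆ n, f n a = ⨆ n, ∑' a, f n a := by
  let _ : MeasurableSpace α := ⊤
  simp only [← lintegral_count]
  exact lintegral_iSup (fun n => measurable_from_top) hf

theorem jumpOn_iSup {f : ℕ → Eu d → Eu d → ℝ≥0∞} (hf : Monotone f) (I : Set ℝ≥0) (ω : Ω) :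
    jumpOn Z (fun x y => ⨆ i, f i x y) I ω = ⨆ i, jumpOn Z (f i) I ω := by
  unfold jumpOn
  rw [← tsum_iSup_of_monotone]
  · refine tsum_congr fun s => ?_
    by_cases hs : s ∈ I
    · simp [indicator_of_mem hs, jumpAt_iSup]
    · simp [indicator_of_notMem hs]
  · intro i j hij s
    exact indicator_le_indicator (jumpAt_mono Z (fun x y => hf hij x y) ω s)

theorem jumpOn_union {I I' : Set ℝ≥0} (h : Disjoint I I') (f : Eu d → Eu d → ℝ≥0∞) (ω : Ω) :
    jumpOn Z f (I ∪ I') ω = jumpOn Z f I ω + jumpOn Z f I' ω := by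
  unfold jumpOn
  rw [indicator_union_of_disjoint h, ← ENNReal.tsum_add]

theorem jumpOn_iSup_set {I : ℕ → Set ℝ≥0} (hI : Monotone I) (f : Eu d → Eu d → ℝ≥0∞) (ω : Ω) :
    jumpOn Z f (⋃ n, I n) ω = ⨆ n, jumpOn Z f (I n) ω := by
  unfold jumpOn
  rw [← tsum_iSup_of_monotone]
  · refine tsum_congr fun s => ?_
    rw [indicator_iUnion_apply (by rfl)]
  · intro i j hij s
    exact indicator_le_indicator_of_subset (hI hij) (fun _ => zero_le) s

/-- Away from the diagonal only finitely many jumps count on a bounded interval. This holds on every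
path, not just almost surely, and it licenses the pathwise subtraction in the monotone class
argument. -/
theorem jumpOn_ne_top {n : ℕ} (hf0 : ∀ x y, (x, y) ∉ offDiag d n → f x y = 0)
    (hf : IsOpen {q : Eu d × Eu d | f q.1 q.2 ≠ 0}) (htop : ∀ x y, f x y ≠ ∞) (a T : ℝ≥0) (ω : Ω) :
    jumpOn Z f (Ioc a (a + T)) ω ≠ ∞ := by
  obtain ⟨J, hJ, h0, -⟩ := exists_finset_jumps (Z.rightContinuous_path ω) (Z.leftLimit_path ω)
    (isOpen_extendZero₂_ne hf0 hf) (extendZero₂_eventually_diag hf0) a T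
  have := tsum_jumps_eq_sum hJ h0
  unfold jumpOn jumpAt
  rw [this]
  refine ENNReal.sum_ne_top.2 fun s _ => ?_
  generalize Function.leftLim (fun u => Z.X u ω) s = x
  generalize Z.X s ω = y
  induction x using OnePoint.rec with
  | infty => simp
  | coe x => induction y using OnePoint.rec <;> simp [htop]

theorem tendsto_skelSum {n : ℕ} (hf0 : ∀ x y, (x, y) ∉ offDiag d n → f x y = 0)
    (hf : Continuous (Function.uncurry f)) (a : ℝ≥0) {T : ℝ≥0} (hT : 0 < T) (ω : Ω) :
    Tendsto (fun N : ℕ => skelSum Z (extendZero₂ f) (T / (N + 1)) a (N + 1) ω) atTop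
      (𝓝 (jumpOn Z f (Ioc a (a + T)) ω)) :=
  tendsto_sum_grid (Z.rightContinuous_path ω) (Z.leftLimit_path ω)
    (continuous_extendZero₂ hf0 hf) (extendZero₂_eventually_diag hf0) a hT

end JumpOn

end

/-! ### Conditional compensation: closure properties and continuous integrands. -/

section

open ProbabilityTheory

variable {d : ℕ} {Ω : Type*} [mΩ : MeasurableSpace Ω] (Z : HuntProcess (Eu d) Ω)

/-- The rate of jumps weighted with `f`. -/
noncomputable def jumpRate (m : Measure (Eu d)) (j f : Eu d → Eu d → ℝ≥0∞) (w : Eu d) : ℝ≥0∞ :=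
  ∫⁻ y, j w y * f w y ∂m

/-- The data of a process with transition density `pk` and Lévy system `j (x, y) m(dy) dt`. -/
structure LevyData (m : Measure (Eu d)) (pk : ℝ → Eu d → Eu d → ℝ≥0∞)
    (j : Eu d → Eu d → ℝ≥0∞) : Prop where
  pk_meas : Measurable fun q : ℝ × Eu d × Eu d => pk q.1 q.2.1 q.2.2
  pk_zero : ∀ t x z, t ≤ 0 → pk t x z = 0
  j_meas : Measurable (Function.uncurry j)
  trans : ∀ t : ℝ≥0, 0 < t → ∀ (x : Eu d) (h : Eu d → ℝ≥0∞), Measurable h →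
    ∫⁻ ω, extendZero h (Z.X t ω) ∂(Z.P x) = ∫⁻ z, pk t x z * h z ∂m
  levy : ∀ f : Eu d → Eu d → ℝ≥0∞, Measurable (Function.uncurry f) → (∀ x, f x x = 0) →
    ∀ (x : Eu d) (t : ℝ≥0), 0 < t → ∫⁻ ω, jumpOn Z f (Ioc 0 t) ω ∂(Z.P x) =
      ∫⁻ ω, (∫⁻ s in Ioc (0 : ℝ) t, extendZero (jumpRate m j f) (Z.X s.toNNReal ω)) ∂(Z.P x)
  rate_fin : ∀ n, ∃ c : ℝ≥0∞, c ≠ ∞ ∧ ∀ w,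
    jumpRate m j (fun x y => (offDiag d n).indicator 1 (x, y)) w ≤ c

variable {Z} {m : Measure (Eu d)} [SFinite m] {pk : ℝ → Eu d → Eu d → ℝ≥0∞}
  {j : Eu d → Eu d → ℝ≥0∞}

/-- The expected weighted number of jumps up to time `T`. -/
noncomputable def jumpComp (m : Measure (Eu d)) (pk : ℝ → Eu d → Eu d → ℝ≥0∞)
    (j f : Eu d → Eu d → ℝ≥0∞) (T : ℝ≥0) (y : Eu d) : ℝ≥0∞ :=
  ∫⁻ s in Ioc (0 : ℝ) T, ∫⁻ z, pk s y z * jumpRate m j f z ∂m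

section Comp
variable (hD : LevyData Z m pk j)
include hD

theorem measurable_jumpRate {f : Eu d → Eu d → ℝ≥0∞} (hf : Measurable (Function.uncurry f)) :
    Measurable (jumpRate m j f) :=
  Measurable.lintegral_prod_right' (f := fun q : Eu d × Eu d => j q.1 q.2 * f q.1 q.2)
    (hD.j_meas.mul hf)

theorem measurable_pk_snd (s : ℝ) (y : Eu d) : Measurable (pk s y) :=
  hD.pk_meas.comp (by fun_prop : Measurable fun z : Eu d => (s, y, z))

theorem measurable_pk_rate {f : Eu d → Eu d → ℝ≥0∞} (hf : Measurable (Function.uncurry f)) :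
    Measurable fun q : (Eu d × ℝ) => ∫⁻ z, pk q.2 q.1 z * jumpRate m j f z ∂m := by
  have h : Measurable fun q : (Eu d × ℝ) × Eu d => pk q.1.2 q.1.1 q.2 * jumpRate m j f q.2 :=
    (hD.pk_meas.comp (by fun_prop : Measurable fun q : (Eu d × ℝ) × Eu d =>
      (q.1.2, q.1.1, q.2))).mul ((measurable_jumpRate hD hf).comp measurable_snd)
  exact h.lintegral_prod_right'

theorem measurable_jumpComp {f : Eu d → Eu d → ℝ≥0∞} (hf : Measurable (Function.uncurry f))
    (T : ℝ≥0) : Measurable (jumpComp m pk j f T) :=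
  (measurable_pk_rate hD hf).lintegral_prod_right'

theorem pk_mass_le (t : ℝ) (x : Eu d) : ∫⁻ z, pk t x z ∂m ≤ 1 := by
  rcases le_or_gt t 0 with h | h
  · simp [hD.pk_zero _ _ _ h]
  · have := hD.trans t.toNNReal (by simpa using h) x (fun _ => 1) measurable_const
    simp only [mul_one, Real.coe_toNNReal t h.le] at this
    rw [← this]
    calc _ ≤ ∫⁻ _, 1 ∂(Z.P x) := by
          refine lintegral_mono fun ω => ?_
          generalize Z.X t.toNNReal ω = y
          induction y using OnePoint.rec <;> simp
      _ = 1 := by simp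

theorem measurable_extendZero_path {h : Eu d → ℝ≥0∞} (hh : Measurable h) :
    Measurable fun q : Ω × ℝ => extendZero h (Z.X q.2.toNNReal q.1) :=
  (measurable_extendZero hh).comp ((measurable_uncurry_X Z).comp
    (by fun_prop : Measurable fun q : Ω × ℝ => (q.2.toNNReal, q.1)))

/-- From the cemetery nothing happens; from a point of the space, the Lévy system is combined with
the transition density. -/
theorem lintegral_jumpOn {f : Eu d → Eu d → ℝ≥0∞} (hf : Measurable (Function.uncurry f))
    (hf0 : ∀ x, f x x = 0) {T : ℝ≥0} (hT : 0 < T) (y : OnePoint (Eu d)) :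
    ∫⁻ ω, jumpOn Z f (Ioc 0 T) ω ∂(Z.P y) = extendZero (jumpComp m pk j f T) y := by
  induction y using OnePoint.rec with
  | infty =>
    rw [extendZero_infty]
    refine lintegral_eq_zero_of_ae_eq_zero ?_
    filter_upwards [Z.start OnePoint.infty] with ω hω
    have h : ∀ s, Z.X s ω = OnePoint.infty := fun s => Z.cemetery_absorbing ω 0 s zero_le hω
    simp [jumpOn, jumpAt, h, indicator]
  | coe y =>
    rw [hD.levy f hf hf0 y T hT, lintegral_lintegral_swap
      (measurable_extendZero_path hD (measurable_jumpRate hD hf)).aemeasurable]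
    refine setLIntegral_congr_fun measurableSet_Ioc fun s hs => ?_
    have := hD.trans s.toNNReal (by simpa using hs.1) y _ (measurable_jumpRate hD hf)
    rwa [Real.coe_toNNReal s hs.1.le] at this

theorem jumpComp_le {f : Eu d → Eu d → ℝ≥0∞} {c : ℝ≥0∞} (hc : ∀ w, jumpRate m j f w ≤ c)
    (T : ℝ≥0) (y : Eu d) : jumpComp m pk j f T y ≤ T * c := by
  calc _ ≤ ∫⁻ s in Ioc (0 : ℝ) T, c := by
        refine lintegral_mono fun s => ?_
        calc _ ≤ ∫⁻ z, pk s y z * c ∂m := by gcongr; exact hc _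
          _ = (∫⁻ z, pk s y z ∂m) * c := lintegral_mul_const _ (measurable_pk_snd hD s y)
          _ ≤ 1 * c := by gcongr; exact pk_mass_le hD s y
          _ = c := one_mul c
    _ = T * c := by simp [mul_comm]

end Comp

/-- `f` satisfies the Markovian form of the Lévy system identity. -/
def IsCompensated (Z : HuntProcess (Eu d) Ω) (m : Measure (Eu d)) (pk : ℝ → Eu d → Eu d → ℝ≥0∞)
    (j f : Eu d → Eu d → ℝ≥0∞) : Prop :=
  ∀ a T : ℝ≥0, 0 < T → Measurable[Z.filt (a + T)] (jumpOn Z f (Ioc a (a + T))) ∧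
    ∀ (x : OnePoint (Eu d)) (W : Ω → ℝ≥0∞), Measurable[Z.filt a] W → (∀ ω, W ω ≤ 1) →
      ∫⁻ ω, W ω * jumpOn Z f (Ioc a (a + T)) ω ∂(Z.P x) =
        ∫⁻ ω, W ω * extendZero (jumpComp m pk j f T) (Z.X a ω) ∂(Z.P x)

theorem extendZero_iSup {ι : Type*} (f : ι → Eu d → ℝ≥0∞) (x : OnePoint (Eu d)) :
    extendZero (fun y => ⨆ i, f i y) x = ⨆ i, extendZero (f i) x := by
  induction x using OnePoint.rec <;> simp

theorem extendZero_add (f g : Eu d → ℝ≥0∞) (x : OnePoint (Eu d)) :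
    extendZero (fun y => f y + g y) x = extendZero f x + extendZero g x := by
  induction x using OnePoint.rec <;> simp

theorem extendZero_const_mul (c : ℝ≥0∞) (f : Eu d → ℝ≥0∞) (x : OnePoint (Eu d)) :
    extendZero (fun y => c * f y) x = c * extendZero f x := by
  induction x using OnePoint.rec <;> simp

theorem extendZero_mono {f g : Eu d → ℝ≥0∞} (h : ∀ y, f y ≤ g y) (x : OnePoint (Eu d)) :
    extendZero f x ≤ extendZero g x := by
  induction x using OnePoint.rec <;> simp [h]

theorem extendZero_le {g : Eu d → ℝ≥0∞} {c : ℝ≥0∞} (h : ∀ y, g y ≤ c) (x : OnePoint (Eu d)) :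
    extendZero g x ≤ c := by
  induction x using OnePoint.rec <;> simp [h]

section Closure
variable (hD : LevyData Z m pk j)
include hD

theorem jumpRate_add {f g : Eu d → Eu d → ℝ≥0∞} (hf : Measurable (Function.uncurry f))
    (w : Eu d) :
    jumpRate m j (fun x y => f x y + g x y) w = jumpRate m j f w + jumpRate m j g w := by
  unfold jumpRate
  simp only [mul_add]
  exact lintegral_add_left (hD.j_meas.of_uncurry_left.mul hf.of_uncurry_left) _

theorem jumpComp_add {f g : Eu d → Eu d → ℝ≥0∞} (hf : Measurable (Function.uncurry f))
    (T : ℝ≥0) (y : Eu d) : jumpComp m pk j (fun x y => f x y + g x y) T y =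
      jumpComp m pk j f T y + jumpComp m pk j g T y := by
  unfold jumpComp
  rw [← lintegral_add_left (by exact (measurable_pk_rate hD hf).comp measurable_prodMk_left)]
  refine lintegral_congr fun s => ?_
  rw [← lintegral_add_left (by exact (measurable_pk_snd hD s y).mul (measurable_jumpRate hD hf))]
  simp only [jumpRate_add hD hf, mul_add]

theorem jumpComp_const_mul {f : Eu d → Eu d → ℝ≥0∞} (hf : Measurable (Function.uncurry f))
    (c : ℝ≥0∞) (T : ℝ≥0) (y : Eu d) :
    jumpComp m pk j (fun x y => c * f x y) T y = c * jumpComp m pk j f T y := by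
  have h1 : ∀ w, jumpRate m j (fun x y => c * f x y) w = c * jumpRate m j f w := by
    intro w
    unfold jumpRate
    simp only [mul_left_comm _ c]
    exact lintegral_const_mul _ (hD.j_meas.of_uncurry_left.mul hf.of_uncurry_left)
  unfold jumpComp
  simp only [h1, mul_left_comm _ c]
  rw [← lintegral_const_mul _ (by exact (measurable_pk_rate hD hf).comp measurable_prodMk_left)]
  refine lintegral_congr fun s => ?_
  exact lintegral_const_mul _ ((measurable_pk_snd hD s y).mul (measurable_jumpRate hD hf))

theorem jumpComp_iSup {f : ℕ → Eu d → Eu d → ℝ≥0∞}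
    (hf : ∀ n, Measurable (Function.uncurry (f n))) (hmono : Monotone f) (T : ℝ≥0) (y : Eu d) :
    jumpComp m pk j (fun x y => ⨆ n, f n x y) T y = ⨆ n, jumpComp m pk j (f n) T y := by
  have h1 : ∀ w, jumpRate m j (fun x y => ⨆ n, f n x y) w = ⨆ n, jumpRate m j (f n) w := by
    intro w
    unfold jumpRate
    simp only [ENNReal.mul_iSup]
    exact lintegral_iSup (fun n => hD.j_meas.of_uncurry_left.mul (hf n).of_uncurry_left)
      fun a b hab y => mul_le_mul_right (hmono hab w y) _
  have hr : Monotone fun n => jumpRate m j (f n) := fun a b hab w =>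
    lintegral_mono fun y => mul_le_mul_right (hmono hab w y) _
  unfold jumpComp
  rw [← lintegral_iSup (by exact fun n => (measurable_pk_rate hD (hf n)).comp measurable_prodMk_left)
    (by exact fun a b hab s => lintegral_mono fun z => mul_le_mul_right (hr hab z) _)]
  refine lintegral_congr fun s => ?_
  simp only [h1, ENNReal.mul_iSup]
  exact lintegral_iSup (fun n => (measurable_pk_snd hD s y).mul (measurable_jumpRate hD (hf n)))
    fun a b hab z => mul_le_mul_right (hr hab z) _

theorem measurable_extendZero_jumpComp {f : Eu d → Eu d → ℝ≥0∞}
    (hf : Measurable (Function.uncurry f)) (a T : ℝ≥0) :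
    Measurable fun ω => extendZero (jumpComp m pk j f T) (Z.X a ω) :=
  (measurable_extendZero (measurable_jumpComp hD hf T)).comp (measurable_X Z a)

theorem IsCompensated.add {f g : Eu d → Eu d → ℝ≥0∞} (hf : Measurable (Function.uncurry f))
    (h1 : IsCompensated Z m pk j f) (h2 : IsCompensated Z m pk j g) :
    IsCompensated Z m pk j fun x y => f x y + g x y := by
  intro a T hT
  obtain ⟨m1, e1⟩ := h1 a T hT
  obtain ⟨m2, e2⟩ := h2 a T hT
  have hj : jumpOn Z (fun x y => f x y + g x y) (Ioc a (a + T)) = fun ω =>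
      jumpOn Z f (Ioc a (a + T)) ω + jumpOn Z g (Ioc a (a + T)) ω := funext (jumpOn_add Z f g _)
  refine ⟨hj ▸ m1.add m2, fun x W hW hW1 => ?_⟩
  have hW' := hW.mono (Z.filt.le a) le_rfl
  rw [hj, funext (jumpComp_add hD hf (g := g) T)]
  simp only [mul_add, extendZero_add]
  rw [lintegral_add_left (by exact hW'.mul (m1.mono (Z.filt.le _) le_rfl)),
    lintegral_add_left (by exact hW'.mul (measurable_extendZero_jumpComp hD hf a T)), e1 x W hW hW1,
    e2 x W hW hW1]

theorem IsCompensated.const_mul {f : Eu d → Eu d → ℝ≥0∞} (hf : Measurable (Function.uncurry f))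
    (h1 : IsCompensated Z m pk j f) (c : ℝ≥0∞) :
    IsCompensated Z m pk j fun x y => c * f x y := by
  intro a T hT
  obtain ⟨m1, e1⟩ := h1 a T hT
  have hj : jumpOn Z (fun x y => c * f x y) (Ioc a (a + T)) = fun ω =>
      c * jumpOn Z f (Ioc a (a + T)) ω := funext (jumpOn_const_mul Z c f _)
  refine ⟨hj ▸ m1.const_mul c, fun x W hW hW1 => ?_⟩
  have hW' := hW.mono (Z.filt.le a) le_rfl
  rw [hj, funext (jumpComp_const_mul hD hf c T)]
  simp only [extendZero_const_mul, mul_left_comm _ c]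
  rw [lintegral_const_mul _ (by exact hW'.mul (m1.mono (Z.filt.le _) le_rfl)),
    lintegral_const_mul _ (by exact hW'.mul (measurable_extendZero_jumpComp hD hf a T)), e1 x W hW hW1]

theorem IsCompensated.iSup {f : ℕ → Eu d → Eu d → ℝ≥0∞}
    (hf : ∀ n, Measurable (Function.uncurry (f n))) (hmono : Monotone f)
    (h1 : ∀ n, IsCompensated Z m pk j (f n)) :
    IsCompensated Z m pk j fun x y => ⨆ n, f n x y := by
  intro a T hT
  have hj : jumpOn Z (fun x y => ⨆ n, f n x y) (Ioc a (a + T)) = fun ω =>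
      ⨆ n, jumpOn Z (f n) (Ioc a (a + T)) ω := funext (jumpOn_iSup Z hmono _)
  refine ⟨hj ▸ Measurable.iSup fun n => (h1 n a T hT).1, fun x W hW hW1 => ?_⟩
  have hW' := hW.mono (Z.filt.le a) le_rfl
  have hc : Monotone fun n => jumpComp m pk j (f n) T := fun n n' hn y =>
    lintegral_mono fun s => lintegral_mono fun z => mul_le_mul_right
      (lintegral_mono fun u => mul_le_mul_right (hmono hn z u) _) _
  rw [hj, funext (jumpComp_iSup hD hf hmono T)]
  simp only [extendZero_iSup, ENNReal.mul_iSup]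
  rw [lintegral_iSup, lintegral_iSup]
  · exact iSup_congr fun n => (h1 n a T hT).2 x W hW hW1
  · exact fun n => hW'.mul (measurable_extendZero_jumpComp hD (hf n) a T)
  · exact fun n n' hn ω => mul_le_mul_right (extendZero_mono (hc hn) _) _
  · exact fun n => hW'.mul ((h1 n a T hT).1.mono (Z.filt.le _) le_rfl)
  · exact fun n n' hn ω => mul_le_mul_right (jumpOn_mono Z (hmono hn) _ _) _

/-- For continuous f the jump sum over (a, a + T] is a limit of skeleton sums, from which it
inherits adaptedness and the Markov property at a. The mean from X_a that results is the
compensator, by the Lévy system. -/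
theorem isCompensated_of_continuous {f : Eu d → Eu d → ℝ≥0∞} {n : ℕ}
    (hf0 : ∀ x y, (x, y) ∉ offDiag d n → f x y = 0) (hf : Continuous (Function.uncurry f)) :
    IsCompensated Z m pk j f := by
  intro a T hT
  have hfd : ∀ x, f x x = 0 := fun x => hf0 x x fun h => by
    have h1 := h.2.2
    simp only [dist_self] at h1
    have h2 : (0 : ℝ) < 1 / (n + 1) := by positivity
    linarith
  have hfm := measurable_extendZero₂ hf.measurable
  have hstep (N : ℕ) : a + (N + 1 : ℕ) * (T / ((N : ℝ≥0) + 1)) = a + T := by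
    have : ((N : ℝ≥0) + 1) ≠ 0 := by positivity
    push_cast
    rw [mul_div_cancel₀ _ this]
  have hsm (N : ℕ) : Measurable[Z.filt (a + T)]
      (skelSum Z (extendZero₂ f) (T / (N + 1)) a (N + 1)) := by
    have := measurable_skelSum Z hfm (T / ((N : ℝ≥0) + 1)) a (N + 1)
    rwa [hstep] at this
  have hsm0 (N : ℕ) : Measurable (skelSum Z (extendZero₂ f) (T / (N + 1)) 0 (N + 1)) :=
    (measurable_skelSum Z hfm (T / ((N : ℝ≥0) + 1)) 0 (N + 1)).mono (Z.filt.le _) le_rfl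
  have hjm : Measurable[Z.filt (a + T)] (jumpOn Z f (Ioc a (a + T))) :=
    @measurable_of_tendsto_metrizable _ _ (Z.filt (a + T)) _ _ _ _ _ _ hsm (tendsto_pi_nhds.2 fun ω => tendsto_skelSum Z hf0 hf a hT ω)
  have hjm0 : Measurable (jumpOn Z f (Ioc 0 (0 + T))) :=
    measurable_of_tendsto_metrizable hsm0
      (tendsto_pi_nhds.2 fun ω => tendsto_skelSum Z hf0 hf 0 hT ω)
  refine ⟨hjm, fun x W hW hW1 => ?_⟩
  have hW' := hW.mono (Z.filt.le a) le_rfl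
  have hjm' := hjm.mono (Z.filt.le _) le_rfl
  have hsm' (N : ℕ) := (hsm N).mono (Z.filt.le _) le_rfl
  have hminm (M : ℕ) : Measurable fun σ : ℝ≥0∞ => min σ (M : ℝ≥0∞) :=
    measurable_id.min measurable_const
  -- Measurability in the starting point is assumed for events at one time only. For skeleton sums
  -- it comes from the iterated kernels `skelExp`.
  have hker (M N : ℕ) : Measurable fun y => ∫⁻ ω',
      min (skelSum Z (extendZero₂ f) (T / (N + 1)) 0 (N + 1) ω') M ∂(Z.P y) := by
    have h1 := measurable_skelExp Z hfm (T / (N + 1)) (hminm M) (N + 1)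
    convert h1.comp (measurable_id.prodMk measurable_const :
      Measurable fun y : OnePoint (Eu d) => (y, (0 : ℝ≥0∞))) using 1
    ext y
    have h2 := lintegral_skelSum_add Z hfm (T / (N + 1)) (hminm M) (N + 1) y 0 (W := fun _ => 1)
      (Y := fun _ => 0) measurable_const measurable_const
    simp only [one_mul, zero_add] at h2
    rw [h2]
    calc _ = ∫⁻ _, skelExp Z (extendZero₂ f) (T / (N + 1)) (fun σ => min σ (M : ℝ≥0∞))
          (N + 1) y 0 ∂(Z.P y) := by
          refine lintegral_congr_ae ?_
          filter_upwards [Z.start y] with ω hω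
          rw [hω]
      _ = _ := by simp [Function.uncurry]
  -- The skeleton sums satisfy this identity exactly. Truncation at M makes dominated convergence
  -- applicable on both sides, without any knowledge of moments; M is removed at the end by monotone
  -- convergence.
  have htr : ∀ M : ℕ, ∫⁻ ω, W ω * min (jumpOn Z f (Ioc a (a + T)) ω) M ∂(Z.P x) =
      ∫⁻ ω, W ω * ∫⁻ ω', min (jumpOn Z f (Ioc 0 (0 + T)) ω') M ∂(Z.P (Z.X a ω)) ∂(Z.P x) := by
    intro M
    have hmin : Measurable fun σ : ℝ≥0∞ => min σ (M : ℝ≥0∞) := measurable_id.min measurable_const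
    have hcont : Continuous fun σ : ℝ≥0∞ => min σ (M : ℝ≥0∞) := by fun_prop
    have l1 : Tendsto (fun N : ℕ => ∫⁻ ω, W ω *
        min (skelSum Z (extendZero₂ f) (T / (N + 1)) a (N + 1) ω) M ∂(Z.P x)) atTop
        (𝓝 (∫⁻ ω, W ω * min (jumpOn Z f (Ioc a (a + T)) ω) M ∂(Z.P x))) := by
      refine tendsto_lintegral_of_dominated_convergence (fun _ => (M : ℝ≥0∞))
        (fun N => hW'.mul (hmin.comp (hsm' N))) (fun N => Eventually.of_forall fun ω => ?_)
        (by simp) (Eventually.of_forall fun ω => ?_)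
      · exact (mul_le_of_le_one_left' (hW1 ω)).trans (min_le_right _ _)
      · refine ENNReal.Tendsto.const_mul ((hcont.tendsto _).comp
          (tendsto_skelSum Z hf0 hf a hT ω)) (Or.inr (ne_top_of_le_ne_top (by simp) (hW1 ω)))
    have l2 : ∀ y, Tendsto (fun N : ℕ => ∫⁻ ω',
        min (skelSum Z (extendZero₂ f) (T / (N + 1)) 0 (N + 1) ω') M ∂(Z.P y)) atTop
        (𝓝 (∫⁻ ω', min (jumpOn Z f (Ioc 0 (0 + T)) ω') M ∂(Z.P y))) := by
      intro y
      refine tendsto_lintegral_of_dominated_convergence (fun _ => (M : ℝ≥0∞))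
        (fun N => hmin.comp (hsm0 N)) (fun N => Eventually.of_forall fun ω => min_le_right _ _)
        (by simp) (Eventually.of_forall fun ω => ?_)
      exact (hcont.tendsto _).comp (tendsto_skelSum Z hf0 hf 0 hT ω)
    have l3 : Tendsto (fun N : ℕ => ∫⁻ ω, W ω * ∫⁻ ω',
        min (skelSum Z (extendZero₂ f) (T / (N + 1)) 0 (N + 1) ω') M ∂(Z.P (Z.X a ω)) ∂(Z.P x))
        atTop (𝓝 (∫⁻ ω, W ω * ∫⁻ ω', min (jumpOn Z f (Ioc 0 (0 + T)) ω') M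
          ∂(Z.P (Z.X a ω)) ∂(Z.P x))) := by
      refine tendsto_lintegral_of_dominated_convergence (fun _ => (M : ℝ≥0∞))
        (fun N => hW'.mul ((hker M N).comp (measurable_X Z a)))
        (fun N => Eventually.of_forall fun ω => ?_)
        (by simp) (Eventually.of_forall fun ω => ?_)
      · refine (mul_le_of_le_one_left' (hW1 ω)).trans ?_
        calc _ ≤ ∫⁻ _, (M : ℝ≥0∞) ∂(Z.P (Z.X a ω)) := lintegral_mono fun _ => min_le_right _ _
          _ = M := by simp
      · exact ENNReal.Tendsto.const_mul (l2 _) (Or.inr (ne_top_of_le_ne_top (by simp) (hW1 ω)))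
    refine tendsto_nhds_unique l1 (l3.congr fun N => ?_)
    exact (lintegral_skelSum Z hfm (T / (N + 1)) hmin (N + 1) x a hW).symm
  have hsup : ∀ σ : ℝ≥0∞, ⨆ M : ℕ, min σ (M : ℝ≥0∞) = σ := by
    intro σ
    rw [← inf_iSup_eq, ENNReal.iSup_natCast, inf_top_eq]
  have hmonoM : Monotone fun (M : ℕ) (σ : ℝ≥0∞) => min σ (M : ℝ≥0∞) := fun M M' h σ =>
    min_le_min le_rfl (by exact_mod_cast h)
  have hIm (M : ℕ) : Measurable fun y =>
      ∫⁻ ω', min (jumpOn Z f (Ioc 0 (0 + T)) ω') M ∂(Z.P y) := by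
    refine measurable_of_tendsto_metrizable (hker M) (tendsto_pi_nhds.2 fun y => ?_)
    refine tendsto_lintegral_of_dominated_convergence (fun _ => (M : ℝ≥0∞))
      (fun N => (hminm M).comp (hsm0 N)) (fun N => Eventually.of_forall fun ω => min_le_right _ _)
      (by simp) (Eventually.of_forall fun ω => ?_)
    exact ((by fun_prop : Continuous fun σ : ℝ≥0∞ => min σ (M : ℝ≥0∞)).tendsto _).comp
      (tendsto_skelSum Z hf0 hf 0 hT ω)
  have r1 : ∫⁻ ω, W ω * jumpOn Z f (Ioc a (a + T)) ω ∂(Z.P x) =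
      ⨆ M : ℕ, ∫⁻ ω, W ω * min (jumpOn Z f (Ioc a (a + T)) ω) M ∂(Z.P x) := by
    rw [← lintegral_iSup (by exact fun M => hW'.mul ((hminm M).comp hjm'))
      (by exact fun M M' h ω => mul_le_mul_right (hmonoM h _) _)]
    simp only [← ENNReal.mul_iSup, hsup]
  have r2 : ∫⁻ ω, W ω * extendZero (jumpComp m pk j f T) (Z.X a ω) ∂(Z.P x) =
      ⨆ M : ℕ, ∫⁻ ω, W ω * ∫⁻ ω', min (jumpOn Z f (Ioc 0 (0 + T)) ω') M
        ∂(Z.P (Z.X a ω)) ∂(Z.P x) := by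
    rw [← lintegral_iSup (by exact fun M => hW'.mul ((hIm M).comp (measurable_X Z a)))
      (by exact fun M M' h ω => mul_le_mul_right (lintegral_mono fun ω' => hmonoM h _) _)]
    refine lintegral_congr fun ω => ?_
    rw [← ENNReal.mul_iSup, ← lintegral_iSup (by exact fun M => (hminm M).comp hjm0)
      (by exact fun M M' h ω' => hmonoM h _)]
    simp only [hsup, zero_add]
    rw [lintegral_jumpOn hD hf.measurable hfd hT]
  rw [r1, r2]
  exact iSup_congr htr

end Closure

end

/-! ### Conditional compensation for all measurable integrands. -/

section

open ProbabilityTheory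

variable {d : ℕ} {Ω : Type*} [mΩ : MeasurableSpace Ω] {Z : HuntProcess (Eu d) Ω}
  {m : Measure (Eu d)} [SFinite m] {pk : ℝ → Eu d → Eu d → ℝ≥0∞} {j : Eu d → Eu d → ℝ≥0∞}

section Compensation
variable (hD : LevyData Z m pk j)
include hD

/-- Subtraction is the one closure operation that needs finiteness: of the jump sum on each path,
for measurability and the decomposition, and of the compensator in mean, for cancelling. -/
theorem IsCompensated.of_add {f g : Eu d → Eu d → ℝ≥0∞} (hf : Measurable (Function.uncurry f))
    (h1 : IsCompensated Z m pk j f) (h2 : IsCompensated Z m pk j fun x y => f x y + g x y)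
    (hfin : ∀ a T ω, jumpOn Z f (Ioc a (a + T)) ω ≠ ∞) {c : ℝ≥0∞} (hc : c ≠ ∞)
    (hfc : ∀ w, jumpRate m j f w ≤ c) : IsCompensated Z m pk j g := by
  intro a T hT
  obtain ⟨m1, e1⟩ := h1 a T hT
  obtain ⟨m2, e2⟩ := h2 a T hT
  have hj (ω) : jumpOn Z (fun x y => f x y + g x y) (Ioc a (a + T)) ω =
      jumpOn Z f (Ioc a (a + T)) ω + jumpOn Z g (Ioc a (a + T)) ω := jumpOn_add Z f g _ ω
  have hg : jumpOn Z g (Ioc a (a + T)) = fun ω =>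
      jumpOn Z (fun x y => f x y + g x y) (Ioc a (a + T)) ω - jumpOn Z f (Ioc a (a + T)) ω := by
    ext ω
    rw [hj, ENNReal.add_sub_cancel_left (hfin a T ω)]
  refine ⟨hg ▸ m2.sub m1, fun x W hW hW1 => ?_⟩
  have hW' := hW.mono (Z.filt.le a) le_rfl
  have := e2 x W hW hW1
  simp only [hj, funext (jumpComp_add hD hf (g := g) T), mul_add, extendZero_add] at this
  rw [lintegral_add_left (by exact hW'.mul (m1.mono (Z.filt.le _) le_rfl)),
    lintegral_add_left (by exact hW'.mul (measurable_extendZero_jumpComp hD hf a T)),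
    e1 x W hW hW1] at this
  have hfin : ∫⁻ ω, W ω * extendZero (jumpComp m pk j f T) (Z.X a ω) ∂(Z.P x) ≤ T * c := by
    calc _ ≤ ∫⁻ _, T * c ∂(Z.P x) := by
          refine lintegral_mono fun ω => (mul_le_of_le_one_left' (hW1 ω)).trans ?_
          exact extendZero_le (jumpComp_le hD hfc T) _
      _ = T * c := by simp
  exact (ENNReal.add_right_inj (ne_top_of_le_ne_top (ENNReal.mul_ne_top (by simp) hc) hfin)).1 this

theorem IsCompensated.tsum {f : ℕ → Eu d → Eu d → ℝ≥0∞}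
    (hf : ∀ n, Measurable (Function.uncurry (f n))) (h : ∀ n, IsCompensated Z m pk j (f n)) :
    IsCompensated Z m pk j fun x y => ∑' n, f n x y := by
  have hm (n : ℕ) : Measurable (Function.uncurry fun x y => ∑ i ∈ Finset.range n, f i x y) := by
    exact Finset.measurable_fun_sum _ fun i _ => hf i
  have hs (n : ℕ) : IsCompensated Z m pk j fun x y => ∑ i ∈ Finset.range n, f i x y := by
    induction n with
    | zero =>
      have := (h 0).const_mul hD (hf 0) 0
      simpa using this
    | succ n ih =>
      simp only [Finset.sum_range_succ]
      exact ih.add hD (hm n) (h n)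
  have := IsCompensated.iSup hD hm (fun a b hab x y => Finset.sum_le_sum_of_subset
    (Finset.range_subset_range.2 hab)) hs
  simpa only [← ENNReal.tsum_eq_iSup_nat] using this

/-- The indicator of an open set is the increasing limit of the continuous functions min(1, k ·
dist(·, Uᶜ)), which still vanish near the diagonal because U is inside `offDiag d n`. -/
theorem isCompensated_indicator_open {U : Set (Eu d × Eu d)} (hU : IsOpen U) {n : ℕ}
    (hUn : U ⊆ offDiag d n) :
    IsCompensated Z m pk j fun x y => U.indicator (fun _ => 1) (x, y) := by
  let f : ℕ → Eu d → Eu d → ℝ≥0∞ := fun k x y => min 1 (k * Metric.infEDist (x, y) Uᶜ)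
  have hcont (k : ℕ) : Continuous (Function.uncurry (f k)) := by
    have h1 : Continuous fun q : Eu d × Eu d => Metric.infEDist q Uᶜ := Metric.continuous_infEDist
    exact continuous_const.min ((ENNReal.continuous_const_mul (by simp)).comp h1)
  have h0 (k : ℕ) (x y) (h : (x, y) ∉ U) : f k x y = 0 := by
    simp only [f]
    rw [Metric.infEDist_zero_of_mem (by simpa using h)]
    simp
  have := IsCompensated.iSup hD (fun k => (hcont k).measurable)
    (fun a b hab x y => min_le_min le_rfl (by gcongr))
    fun k => isCompensated_of_continuous hD (fun x y h => h0 k x y fun h' => h (hUn h')) (hcont k)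
  convert this using 3 with x y
  by_cases h : (x, y) ∈ U
  · rw [indicator_of_mem h]
    refine le_antisymm ?_ (iSup_le fun k => min_le_left _ _)
    have hpos : Metric.infEDist (x, y) Uᶜ ≠ 0 := fun h0 =>
      (Metric.mem_iff_infEDist_zero_of_closed hU.isClosed_compl).2 h0 h
    obtain ⟨k, hk⟩ := ENNReal.exists_nat_mul_gt hpos (b := 1) (by simp)
    exact le_iSup_of_le k (le_min le_rfl hk.le)
  · rw [indicator_of_notMem h]
    simp [h0 _ x y h]

/-- The π-λ argument is run inside `offDiag d n`, where total jump rates are bounded; this is what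
makes complements accessible. -/
theorem isCompensated_indicator {B : Set (Eu d × Eu d)} (hB : MeasurableSet B) (n : ℕ) :
    IsCompensated Z m pk j fun x y => (B ∩ offDiag d n).indicator (fun _ => 1) (x, y) := by
  have hO := (isOpen_offDiag (d := d) n).measurableSet
  have hmeas {A : Set (Eu d × Eu d)} (hA : MeasurableSet A) :
      Measurable (Function.uncurry fun x y => (A ∩ offDiag d n).indicator
        (fun _ => (1 : ℝ≥0∞)) (x, y)) :=
    measurable_const.indicator (hA.inter hO)
  obtain ⟨c, hc, hcn⟩ := hD.rate_fin n
  induction B, hB using MeasurableSpace.induction_on_inter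
    (BorelSpace.measurable_eq.trans rfl : _ = MeasurableSpace.generateFrom
      {U : Set (Eu d × Eu d) | IsOpen U}) isPiSystem_isOpen with
  | empty =>
    simpa using isCompensated_indicator_open hD (U := ∅) isOpen_empty (n := n) (by simp)
  | basic U hU =>
    exact isCompensated_indicator_open hD (IsOpen.inter (show IsOpen U from hU) (isOpen_offDiag n)) inter_subset_right
  | compl B hB ih =>
    have hle (x y : Eu d) : (B ∩ offDiag d n).indicator (fun _ => (1 : ℝ≥0∞)) (x, y) ≤
        (offDiag d n).indicator (fun _ => 1) (x, y) :=
      indicator_le_indicator_of_subset inter_subset_right (fun _ => zero_le) _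
    refine IsCompensated.of_add hD (hmeas hB) ih ?_ (fun a T ω => ?_) hc (fun w => ?_)
    · convert isCompensated_indicator_open hD (isOpen_offDiag n) subset_rfl using 3 with x y
      by_cases h : (x, y) ∈ B <;> by_cases h' : (x, y) ∈ offDiag d n <;> simp [h, h']
    · refine ne_top_of_le_ne_top (jumpOn_ne_top Z (n := n)
        (f := fun x y => (offDiag d n).indicator (fun _ => 1) (x, y)) ?_ ?_ ?_ a T ω)
        (jumpOn_mono Z hle _ ω)
      · exact fun x y h => indicator_of_notMem h _
      · convert isOpen_offDiag (d := d) n using 1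
        ext q
        simp
      · intro x y
        by_cases h' : (x, y) ∈ offDiag d n <;> simp [h']
    · exact (lintegral_mono fun y => mul_le_mul_right (hle w y) _).trans (hcn w)
  | iUnion B hdisj hB ih =>
    have := IsCompensated.tsum hD (fun i => hmeas (hB i)) ih
    convert this using 3 with x y
    rw [iUnion_inter]
    by_cases h : (x, y) ∈ ⋃ i, B i ∩ offDiag d n
    · obtain ⟨i, hi⟩ := mem_iUnion.1 h
      rw [indicator_of_mem h, tsum_eq_single i fun i' hi' => indicator_of_notMem
        (fun h' => disjoint_left.1 (hdisj hi') h'.1 hi.1) _, indicator_of_mem hi]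
    · rw [indicator_of_notMem h]
      simp only [mem_iUnion, not_exists] at h
      simp [indicator_of_notMem (h _)]

/-- The Lévy system identity, in its Markovian form. -/
theorem isCompensated {f : Eu d → Eu d → ℝ≥0∞} (hf : Measurable (Function.uncurry f))
    (hf0 : ∀ x, f x x = 0) : IsCompensated Z m pk j f := by
  have hO (n : ℕ) := (isOpen_offDiag (d := d) n).measurableSet
  have key (n : ℕ) {φ : Eu d × Eu d → ℝ≥0∞} (hφ : Measurable φ) :
      IsCompensated Z m pk j fun x y => (offDiag d n).indicator φ (x, y) := by
    refine Measurable.ennreal_induction (motive := fun φ => IsCompensated Z m pk j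
      fun x y => (offDiag d n).indicator φ (x, y)) ?_ ?_ ?_ hφ
    · intro c B hB
      have h1 : IsCompensated Z m pk j fun x y =>
          c * (B ∩ offDiag d n).indicator (fun _ => 1) (x, y) :=
        (isCompensated_indicator hD hB n).const_mul hD
          (by exact measurable_const.indicator (hB.inter (hO n))) c
      convert h1 using 3 with x y
      by_cases h : (x, y) ∈ B <;> by_cases h' : (x, y) ∈ offDiag d n <;> simp [h, h']
    · intro φ ψ _ hφ hψ h1 h2
      have h3 : IsCompensated Z m pk j fun x y =>
          (offDiag d n).indicator φ (x, y) + (offDiag d n).indicator ψ (x, y) :=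
        h1.add hD (by exact hφ.indicator (hO n)) h2
      convert h3 using 3 with x y
      simp [indicator_add']
    · intro φ hφ hmono ih
      have h3 : IsCompensated Z m pk j fun x y => ⨆ i, (offDiag d n).indicator (φ i) (x, y) :=
        IsCompensated.iSup (f := fun i x y => (offDiag d n).indicator (φ i) (x, y)) hD
          (fun i => by exact (hφ i).indicator (hO n))
          (fun a b hab x y => indicator_le_indicator (hmono hab _)) ih
      convert h3 using 3 with x y
      by_cases h' : (x, y) ∈ offDiag d n <;> simp [h']
  -- Since f vanishes on the diagonal, it is the increasing limit of its restrictions to the sets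
  -- `offDiag d n`.
  have h3 : IsCompensated Z m pk j fun x y =>
      ⨆ n, (offDiag d n).indicator (Function.uncurry f) (x, y) :=
    IsCompensated.iSup (f := fun n x y => (offDiag d n).indicator (Function.uncurry f) (x, y)) hD
      (fun n => by exact hf.indicator (hO n))
      (fun a b hab x y => indicator_le_indicator_of_subset (offDiag_mono hab) (fun _ => zero_le) _)
      (fun n => key n hf)
  convert h3 using 3 with x y
  by_cases h : x = y
  · subst h
    simp [indicator, hf0]
  · obtain ⟨n, hn⟩ := exists_mem_offDiag h
    refine le_antisymm (le_iSup_of_le n (by rw [indicator_of_mem hn]; rfl)) (iSup_le fun n => ?_)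
    exact indicator_le_self (offDiag d n) (Function.uncurry f) (x, y)

theorem measurable_jumpOn {f : Eu d → Eu d → ℝ≥0∞} (hf : Measurable (Function.uncurry f))
    (hf0 : ∀ x, f x x = 0) {a b : ℝ≥0} (hab : a < b) :
    Measurable[Z.filt b] (jumpOn Z f (Ioc a b)) := by
  have := (isCompensated hD hf hf0 a (b - a) (tsub_pos_of_lt hab)).1
  rwa [add_tsub_cancel_of_le hab.le] at this

theorem lintegral_mul_jumpOn {f : Eu d → Eu d → ℝ≥0∞} (hf : Measurable (Function.uncurry f))
    (hf0 : ∀ x, f x x = 0) (x : OnePoint (Eu d)) (a : ℝ≥0) {T : ℝ≥0} (hT : 0 < T) {W : Ω → ℝ≥0∞}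
    (hW : Measurable[Z.filt a] W) {K : ℝ≥0} (hK : ∀ ω, W ω ≤ K) :
    ∫⁻ ω, W ω * jumpOn Z f (Ioc a (a + T)) ω ∂(Z.P x) =
      ∫⁻ ω, W ω * extendZero (jumpComp m pk j f T) (Z.X a ω) ∂(Z.P x) := by
  rcases eq_or_ne K 0 with rfl | hK0
  · have : ∀ ω, W ω = 0 := fun ω => by simpa using hK ω
    simp [this]
  have hK0' : (K : ℝ≥0∞) ≠ 0 := by simpa using hK0
  have h := (isCompensated hD hf hf0 a T hT).2 x (fun ω => (K : ℝ≥0∞)⁻¹ * W ω)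
    (hW.const_mul _) (fun ω => by
      rw [mul_comm, ← div_eq_mul_inv]
      exact ENNReal.div_le_of_le_mul (by simpa using hK ω))
  have e (V : Ω → ℝ≥0∞) : ∫⁻ ω, W ω * V ω ∂(Z.P x) =
      K * ∫⁻ ω, (K : ℝ≥0∞)⁻¹ * W ω * V ω ∂(Z.P x) := by
    rw [← lintegral_const_mul' _ _ (by simp)]
    refine lintegral_congr fun ω => ?_
    rw [← mul_assoc, ← mul_assoc, ENNReal.mul_inv_cancel hK0' (by simp), one_mul]
  rw [e, e, h]

end Compensation

end

/-! ### Compensation with an adapted weight and a later observation. -/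

section

open ProbabilityTheory

/-- Dominated convergence for weighted sums. -/
theorem tendsto_tsum_mul {α : Type*} {a : α → ℝ≥0∞} (ha : ∑' s, a s ≠ ∞) {c : ℕ → α → ℝ≥0∞}
    {c' : α → ℝ≥0∞} {K : ℝ≥0} (hK : ∀ N s, c N s ≤ K)
    (hc : ∀ s, a s ≠ 0 → Tendsto (fun N => c N s) atTop (𝓝 (c' s))) :
    Tendsto (fun N => ∑' s, c N s * a s) atTop (𝓝 (∑' s, c' s * a s)) := by
  let _ : MeasurableSpace α := ⊤
  simp only [← lintegral_count]
  refine tendsto_lintegral_of_dominated_convergence (fun s => K * a s)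
    (fun N => measurable_from_top) (fun N => Eventually.of_forall fun s => by
      simp only; gcongr; exact hK N s) ?_
    (Eventually.of_forall fun s => ?_)
  · rw [lintegral_count, ENNReal.tsum_mul_left]
    exact ENNReal.mul_ne_top (by simp) ha
  · rcases eq_or_ne (a s) 0 with h | h
    · simp [h]
    · exact ENNReal.Tendsto.mul_const (hc s h) (Or.inr (ENNReal.ne_top_of_tsum_ne_top ha s))

variable {d : ℕ} {Ω : Type*} [mΩ : MeasurableSpace Ω] {Z : HuntProcess (Eu d) Ω}
  {m : Measure (Eu d)} [SFinite m] {pk : ℝ → Eu d → Eu d → ℝ≥0∞} {j : Eu d → Eu d → ℝ≥0∞}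

/-- The sum of `f` over the jumps in `I`, weighted with a process. -/
noncomputable def wJump (Z : HuntProcess (Eu d) Ω) (c : ℝ≥0 → Ω → ℝ≥0∞)
    (f : Eu d → Eu d → ℝ≥0∞) (I : Set ℝ≥0) (ω : Ω) : ℝ≥0∞ :=
  ∑' s, c s ω * I.indicator (jumpAt Z f ω) s

theorem sum_mul_jumpOn_grid {a T : ℝ≥0} (hT : 0 < T) (N : ℕ) (c : ℕ → ℝ≥0∞)
    (F : ℕ → Eu d → Eu d → ℝ≥0∞) (ω : Ω) :
    ∑ k ∈ Finset.range (N + 1),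
        c k * jumpOn Z (F k) (Ioc (grid a T N k) (grid a T N (k + 1))) ω =
      ∑' s, (Ioc a (a + T)).indicator
        (fun s => c (gridIdx a T N s) * jumpAt Z (F (gridIdx a T N s)) ω s) s := by
  unfold jumpOn
  simp only [← ENNReal.tsum_mul_left]
  rw [← Summable.tsum_finsetSum fun _ _ => ENNReal.summable]
  refine tsum_congr fun s => ?_
  by_cases hs : s ∈ Ioc a (a + T)
  · rw [indicator_of_mem hs, Finset.sum_eq_single (gridIdx a T N s)]
    · rw [indicator_of_mem ((mem_block_iff hT hs.1).2 rfl)]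
    · intro k _ hk
      rw [indicator_of_notMem fun h => hk ((mem_block_iff hT hs.1).1 h), mul_zero]
    · intro h
      exact absurd (Finset.mem_range.2 (gridIdx_lt hT hs)) h
  · rw [indicator_of_notMem hs]
    refine Finset.sum_eq_zero fun k hk => ?_
    rw [indicator_of_notMem, mul_zero]
    exact fun h => hs ⟨(le_grid k).trans_lt h.1, h.2.trans (grid_le (Finset.mem_range.1 hk))⟩

theorem jumpAt_ne_zero {R : Type*} [Zero R] {f : Eu d → Eu d → R} {ω : Ω} {s : ℝ≥0}
    (h : jumpAt Z f ω s ≠ 0) : ∃ y : Eu d, Z.X s ω = y := by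
  unfold jumpAt at h
  generalize Z.X s ω = y at h
  induction y using OnePoint.rec with
  | infty => simp at h
  | coe y => exact ⟨y, rfl⟩

theorem jumpAt_mul_right (f : Eu d → Eu d → ℝ≥0∞) (φ : Eu d → ℝ≥0∞) (ω : Ω) (s : ℝ≥0) :
    jumpAt Z (fun w y => f w y * φ y) ω s = extendZero φ (Z.X s ω) * jumpAt Z f ω s := by
  unfold jumpAt
  generalize Function.leftLim (fun u => Z.X u ω) s = x
  generalize Z.X s ω = y
  induction x using OnePoint.rec with
  | infty => simp
  | coe x => induction y using OnePoint.rec <;> simp [mul_comm]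

theorem tendsto_extendZero {φ : ℝ → Eu d → ℝ≥0∞}
    (hφ : ContinuousOn (fun q : ℝ × Eu d => φ q.1 q.2) (Ioi 0 ×ˢ univ)) {u : ℝ} (hu : 0 < u)
    (y : Eu d) : ContinuousAt (fun q : ℝ × OnePoint (Eu d) => extendZero (φ q.1) q.2) (u, ↑y) := by
  have he : IsOpenEmbedding (Prod.map (id : ℝ → ℝ) ((↑) : Eu d → OnePoint (Eu d))) :=
    IsOpenEmbedding.id.prodMap OnePoint.isOpenEmbedding_coe
  have h : ContinuousAt ((fun q : ℝ × OnePoint (Eu d) => extendZero (φ q.1) q.2) ∘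
      Prod.map (id : ℝ → ℝ) ((↑) : Eu d → OnePoint (Eu d))) (u, y) :=
    hφ.continuousAt ((isOpen_Ioi.prod isOpen_univ).mem_nhds ⟨hu, mem_univ _⟩)
  exact he.continuousAt_iff.1 h

theorem lintegral_Ioc_add_left (h : ℝ → ℝ≥0∞) (a δ : ℝ) :
    ∫⁻ s in Ioc 0 δ, h (a + s) = ∫⁻ s in Ioc a (a + δ), h s := by
  rw [← lintegral_indicator measurableSet_Ioc, ← lintegral_indicator measurableSet_Ioc,
    ← lintegral_add_left_eq_self (μ := volume) ((Ioc a (a + δ)).indicator h) a]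
  refine lintegral_congr fun s => ?_
  by_cases hs : s ∈ Ioc 0 δ
  · rw [indicator_of_mem hs, indicator_of_mem]
    exact ⟨by linarith [hs.1], by linarith [hs.2]⟩
  · rw [indicator_of_notMem hs, indicator_of_notMem]
    exact fun h => hs ⟨by linarith [h.1], by linarith [h.2]⟩

/-- Dominated convergence is used twice with the same bound: K times the jump sum dominates the
weighted sum on each path where it is finite, and again under the expectation. -/
theorem tendsto_lintegral_wJump {f : Eu d → Eu d → ℝ≥0∞} {I : Set ℝ≥0}
    {x : OnePoint (Eu d)} (hfin : ∫⁻ ω, jumpOn Z f I ω ∂(Z.P x) ≠ ∞)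
    (hmeas : Measurable (jumpOn Z f I)) {c : ℕ → ℝ≥0 → Ω → ℝ≥0∞} {c' : ℝ≥0 → Ω → ℝ≥0∞} {K : ℝ≥0}
    (hcm : ∀ N, Measurable (wJump Z (c N) f I)) (hK : ∀ N s ω, c N s ω ≤ K)
    (hc : ∀ᵐ ω ∂(Z.P x), ∀ s ∈ I, jumpAt Z f ω s ≠ 0 →
      Tendsto (fun N => c N s ω) atTop (𝓝 (c' s ω))) :
    Tendsto (fun N => ∫⁻ ω, wJump Z (c N) f I ω ∂(Z.P x)) atTop
      (𝓝 (∫⁻ ω, wJump Z c' f I ω ∂(Z.P x))) := by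
  refine tendsto_lintegral_of_dominated_convergence (fun ω => K * jumpOn Z f I ω) hcm
    (fun N => Eventually.of_forall fun ω => ?_) ?_ ?_
  · simp only [wJump, jumpOn, ← ENNReal.tsum_mul_left]
    exact ENNReal.tsum_le_tsum fun s => mul_le_mul_left (hK N s ω) _
  · rw [lintegral_const_mul _ hmeas]
    exact ENNReal.mul_ne_top (by simp) hfin
  · filter_upwards [hc, ae_lt_top hmeas hfin] with ω hω hlt
    refine tendsto_tsum_mul hlt.ne (fun N s => hK N s ω) fun s hs => ?_
    by_cases h : s ∈ I
    · rw [indicator_of_mem h] at hs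
      exact hω s h hs
    · exact absurd (indicator_of_notMem h _) hs

section Step
variable (hD : LevyData Z m pk j)
include hD

/-- The transition operator acting on `g`. -/
theorem lintegral_transKernel_extendZero {g : Eu d → ℝ≥0∞} (hg : Measurable g) {s : ℝ≥0}
    (hs : 0 < s) (y : OnePoint (Eu d)) :
    ∫⁻ z, extendZero g z ∂(transKernel Z s y) =
      extendZero (fun y => ∫⁻ z, pk s y z * g z ∂m) y := by
  rw [lintegral_transKernel Z y s (measurable_extendZero hg)]
  induction y using OnePoint.rec with
  | infty =>
    rw [extendZero_infty]
    refine lintegral_eq_zero_of_ae_eq_zero ?_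
    filter_upwards [Z.start OnePoint.infty] with ω hω
    rw [Z.cemetery_absorbing ω 0 s zero_le hω]
    rfl
  | coe y => exact hD.trans s hs y g hg

theorem measurable_lintegral_path {W : Ω → ℝ≥0∞} (hW : Measurable W) {r : Eu d → ℝ≥0∞}
    (hr : Measurable r) (x : OnePoint (Eu d)) :
    Measurable fun s : ℝ => ∫⁻ ω, W ω * extendZero r (Z.X s.toNNReal ω) ∂(Z.P x) :=
  Measurable.lintegral_prod_left' (f := fun q : Ω × ℝ => W q.1 * extendZero r
    (Z.X q.2.toNNReal q.1)) ((hW.comp measurable_fst).mul (measurable_extendZero_path hD hr))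

/-- The Markov property at a turns the compensator evaluated at X_a back into the mean jump rate
along the path after a. -/
theorem lintegral_mul_jumpComp {f : Eu d → Eu d → ℝ≥0∞} (hf : Measurable (Function.uncurry f))
    (x : OnePoint (Eu d)) (a δ : ℝ≥0) {W : Ω → ℝ≥0∞} (hW : Measurable[Z.filt a] W) :
    ∫⁻ ω, W ω * extendZero (jumpComp m pk j f δ) (Z.X a ω) ∂(Z.P x) =
      ∫⁻ s in Ioc (a : ℝ) (a + δ),
        ∫⁻ ω, W ω * extendZero (jumpRate m j f) (Z.X s.toNNReal ω) ∂(Z.P x) := by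
  have hr := measurable_jumpRate hD hf
  have hW' := hW.mono (Z.filt.le a) le_rfl
  rw [← lintegral_Ioc_add_left]
  have e1 (y : OnePoint (Eu d)) : extendZero (jumpComp m pk j f δ) y = ∫⁻ s in Ioc (0 : ℝ) δ,
      extendZero (fun y => ∫⁻ z, pk s y z * jumpRate m j f z ∂m) y := by
    induction y using OnePoint.rec with
    | infty => simp
    | coe y => rfl
  have hm : Measurable fun q : OnePoint (Eu d) × ℝ =>
      extendZero (fun y => ∫⁻ z, pk q.2 y z * jumpRate m j f z ∂m) q.1 := by
    have h := (measurableEmbedding_coe (d := d)).prodMap ((MeasurableEmbedding.id : MeasurableEmbedding (id : ℝ → ℝ)))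
    have h1 := h.measurable_extend (g := fun q : Eu d × ℝ =>
      ∫⁻ z, pk q.2 q.1 z * jumpRate m j f z ∂m) (g' := fun _ => 0) (measurable_pk_rate hD hf)
      measurable_const
    convert h1 using 1
    ext q
    obtain ⟨y, s⟩ := q
    induction y using OnePoint.rec with
    | infty =>
      rw [Function.extend_apply']
      · rfl
      · rintro ⟨⟨a, s'⟩, ha⟩
        exact OnePoint.coe_ne_infty a (congrArg Prod.fst ha)
    | coe y =>
      have := h.injective.extend_apply (fun q : Eu d × ℝ =>
        ∫⁻ z, pk q.2 q.1 z * jumpRate m j f z ∂m) (fun _ => 0) (y, s)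
      exact this.symm
  simp only [e1]
  have e2 (ω : Ω) : W ω * ∫⁻ s in Ioc (0 : ℝ) δ, extendZero
      (fun y => ∫⁻ z, pk s y z * jumpRate m j f z ∂m) (Z.X a ω) =
      ∫⁻ s in Ioc (0 : ℝ) δ, W ω * extendZero
      (fun y => ∫⁻ z, pk s y z * jumpRate m j f z ∂m) (Z.X a ω) :=
    (lintegral_const_mul _ (hm.comp measurable_prodMk_left)).symm
  simp only [e2]
  rw [lintegral_lintegral_swap]
  · refine setLIntegral_congr_fun measurableSet_Ioc fun s hs => ?_
    have hs' : 0 < s.toNNReal := by simpa using hs.1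
    have h1 := lintegral_markov' Z x a s.toNNReal hW (measurable_extendZero hr)
    simp only [lintegral_transKernel_extendZero hD hr hs', Real.coe_toNNReal s hs.1.le] at h1
    have h2 : ((a : ℝ) + s).toNNReal = a + s.toNNReal := by
      rw [Real.toNNReal_add (NNReal.coe_nonneg a) hs.1.le, Real.toNNReal_coe]
    simp only [h2, h1]
  · exact ((hW'.comp measurable_fst).mul (hm.comp (((measurable_X Z a).comp
      measurable_fst).prodMk measurable_snd))).aemeasurable

theorem tendsto_jumpRate {f : Eu d → Eu d → ℝ≥0∞} (hf : Measurable (Function.uncurry f))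
    {w : Eu d} (hw : jumpRate m j f w ≠ ∞) {φ : ℕ → Eu d → ℝ≥0∞} {φ' : Eu d → ℝ≥0∞}
    (hφm : ∀ N, Measurable (φ N)) (hφ1 : ∀ N y, φ N y ≤ 1)
    (hφ : ∀ y, Tendsto (fun N => φ N y) atTop (𝓝 (φ' y))) :
    Tendsto (fun N => jumpRate m j (fun w y => f w y * φ N y) w) atTop
      (𝓝 (jumpRate m j (fun w y => f w y * φ' y) w)) := by
  have hjf : Measurable fun y => j w y * f w y :=
    hD.j_meas.of_uncurry_left.mul hf.of_uncurry_left
  have := tendsto_lintegral_of_dominated_convergence' (μ := m)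
    (F := fun N y => j w y * f w y * φ N y) (f := fun y => j w y * f w y * φ' y)
    (fun y => j w y * f w y) (fun N => (hjf.mul (hφm N)).aemeasurable)
    (fun N => Eventually.of_forall fun y => mul_le_of_le_one_right' (hφ1 N y)) hw ?_
  · simpa only [jumpRate, mul_assoc] using this
  · filter_upwards [ae_lt_top hjf hw] with y hy
    exact ENNReal.Tendsto.const_mul (hφ y) (Or.inr hy.ne)

theorem wJump_grid (f : Eu d → Eu d → ℝ≥0∞) {T : ℝ≥0} (hT : 0 < T) (N : ℕ)
    (c : ℕ → Ω → ℝ≥0∞) (ω : Ω) :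
    wJump Z (fun s ω => c (gridIdx 0 T N s) ω) f (Ioc 0 T) ω =
      ∑ k ∈ Finset.range (N + 1),
        c k ω * jumpOn Z f (Ioc (grid 0 T N k) (grid 0 T N (k + 1))) ω := by
  have := sum_mul_jumpOn_grid (Z := Z) (a := 0) hT N (fun k => c k ω) (fun _ => f) ω
  rw [this, zero_add, wJump]
  exact tsum_congr fun s => (indicator_mul_right (Ioc 0 T) (fun s => c (gridIdx 0 T N s) ω) _).symm

theorem wJump_grid_mul (f : Eu d → Eu d → ℝ≥0∞) {T : ℝ≥0} (hT : 0 < T) (N : ℕ)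
    (c : ℕ → Ω → ℝ≥0∞) (φ : ℕ → Eu d → ℝ≥0∞) (ω : Ω) :
    wJump Z (fun s ω => c (gridIdx 0 T N s) ω * extendZero (φ (gridIdx 0 T N s)) (Z.X s ω)) f
        (Ioc 0 T) ω =
      ∑ k ∈ Finset.range (N + 1), c k ω * jumpOn Z (fun w y => f w y * φ k y)
        (Ioc (grid 0 T N k) (grid 0 T N (k + 1))) ω := by
  have := sum_mul_jumpOn_grid (Z := Z) (a := 0) hT N (fun k => c k ω)
    (fun k w y => f w y * φ k y) ω
  rw [this, zero_add, wJump]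
  simp only [jumpAt_mul_right, ← mul_assoc]
  exact tsum_congr fun s => (indicator_mul_right (Ioc 0 T) (fun s =>
    c (gridIdx 0 T N s) ω * extendZero (φ (gridIdx 0 T N s)) (Z.X s ω)) _).symm

theorem grid_lt_grid {T : ℝ≥0} (hT : 0 < T) (N k : ℕ) : grid 0 T N k < grid 0 T N (k + 1) := by
  rw [grid_succ]
  have : 0 < T / ((N : ℝ≥0) + 1) := by positivity
  exact lt_add_of_pos_right _ this

theorem sum_lintegral_grid {T : ℝ≥0} (hT : 0 < T) (N : ℕ) {h : ℕ → ℝ → ℝ≥0∞}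
    (hh : ∀ k, Measurable (h k)) :
    ∑ k ∈ Finset.range (N + 1), ∫⁻ s in Ioc (grid 0 T N k : ℝ) (grid 0 T N (k + 1)), h k s =
      ∫⁻ s in Ioc (0 : ℝ) T, h (gridIdx 0 T N s.toNNReal) s := by
  have e (k : ℕ) : ∫⁻ s in Ioc (grid 0 T N k : ℝ) (grid 0 T N (k + 1)), h k s =
      ∫⁻ s, (Ioc (grid 0 T N k : ℝ) (grid 0 T N (k + 1))).indicator (h k) s :=
    (lintegral_indicator measurableSet_Ioc _).symm
  simp only [e]
  rw [← lintegral_finsetSum _ fun k _ => (hh k).indicator measurableSet_Ioc,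
    ← lintegral_indicator measurableSet_Ioc]
  refine lintegral_congr fun s => ?_
  have hmem (k : ℕ) (hs : 0 < s) : s ∈ Ioc (grid 0 T N k : ℝ) (grid 0 T N (k + 1)) ↔
      k = gridIdx 0 T N s.toNNReal := by
    rw [← mem_block_iff hT (by simpa using hs), mem_Ioc, mem_Ioc, ← NNReal.coe_lt_coe,
      ← NNReal.coe_le_coe, Real.coe_toNNReal s hs.le]
  by_cases hs : s ∈ Ioc (0 : ℝ) T
  · rw [indicator_of_mem hs, Finset.sum_eq_single (gridIdx 0 T N s.toNNReal)]
    · rw [indicator_of_mem ((hmem _ hs.1).2 rfl)]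
    · exact fun k _ hk => indicator_of_notMem (fun h' => hk ((hmem k hs.1).1 h')) _
    · intro h'
      refine absurd (Finset.mem_range.2 (gridIdx_lt hT ?_)) h'
      rw [zero_add]
      exact ⟨by simpa using hs.1, Real.toNNReal_le_iff_le_coe.2 hs.2⟩
  · rw [indicator_of_notMem hs]
    refine Finset.sum_eq_zero fun k hk => indicator_of_notMem (fun h' => hs ⟨?_, ?_⟩) _
    · exact (NNReal.coe_nonneg _).trans_lt h'.1
    · refine h'.2.trans ?_
      have := grid_le (a := 0) (T := T) (Finset.mem_range.1 hk)
      rw [zero_add] at this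
      exact_mod_cast this

/-- The compensation formula for a weighted sum over the jumps before `T`, evaluated together with
a function of the position at a later time `t`. -/
theorem lintegral_wJump_mul {f : Eu d → Eu d → ℝ≥0∞} (hf : Measurable (Function.uncurry f))
    (hf0 : ∀ x, f x x = 0) (x : OnePoint (Eu d)) {T t : ℝ≥0} (hT : 0 < T) (hTt : T < t)
    (hfin : ∫⁻ ω, jumpOn Z f (Ioc 0 T) ω ∂(Z.P x) ≠ ∞)
    {H : ℝ≥0 → Ω → ℝ≥0∞} (hH : ∀ s, Measurable[Z.filt s] (H s)) {K : ℝ≥0}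
    (hK : ∀ s ω, H s ω ≤ K)
    (hHc : ∀ᵐ ω ∂(Z.P x), ∀ s ∈ Ioc 0 T, Tendsto (fun r => H r ω) (𝓝[<] s) (𝓝 (H s ω)))
    {g : Eu d → ℝ≥0∞} (hg : Measurable g) (hg1 : ∀ y, g y ≤ 1)
    (hφ : ContinuousOn (fun q : ℝ × Eu d => ∫⁻ z, pk q.1 q.2 z * g z ∂m) (Ioi 0 ×ˢ univ)) :
    ∫⁻ ω, wJump Z H f (Ioc 0 T) ω * extendZero g (Z.X t ω) ∂(Z.P x) =
      ∫⁻ s in Ioc (0 : ℝ) T, ∫⁻ ω, H s.toNNReal ω * extendZero (jumpRate m j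
        (fun w y => f w y * ∫⁻ z, pk (t - s) y z * g z ∂m)) (Z.X s.toNNReal ω) ∂(Z.P x) := by
  set φ : ℝ → Eu d → ℝ≥0∞ := fun u y => ∫⁻ z, pk u y z * g z ∂m with hφdef
  have hφ1 (u : ℝ) (y : Eu d) : φ u y ≤ 1 :=
    (lintegral_mono fun z => mul_le_of_le_one_right' (hg1 z)).trans (pk_mass_le hD u y)
  have hφm (u : ℝ) : Measurable (φ u) := by
    have h : Measurable fun q : Eu d × Eu d => pk u q.1 q.2 * g q.2 :=
      (hD.pk_meas.comp (by fun_prop : Measurable fun q : Eu d × Eu d => (u, q.1, q.2))).mul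
        (hg.comp measurable_snd)
    exact h.lintegral_prod_right'
  have hφx1 (u : ℝ) (y : OnePoint (Eu d)) : extendZero (φ u) y ≤ 1 := extendZero_le (hφ1 u) y
  have hH' (s : ℝ≥0) : Measurable (H s) := (hH s).mono (Z.filt.le s) le_rfl
  have hgm : Measurable fun ω => extendZero g (Z.X t ω) :=
    (measurable_extendZero hg).comp (measurable_X Z t)
  have hgX1 (ω : Ω) : extendZero g (Z.X t ω) ≤ 1 := extendZero_le hg1 _
  have hblk (N k : ℕ) : Measurable[Z.filt (grid 0 T N (k + 1))]
      (jumpOn Z f (Ioc (grid 0 T N k) (grid 0 T N (k + 1)))) :=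
    measurable_jumpOn hD hf hf0 (grid_lt_grid hD hT N k)
  have hblk' (N k : ℕ) := (hblk N k).mono (Z.filt.le _) le_rfl
  have hfφ (u : ℝ) : Measurable (Function.uncurry fun w y => f w y * φ u y) :=
    hf.mul ((hφm u).comp measurable_snd)
  have hfφ0 (u : ℝ) (w : Eu d) : f w w * φ u w = 0 := by simp [hf0]
  have hjm : Measurable (jumpOn Z f (Ioc 0 T)) :=
    (measurable_jumpOn hD hf hf0 hT).mono (Z.filt.le _) le_rfl
  have hle1 {K : ℝ≥0} {u v : ℝ≥0∞} (hu : u ≤ K) (hv : v ≤ 1) : u * v ≤ K :=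
    (mul_le_of_le_one_right' hv).trans hu
  have hℓ (s : ℝ≥0) (hs : s ∈ Ioc 0 T) := tendsto_grid_left hT hs.1
  have hr (s : ℝ≥0) (hs : s ∈ Ioc 0 T) := tendsto_grid_right hT hs.1
  -- As T < t, the remaining time stays positive, which is where φ is continuous.
  have hsub (s : ℝ≥0) (hs : s ∈ Ioc 0 T) : (0 : ℝ) < t - s := by
    have : (s : ℝ) < t := by exact_mod_cast hs.2.trans_lt hTt
    linarith
  have hne1 {u : ℝ≥0∞} (h : u ≤ 1) : u ≠ ∞ := ne_top_of_le_ne_top (by simp) h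
  -- the value at time `t`
  have limA : Tendsto (fun N => ∫⁻ ω, wJump Z (fun s ω => H (grid 0 T N (gridIdx 0 T N s)) ω *
      extendZero g (Z.X t ω)) f (Ioc 0 T) ω ∂(Z.P x)) atTop
      (𝓝 (∫⁻ ω, wJump Z (fun s ω => H s ω * extendZero g (Z.X t ω)) f (Ioc 0 T) ω ∂(Z.P x))) := by
    refine tendsto_lintegral_wJump (K := K) hfin hjm (fun N => ?_)
      (fun N s ω => hle1 (hK _ _) (hgX1 ω)) ?_
    · simp only [funext (wJump_grid hD f hT N
        (fun k ω => H (grid 0 T N k) ω * extendZero g (Z.X t ω)))]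
      exact Finset.measurable_fun_sum _ fun k _ => ((hH' _).mul hgm).mul (hblk' N k)
    · filter_upwards [hHc] with ω hω s hs _
      exact ENNReal.Tendsto.mul_const ((hω s hs).comp (hℓ s hs)) (Or.inr (hne1 (hgX1 ω)))
  -- the conditional expectation at the end of each block
  have limB : Tendsto (fun N => ∫⁻ ω, wJump Z (fun s ω => H (grid 0 T N (gridIdx 0 T N s)) ω *
      extendZero (φ (t - grid 0 T N (gridIdx 0 T N s + 1)))
        (Z.X (grid 0 T N (gridIdx 0 T N s + 1)) ω)) f (Ioc 0 T) ω ∂(Z.P x)) atTop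
      (𝓝 (∫⁻ ω, wJump Z (fun s ω => H s ω * extendZero (φ (t - s)) (Z.X s ω)) f
        (Ioc 0 T) ω ∂(Z.P x))) := by
    refine tendsto_lintegral_wJump (K := K) hfin hjm (fun N => ?_)
      (fun N s ω => hle1 (hK _ _) (hφx1 _ _)) ?_
    · simp only [funext (wJump_grid hD f hT N (fun k ω => H (grid 0 T N k) ω *
        extendZero (φ (t - grid 0 T N (k + 1))) (Z.X (grid 0 T N (k + 1)) ω)))]
      exact Finset.measurable_fun_sum _ fun k _ => ((hH' _).mul
        ((measurable_extendZero (hφm _)).comp (measurable_X Z _))).mul (hblk' N k)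
    · filter_upwards [hHc] with ω hω s hs hne
      obtain ⟨y, hy⟩ := jumpAt_ne_zero hne
      refine ENNReal.Tendsto.mul ((hω s hs).comp (hℓ s hs)) (Or.inr (hne1 (hφx1 _ _))) ?_
        (Or.inr (ne_top_of_le_ne_top (by simp) (hK s ω)))
      have h1 := tendsto_extendZero (φ := φ) hφ (hsub s hs) y
      rw [hy]
      refine h1.tendsto.comp (Tendsto.prodMk_nhds ?_ ?_)
      · exact tendsto_const_nhds.sub
          (NNReal.tendsto_coe.2 ((hr s hs).mono_right nhdsWithin_le_nhds))
      · rw [← hy]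
        exact (Z.rightContinuous_path ω s).tendsto.comp (hr s hs)
  -- the same with the jump target
  have limC : Tendsto (fun N => ∫⁻ ω, wJump Z (fun s ω => H (grid 0 T N (gridIdx 0 T N s)) ω *
      extendZero (φ (t - grid 0 T N (gridIdx 0 T N s))) (Z.X s ω)) f (Ioc 0 T) ω ∂(Z.P x)) atTop
      (𝓝 (∫⁻ ω, wJump Z (fun s ω => H s ω * extendZero (φ (t - s)) (Z.X s ω)) f
        (Ioc 0 T) ω ∂(Z.P x))) := by
    refine tendsto_lintegral_wJump (K := K) hfin hjm (fun N => ?_)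
      (fun N s ω => hle1 (hK _ _) (hφx1 _ _)) ?_
    · simp only [funext (wJump_grid_mul hD f hT N (fun k ω => H (grid 0 T N k) ω)
        (fun k => φ (t - grid 0 T N k)))]
      exact Finset.measurable_fun_sum _ fun k _ => (hH' _).mul
        ((measurable_jumpOn hD (hfφ _) (hfφ0 _) (grid_lt_grid hD hT N k)).mono
          (Z.filt.le _) le_rfl)
    · filter_upwards [hHc] with ω hω s hs hne
      obtain ⟨y, hy⟩ := jumpAt_ne_zero hne
      refine ENNReal.Tendsto.mul ((hω s hs).comp (hℓ s hs)) (Or.inr (hne1 (hφx1 _ _))) ?_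
        (Or.inr (ne_top_of_le_ne_top (by simp) (hK s ω)))
      have h1 := tendsto_extendZero (φ := φ) hφ (hsub s hs) y
      rw [hy]
      refine h1.tendsto.comp (Tendsto.prodMk_nhds ?_ tendsto_const_nhds)
      exact tendsto_const_nhds.sub
        (NNReal.tendsto_coe.2 ((hℓ s hs).mono_right nhdsWithin_le_nhds))
  -- The jump sum of a block and the weight at its left end are both known at its right end;
  -- conditioning there replaces g(X_t) by φ at the remaining time.
  have eAB (N : ℕ) : ∫⁻ ω, wJump Z (fun s ω => H (grid 0 T N (gridIdx 0 T N s)) ω *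
      extendZero g (Z.X t ω)) f (Ioc 0 T) ω ∂(Z.P x) =
      ∫⁻ ω, wJump Z (fun s ω => H (grid 0 T N (gridIdx 0 T N s)) ω *
      extendZero (φ (t - grid 0 T N (gridIdx 0 T N s + 1)))
        (Z.X (grid 0 T N (gridIdx 0 T N s + 1)) ω)) f (Ioc 0 T) ω ∂(Z.P x) := by
    simp only [funext (wJump_grid hD f hT N
        (fun k ω => H (grid 0 T N k) ω * extendZero g (Z.X t ω))),
      funext (wJump_grid hD f hT N (fun k ω => H (grid 0 T N k) ω *
        extendZero (φ (t - grid 0 T N (k + 1))) (Z.X (grid 0 T N (k + 1)) ω)))]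
    rw [lintegral_finsetSum _ (by exact fun k _ => ((hH' _).mul hgm).mul (hblk' N k)),
      lintegral_finsetSum _ (by exact fun k _ => ((hH' _).mul
        ((measurable_extendZero (hφm _)).comp (measurable_X Z _))).mul (hblk' N k))]
    refine Finset.sum_congr rfl fun k hk => ?_
    have hk1 : grid 0 T N (k + 1) ≤ T := by
      simpa using grid_le (a := 0) (T := T) (Nat.succ_le_of_lt (Finset.mem_range.1 hk))
    have hk2 := hk1.trans_lt hTt
    have h1 := lintegral_markov' Z x (grid 0 T N (k + 1)) (t - grid 0 T N (k + 1))
      (W := fun ω => H (grid 0 T N k) ω *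
        jumpOn Z f (Ioc (grid 0 T N k) (grid 0 T N (k + 1))) ω)
      (((hH _).mono (Z.filt.mono (grid_mono k.le_succ)) le_rfl).mul (hblk N k))
      (measurable_extendZero hg)
    simp only [lintegral_transKernel_extendZero hD hg (tsub_pos_of_lt hk2),
      add_tsub_cancel_of_le hk2.le, NNReal.coe_sub hk2.le] at h1
    simp only [mul_right_comm _ (extendZero _ _)]
    exact h1
  -- Here φ is frozen at the left end of the block in time and evaluated at the jump target in
  -- space, so it is part of the integrand and each block is an instance of conditional
  -- compensation.
  have eC (N : ℕ) : ∫⁻ ω, wJump Z (fun s ω => H (grid 0 T N (gridIdx 0 T N s)) ω *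
      extendZero (φ (t - grid 0 T N (gridIdx 0 T N s))) (Z.X s ω)) f (Ioc 0 T) ω ∂(Z.P x) =
      ∫⁻ s in Ioc (0 : ℝ) T, ∫⁻ ω, H (grid 0 T N (gridIdx 0 T N s.toNNReal)) ω *
        extendZero (jumpRate m j fun w y =>
          f w y * φ (t - grid 0 T N (gridIdx 0 T N s.toNNReal)) y) (Z.X s.toNNReal ω) ∂(Z.P x) := by
    rw [← sum_lintegral_grid hD hT N (h := fun k s => ∫⁻ ω, H (grid 0 T N k) ω *
        extendZero (jumpRate m j fun w y => f w y * φ (t - grid 0 T N k) y)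
          (Z.X s.toNNReal ω) ∂(Z.P x))
      fun k => measurable_lintegral_path hD (hH' _) (measurable_jumpRate hD (hfφ _)) x]
    simp only [funext (wJump_grid_mul hD f hT N (fun k ω => H (grid 0 T N k) ω)
        (fun k => φ (t - grid 0 T N k)))]
    rw [lintegral_finsetSum _ (by exact fun k _ => ((hH' _).mul
        ((measurable_jumpOn hD (hfφ _) (hfφ0 _) (grid_lt_grid hD hT N k)).mono
          (Z.filt.le _) le_rfl)))]
    refine Finset.sum_congr rfl fun k hk => ?_
    have hδ : 0 < T / ((N : ℝ≥0) + 1) := by positivity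
    have h1 := lintegral_mul_jumpOn hD (hfφ (t - grid 0 T N k)) (hfφ0 _) x (grid 0 T N k) hδ
      (hH _) (hK _)
    have h2 := lintegral_mul_jumpComp hD (hfφ (t - grid 0 T N k)) x (grid 0 T N k)
      (T / ((N : ℝ≥0) + 1)) (hH _)
    rw [grid_succ]
    exact h1.trans (by simpa using h2)
  have hrate : ∫⁻ s in Ioc (0 : ℝ) T, ∫⁻ ω, extendZero (jumpRate m j f) (Z.X s.toNNReal ω) ∂(Z.P x) ≠ ∞ := by
    have h1 := lintegral_mul_jumpOn hD hf hf0 x 0 hT (W := fun _ => 1) measurable_const (K := 1)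
      (by simp)
    have h2 := lintegral_mul_jumpComp hD hf x 0 T (W := fun _ => 1) measurable_const
    simp only [one_mul, zero_add, NNReal.coe_zero] at h1 h2
    rwa [← h2, ← h1]
  have hrm : Measurable fun s : ℝ =>
      ∫⁻ ω, extendZero (jumpRate m j f) (Z.X s.toNNReal ω) ∂(Z.P x) := by
    simpa using measurable_lintegral_path hD (W := fun _ => 1) measurable_const
      (measurable_jumpRate hD hf) x
  have limR : Tendsto (fun N => ∫⁻ s in Ioc (0 : ℝ) T,
      ∫⁻ ω, H (grid 0 T N (gridIdx 0 T N s.toNNReal)) ω * extendZero (jumpRate m j fun w y =>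
          f w y * φ (t - grid 0 T N (gridIdx 0 T N s.toNNReal)) y) (Z.X s.toNNReal ω) ∂(Z.P x))
      atTop (𝓝 (∫⁻ s in Ioc (0 : ℝ) T, ∫⁻ ω, H s.toNNReal ω * extendZero (jumpRate m j
        (fun w y => f w y * φ (t - s) y)) (Z.X s.toNNReal ω) ∂(Z.P x))) := by
    have hdom (s : ℝ) (r : ℝ≥0) (u : ℝ) (ω : Ω) : H r ω * extendZero (jumpRate m j fun w y =>
        f w y * φ u y) (Z.X s.toNNReal ω) ≤ K * extendZero (jumpRate m j f) (Z.X s.toNNReal ω) := by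
      refine mul_le_mul' (hK _ _) (extendZero_mono (fun w => ?_) _)
      exact lintegral_mono fun y => mul_le_mul_right (mul_le_of_le_one_right' (hφ1 _ _)) _
    refine tendsto_lintegral_of_dominated_convergence'
      (fun s => K * ∫⁻ ω, extendZero (jumpRate m j f) (Z.X s.toNNReal ω) ∂(Z.P x))
      (fun N => ?_) (fun N => Eventually.of_forall fun s => ?_) ?_ ?_
    · have hm (k : ℕ) := measurable_lintegral_path hD (hH' (grid 0 T N k))
        (measurable_jumpRate hD (hfφ (t - grid 0 T N k))) x
      have h1 : Measurable (Function.uncurry fun (k : ℕ) (s : ℝ) => ∫⁻ ω, H (grid 0 T N k) ω *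
        extendZero (jumpRate m j fun w y => f w y * φ (t - grid 0 T N k) y)
          (Z.X s.toNNReal ω) ∂(Z.P x)) := measurable_from_prod_countable_right hm
      have h2 : Measurable fun s : ℝ => gridIdx 0 T N s.toNNReal := by
        unfold gridIdx
        exact (measurable_from_top (f := fun n : ℕ => n - 1)).comp (Nat.measurable_ceil.comp
          ((measurable_real_toNNReal.sub_const 0).div_const _))
      exact (h1.comp (h2.prodMk measurable_id)).aemeasurable
    · simp only
      rw [← lintegral_const_mul' _ _ ENNReal.coe_ne_top]
      exact lintegral_mono fun ω => hdom s _ _ ω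
    · rw [lintegral_const_mul' _ _ (by simp)]
      exact ENNReal.mul_ne_top (by simp) hrate
    · filter_upwards [ae_lt_top hrm hrate, ae_restrict_mem measurableSet_Ioc] with s hs hsT
      have hσ : s.toNNReal ∈ Ioc 0 T :=
        ⟨by simpa using hsT.1, Real.toNNReal_le_iff_le_coe.2 hsT.2⟩
      have hXm : Measurable fun ω => extendZero (jumpRate m j f) (Z.X s.toNNReal ω) :=
        (measurable_extendZero (measurable_jumpRate hD hf)).comp (measurable_X Z _)
      refine tendsto_lintegral_of_dominated_convergence'
        (fun ω => K * extendZero (jumpRate m j f) (Z.X s.toNNReal ω))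
        (fun N => ((hH' _).mul ((measurable_extendZero (measurable_jumpRate hD (hfφ _))).comp
          (measurable_X Z _))).aemeasurable)
        (fun N => Eventually.of_forall fun ω => hdom s _ _ ω) ?_ ?_
      · rw [lintegral_const_mul' _ _ (by simp)]
        exact ENNReal.mul_ne_top (by simp) hs.ne
      · filter_upwards [hHc, ae_lt_top hXm hs.ne] with ω hω hlt
        have hle : extendZero (jumpRate m j fun w y => f w y * φ (t - s) y) (Z.X s.toNNReal ω) ≤
            extendZero (jumpRate m j f) (Z.X s.toNNReal ω) := by
          refine extendZero_mono (fun w => ?_) _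
          exact lintegral_mono fun y => mul_le_mul_right (mul_le_of_le_one_right' (hφ1 _ _)) _
        refine ENNReal.Tendsto.mul ((hω _ hσ).comp (hℓ _ hσ)) (Or.inr (hle.trans_lt hlt).ne) ?_
          (Or.inr (ne_top_of_le_ne_top (by simp) (hK _ ω)))
        generalize Z.X s.toNNReal ω = w at hlt ⊢
        induction w using OnePoint.rec with
        | infty => simp
        | coe w =>
          simp only [extendZero_coe] at hlt ⊢
          refine tendsto_jumpRate hD hf hlt.ne (fun N => hφm _) (fun N => hφ1 _) fun y => ?_
          have h1 : ContinuousAt (fun q : ℝ × Eu d => φ q.1 q.2) ((t : ℝ) - s, y) := by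
            refine hφ.continuousAt ((isOpen_Ioi.prod isOpen_univ).mem_nhds ⟨?_, mem_univ _⟩)
            have := hsub _ hσ
            rwa [Real.coe_toNNReal s hsT.1.le] at this
          refine h1.tendsto.comp (Tendsto.prodMk_nhds ?_ tendsto_const_nhds)
          refine tendsto_const_nhds.sub ?_
          have := NNReal.tendsto_coe.2 ((hℓ _ hσ).mono_right nhdsWithin_le_nhds)
          rwa [Real.coe_toNNReal s hsT.1.le] at this
  have e1 : ∫⁻ ω, wJump Z (fun s ω => H s ω * extendZero g (Z.X t ω)) f (Ioc 0 T) ω ∂(Z.P x) =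
      ∫⁻ ω, wJump Z H f (Ioc 0 T) ω * extendZero g (Z.X t ω) ∂(Z.P x) := by
    refine lintegral_congr fun ω => ?_
    simp only [wJump, mul_right_comm _ (extendZero _ _), ENNReal.tsum_mul_right]
  rw [← e1]
  -- `limB` and `limC` have the same limit: by right-continuity the position at the end of the block
  -- tends to X_s, which is the jump target. This links the conditional expectation with the
  -- compensated integral.
  have h1 := tendsto_nhds_unique (limA.congr eAB) limB
  rw [h1]
  exact tendsto_nhds_unique (limC.congr eC) limR

end Step

end

/-! ### Removal of the truncations: all jumps before the time of observation. -/

section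

open ProbabilityTheory

variable {d : ℕ} {Ω : Type*} [mΩ : MeasurableSpace Ω] {Z : HuntProcess (Eu d) Ω}
  {m : Measure (Eu d)} [SFinite m] {pk : ℝ → Eu d → Eu d → ℝ≥0∞} {j : Eu d → Eu d → ℝ≥0∞}

theorem measurable_extendZero_param {Y : Type*} [MeasurableSpace Y] {φ : Y → Eu d → ℝ≥0∞}
    (hφ : Measurable (Function.uncurry φ)) :
    Measurable fun q : Y × OnePoint (Eu d) => extendZero (φ q.1) q.2 := by
  have h := (MeasurableEmbedding.id : MeasurableEmbedding (id : Y → Y)).prodMap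
    (measurableEmbedding_coe (d := d))
  have h1 := h.measurable_extend (g := Function.uncurry φ) (g' := fun _ => 0) hφ measurable_const
  convert h1 using 1
  ext q
  obtain ⟨s, y⟩ := q
  induction y using OnePoint.rec with
  | infty =>
    rw [Function.extend_apply']
    · rfl
    · rintro ⟨⟨s', a⟩, ha⟩
      exact OnePoint.coe_ne_infty a (congrArg Prod.snd ha)
  | coe y =>
    have := h.injective.extend_apply (Function.uncurry φ) (fun _ => 0) (s, y)
    exact this.symm

theorem wJump_mono {c c' : ℝ≥0 → Ω → ℝ≥0∞} (f : Eu d → Eu d → ℝ≥0∞) {I I' : Set ℝ≥0}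
    (hI : I ⊆ I') {ω : Ω} (hc : ∀ s, c s ω ≤ c' s ω) :
    wJump Z c f I ω ≤ wJump Z c' f I' ω :=
  ENNReal.tsum_le_tsum fun s =>
    mul_le_mul' (hc s) (indicator_le_indicator_of_subset hI (fun _ => zero_le) s)

theorem wJump_iSup {c : ℕ → ℝ≥0 → Ω → ℝ≥0∞} (hc : ∀ s ω, Monotone fun n => c n s ω)
    (f : Eu d → Eu d → ℝ≥0∞) {I : ℕ → Set ℝ≥0} (hI : Monotone I) (ω : Ω) :
    ⨆ n, wJump Z (c n) f (I n) ω = wJump Z (fun s ω => ⨆ n, c n s ω) f (⋃ n, I n) ω := by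
  unfold wJump
  rw [← tsum_iSup_of_monotone]
  · refine tsum_congr fun s => ?_
    rw [indicator_iUnion_apply (by rfl)]
    have hm : Monotone fun n => (I n).indicator (jumpAt Z f ω) s := fun a b hab =>
      indicator_le_indicator_of_subset (hI hab) (fun _ => zero_le) s
    rw [ENNReal.iSup_mul]
    refine le_antisymm (iSup_le fun n => ?_) (iSup_le fun n => ?_)
    · exact le_iSup_of_le n (mul_le_mul_right (le_iSup (fun n => (I n).indicator (jumpAt Z f ω) s)
        n) _)
    · rw [ENNReal.mul_iSup]
      refine iSup_le fun k => le_iSup_of_le (max n k) ?_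
      exact mul_le_mul' (hc s ω (le_max_left _ _)) (hm (le_max_right _ _))
  · exact fun a b hab s => mul_le_mul' (hc s ω hab)
      (indicator_le_indicator_of_subset (hI hab) (fun _ => zero_le) s)

section Step
variable (hD : LevyData Z m pk j)
include hD

theorem aemeasurable_wJump {f : Eu d → Eu d → ℝ≥0∞} (hf : Measurable (Function.uncurry f))
    (hf0 : ∀ x, f x x = 0) (x : OnePoint (Eu d)) {T : ℝ≥0} (hT : 0 < T)
    (hfin : ∫⁻ ω, jumpOn Z f (Ioc 0 T) ω ∂(Z.P x) ≠ ∞)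
    {H : ℝ≥0 → Ω → ℝ≥0∞} (hH : ∀ s, Measurable (H s)) {K : ℝ≥0} (hK : ∀ s ω, H s ω ≤ K)
    (hHc : ∀ᵐ ω ∂(Z.P x), ∀ s ∈ Ioc 0 T, Tendsto (fun r => H r ω) (𝓝[<] s) (𝓝 (H s ω))) :
    AEMeasurable (wJump Z H f (Ioc 0 T)) (Z.P x) := by
  have hjm : Measurable (jumpOn Z f (Ioc 0 T)) :=
    (measurable_jumpOn hD hf hf0 hT).mono (Z.filt.le _) le_rfl
  refine aemeasurable_of_tendsto_metrizable_ae atTop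
    (f := fun N => wJump Z (fun s ω => H (grid 0 T N (gridIdx 0 T N s)) ω) f (Ioc 0 T))
    (fun N => ?_) ?_
  · rw [funext (wJump_grid hD f hT N (fun k ω => H (grid 0 T N k) ω))]
    exact (Finset.measurable_fun_sum _ fun k _ => (hH _).mul
      ((measurable_jumpOn hD hf hf0 (grid_lt_grid hD hT N k)).mono
        (Z.filt.le _) le_rfl)).aemeasurable
  · filter_upwards [hHc, ae_lt_top hjm hfin] with ω hω hlt
    refine tendsto_tsum_mul hlt.ne (fun N s => hK _ ω) fun s hs => ?_
    by_cases h : s ∈ Ioc 0 T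
    · exact (hω s h).comp (tendsto_grid_left hT h.1)
    · exact absurd (indicator_of_notMem h _) hs

theorem measurable_jumpRate_param {f : Eu d → Eu d → ℝ≥0∞} (hf : Measurable (Function.uncurry f))
    {g : Eu d → ℝ≥0∞} (hg : Measurable g) (t : ℝ) :
    Measurable (Function.uncurry fun (s : ℝ) w =>
      jumpRate m j (fun w y => f w y * ∫⁻ z, pk (t - s) y z * g z ∂m) w) := by
  have h1 : Measurable fun q : ((ℝ × Eu d) × Eu d) => ∫⁻ z, pk (t - q.1.1) q.2 z * g z ∂m := by
    have h : Measurable fun q : ((ℝ × Eu d) × Eu d) × Eu d =>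
        pk (t - q.1.1.1) q.1.2 q.2 * g q.2 :=
      (hD.pk_meas.comp (by fun_prop : Measurable fun q : ((ℝ × Eu d) × Eu d) × Eu d =>
        (t - q.1.1.1, q.1.2, q.2))).mul (hg.comp measurable_snd)
    exact h.lintegral_prod_right'
  have h2 : Measurable fun q : ((ℝ × Eu d) × Eu d) =>
      j q.1.2 q.2 * (f q.1.2 q.2 * ∫⁻ z, pk (t - q.1.1) q.2 z * g z ∂m) :=
    (hD.j_meas.comp (by fun_prop : Measurable fun q : ((ℝ × Eu d) × Eu d) => (q.1.2, q.2))).mul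
      ((hf.comp (by fun_prop : Measurable fun q : ((ℝ × Eu d) × Eu d) => (q.1.2, q.2))).mul h1)
  exact h2.lintegral_prod_right'

/-- The compensation formula for weighted sums over the jumps before `t`. -/
theorem lintegral_wJump_Ioo {f : Eu d → Eu d → ℝ≥0∞} (hf : Measurable (Function.uncurry f))
    (hf0 : ∀ x, f x x = 0) (x : OnePoint (Eu d)) {t : ℝ≥0} (ht : 0 < t)
    (hfin : ∫⁻ ω, jumpOn Z f (Ioc 0 t) ω ∂(Z.P x) ≠ ∞)
    {H : ℝ≥0 → Ω → ℝ≥0∞} (hH : ∀ s, Measurable[Z.filt s] (H s))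
    (hHm : Measurable (Function.uncurry H))
    (hHc : ∀ᵐ ω ∂(Z.P x), ∀ s ∈ Ioo 0 t, Tendsto (fun r => H r ω) (𝓝[<] s) (𝓝 (H s ω)))
    {g : Eu d → ℝ≥0∞} (hg : Measurable g) (hg1 : ∀ y, g y ≤ 1)
    (hφ : ContinuousOn (fun q : ℝ × Eu d => ∫⁻ z, pk q.1 q.2 z * g z ∂m) (Ioi 0 ×ˢ univ)) :
    ∫⁻ ω, wJump Z H f (Ioo 0 t) ω * extendZero g (Z.X t ω) ∂(Z.P x) =
      ∫⁻ s in Ioo (0 : ℝ) t, ∫⁻ ω, H s.toNNReal ω * extendZero (jumpRate m j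
        (fun w y => f w y * ∫⁻ z, pk (t - s) y z * g z ∂m)) (Z.X s.toNNReal ω) ∂(Z.P x) := by
  -- Two truncations disappear together by monotone convergence: T n increases to t and keeps t - s
  -- positive, and min(H, n) bounds the weight.
  obtain ⟨T, hTm, hT, hTt⟩ := exists_seq_strictMono_tendsto' ht
  let Hn : ℕ → ℝ≥0 → Ω → ℝ≥0∞ := fun n s ω => min (H s ω) (n : ℝ≥0)
  have hHn (n : ℕ) (s : ℝ≥0) : Measurable[Z.filt s] (Hn n s) := (hH s).min measurable_const
  have hHmono (s : ℝ≥0) (ω : Ω) : Monotone fun n => Hn n s ω := fun a b hab =>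
    min_le_min le_rfl (by simpa using hab)
  have hHsup (s : ℝ≥0) (ω : Ω) : ⨆ n, Hn n s ω = H s ω := by
    simp only [Hn]
    rw [← inf_iSup_eq]
    simp [ENNReal.iSup_natCast]
  have hHnc (n : ℕ) : ∀ᵐ ω ∂(Z.P x), ∀ s ∈ Ioc 0 (T n),
      Tendsto (fun r => Hn n r ω) (𝓝[<] s) (𝓝 (Hn n s ω)) := by
    filter_upwards [hHc] with ω hω s hs
    exact (hω s ⟨hs.1, hs.2.trans_lt (hT n).2⟩).min tendsto_const_nhds
  have hfinn (n : ℕ) : ∫⁻ ω, jumpOn Z f (Ioc 0 (T n)) ω ∂(Z.P x) ≠ ∞ :=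
    ne_top_of_le_ne_top hfin (lintegral_mono fun ω =>
      jumpOn_mono_set Z (Ioc_subset_Ioc le_rfl (hT n).2.le) f ω)
  have hIm : Monotone fun n => Ioc 0 (T n) := fun a b hab =>
    Ioc_subset_Ioc le_rfl (hTm.monotone hab)
  have hIU : ⋃ n, Ioc 0 (T n) = Ioo 0 t := by
    ext s
    simp only [mem_iUnion, mem_Ioc, mem_Ioo]
    constructor
    · rintro ⟨n, h1, h2⟩
      exact ⟨h1, h2.trans_lt (hT n).2⟩
    · rintro ⟨h1, h2⟩
      obtain ⟨n, hn⟩ := (hTt.eventually (lt_mem_nhds h2)).exists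
      exact ⟨n, h1, hn.le⟩
  have hstep (n : ℕ) := lintegral_wJump_mul hD hf hf0 x (hT n).1 (hT n).2 (hfinn n) (hHn n)
    (K := n) (fun s ω => min_le_right _ _) (hHnc n) hg hg1 hφ
  have hgm : Measurable fun ω => extendZero g (Z.X t ω) :=
    (measurable_extendZero hg).comp (measurable_X Z t)
  have e1 : ∫⁻ ω, wJump Z H f (Ioo 0 t) ω * extendZero g (Z.X t ω) ∂(Z.P x) =
      ⨆ n, ∫⁻ ω, wJump Z (Hn n) f (Ioc 0 (T n)) ω * extendZero g (Z.X t ω) ∂(Z.P x) := by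
    rw [← lintegral_iSup' (fun n => by
        exact (aemeasurable_wJump hD hf hf0 x (hT n).1 (hfinn n)
          (fun s => (hHn n s).mono (Z.filt.le _) le_rfl) (K := n) (fun s ω => min_le_right _ _)
          (hHnc n)).mul hgm.aemeasurable)
      (Eventually.of_forall fun ω a b hab => by
        exact mul_le_mul_left (wJump_mono f (hIm hab) fun s => hHmono s ω hab) _)]
    refine lintegral_congr fun ω => ?_
    rw [← ENNReal.iSup_mul, wJump_iSup hHmono f hIm ω, hIU]
    simp only [hHsup]
  rw [e1, iSup_congr hstep]
  have hrm := measurable_extendZero_param (measurable_jumpRate_param hD hf hg t)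
  have hHnm (n : ℕ) : Measurable fun q : ℝ × Ω => Hn n q.1.toNNReal q.2 :=
    (hHm.comp (by fun_prop : Measurable fun q : ℝ × Ω => (q.1.toNNReal, q.2))).min measurable_const
  have hXm : Measurable fun q : ℝ × Ω => (q.1, Z.X q.1.toNNReal q.2) :=
    measurable_fst.prodMk ((measurable_uncurry_X Z).comp
      (by fun_prop : Measurable fun q : ℝ × Ω => (q.1.toNNReal, q.2)))
  have hjm (n : ℕ) : Measurable fun s : ℝ => ∫⁻ ω, Hn n s.toNNReal ω * extendZero (jumpRate m j
        (fun w y => f w y * ∫⁻ z, pk (t - s) y z * g z ∂m)) (Z.X s.toNNReal ω) ∂(Z.P x) := by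
    have h : Measurable fun q : ℝ × Ω => Hn n q.1.toNNReal q.2 * extendZero (jumpRate m j
        (fun w y => f w y * ∫⁻ z, pk (t - q.1) y z * g z ∂m)) (Z.X q.1.toNNReal q.2) :=
      (hHnm n).mul (hrm.comp hXm)
    exact h.lintegral_prod_right'
  have hmem (n : ℕ) (s : ℝ) : s ∈ Ioc (0 : ℝ) (T n) ↔ s.toNNReal ∈ Ioc 0 (T n) := by
    rw [mem_Ioc, mem_Ioc, Real.toNNReal_pos, Real.toNNReal_le_iff_le_coe]
  simp only [← lintegral_indicator measurableSet_Ioc, ← lintegral_indicator measurableSet_Ioo]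
  rw [← lintegral_iSup (fun n => (hjm n).indicator measurableSet_Ioc)]
  · refine lintegral_congr fun s => ?_
    have hs : s ∈ Ioo (0 : ℝ) t ↔ ∃ n, s ∈ Ioc (0 : ℝ) (T n) := by
      simp only [hmem, ← mem_iUnion, hIU]
      rw [mem_Ioo, mem_Ioo, Real.toNNReal_pos]
      refine and_congr_right fun h => ?_
      rw [Real.toNNReal_lt_iff_lt_coe h.le]
    by_cases h : s ∈ Ioo (0 : ℝ) t
    · rw [indicator_of_mem h]
      obtain ⟨n₀, hn₀⟩ := hs.1 h
      have hev : ∀ n, n₀ ≤ n → s ∈ Ioc (0 : ℝ) (T n) := fun n hn =>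
        ⟨hn₀.1, hn₀.2.trans (by exact_mod_cast hTm.monotone hn)⟩
      have hmono : Monotone fun n => ∫⁻ ω, Hn n s.toNNReal ω * extendZero (jumpRate m j
          (fun w y => f w y * ∫⁻ z, pk (t - s) y z * g z ∂m)) (Z.X s.toNNReal ω) ∂(Z.P x) :=
        fun a b hab => lintegral_mono fun ω => mul_le_mul_left (hHmono _ ω hab) _
      trans ⨆ n, ∫⁻ ω, Hn n s.toNNReal ω * extendZero (jumpRate m j
          (fun w y => f w y * ∫⁻ z, pk (t - s) y z * g z ∂m)) (Z.X s.toNNReal ω) ∂(Z.P x)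
      · refine le_antisymm (iSup_mono fun n => indicator_le_self _ _ _) (iSup_le fun n => ?_)
        refine le_iSup_of_le (max n₀ n) ?_
        rw [indicator_of_mem (hev _ (le_max_left _ _))]
        exact hmono (le_max_right _ _)
      · rw [← lintegral_iSup (fun n => ?_) fun a b hab ω => ?_]
        · simp only [← ENNReal.iSup_mul, hHsup]
        · exact ((hHn n _).mono (Z.filt.le _) le_rfl).mul ((measurable_extendZero
            ((measurable_jumpRate_param hD hf hg t).comp measurable_prodMk_left)).comp
            (measurable_X Z _))
        · exact mul_le_mul_left (hHmono _ ω hab) _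
    · rw [indicator_of_notMem h]
      refine ENNReal.iSup_eq_zero.2 fun n => indicator_of_notMem (fun h' => h (hs.2 ⟨n, h'⟩)) _
  · intro a b hab s
    refine (indicator_le_indicator_of_subset (Ioc_subset_Ioc le_rfl ?_) (fun _ => zero_le) s).trans
      (indicator_le_indicator ?_)
    · exact_mod_cast hTm.monotone hab
    · exact lintegral_mono fun ω => mul_le_mul_left (hHmono _ ω hab) _

end Step

end

/-! ### Exponentials of jump sums as telescoping sums. -/

section

open ProbabilityTheory

section Order
variable {ι : Type*} [LinearOrder ι]

/-- A product formula for `exp` of a sum of nonnegative terms, truncated at the level `K`. -/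
theorem min_exp_tsum_le (a : ι → ℝ≥0∞) (K : ℝ≥0∞) :
    min (EReal.exp (∑' s, a s : ℝ≥0∞)) K ≤
      1 + ∑' s, min (EReal.exp (∑' r, (Iio s).indicator a r : ℝ≥0∞)) K *
        (EReal.exp (a s) - 1) := by
  classical
  have key (S : Finset ι) : min (EReal.exp (∑ s ∈ S, a s : ℝ≥0∞)) K ≤
      1 + ∑ s ∈ S, min (EReal.exp (∑ r ∈ S.filter (· < s), a r : ℝ≥0∞)) K *
        (EReal.exp (a s) - 1) := by
    -- Adding the latest index leaves the past of all the earlier ones unchanged.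
    induction S using Finset.induction_on_max with
    | empty => simp
    | insert b S hb ih =>
      have hbS : b ∉ S := fun h => lt_irrefl b (hb b h)
      have e1 : (insert b S).filter (· < b) = S := by
        ext r
        simp only [Finset.mem_filter, Finset.mem_insert]
        constructor
        · rintro ⟨rfl | h, h'⟩
          · exact absurd h' (lt_irrefl _)
          · exact h
        · exact fun h => ⟨Or.inr h, hb r h⟩
      have e2 : ∀ s ∈ S, (insert b S).filter (· < s) = S.filter (· < s) := by
        intro s hs
        rw [Finset.filter_insert, if_neg (not_lt.2 (hb s hs).le)]
      have e3 : ∑ s ∈ S, min (EReal.exp (∑ r ∈ (insert b S).filter (· < s), a r : ℝ≥0∞)) K *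
          (EReal.exp (a s) - 1) = ∑ s ∈ S, min (EReal.exp (∑ r ∈ S.filter (· < s), a r : ℝ≥0∞)) K *
          (EReal.exp (a s) - 1) := Finset.sum_congr rfl fun s hs => by rw [e2 s hs]
      rw [Finset.sum_insert hbS, Finset.sum_insert hbS, e1, e3]
      set A : ℝ≥0∞ := ∑ s ∈ S, a s
      have h1 : 1 ≤ EReal.exp (a b) := EReal.one_le_exp_iff.2 (EReal.coe_ennreal_nonneg _)
      -- The truncation survives one factor v = e^{a b} because v ≥ 1: min(uv, K) ≤ min(u, K) v.
      -- This is why the truncated formula is only an inequality.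
      have h2 : min (EReal.exp ((a b + A : ℝ≥0∞) : EReal)) K ≤
          min (EReal.exp A) K * EReal.exp (a b) := by
        rw [EReal.coe_ennreal_add, EReal.exp_add, mul_comm]
        rcases le_total (EReal.exp A) K with h | h
        · rw [min_eq_left h]
          exact min_le_left _ _
        · rw [min_eq_right h]
          exact (min_le_right _ _).trans (le_mul_of_one_le_right' h1)
      calc _ ≤ min (EReal.exp A) K * EReal.exp (a b) := h2
        _ = min (EReal.exp A) K + min (EReal.exp A) K * (EReal.exp (a b) - 1) := by
          conv_lhs => rw [← add_tsub_cancel_of_le h1, mul_add, mul_one]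
        _ ≤ _ := by
          rw [add_left_comm, add_comm (min (EReal.exp A) K)]
          gcongr
  have hlim : Tendsto (fun S : Finset ι => min (EReal.exp (∑ s ∈ S, a s : ℝ≥0∞)) K) atTop
      (𝓝 (min (EReal.exp (∑' s, a s : ℝ≥0∞)) K)) := by
    refine Tendsto.min ?_ tendsto_const_nhds
    have h1 : HasSum a (∑' s, a s) := ENNReal.summable.hasSum
    exact (ENNReal.continuous_exp.tendsto _).comp
      ((continuous_coe_ennreal_ereal.tendsto _).comp h1)
  refine le_of_tendsto hlim (Eventually.of_forall fun S => (key S).trans ?_)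
  gcongr
  refine (Finset.sum_le_sum fun s _ => ?_).trans (ENNReal.sum_le_tsum S)
  refine mul_le_mul_left (min_le_min (EReal.exp_monotone
    (EReal.coe_ennreal_le_coe_ennreal_iff.2 ?_)) le_rfl) _
  rw [Finset.sum_filter]
  refine le_trans (le_of_eq ?_) (ENNReal.sum_le_tsum S)
  exact Finset.sum_congr rfl fun r _ => by simp [indicator]

theorem abs_exp_neg_sub_one_le (x : ℝ) : |Real.exp (-x) - 1| ≤ |x| * Real.exp |x| := by
  rcases le_total 0 x with h | h
  · have h1 : Real.exp (-x) ≤ 1 := Real.exp_le_one_iff.2 (by linarith)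
    rw [abs_of_nonpos (by linarith), abs_of_nonneg h]
    have h2 := Real.add_one_le_exp (-x)
    have h3 := Real.one_le_exp h
    nlinarith
  · have h1 : 1 ≤ Real.exp (-x) := Real.one_le_exp (by linarith)
    rw [abs_of_nonneg (by linarith), abs_of_nonpos h]
    have h2 := Real.add_one_le_exp x
    have h3 := Real.exp_pos (-x)
    have h4 : Real.exp (-x) * Real.exp x = 1 := by rw [← Real.exp_add]; simp
    nlinarith

/-- On a finite set, adding the largest index multiplies the exponential by one factor, so the
finite formula telescopes. The limit over finite sets is dominated by |x s| e^{2M} with M = Σ|x|. -/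
theorem exp_neg_tsum {x : ι → ℝ} (hx : Summable x) :
    (Summable fun s => Real.exp (-∑' r, (Iio s).indicator x r) * (Real.exp (-x s) - 1)) ∧
    Real.exp (-∑' s, x s) =
      1 + ∑' s, Real.exp (-∑' r, (Iio s).indicator x r) * (Real.exp (-x s) - 1) := by
  classical
  have hxa : Summable fun s => |x s| := hx.abs
  set M := ∑' s, |x s|
  have hpart (S : Finset ι) : -∑ r ∈ S, x r ≤ M := by
    calc -∑ r ∈ S, x r ≤ |∑ r ∈ S, x r| := neg_le_abs _
      _ ≤ ∑ r ∈ S, |x r| := Finset.abs_sum_le_sum_abs _ _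
      _ ≤ M := hxa.sum_le_tsum S fun _ _ => abs_nonneg _
  have hxM (s : ι) : |x s| ≤ M := hxa.le_tsum s fun _ _ => abs_nonneg _
  have hbound : Summable fun s => Real.exp M * (|x s| * Real.exp M) :=
    (hxa.mul_right _).mul_left _
  have hle (c : ℝ) (s : ι) (hc : c ≤ M) :
      ‖Real.exp c * (Real.exp (-x s) - 1)‖ ≤ Real.exp M * (|x s| * Real.exp M) := by
    rw [norm_mul, Real.norm_eq_abs, Real.norm_eq_abs, abs_of_pos (Real.exp_pos _)]
    refine mul_le_mul (Real.exp_le_exp.2 hc) ((abs_exp_neg_sub_one_le _).trans ?_)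
      (abs_nonneg _) (Real.exp_pos _).le
    gcongr
    exact hxM s
  have hfin (s : ι) : Tendsto (fun S : Finset ι => ∑ r ∈ S.filter (· < s), x r) atTop
      (𝓝 (∑' r, (Iio s).indicator x r)) := by
    have h : HasSum ((Iio s).indicator x) (∑' r, (Iio s).indicator x r) :=
      (hx.indicator (Iio s)).hasSum
    refine Tendsto.congr (fun S => ?_) h
    rw [Finset.sum_filter]
    exact Finset.sum_congr rfl fun r _ => by simp [indicator]
  have key (S : Finset ι) : Real.exp (-∑ s ∈ S, x s) =
      1 + ∑ s ∈ S, Real.exp (-∑ r ∈ S.filter (· < s), x r) * (Real.exp (-x s) - 1) := by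
    induction S using Finset.induction_on_max with
    | empty => simp
    | insert b S hb ih =>
      have hbS : b ∉ S := fun h => lt_irrefl b (hb b h)
      have e1 : (insert b S).filter (· < b) = S := by
        ext r
        simp only [Finset.mem_filter, Finset.mem_insert]
        constructor
        · rintro ⟨rfl | h, h'⟩
          · exact absurd h' (lt_irrefl _)
          · exact h
        · exact fun h => ⟨Or.inr h, hb r h⟩
      have e2 : ∀ s ∈ S, (insert b S).filter (· < s) = S.filter (· < s) := by
        intro s hs
        rw [Finset.filter_insert, if_neg (not_lt.2 (hb s hs).le)]
      have e3 : ∑ s ∈ S, Real.exp (-∑ r ∈ (insert b S).filter (· < s), x r) *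
          (Real.exp (-x s) - 1) = ∑ s ∈ S, Real.exp (-∑ r ∈ S.filter (· < s), x r) *
          (Real.exp (-x s) - 1) := Finset.sum_congr rfl fun s hs => by rw [e2 s hs]
      rw [Finset.sum_insert hbS, Finset.sum_insert hbS, e1, e3, neg_add, Real.exp_add]
      linarith
  have hs1 : Summable fun s => Real.exp (-∑' r, (Iio s).indicator x r) * (Real.exp (-x s) - 1) := by
    refine Summable.of_norm_bounded hbound fun s => hle _ s ?_
    exact le_of_tendsto (hfin s).neg (Eventually.of_forall fun S => hpart _)
  refine ⟨hs1, ?_⟩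
  have l1 : Tendsto (fun S : Finset ι => Real.exp (-∑ s ∈ S, x s)) atTop
      (𝓝 (Real.exp (-∑' s, x s))) :=
    (Real.continuous_exp.tendsto _).comp (Tendsto.neg hx.hasSum)
  have l2 := tendsto_tsum_of_dominated_convergence (𝓕 := (atTop : Filter (Finset ι)))
    (f := fun S s => if s ∈ S then
      Real.exp (-∑ r ∈ S.filter (· < s), x r) * (Real.exp (-x s) - 1) else 0)
    (g := fun s => Real.exp (-∑' r, (Iio s).indicator x r) * (Real.exp (-x s) - 1)) hbound
    (fun s => by
      refine Tendsto.congr' ?_ (((Real.continuous_exp.tendsto _).comp (hfin s).neg).mul_const _)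
      filter_upwards [eventually_ge_atTop {s}] with S hS
      rw [if_pos (hS (Finset.mem_singleton_self s))]
      rfl)
    (Eventually.of_forall fun S s => by
      split_ifs
      · exact hle _ s (hpart _)
      · rw [norm_zero]; positivity)
  refine tendsto_nhds_unique l1 ((l2.const_add 1).congr fun S => ?_)
  rw [key S, tsum_eq_sum (s := S) fun s hs => if_neg hs]
  congr 1
  exact Finset.sum_congr rfl fun s hs => if_pos hs

/-- With e^{-x} - 1 = a - b, moving b to the other side turns the signed formula into an identity of
nonnegative terms, the form that can be integrated without further conditions. -/
theorem ofReal_exp_neg_tsum {x : ι → ℝ} (hx : Summable x) {a b : ι → ℝ≥0∞} (ha : ∑' s, a s ≠ ∞)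
    (hb : ∑' s, b s ≠ ∞) (hab : ∀ s, (a s).toReal - (b s).toReal = Real.exp (-x s) - 1) :
    ENNReal.ofReal (Real.exp (-∑' s, x s)) +
        ∑' s, ENNReal.ofReal (Real.exp (-∑' r, (Iio s).indicator x r)) * b s =
      1 + ∑' s, ENNReal.ofReal (Real.exp (-∑' r, (Iio s).indicator x r)) * a s := by
  obtain ⟨hs, he⟩ := exp_neg_tsum hx
  set h : ι → ℝ := fun s => Real.exp (-∑' r, (Iio s).indicator x r) with hh
  have hbd (s : ι) : h s ≤ Real.exp (∑' s, |x s|) := by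
    refine Real.exp_le_exp.2 ?_
    have h1 : Summable fun r => |(Iio s).indicator x r| := (hx.indicator (Iio s)).abs
    calc _ ≤ |∑' r, (Iio s).indicator x r| := neg_le_abs _
      _ ≤ ∑' r, |(Iio s).indicator x r| := by
        simpa [Real.norm_eq_abs] using norm_tsum_le_tsum_norm (f := (Iio s).indicator x)
          (by simpa [Real.norm_eq_abs] using h1)
      _ ≤ _ := by
        refine h1.tsum_le_tsum (fun r => ?_) hx.abs
        by_cases hr : r ∈ Iio s
        · rw [indicator_of_mem hr]
        · rw [indicator_of_notMem hr, abs_zero]; positivity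
  have hsum {a : ι → ℝ≥0∞} (ha : ∑' s, a s ≠ ∞) : Summable fun s => h s * (a s).toReal := by
    refine Summable.of_nonneg_of_le (fun s => by positivity) (fun s =>
      mul_le_mul_of_nonneg_right (hbd s) ENNReal.toReal_nonneg)
      ((ENNReal.summable_toReal ha).mul_left _)
  have hconv {a : ι → ℝ≥0∞} (ha : ∑' s, a s ≠ ∞) : ∑' s, ENNReal.ofReal (h s) * a s =
      ENNReal.ofReal (∑' s, h s * (a s).toReal) := by
    rw [ENNReal.ofReal_tsum_of_nonneg (fun s => by positivity) (hsum ha)]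
    refine tsum_congr fun s => ?_
    rw [ENNReal.ofReal_mul (by positivity), ENNReal.ofReal_toReal (ENNReal.ne_top_of_tsum_ne_top ha s)]
  have e1 : ∑' s, h s * (Real.exp (-x s) - 1) =
      ∑' s, h s * (a s).toReal - ∑' s, h s * (b s).toReal := by
    rw [← (hsum ha).tsum_sub (hsum hb)]
    exact tsum_congr fun s => by rw [← hab s, mul_sub]
  have p1 : 0 ≤ ∑' s, h s * (a s).toReal := tsum_nonneg fun s => by positivity
  have p2 : 0 ≤ ∑' s, h s * (b s).toReal := tsum_nonneg fun s => by positivity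
  rw [hconv ha, hconv hb, ← ENNReal.ofReal_add (by positivity) p2, ← ENNReal.ofReal_one,
    ← ENNReal.ofReal_add zero_le_one p1, he, e1]
  congr 1
  ring

end Order

variable {d : ℕ} {Ω : Type*} [mΩ : MeasurableSpace Ω] {Z : HuntProcess (Eu d) Ω}
  {m : Measure (Eu d)} [SFinite m] {pk : ℝ → Eu d → Eu d → ℝ≥0∞} {j : Eu d → Eu d → ℝ≥0∞}

/-- The strict past matters: including the jump at s would destroy left-continuity, which the
compensation formula requires of its weights. -/
theorem tendsto_jumpOn_Ioo (f : Eu d → Eu d → ℝ≥0∞) (ω : Ω) {s : ℝ≥0} (hs : 0 < s) :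
    Tendsto (fun r => jumpOn Z f (Ioo 0 r) ω) (𝓝[<] s) (𝓝 (jumpOn Z f (Ioo 0 s) ω)) := by
  have hmono : Monotone fun r => jumpOn Z f (Ioo 0 r) ω := fun a b hab =>
    jumpOn_mono_set Z (Ioo_subset_Ioo le_rfl hab) f ω
  have : (𝓝[<] s).NeBot := nhdsLT_neBot_of_exists_lt ⟨0, hs⟩
  convert hmono.tendsto_nhdsLT s using 2
  obtain ⟨T, hTm, hT, hTt⟩ := exists_seq_strictMono_tendsto' hs
  have hU : Ioo 0 s = ⋃ n, Ioo 0 (T n) := by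
    ext u
    simp only [mem_iUnion, mem_Ioo]
    constructor
    · rintro ⟨h1, h2⟩
      obtain ⟨n, hn⟩ := (hTt.eventually (lt_mem_nhds h2)).exists
      exact ⟨n, h1, hn⟩
    · rintro ⟨n, h1, h2⟩
      exact ⟨h1, h2.trans (hT n).2⟩
  refine le_antisymm ?_ (sSup_le ?_)
  · rw [hU, jumpOn_iSup_set Z (fun a b hab => Ioo_subset_Ioo le_rfl (hTm.monotone hab))]
    exact iSup_le fun n => le_sSup ⟨T n, (hT n).2, rfl⟩
  · rintro _ ⟨r, hr, rfl⟩
    exact hmono (le_of_lt hr)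

/-- A supremum over countably many times gives adaptedness at each s and joint measurability in (s,
ω) at once. -/
theorem jumpOn_Ioo_eq_iSup (f : Eu d → Eu d → ℝ≥0∞) (s : ℝ≥0) (ω : Ω) :
    jumpOn Z f (Ioo 0 s) ω = ⨆ n, if TopologicalSpace.denseSeq ℝ≥0 n < s then
      jumpOn Z f (Ioc 0 (TopologicalSpace.denseSeq ℝ≥0 n)) ω else 0 := by
  refine le_antisymm ?_ (iSup_le fun n => ?_)
  · rcases eq_or_lt_of_le (zero_le (a := s)) with rfl | hs
    · simp [jumpOn]
    · have : (𝓝[<] s).NeBot := nhdsLT_neBot_of_exists_lt ⟨0, hs⟩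
      refine le_of_tendsto (tendsto_jumpOn_Ioo f ω hs) ?_
      filter_upwards [self_mem_nhdsWithin] with r hr
      obtain ⟨n, hn⟩ := (TopologicalSpace.denseRange_denseSeq ℝ≥0).exists_mem_open (isOpen_Ioo (a := r) (b := s))
        (nonempty_Ioo.2 hr)
      refine le_iSup_of_le n ?_
      rw [if_pos hn.2]
      exact jumpOn_mono_set Z (Ioo_subset_Ioc_self.trans (Ioc_subset_Ioc le_rfl hn.1.le)) f ω
  · split_ifs with h
    · exact jumpOn_mono_set Z (Ioc_subset_Ioo_right h) f ω
    · exact zero_le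

theorem jumpAt_comp {R R' : Type*} [Zero R] [Zero R'] (φ : R → R') (hφ : φ 0 = 0)
    (f : Eu d → Eu d → R) (ω : Ω) (s : ℝ≥0) :
    jumpAt Z (fun w y => φ (f w y)) ω s = φ (jumpAt Z f ω s) := by
  unfold jumpAt
  generalize Function.leftLim (fun u => Z.X u ω) s = x
  generalize Z.X s ω = y
  induction x using OnePoint.rec with
  | infty => simp [hφ]
  | coe x => induction y using OnePoint.rec <;> simp [hφ]

theorem indicator_Iio_Ioo {R : Type*} [Zero R] (x : ℝ≥0 → R) {s t : ℝ≥0} (hs : s ≤ t) :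
    (Iio s).indicator ((Ioo 0 t).indicator x) = (Ioo 0 s).indicator x := by
  rw [indicator_indicator]
  congr 1
  ext u
  exact ⟨fun h => ⟨h.2.1, h.1⟩, fun h => ⟨h.2, h.1, h.2.trans_le hs⟩⟩

theorem min_exp_jumpOn_le (G : Eu d → Eu d → ℝ≥0∞) (K : ℝ≥0∞) (t : ℝ≥0) (ω : Ω) :
    min (EReal.exp (jumpOn Z G (Ioo 0 t) ω)) K ≤
      1 + wJump Z (fun s ω => min (EReal.exp (jumpOn Z G (Ioo 0 s) ω)) K)
        (fun w y => EReal.exp (G w y) - 1) (Ioo 0 t) ω := by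
  refine (min_exp_tsum_le _ K).trans (le_of_eq ?_)
  unfold wJump
  congr 1
  refine tsum_congr fun s => ?_
  by_cases hs : s ∈ Ioo 0 t
  · rw [indicator_of_mem hs, indicator_of_mem hs, indicator_Iio_Ioo _ hs.2.le,
      jumpAt_comp (fun u : ℝ≥0∞ => EReal.exp u - 1) (by simp)]
    rfl
  · rw [indicator_of_notMem hs, indicator_of_notMem hs]
    simp

/-- The weight `exp (-∑ F)`, where the sum runs over the jumps strictly before `s`. -/
noncomputable def expWeight (Z : HuntProcess (Eu d) Ω) (F : Eu d → Eu d → ℝ) (s : ℝ≥0) (ω : Ω) :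
    ℝ≥0∞ :=
  ENNReal.ofReal (Real.exp ((jumpOn Z (fun w y => ENNReal.ofReal (-F w y)) (Ioo 0 s) ω).toReal -
    (jumpOn Z (fun w y => ENNReal.ofReal (F w y)) (Ioo 0 s) ω).toReal))

theorem summable_of_tsum_ofReal_abs {ι : Type*} {x : ι → ℝ}
    (hx : ∑' s, ENNReal.ofReal |x s| ≠ ∞) : Summable x := by
  have := ENNReal.summable_toReal hx
  simp only [ENNReal.toReal_ofReal (abs_nonneg _)] at this
  exact this.of_abs

theorem tsum_eq_toReal_sub {ι : Type*} {x : ι → ℝ} (hx : ∑' s, ENNReal.ofReal |x s| ≠ ∞) :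
    ∑' s, x s = (∑' s, ENNReal.ofReal (x s)).toReal - (∑' s, ENNReal.ofReal (-x s)).toReal := by
  have h1 : ∑' s, ENNReal.ofReal (x s) ≠ ∞ := ne_top_of_le_ne_top hx
    (ENNReal.tsum_le_tsum fun s => ENNReal.ofReal_le_ofReal (le_abs_self _))
  have h2 : ∑' s, ENNReal.ofReal (-x s) ≠ ∞ := ne_top_of_le_ne_top hx
    (ENNReal.tsum_le_tsum fun s => ENNReal.ofReal_le_ofReal (neg_le_abs _))
  rw [ENNReal.tsum_toReal_eq (ENNReal.ne_top_of_tsum_ne_top h1),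
    ENNReal.tsum_toReal_eq (ENNReal.ne_top_of_tsum_ne_top h2),
    ← (ENNReal.summable_toReal h1).tsum_sub (ENNReal.summable_toReal h2)]
  refine tsum_congr fun s => ?_
  rw [ENNReal.toReal_ofReal', ENNReal.toReal_ofReal']
  rcases le_total 0 (x s) with h | h
  · rw [max_eq_left h, max_eq_right (by linarith), sub_zero]
  · rw [max_eq_right h, max_eq_left (by linarith)]; ring

theorem jumpOn_ofReal {F : Eu d → Eu d → ℝ} {φ : ℝ → ℝ} (hφ : φ 0 = 0) (I : Set ℝ≥0) (ω : Ω) :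
    jumpOn Z (fun w y => ENNReal.ofReal (φ (F w y))) I ω =
      ∑' s, ENNReal.ofReal (φ (I.indicator (jumpAt Z F ω) s)) := by
  unfold jumpOn
  refine tsum_congr fun s => ?_
  by_cases hs : s ∈ I
  · rw [indicator_of_mem hs, indicator_of_mem hs,
      jumpAt_comp (fun u : ℝ => ENNReal.ofReal (φ u)) (by simp [hφ])]
  · rw [indicator_of_notMem hs, indicator_of_notMem hs]
    simp [hφ]

/-- The weight is built from two separate values of `toReal`, so it is the intended exponential only
where Σ|F| is finite. -/
theorem expWeight_eq {F : Eu d → Eu d → ℝ} {s : ℝ≥0} {ω : Ω}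
    (h : jumpOn Z (fun w y => ENNReal.ofReal |F w y|) (Ioo 0 s) ω ≠ ∞) :
    expWeight Z F s ω =
      ENNReal.ofReal (Real.exp (-∑' r, (Ioo 0 s).indicator (jumpAt Z F ω) r)) := by
  rw [jumpOn_ofReal (φ := fun u => |u|) abs_zero] at h
  rw [expWeight, jumpOn_ofReal (φ := fun u => -u) neg_zero, jumpOn_ofReal (φ := fun u => u) rfl,
    tsum_eq_toReal_sub h, neg_sub]

theorem expWeight_add_wJump {F : Eu d → Eu d → ℝ} {t : ℝ≥0} {ω : Ω}
    (h : jumpOn Z (fun w y => ENNReal.ofReal |F w y|) (Ioo 0 t) ω ≠ ∞)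
    {a b : Eu d → Eu d → ℝ≥0∞} (ha : jumpOn Z a (Ioo 0 t) ω ≠ ∞) (hb : jumpOn Z b (Ioo 0 t) ω ≠ ∞)
    (hab : ∀ w y, (a w y).toReal - (b w y).toReal = Real.exp (-F w y) - 1) :
    expWeight Z F t ω + wJump Z (expWeight Z F) b (Ioo 0 t) ω =
      1 + wJump Z (expWeight Z F) a (Ioo 0 t) ω := by
  have hx : Summable ((Ioo 0 t).indicator (jumpAt Z F ω)) := by
    rw [jumpOn_ofReal (φ := fun u => |u|) abs_zero] at h
    exact summable_of_tsum_ofReal_abs h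
  have habs (s : ℝ≥0) : ((Ioo 0 t).indicator (jumpAt Z a ω) s).toReal -
      ((Ioo 0 t).indicator (jumpAt Z b ω) s).toReal =
      Real.exp (-(Ioo 0 t).indicator (jumpAt Z F ω) s) - 1 := by
    by_cases hs : s ∈ Ioo 0 t
    · simp only [indicator_of_mem hs]
      unfold jumpAt
      generalize Function.leftLim (fun u => Z.X u ω) s = x
      generalize Z.X s ω = y
      induction x using OnePoint.rec with
      | infty => simp
      | coe x => induction y using OnePoint.rec <;> simp [hab]
    · simp [indicator_of_notMem hs]
  have key := ofReal_exp_neg_tsum hx ha hb habs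
  have hw (f : Eu d → Eu d → ℝ≥0∞) : wJump Z (expWeight Z F) f (Ioo 0 t) ω =
      ∑' s, ENNReal.ofReal (Real.exp (-∑' r, (Iio s).indicator
        ((Ioo 0 t).indicator (jumpAt Z F ω)) r)) * (Ioo 0 t).indicator (jumpAt Z f ω) s := by
    refine tsum_congr fun s => ?_
    by_cases hs : s ∈ Ioo 0 t
    · rw [indicator_Iio_Ioo _ hs.2.le, expWeight_eq]
      exact ne_top_of_le_ne_top h (jumpOn_mono_set Z (Ioo_subset_Ioo le_rfl hs.2.le) _ ω)
    · rw [indicator_of_notMem hs]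
      simp
  rw [hw, hw, expWeight_eq h]
  exact key

theorem tendsto_expWeight {F : Eu d → Eu d → ℝ} {s : ℝ≥0} {ω : Ω} (hs : 0 < s)
    (h : jumpOn Z (fun w y => ENNReal.ofReal |F w y|) (Ioo 0 s) ω ≠ ∞) :
    Tendsto (fun r => expWeight Z F r ω) (𝓝[<] s) (𝓝 (expWeight Z F s ω)) := by
  have h1 := (ENNReal.tendsto_toReal (ne_top_of_le_ne_top h (jumpOn_mono Z (fun w y =>
    ENNReal.ofReal_le_ofReal (neg_le_abs (F w y))) _ ω))).comp (tendsto_jumpOn_Ioo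
      (fun w y => ENNReal.ofReal (-F w y)) ω hs)
  have h2 := (ENNReal.tendsto_toReal (ne_top_of_le_ne_top h (jumpOn_mono Z (fun w y =>
    ENNReal.ofReal_le_ofReal (le_abs_self (F w y))) _ ω))).comp (tendsto_jumpOn_Ioo
      (fun w y => ENNReal.ofReal (F w y)) ω hs)
  exact (ENNReal.continuous_ofReal.tendsto _).comp ((Real.continuous_exp.tendsto _).comp
    (h1.sub h2))

/-- This holds on every path: where Σ|F| is infinite the right side is infinite, whatever value the
left side takes by default. -/
theorem expWeight_le (F : Eu d → Eu d → ℝ) (s : ℝ≥0) (ω : Ω) :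
    expWeight Z F s ω ≤
      EReal.exp (jumpOn Z (fun w y => ENNReal.ofReal |F w y|) (Ioo 0 s) ω) := by
  by_cases h : jumpOn Z (fun w y => ENNReal.ofReal |F w y|) (Ioo 0 s) ω = ∞
  · rw [h]
    simp
  · have h1 := ENNReal.toReal_mono h (jumpOn_mono Z (fun w y =>
      ENNReal.ofReal_le_ofReal (neg_le_abs (F w y))) (Ioo 0 s) ω)
    rw [← ENNReal.ofReal_toReal h, EReal.coe_ennreal_ofReal, max_eq_left ENNReal.toReal_nonneg,
      EReal.exp_coe]
    refine ENNReal.ofReal_le_ofReal (Real.exp_le_exp.2 ?_)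
    have h2 : 0 ≤ (jumpOn Z (fun w y => ENNReal.ofReal (F w y)) (Ioo 0 s) ω).toReal :=
      ENNReal.toReal_nonneg
    linarith

section Meas
variable (hD : LevyData Z m pk j)
include hD

theorem measurable_jumpOn_Ioo {f : Eu d → Eu d → ℝ≥0∞} (hf : Measurable (Function.uncurry f))
    (hf0 : ∀ x, f x x = 0) (s : ℝ≥0) : Measurable[Z.filt s] (jumpOn Z f (Ioo 0 s)) := by
  rw [funext (jumpOn_Ioo_eq_iSup f s)]
  refine Measurable.iSup fun n => ?_
  split_ifs with h
  · rcases eq_or_lt_of_le (zero_le (a := TopologicalSpace.denseSeq ℝ≥0 n)) with h0 | h0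
    · rw [← h0]
      simp [jumpOn]
    · exact (measurable_jumpOn hD hf hf0 h0).mono (Z.filt.mono h.le) le_rfl
  · exact measurable_const

theorem measurable_uncurry_jumpOn_Ioo {f : Eu d → Eu d → ℝ≥0∞}
    (hf : Measurable (Function.uncurry f)) (hf0 : ∀ x, f x x = 0) :
    Measurable fun q : ℝ≥0 × Ω => jumpOn Z f (Ioo 0 q.1) q.2 := by
  simp only [jumpOn_Ioo_eq_iSup f]
  refine Measurable.iSup fun n => Measurable.ite (measurableSet_lt measurable_const measurable_fst)
    ?_ measurable_const
  rcases eq_or_lt_of_le (zero_le (a := TopologicalSpace.denseSeq ℝ≥0 n)) with h0 | h0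
  · rw [← h0]
    simp [jumpOn]
  · exact ((measurable_jumpOn hD hf hf0 h0).mono (Z.filt.le _) le_rfl).comp measurable_snd

theorem measurable_expWeight {F : Eu d → Eu d → ℝ} (hF : Measurable (Function.uncurry F))
    (hF0 : ∀ x, F x x = 0) (s : ℝ≥0) : Measurable[Z.filt s] (expWeight Z F s) :=
  ENNReal.measurable_ofReal.comp (Real.measurable_exp.comp
    ((ENNReal.measurable_toReal.comp (measurable_jumpOn_Ioo hD
      (by exact ENNReal.measurable_ofReal.comp hF.neg) (by simp [hF0]) s)).sub
    (ENNReal.measurable_toReal.comp (measurable_jumpOn_Ioo hD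
      (by exact ENNReal.measurable_ofReal.comp hF) (by simp [hF0]) s))))

theorem measurable_uncurry_expWeight {F : Eu d → Eu d → ℝ} (hF : Measurable (Function.uncurry F))
    (hF0 : ∀ x, F x x = 0) : Measurable (Function.uncurry (expWeight Z F)) :=
  ENNReal.measurable_ofReal.comp (Real.measurable_exp.comp
    ((ENNReal.measurable_toReal.comp (measurable_uncurry_jumpOn_Ioo hD
      (by exact ENNReal.measurable_ofReal.comp hF.neg) (by simp [hF0]))).sub
    (ENNReal.measurable_toReal.comp (measurable_uncurry_jumpOn_Ioo hD
      (by exact ENNReal.measurable_ofReal.comp hF) (by simp [hF0])))))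

end Meas

end

/-! ### Forward equations for the weights, and rows as kernels. -/

section

open ProbabilityTheory

variable {d : ℕ} {Ω : Type*} [mΩ : MeasurableSpace Ω] {Z : HuntProcess (Eu d) Ω}
  {m : Measure (Eu d)} [SFinite m] {pk : ℝ → Eu d → Eu d → ℝ≥0∞} {j : Eu d → Eu d → ℝ≥0∞}

/-- The function `exp |F| - 1`. -/
noncomputable def expAbs (F : Eu d → Eu d → ℝ) (w y : Eu d) : ℝ≥0∞ :=
  ENNReal.ofReal (Real.exp |F w y| - 1)

theorem measurable_expAbs {F : Eu d → Eu d → ℝ} (hF : Measurable (Function.uncurry F)) :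
    Measurable (Function.uncurry (expAbs F)) := by
  have h : Measurable fun q : Eu d × Eu d => ENNReal.ofReal (Real.exp |Function.uncurry F q| - 1) := by
    fun_prop
  exact h

theorem ofReal_abs_le_expAbs (F : Eu d → Eu d → ℝ) (w y : Eu d) :
    ENNReal.ofReal |F w y| ≤ expAbs F w y :=
  ENNReal.ofReal_le_ofReal (by linarith [Real.add_one_le_exp |F w y|])

theorem exp_ofReal_sub_one (F : Eu d → Eu d → ℝ) (w y : Eu d) :
    EReal.exp (ENNReal.ofReal |F w y| : ℝ≥0∞) - 1 = expAbs F w y := by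
  rw [EReal.coe_ennreal_ofReal, max_eq_left (abs_nonneg _), EReal.exp_coe, expAbs,
    ENNReal.ofReal_sub _ zero_le_one, ENNReal.ofReal_one]

/-- Bounded functions of bounded support are mapped to continuous functions. -/
def HasContinuousAction (m : Measure (Eu d)) (pk : ℝ → Eu d → Eu d → ℝ≥0∞) : Prop :=
  ∀ g : Eu d → ℝ≥0∞, Measurable g → (∀ y, g y ≤ 1) → (∃ n : ℕ, ∀ y, (n : ℝ) ≤ ‖y‖ → g y = 0) →
    ContinuousOn (fun q : ℝ × Eu d => ∫⁻ z, pk q.1 q.2 z * g z ∂m) (Ioi 0 ×ˢ univ)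

/-- The truncated exponential of the sum of `|F|` over the jumps before `s`. -/
noncomputable def truncWeight (Z : HuntProcess (Eu d) Ω) (F : Eu d → Eu d → ℝ) (K : ℕ) (s : ℝ≥0)
    (ω : Ω) : ℝ≥0∞ :=
  min (EReal.exp (jumpOn Z (fun w y => ENNReal.ofReal |F w y|) (Ioo 0 s) ω)) (K : ℝ≥0)

section Paths
variable (hD : LevyData Z m pk j) {F : Eu d → Eu d → ℝ} (hF : Measurable (Function.uncurry F))
  (hF0 : ∀ x, F x x = 0)
include hD hF hF0

theorem measurable_truncWeight (K : ℕ) (s : ℝ≥0) : Measurable[Z.filt s] (truncWeight Z F K s) :=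
  Measurable.min (Measurable.ereal_exp (measurable_coe_ennreal_ereal.comp
    (measurable_jumpOn_Ioo hD (by exact ENNReal.measurable_ofReal.comp (hF.norm)) (by simp [hF0]) s)))
    measurable_const

theorem measurable_uncurry_truncWeight (K : ℕ) :
    Measurable (Function.uncurry (truncWeight Z F K)) :=
  Measurable.min (Measurable.ereal_exp (measurable_coe_ennreal_ereal.comp
    (measurable_uncurry_jumpOn_Ioo hD (by exact ENNReal.measurable_ofReal.comp (hF.norm))
      (by simp [hF0])))) measurable_const

variable (hm : HasContinuousAction m pk) (x : Eu d)
  (hfin : ∀ t : ℝ≥0, 0 < t → ∫⁻ ω, jumpOn Z (expAbs F) (Ioc 0 t) ω ∂(Z.P x) ≠ ∞)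
  {t : ℝ≥0} (ht : 0 < t) {g : Eu d → ℝ≥0∞} (hg : Measurable g) (hg1 : ∀ y, g y ≤ 1)
  (hgb : ∃ n : ℕ, ∀ y, (n : ℝ) ≤ ‖y‖ → g y = 0)
include hm hfin ht hg hg1 hgb

/-- Truncation makes the weight bounded, and the price is an inequality in the forward equation. The
compensated integrand is e^{|F|} - 1. -/
theorem lintegral_truncWeight_le (K : ℕ) :
    ∫⁻ ω, truncWeight Z F K t ω * extendZero g (Z.X t ω) ∂(Z.P x) ≤
      ∫⁻ z, pk t x z * g z ∂m +
        ∫⁻ s in Ioo (0 : ℝ) t, ∫⁻ ω, truncWeight Z F K s.toNNReal ω * extendZero (jumpRate m j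
          (fun w y => expAbs F w y * ∫⁻ z, pk (t - s) y z * g z ∂m)) (Z.X s.toNNReal ω) ∂(Z.P x) := by
  have hgm : Measurable fun ω => extendZero g (Z.X t ω) :=
    (measurable_extendZero hg).comp (measurable_X Z t)
  rw [← hD.trans t ht x g hg, ← lintegral_wJump_Ioo hD (measurable_expAbs hF)
    (by simp [expAbs, hF0]) x ht (hfin t ht) (measurable_truncWeight hD hF hF0 K)
    (measurable_uncurry_truncWeight hD hF hF0 K) (Eventually.of_forall fun ω s hs =>
      Tendsto.min ((ENNReal.continuous_exp.tendsto _).comp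
        ((continuous_coe_ennreal_ereal.tendsto _).comp (tendsto_jumpOn_Ioo _ ω hs.1)))
        tendsto_const_nhds) hg hg1 (hm g hg hg1 hgb), ← lintegral_add_left hgm]
  refine lintegral_mono fun ω => ?_
  have h := min_exp_jumpOn_le (Z := Z) (fun w y => ENNReal.ofReal |F w y|) (K : ℝ≥0) t ω
  simp only [exp_ofReal_sub_one] at h
  calc _ ≤ _ := mul_le_mul_left h _
    _ = _ := by rw [add_mul, one_mul]; rfl

/-- The forward equation of e^{-A} with its negative part moved to the left. The finite mean of
Σ(e^{|F|} - 1) makes the path identity and the left-continuity of the weight hold almost surely. -/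
theorem lintegral_expWeight_add {a b : Eu d → Eu d → ℝ≥0∞} (ha : Measurable (Function.uncurry a))
    (hb : Measurable (Function.uncurry b)) (hab : ∀ w y, a w y + b w y = expAbs F w y)
    (hab' : ∀ w y, (a w y).toReal - (b w y).toReal = Real.exp (-F w y) - 1) :
    ∫⁻ ω, expWeight Z F t ω * extendZero g (Z.X t ω) ∂(Z.P x) +
        ∫⁻ s in Ioo (0 : ℝ) t, ∫⁻ ω, expWeight Z F s.toNNReal ω * extendZero (jumpRate m j
          (fun w y => b w y * ∫⁻ z, pk (t - s) y z * g z ∂m)) (Z.X s.toNNReal ω) ∂(Z.P x) =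
      ∫⁻ z, pk t x z * g z ∂m +
        ∫⁻ s in Ioo (0 : ℝ) t, ∫⁻ ω, expWeight Z F s.toNNReal ω * extendZero (jumpRate m j
          (fun w y => a w y * ∫⁻ z, pk (t - s) y z * g z ∂m)) (Z.X s.toNNReal ω) ∂(Z.P x) := by
  have hgm : Measurable fun ω => extendZero g (Z.X t ω) :=
    (measurable_extendZero hg).comp (measurable_X Z t)
  have hale (w y) : a w y ≤ expAbs F w y := hab w y ▸ le_self_add
  have hble (w y) : b w y ≤ expAbs F w y := hab w y ▸ le_add_self
  have hγ0 (w) : expAbs F w w = 0 := by simp [expAbs, hF0]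
  have ha0 (w) : a w w = 0 := le_zero_iff.1 ((hale w w).trans (hγ0 w).le)
  have hb0 (w) : b w w = 0 := le_zero_iff.1 ((hble w w).trans (hγ0 w).le)
  have hjm : Measurable (jumpOn Z (expAbs F) (Ioc 0 t)) :=
    (measurable_jumpOn hD (measurable_expAbs hF) hγ0 ht).mono (Z.filt.le _) le_rfl
  have hae : ∀ᵐ ω ∂(Z.P x), jumpOn Z (expAbs F) (Ioc 0 t) ω < ∞ := ae_lt_top hjm (hfin t ht)
  have hsmall {ω : Ω} (h : jumpOn Z (expAbs F) (Ioc 0 t) ω < ∞) {f : Eu d → Eu d → ℝ≥0∞}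
      (hf : ∀ w y, f w y ≤ expAbs F w y) {s : ℝ≥0} (hs : s ≤ t) : jumpOn Z f (Ioo 0 s) ω ≠ ∞ :=
    ne_top_of_le_ne_top h.ne ((jumpOn_mono Z hf _ ω).trans (jumpOn_mono_set Z
      (Ioo_subset_Ioc_self.trans (Ioc_subset_Ioc le_rfl hs)) _ ω))
  have hcont : ∀ᵐ ω ∂(Z.P x), ∀ s ∈ Ioo 0 t,
      Tendsto (fun r => expWeight Z F r ω) (𝓝[<] s) (𝓝 (expWeight Z F s ω)) := by
    filter_upwards [hae] with ω hω s hs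
    exact tendsto_expWeight hs.1 (hsmall hω (ofReal_abs_le_expAbs F) hs.2.le)
  have hone {f : Eu d → Eu d → ℝ≥0∞} (hf : Measurable (Function.uncurry f))
      (hf' : ∀ w y, f w y ≤ expAbs F w y) (hf0 : ∀ w, f w w = 0) :=
    lintegral_wJump_Ioo hD hf hf0 x ht (ne_top_of_le_ne_top (hfin t ht)
      (lintegral_mono fun ω => jumpOn_mono Z hf' _ ω)) (measurable_expWeight hD hF hF0)
      (measurable_uncurry_expWeight hD hF hF0) hcont hg hg1 (hm g hg hg1 hgb)
  rw [← hD.trans t ht x g hg, ← hone ha hale ha0, ← hone hb hble hb0,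
    ← lintegral_add_left hgm, ← lintegral_add_left (by
      exact ((measurable_expWeight hD hF hF0 t).mono (Z.filt.le _) le_rfl).mul hgm)]
  refine lintegral_congr_ae ?_
  filter_upwards [hae] with ω hω
  have h := expWeight_add_wJump (hsmall hω (ofReal_abs_le_expAbs F) le_rfl)
    (hsmall hω hale le_rfl) (hsmall hω hble le_rfl) hab'
  rw [← add_mul, h, add_mul, one_mul]

end Paths

/-- The kernel `s ↦ E[H s; X s ∈ ·]`. -/
noncomputable def rowKernel (Z : HuntProcess (Eu d) Ω) (x : OnePoint (Eu d))
    (H : ℝ≥0 → Ω → ℝ≥0∞) : Kernel ℝ (Eu d) :=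
  (((Kernel.deterministic (id : ℝ → ℝ) measurable_id ×ₖ Kernel.const ℝ (Z.P x)).withDensity
    fun _ q => H q.1.toNNReal q.2).map fun q : ℝ × Ω => Z.X q.1.toNNReal q.2).comapRight
      (measurableEmbedding_coe (d := d))

/-- A finite weight keeps the row s-finite, as the exchange of integrals in the duality argument
demands. -/
theorem isSFiniteKernel_rowKernel (x : OnePoint (Eu d)) {H : ℝ≥0 → Ω → ℝ≥0∞}
    (hH : ∀ s ω, H s ω ≠ ∞) : IsSFiniteKernel (rowKernel Z x H) := by
  have := Kernel.IsSFiniteKernel.withDensity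
    (Kernel.deterministic (id : ℝ → ℝ) measurable_id ×ₖ Kernel.const ℝ (Z.P x))
    (f := fun _ q => H q.1.toNNReal q.2) fun _ _ => hH _ _
  unfold rowKernel
  infer_instance

theorem lintegral_comap_coe (ν : Measure (OnePoint (Eu d))) (g : Eu d → ℝ≥0∞) :
    ∫⁻ w, g w ∂(ν.comap ((↑) : Eu d → OnePoint (Eu d))) = ∫⁻ y, extendZero g y ∂ν := by
  have he := measurableEmbedding_coe (d := d)
  have h1 := he.lintegral_map (μ := ν.comap ((↑) : Eu d → OnePoint (Eu d))) (extendZero g)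
  simp only [extendZero_coe] at h1
  rw [← h1, he.map_comap, ← lintegral_indicator he.measurableSet_range]
  refine lintegral_congr fun y => ?_
  induction y using OnePoint.rec with
  | infty => simp
  | coe y => simp

theorem lintegral_rowKernel (x : OnePoint (Eu d)) {H : ℝ≥0 → Ω → ℝ≥0∞}
    (hH : Measurable (Function.uncurry H)) (s : ℝ) {g : Eu d → ℝ≥0∞} (hg : Measurable g) :
    ∫⁻ w, g w ∂(rowKernel Z x H s) =
      ∫⁻ ω, H s.toNNReal ω * extendZero g (Z.X s.toNNReal ω) ∂(Z.P x) := by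
  have hX : Measurable fun q : ℝ × Ω => Z.X q.1.toNNReal q.2 :=
    (measurable_uncurry_X Z).comp (by fun_prop : Measurable fun q : ℝ × Ω => (q.1.toNNReal, q.2))
  have hH' : Measurable fun q : ℝ × Ω => H q.1.toNNReal q.2 :=
    hH.comp (by fun_prop : Measurable fun q : ℝ × Ω => (q.1.toNNReal, q.2))
  have hgX : Measurable fun q : ℝ × Ω => extendZero g (Z.X q.1.toNNReal q.2) :=
    (measurable_extendZero hg).comp hX
  rw [rowKernel, Kernel.comapRight_apply, lintegral_comap_coe _ g,
    Kernel.lintegral_map _ hX _ (measurable_extendZero hg),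
    Kernel.lintegral_withDensity _ (by exact hH'.comp measurable_snd) _ hgX,
    Kernel.lintegral_deterministic_prod _ _ _ (by exact hH'.mul hgX)]
  simp

end

/-! ### Densities of rows, and two colours as a device for signs. -/

section

open ProbabilityTheory

section Rows

variable {S : Type*} [MeasurableSpace S] {μ : Measure S} [SFinite μ]

/-- The space-time density obtained by integrating a kernel over the row `u`. -/
noncomputable def rowDens (u : Kernel ℝ S) (a : ℝ × S → ℝ × S → ℝ≥0∞) (w : ℝ × S) : ℝ≥0∞ :=
  ∫⁻ r in Ioi (0 : ℝ), ∫⁻ y, a (r, y) w ∂(u r)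

variable (u : Kernel ℝ S) [IsSFiniteKernel u] {a : ℝ × S → ℝ × S → ℝ≥0∞}

theorem measurable_lintegral_row (ha : Measurable (Function.uncurry a)) :
    Measurable fun q : (ℝ × S) × ℝ => ∫⁻ y, a (q.2, y) q.1 ∂(u q.2) := by
  refine Measurable.lintegral_kernel_prod_right (κ := u.comap (Prod.snd : (ℝ × S) × ℝ → ℝ)
      measurable_snd) (f := fun (q : (ℝ × S) × ℝ) y => a (q.2, y) q.1) ?_
  exact ha.comp (by fun_prop : Measurable fun q : ((ℝ × S) × ℝ) × S => (((q.1.2, q.2) : ℝ × S), q.1.1))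

theorem measurable_rowDens (ha : Measurable (Function.uncurry a)) : Measurable (rowDens u a) :=
  (measurable_lintegral_row u ha).lintegral_prod_right'

theorem lintegral_rowDens (ha : Measurable (Function.uncurry a)) (t : ℝ) {h : S → ℝ≥0∞}
    (hh : Measurable h) :
    ∫⁻ r in Ioi (0 : ℝ), ∫⁻ w, gact μ a t h (r, w) ∂(u r) = ∫⁻ z, rowDens u a (t, z) * h z ∂μ := by
  have h1 := measurable_lintegral_row u ha
  have e1 (z : S) : rowDens u a (t, z) * h z =
      ∫⁻ r in Ioi (0 : ℝ), (∫⁻ y, a (r, y) (t, z) ∂(u r)) * h z :=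
    (lintegral_mul_const _ (by exact h1.comp (by fun_prop :
      Measurable fun r : ℝ => (((t, z) : ℝ × S), r)))).symm
  simp only [e1]
  rw [lintegral_lintegral_swap]
  · refine lintegral_congr fun r => ?_
    have h2 : Measurable fun q : S × S => a (r, q.1) (t, q.2) :=
      ha.comp (by fun_prop : Measurable fun q : S × S => (((r, q.1) : ℝ × S), ((t, q.2) : ℝ × S)))
    have e2 (z : S) : (∫⁻ y, a (r, y) (t, z) ∂(u r)) * h z = ∫⁻ y, a (r, y) (t, z) * h z ∂(u r) :=
      (lintegral_mul_const _ (h2.comp measurable_prodMk_right)).symm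
    simp only [e2, gact]
    exact lintegral_lintegral_swap (h2.mul (hh.comp measurable_snd)).aemeasurable
  · exact ((h1.comp (by fun_prop : Measurable fun q : S × ℝ => (((t, q.1) : ℝ × S), q.2))).mul
      (hh.comp measurable_fst)).aemeasurable

theorem gact_lmul {P : ℝ × S → ℝ × S → ℝ≥0∞} {κ : S → S → ℝ≥0∞}
    (hP : Measurable (Function.uncurry P)) (hκ : Measurable (Function.uncurry κ)) (t : ℝ)
    {h : S → ℝ≥0∞} (hh : Measurable h) (r : ℝ) (w : S) :
    gact μ (lmul μ κ P) t h (r, w) = ∫⁻ y, κ w y * gact μ P t h (r, y) ∂μ := by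
  have h2 : Measurable fun q : S × S => P (r, q.2) (t, q.1) :=
    hP.comp (by fun_prop : Measurable fun q : S × S => (((r, q.2) : ℝ × S), ((t, q.1) : ℝ × S)))
  have hκw : Measurable (κ w) := hκ.of_uncurry_left
  have e1 (z : S) : (∫⁻ y, κ w y * P (r, y) (t, z) ∂μ) * h z =
      ∫⁻ y, κ w y * P (r, y) (t, z) * h z ∂μ :=
    (lintegral_mul_const _ (by exact hκw.mul (h2.comp measurable_prodMk_left))).symm
  have e2 (y : S) : κ w y * ∫⁻ z, P (r, y) (t, z) * h z ∂μ =
      ∫⁻ z, κ w y * P (r, y) (t, z) * h z ∂μ := by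
    simp only [mul_assoc]
    exact (lintegral_const_mul _ (by exact (h2.comp measurable_prodMk_right).mul hh)).symm
  simp only [gact, lmul, e1, e2]
  exact lintegral_lintegral_swap (((hκw.comp measurable_snd).mul h2).mul
    (hh.comp measurable_fst)).aemeasurable

end Rows

section Colour

variable {S : Type*} [MeasurableSpace S]

/-- The coloured measure. -/
noncomputable abbrev colMeasure (μ : Measure S) : Measure (S × Bool) := μ.prod Measure.count

/-- The coloured transition density: the colour does not change between jumps. -/
noncomputable def colP (P : ℝ × S → ℝ × S → ℝ≥0∞) (v w : ℝ × (S × Bool)) : ℝ≥0∞ :=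
  if v.2.2 = w.2.2 then P (v.1, v.2.1) (w.1, w.2.1) else 0

/-- The coloured jump density: `κp` keeps and `κm` flips the colour. -/
noncomputable def colK (κp κm : S → S → ℝ≥0∞) (v w : S × Bool) : ℝ≥0∞ :=
  if v.2 = w.2 then κp v.1 w.1 else κm v.1 w.1

variable {μ : Measure S} [SFinite μ] {P : ℝ × S → ℝ × S → ℝ≥0∞} {κp κm : S → S → ℝ≥0∞}

theorem lintegral_colMeasure {f : S × Bool → ℝ≥0∞} (hf : Measurable f) :
    ∫⁻ w, f w ∂(colMeasure μ) = ∫⁻ z, (f (z, true) + f (z, false)) ∂μ := by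
  rw [lintegral_prod _ hf.aemeasurable]
  simp [lintegral_count]

theorem lintegral_prod_colMeasure {f : ℝ × (S × Bool) → ℝ≥0∞} (hf : Measurable f) :
    ∫⁻ w, f w ∂(volume.prod (colMeasure μ)) =
      ∫⁻ v : ℝ × S, (f (v.1, (v.2, true)) + f (v.1, (v.2, false))) ∂(volume.prod μ) := by
  rw [lintegral_prod _ hf.aemeasurable, lintegral_prod _ (by fun_prop)]
  exact lintegral_congr fun r => lintegral_colMeasure (hf.comp measurable_prodMk_left)

theorem measurable_colP (hP : Measurable (Function.uncurry P)) :
    Measurable (Function.uncurry (colP P)) := by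
  refine Measurable.ite (measurableSet_eq_fun (by fun_prop) (by fun_prop)) ?_ measurable_const
  exact hP.comp (by fun_prop : Measurable fun q : (ℝ × (S × Bool)) × (ℝ × (S × Bool)) =>
    (((q.1.1, q.1.2.1) : ℝ × S), ((q.2.1, q.2.2.1) : ℝ × S)))

theorem measurable_colK (hp : Measurable (Function.uncurry κp))
    (hm : Measurable (Function.uncurry κm)) : Measurable (Function.uncurry (colK κp κm)) := by
  have h : Measurable fun q : (S × Bool) × (S × Bool) => (q.1.1, q.2.1) := by fun_prop
  exact Measurable.ite (measurableSet_eq_fun (by fun_prop) (by fun_prop)) (hp.comp h) (hm.comp h)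

theorem isTransition_colP (hP : IsTransition μ P) : IsTransition (colMeasure μ) (colP P) where
  meas := measurable_colP hP.meas
  causal s t x z hts := by simp [colP, hP.causal s t x.1 z.1 hts]
  ck s r t x z hsr hrt := by
    have h := measurable_colP hP.meas
    rw [lintegral_colMeasure (by
      exact (h.of_uncurry_left.comp measurable_prodMk_left).mul
        (h.of_uncurry_right.comp measurable_prodMk_left))]
    obtain ⟨x, a⟩ := x
    obtain ⟨z, b⟩ := z
    cases a <;> cases b <;> simp [colP, hP.ck s r t x z hsr hrt]
  mass s t x := by
    have h := measurable_colP hP.meas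
    rw [lintegral_colMeasure (by exact h.of_uncurry_left.comp measurable_prodMk_left)]
    obtain ⟨x, a⟩ := x
    cases a <;> simpa [colP] using hP.mass s t x

theorem rmul_col (hP : Measurable (Function.uncurry P)) (hp : Measurable (Function.uncurry κp))
    (hm : Measurable (Function.uncurry κm)) (s r : ℝ) (x y : S) (a b : Bool) :
    rmul (colMeasure μ) (colP P) (colK κp κm) (s, (x, a)) (r, (y, b)) =
      if a = b then rmul μ P κp (s, x) (r, y) else rmul μ P κm (s, x) (r, y) := by
  unfold rmul
  rw [lintegral_colMeasure (by
      exact ((measurable_colP hP).of_uncurry_left.comp measurable_prodMk_left).mul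
        (measurable_colK hp hm).of_uncurry_right)]
  cases a <;> cases b <;> simp [colP, colK]

theorem lmul_col (hP : Measurable (Function.uncurry P)) (hp : Measurable (Function.uncurry κp))
    (hm : Measurable (Function.uncurry κm)) (s r : ℝ) (x y : S) (a b : Bool) :
    lmul (colMeasure μ) (colK κp κm) (colP P) (s, (x, a)) (r, (y, b)) =
      if a = b then lmul μ κp P (s, x) (r, y) else lmul μ κm P (s, x) (r, y) := by
  unfold lmul
  rw [lintegral_colMeasure (by
      exact (measurable_colK hp hm).of_uncurry_left.mul
        ((measurable_colP hP).of_uncurry_right.comp measurable_prodMk_left))]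
  cases a <;> cases b <;> simp [colP, colK]

theorem rmul_add (hP : Measurable (Function.uncurry P)) (hp : Measurable (Function.uncurry κp))
    (v w : ℝ × S) :
    rmul μ P (fun w y => κp w y + κm w y) v w = rmul μ P κp v w + rmul μ P κm v w := by
  unfold rmul
  simp only [mul_add]
  exact lintegral_add_left (by
    exact (hP.of_uncurry_left.comp measurable_prodMk_left).mul hp.of_uncurry_right) _

theorem lmul_add (hP : Measurable (Function.uncurry P)) (hp : Measurable (Function.uncurry κp))
    (v w : ℝ × S) :
    lmul μ (fun w y => κp w y + κm w y) P v w = lmul μ κp P v w + lmul μ κm P v w := by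
  unfold lmul
  simp only [add_mul]
  exact lintegral_add_left (by
    exact hp.of_uncurry_left.mul (hP.of_uncurry_right.comp measurable_prodMk_left)) _

variable {t₀ : ℝ} {θ B D : ℝ≥0∞} {ρ : ℝ → ℝ≥0∞}

/-- The jumps to the two colours together have rate κp + κm, whatever the initial colour; by
symmetry the same holds for jumps into a given colour. So the constants are unchanged. -/
theorem IsKato.col (hK : IsKato μ P (fun w y => κp w y + κm w y) t₀ θ B D ρ)
    (hP : Measurable (Function.uncurry P)) (hp : Measurable (Function.uncurry κp))
    (hm : Measurable (Function.uncurry κm)) :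
    IsKato (colMeasure μ) (colP P) (colK κp κm) t₀ θ B D ρ where
  pos := hK.pos
  left s t x hst := by
    obtain ⟨x, a⟩ := x
    refine le_trans (le_of_eq ?_) (hK.left s t x hst)
    have hms : MeasurableSet {w : ℝ × S × Bool | w.1 < t} :=
      measurableSet_lt measurable_fst measurable_const
    have hms' : MeasurableSet {w : ℝ × S | w.1 < t} :=
      measurableSet_lt measurable_fst measurable_const
    rw [← lintegral_indicator hms, ← lintegral_indicator hms', lintegral_prod_colMeasure (by
      exact (measurable_rmul (measurable_colP hP) (measurable_colK hp hm)).of_uncurry_left.indicator hms)]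
    refine lintegral_congr fun v => ?_
    by_cases h : v.1 < t
    · rw [indicator_of_mem (by exact h), indicator_of_mem (by exact h),
        indicator_of_mem (by exact h), rmul_col hP hp hm, rmul_col hP hp hm, rmul_add hP hp]
      cases a
      · simp [add_comm]
      · simp
    · rw [indicator_of_notMem (by exact h), indicator_of_notMem (by exact h),
        indicator_of_notMem (by exact h), add_zero]
  right s t z hst := by
    obtain ⟨z, b⟩ := z
    refine le_trans (le_of_eq ?_) (hK.right s t z hst)
    have hms : MeasurableSet {w : ℝ × S × Bool | s < w.1} :=
      measurableSet_lt measurable_const measurable_fst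
    have hms' : MeasurableSet {w : ℝ × S | s < w.1} :=
      measurableSet_lt measurable_const measurable_fst
    rw [← lintegral_indicator hms, ← lintegral_indicator hms', lintegral_prod_colMeasure (by
      exact (measurable_lmul (measurable_colP hP) (measurable_colK hp hm)).of_uncurry_right.indicator hms)]
    refine lintegral_congr fun v => ?_
    by_cases h : s < v.1
    · rw [indicator_of_mem (by exact h), indicator_of_mem (by exact h),
        indicator_of_mem (by exact h), lmul_col hP hp hm, lmul_col hP hp hm, lmul_add hP hp]
      cases b
      · simp [add_comm]
      · simp
    · rw [indicator_of_notMem (by exact h), indicator_of_notMem (by exact h),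
        indicator_of_notMem (by exact h), add_zero]
  bound s t x z hst := by
    unfold colP
    split_ifs
    · exact hK.bound s t x.1 z.1 hst
    · exact zero_le
  anti := hK.anti
  half := hK.half
  fin := hK.fin
  small := hK.small
  small' := hK.small'

/-- Exchange of the two colours. -/
def flipColour (S : Type*) [MeasurableSpace S] : S × Bool ≃ᵐ S × Bool where
  toEquiv := (Equiv.refl S).prodCongr Equiv.boolNot
  measurable_toFun := by
    change Measurable fun q : S × Bool => (q.1, !q.2)
    exact measurable_fst.prodMk ((measurable_of_finite fun b : Bool => !b).comp measurable_snd)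
  measurable_invFun := by
    change Measurable fun q : S × Bool => (q.1, !q.2)
    exact measurable_fst.prodMk ((measurable_of_finite fun b : Bool => !b).comp measurable_snd)

theorem flipColour_apply (z : S) (b : Bool) : flipColour S (z, b) = (z, !b) := rfl

theorem measurePreserving_flipColour :
    MeasurePreserving (flipColour S) (colMeasure μ) (colMeasure μ) := by
  refine ⟨(flipColour S).measurable, ?_⟩
  refine Measure.ext_of_lintegral _ fun f hf => ?_
  rw [lintegral_map hf (flipColour S).measurable, lintegral_colMeasure hf,
    lintegral_colMeasure (by exact hf.comp (flipColour S).measurable)]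
  simp only [flipColour_apply, Bool.not_true, Bool.not_false, add_comm]

theorem colP_flip (s t : ℝ) (x z : S) (a b : Bool) :
    colP P (s, (x, !a)) (t, (z, !b)) = colP P (s, (x, a)) (t, (z, b)) := by
  cases a <;> cases b <;> simp [colP]

theorem colK_flip (x z : S) (a b : Bool) :
    colK κp κm (x, !a) (z, !b) = colK κp κm (x, a) (z, b) := by
  cases a <;> cases b <;> simp [colK]

theorem pert_flip (s t : ℝ) (x z : S) (a b : Bool) :
    pert (colMeasure μ) (colP P) (colK κp κm) (s, (x, !a)) (t, (z, !b)) =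
      pert (colMeasure μ) (colP P) (colK κp κm) (s, (x, a)) (t, (z, b)) :=
  pert_symm (flipColour S) measurePreserving_flipColour
    (fun s t x z => colP_flip s t x.1 z.1 x.2 z.2) (fun x y => colK_flip x.1 y.1 x.2 y.2) s t
    (x, a) (z, b)

/-- If the row `u` solves the signed forward equation for `κp - κm`, then it is the difference of
the two colours of the perturbation series. -/
theorem IsKato.lintegral_row_add (hK : IsKato μ P (fun w y => κp w y + κm w y) t₀ θ B D ρ)
    (hP : IsTransition μ P) (hp : Measurable (Function.uncurry κp))
    (hm : Measurable (Function.uncurry κm)) (u : Kernel ℝ S) [IsSFiniteKernel u] (x : S)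
    (hu : ∀ t : ℝ, 0 < t → ∀ h : S → ℝ≥0∞, Measurable h →
      ∫⁻ w, h w ∂(u t) + ∫⁻ r in Ioi (0 : ℝ), ∫⁻ w, gact μ (lmul μ κm P) t h (r, w) ∂(u r) =
      gact μ P t h (0, x) + ∫⁻ r in Ioi (0 : ℝ), ∫⁻ w, gact μ (lmul μ κp P) t h (r, w) ∂(u r))
    {g : S → ℝ≥0∞} (hg : Measurable g) (hg1 : ∀ z, g z ≤ 1) (t : ℝ) (ht : 0 < t)
    (hfin : ∫⁻ r in Ioo (0 : ℝ) t, ∫⁻ w, ∫⁻ y, (κp w y + κm w y) ∂μ ∂(u r) ≠ ∞) :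
    ∫⁻ w, g w ∂(u t) +
      ∫⁻ z, pert (colMeasure μ) (colP P) (colK κp κm) (0, (x, true)) (t, (z, false)) * g z ∂μ =
      ∫⁻ z, pert (colMeasure μ) (colP P) (colK κp κm) (0, (x, true)) (t, (z, true)) * g z ∂μ := by
  have hC := isTransition_colP hP
  have hκ := measurable_colK hp hm
  have hR := measurable_pert hC hκ
  have hKR := measurable_lmul (μ := colMeasure μ) hR hκ
  have hKP := measurable_lmul (μ := colMeasure μ) hC.meas hκ
  have hl (κ : S → S → ℝ≥0∞) (hκ : Measurable (Function.uncurry κ)) :=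
    measurable_lmul (μ := μ) hP.meas hκ
  have htag : Measurable fun w : S => (w, true) := measurable_prodMk_right
  have hi (b : Bool) : Measurable fun z : S => (z, b) := measurable_prodMk_right
  -- The row is placed on the colour `true`, and c is the density of what it sends out through
  -- κm-jumps. On the colour `false` these arrivals appear on the right of the coloured equation,
  -- and on the colour `true` they are the term that the signed equation has on its left. Hence the
  -- same correction c serves on both colours.
  let v : Kernel ℝ (S × Bool) := u.map fun w => (w, true)
  have hvi (s : ℝ) {f : S × Bool → ℝ≥0∞} (hf : Measurable f) :
      ∫⁻ w, f w ∂(v s) = ∫⁻ w, f (w, true) ∂(u s) := Kernel.lintegral_map _ htag _ hf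
  have hvI {f : ℝ × (S × Bool) → ℝ≥0∞} (hf : Measurable f) :
      ∫⁻ r in Ioi (0 : ℝ), ∫⁻ w, f (r, w) ∂(v r) = ∫⁻ r in Ioi (0 : ℝ), ∫⁻ w, f (r, (w, true)) ∂(u r) :=
    lintegral_congr fun r => hvi r (hf.comp measurable_prodMk_left)
  let c : ℝ × (S × Bool) → ℝ≥0∞ := fun w => rowDens u (lmul μ κm P) (w.1, w.2.1)
  have hcm : Measurable c := (measurable_rowDens u (hl κm hm)).comp (by fun_prop :
    Measurable fun w : ℝ × (S × Bool) => (w.1, w.2.1))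
  have hrow : ∀ t : ℝ, 0 < t → ∀ h : S × Bool → ℝ≥0∞, Measurable h →
      ∫⁻ w, h w ∂(v t) + ∫⁻ z, c (t, z) * h z ∂(colMeasure μ) =
      gact (colMeasure μ) (colP P) t h (0, (x, true)) + ∫⁻ r in Ioi (0 : ℝ), ∫⁻ w,
        gact (colMeasure μ) (lmul (colMeasure μ) (colK κp κm) (colP P)) t h (r, w) ∂(v r) := by
    intro t ht h hh
    have hht : Measurable fun z => h (z, true) := hh.comp (hi true)
    have hhf : Measurable fun z => h (z, false) := hh.comp (hi false)
    have hcz : Measurable fun z => rowDens u (lmul μ κm P) (t, z) :=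
      (measurable_rowDens u (hl κm hm)).comp measurable_prodMk_left
    rw [hvi t hh, lintegral_colMeasure (by exact (hcm.comp measurable_prodMk_left).mul hh),
      lintegral_add_left (by exact hcz.mul hht), hvI (measurable_gact hKP hh t)]
    have e1 : gact (colMeasure μ) (colP P) t h (0, (x, true)) =
        gact μ P t (fun z => h (z, true)) (0, x) := by
      unfold gact
      rw [lintegral_colMeasure (by
        exact (hC.meas.of_uncurry_left.comp measurable_prodMk_left).mul hh)]
      simp [colP]
    have e2 (r : ℝ) (w : S) :
        gact (colMeasure μ) (lmul (colMeasure μ) (colK κp κm) (colP P)) t h (r, (w, true)) =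
        gact μ (lmul μ κp P) t (fun z => h (z, true)) (r, w) +
          gact μ (lmul μ κm P) t (fun z => h (z, false)) (r, w) := by
      unfold gact
      rw [lintegral_colMeasure (by
        exact (hKP.of_uncurry_left.comp measurable_prodMk_left).mul hh)]
      simp only [lmul_col hP.meas hp hm]
      simp only [if_true, Bool.true_eq_false, if_false]
      exact lintegral_add_left (by
        exact ((hl κp hp).of_uncurry_left.comp measurable_prodMk_left).mul hht) _
    have m1 : Measurable fun q : ℝ × S => gact μ (lmul μ κp P) t (fun z => h (z, true)) q :=
      measurable_gact (hl κp hp) hht t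
    simp only [e1, e2]
    rw [lintegral_congr fun r => lintegral_add_left (by exact m1.comp measurable_prodMk_left) _,
      lintegral_add_left (Measurable.lintegral_kernel_prod_right (κ := u)
        (f := fun r w => gact μ (lmul μ κp P) t (fun z => h (z, true)) (r, w)) m1), ← add_assoc, ← add_assoc,
      ← hu t ht _ hht, lintegral_rowDens u (hl κm hm) t hhf, lintegral_rowDens u (hl κm hm) t hht]
  have hfin' : ∫⁻ r in Ioo (0 : ℝ) t, ∫⁻ w, ∫⁻ y, colK κp κm w y ∂(colMeasure μ) ∂(v r) ≠ ∞ := by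
    refine ne_top_of_le_ne_top hfin (lintegral_mono fun r => ?_)
    rw [hvi r (by exact hκ.lintegral_prod_right')]
    refine lintegral_mono fun w => ?_
    simp only []
    rw [lintegral_colMeasure (by exact hκ.of_uncurry_left)]
    simp [colK]
  let gg : Bool → S × Bool → ℝ≥0∞ := fun b w => if w.2 = b then g w.1 else 0
  have hgg (b : Bool) : Measurable (gg b) := Measurable.ite
    (measurableSet_eq_fun measurable_snd measurable_const) (hg.comp measurable_fst) measurable_const
  have hgg1 (b : Bool) (w) : gg b w ≤ 1 := by
    simp only [gg]; split_ifs
    · exact hg1 _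
    · exact zero_le
  have hCK := hK.col hP.meas hp hm
  have key (b : Bool) := hCK.lintegral_eq_of_forward_eq hC hκ v (x, true) c hrow (hgg b)
    (hgg1 b) t ht hfin'
  have hgR (b : Bool) : gact (colMeasure μ) (pert (colMeasure μ) (colP P) (colK κp κm)) t (gg b)
      (0, (x, true)) = ∫⁻ z, pert (colMeasure μ) (colP P) (colK κp κm) (0, (x, true))
        (t, (z, b)) * g z ∂μ := by
    unfold gact
    rw [lintegral_colMeasure (by
        exact (hR.of_uncurry_left.comp measurable_prodMk_left).mul (hgg b))]
    cases b <;> simp [gg]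
  have hcg (b : Bool) : ∫⁻ z, c (t, z) * gg b z ∂(colMeasure μ) =
      ∫⁻ z, rowDens u (lmul μ κm P) (t, z) * g z ∂μ := by
    rw [lintegral_colMeasure (by exact (hcm.comp measurable_prodMk_left).mul (hgg b))]
    cases b <;> simp [gg, c]
  have hKRflip (s : ℝ) (z : S) (a b : Bool) :
      gact (colMeasure μ) (lmul (colMeasure μ) (colK κp κm)
        (pert (colMeasure μ) (colP P) (colK κp κm))) t (gg !b) (s, (z, !a)) =
      gact (colMeasure μ) (lmul (colMeasure μ) (colK κp κm)
        (pert (colMeasure μ) (colP P) (colK κp κm))) t (gg b) (s, (z, a)) := by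
    have he := (flipColour S).measurableEmbedding
    have hpr := measurePreserving_flipColour (S := S) (μ := μ)
    unfold gact lmul
    rw [← hpr.lintegral_comp_emb he]
    refine lintegral_congr fun w => ?_
    rw [← hpr.lintegral_comp_emb he]
    obtain ⟨y, e⟩ := w
    simp only [flipColour_apply]
    congr 1
    · refine lintegral_congr fun w => ?_
      obtain ⟨y', e'⟩ := w
      rw [flipColour_apply, colK_flip, pert_flip]
    · cases b <;> cases e <;> simp [gg]
  -- The correction c does not depend on the colour and the series is invariant under flipping both
  -- colours. So the correction contributes equally to the two end colours and drops out of their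
  -- difference.
  have hQ : ∫⁻ s in Ioi (0 : ℝ), ∫⁻ z, c (s, z) * gact (colMeasure μ) (lmul (colMeasure μ)
        (colK κp κm) (pert (colMeasure μ) (colP P) (colK κp κm))) t (gg true) (s, z) ∂(colMeasure μ) =
      ∫⁻ s in Ioi (0 : ℝ), ∫⁻ z, c (s, z) * gact (colMeasure μ) (lmul (colMeasure μ)
        (colK κp κm) (pert (colMeasure μ) (colP P) (colK κp κm))) t (gg false) (s, z)
          ∂(colMeasure μ) := by
    refine lintegral_congr fun s => ?_
    have hpr := measurePreserving_flipColour (S := S) (μ := μ)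
    rw [← hpr.lintegral_comp_emb (flipColour S).measurableEmbedding]
    refine lintegral_congr fun w => ?_
    obtain ⟨y, e⟩ := w
    rw [flipColour_apply, ← hKRflip s y e false]
    rfl
  have kt := key true
  have kf := key false
  rw [hgR, hcg, hvi t (hgg _)] at kt kf
  rw [hQ] at kt
  simp only [gg, if_true, Bool.true_eq_false, if_false, lintegral_zero, zero_add] at kf kt
  rw [← kt, ← kf]

end Colour

end

/-! ### Comparison of the process with the perturbation series. -/

section

open ProbabilityTheory

section Bounded

variable {d : ℕ}

/-- An inequality between measures may be tested on bounded functions of bounded support. -/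
theorem lintegral_le_of_bounded {ν₁ ν₂ : Measure (Eu d)}
    (h : ∀ g : Eu d → ℝ≥0∞, Measurable g → (∀ y, g y ≤ 1) →
      (∃ n : ℕ, ∀ y, (n : ℝ) ≤ ‖y‖ → g y = 0) → ∫⁻ y, g y ∂ν₁ ≤ ∫⁻ y, g y ∂ν₂)
    (f : Eu d → ℝ≥0∞) : ∫⁻ y, f y ∂ν₁ ≤ ∫⁻ y, f y ∂ν₂ := by
  refine lintegral_mono' (Measure.le_iff.2 fun s hs => ?_) le_rfl
  have hmono : Monotone fun n : ℕ => s ∩ Metric.ball (0 : Eu d) n := fun i k hik =>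
    inter_subset_inter_right _ (Metric.ball_subset_ball (by exact_mod_cast hik))
  have hU : s = ⋃ n : ℕ, s ∩ Metric.ball (0 : Eu d) n := by
    rw [← inter_iUnion, Metric.iUnion_ball_nat, inter_univ]
  rw [hU, hmono.measure_iUnion, hmono.measure_iUnion]
  refine iSup_mono fun n => ?_
  have hms : MeasurableSet (s ∩ Metric.ball (0 : Eu d) n) := hs.inter measurableSet_ball
  have := h ((s ∩ Metric.ball (0 : Eu d) n).indicator 1) (measurable_one.indicator hms)
    (fun y => indicator_le_self' (fun _ _ => zero_le) y) ⟨n, fun y hy => by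
      rw [indicator_of_notMem]
      intro hy'
      have := hy'.2
      rw [mem_ball_zero_iff] at this
      linarith⟩
  rwa [lintegral_indicator_one hms, lintegral_indicator_one hms] at this

end Bounded

section Mass

variable {S : Type*} [MeasurableSpace S] {μ : Measure S} [SFinite μ]

theorem setLIntegral_rmul {a : ℝ × S → ℝ × S → ℝ≥0∞} {κ : S → S → ℝ≥0∞}
    (ha : Measurable (Function.uncurry a)) (hκ : Measurable (Function.uncurry κ)) (v : ℝ × S)
    (t : ℝ) :
    ∫⁻ w in {w | w.1 < t}, rmul μ a κ v w ∂(volume.prod μ) =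
      ∫⁻ r in Iio t, gact μ a r (fun u => ∫⁻ y, κ u y ∂μ) v := by
  have hset : {w : ℝ × S | w.1 < t} = Iio t ×ˢ univ := by ext; simp
  rw [hset, ← Measure.prod_restrict, Measure.restrict_univ, lintegral_prod _ (by
    exact (measurable_rmul ha hκ).of_uncurry_left.aemeasurable)]
  refine lintegral_congr fun r => ?_
  have h1 : Measurable fun u => a v (r, u) := ha.of_uncurry_left.comp measurable_prodMk_left
  unfold rmul gact
  rw [lintegral_lintegral_swap]
  · exact lintegral_congr fun u => lintegral_const_mul (a v (r, u)) (f := κ u) hκ.of_uncurry_left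
  · exact ((h1.comp measurable_snd).mul (hκ.comp measurable_swap)).aemeasurable

end Mass

variable {d : ℕ} {Ω : Type*} [mΩ : MeasurableSpace Ω] {Z : HuntProcess (Eu d) Ω}
  {m : Measure (Eu d)} [SFinite m] {pk : ℝ → Eu d → Eu d → ℝ≥0∞} {j : Eu d → Eu d → ℝ≥0∞}

/-- The space-time density of a time-homogeneous transition density. -/
def stP (pk : ℝ → Eu d → Eu d → ℝ≥0∞) (v w : ℝ × Eu d) : ℝ≥0∞ := pk (w.1 - v.1) v.2 w.2

section Paths

variable (hD : LevyData Z m pk j) {F : Eu d → Eu d → ℝ} (hF : Measurable (Function.uncurry F))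
  (hF0 : ∀ x, F x x = 0) (hm : HasContinuousAction m pk) (hT : IsTransition m (stP pk))
  {t₀ : ℝ} {θ B D : ℝ≥0∞} {ρ : ℝ → ℝ≥0∞}
  (hK : IsKato m (stP pk) (fun w y => j w y * expAbs F w y) t₀ θ B D ρ)

include hD in
theorem measurable_rate_mul {f : Eu d → Eu d → ℝ≥0∞} (hf : Measurable (Function.uncurry f)) :
    Measurable (Function.uncurry fun w y => j w y * f w y) := hD.j_meas.mul hf

include hD hT in
-- This translates the jump term of the path equation into the row form used by the abstract
-- comparison; the range s < t is automatic there by causality.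
theorem lintegral_row_eq {f : Eu d → Eu d → ℝ≥0∞} (hf : Measurable (Function.uncurry f))
    {H : ℝ≥0 → Ω → ℝ≥0∞} (hH : Measurable (Function.uncurry H)) (x : Eu d) (t : ℝ≥0)
    {g : Eu d → ℝ≥0∞} (hg : Measurable g) :
    ∫⁻ s in Ioo (0 : ℝ) t, ∫⁻ ω, H s.toNNReal ω * extendZero (jumpRate m j
          (fun w y => f w y * ∫⁻ z, pk (t - s) y z * g z ∂m)) (Z.X s.toNNReal ω) ∂(Z.P x) =
      ∫⁻ r in Ioi (0 : ℝ), ∫⁻ w, gact m (lmul m (fun w y => j w y * f w y) (stP pk)) t g (r, w)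
        ∂(rowKernel Z x H r) := by
  have hκ := measurable_rate_mul hD hf
  have hL := measurable_lmul (μ := m) hT.meas hκ
  rw [← lintegral_indicator measurableSet_Ioo, ← lintegral_indicator measurableSet_Ioi]
  refine lintegral_congr fun r => ?_
  by_cases hr : r ∈ Ioi (0 : ℝ)
  · rw [indicator_of_mem hr]
    by_cases hrt : r < t
    · rw [indicator_of_mem (show r ∈ Ioo (0 : ℝ) t from ⟨hr, hrt⟩), lintegral_rowKernel (x : OnePoint (Eu d)) hH r (by
        exact (measurable_gact (μ := m) hL hg (t : ℝ)).comp measurable_prodMk_left)]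
      have e : (fun w => gact m (lmul m (fun w y => j w y * f w y) (stP pk)) t g (r, w)) =
          jumpRate m j (fun w y => f w y * ∫⁻ z, pk (t - r) y z * g z ∂m) := by
        funext w
        rw [gact_lmul hT.meas hκ _ hg]
        simp only [jumpRate, mul_assoc]
        rfl
      rw [e]
    · rw [indicator_of_notMem (fun h => hrt h.2)]
      have h0 : ∀ w, gact m (lmul m (fun w y => j w y * f w y) (stP pk)) t g (r, w) = 0 := by
        intro w
        simp [gact, lmul_causal hT.causal r t w _ (not_lt.1 hrt)]
      simp [h0]
  · rw [indicator_of_notMem hr, indicator_of_notMem (fun h => hr h.1)]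

theorem expAbs_diag {F : Eu d → Eu d → ℝ} (hF0 : ∀ x, F x x = 0) (x : Eu d) :
    expAbs F x x = 0 := by simp [expAbs, hF0]

include hK hT in
theorem jumpMass_ne_top (hκ : Measurable (Function.uncurry fun w y => j w y * expAbs F w y))
    (x : Eu d) (t : ℝ) :
    jumpMass m (stP pk) (fun w y => j w y * expAbs F w y) (0, x) t ≠ ∞ := by
  obtain ⟨C, hC, h⟩ := hK.exists_jumpMass_le hT hκ t
  exact ne_top_of_le_ne_top hC (h 0 t x (by simp))

theorem le_pert {S : Type*} [MeasurableSpace S] {μ : Measure S} {P : ℝ × S → ℝ × S → ℝ≥0∞}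
    {κ : S → S → ℝ≥0∞} (v w : ℝ × S) : P v w ≤ pert μ P κ v w := by
  unfold pert
  exact ENNReal.le_tsum (f := fun n => pertTerm μ P κ n v w) 0

include hD hF hF0 hT hK in
-- The compensator of e^{|F|} - 1 is dominated by the jump mass of the series, of which p is the
-- first term.
theorem lintegral_jumpOn_expAbs_ne_top (x : Eu d) {t : ℝ≥0} (ht : 0 < t) :
    ∫⁻ ω, jumpOn Z (expAbs F) (Ioc 0 t) ω ∂(Z.P x) ≠ ∞ := by
  have hκ := measurable_rate_mul hD (measurable_expAbs hF)
  rw [lintegral_jumpOn hD (measurable_expAbs hF) (expAbs_diag hF0) ht, extendZero_coe]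
  -- The bound t + 1 only serves to fit (0, t] into an open half-line.
  refine ne_top_of_le_ne_top (jumpMass_ne_top hT hK hκ x (t + 1)) ?_
  rw [jumpMass, setLIntegral_rmul (measurable_pert hT hκ) hκ]
  calc jumpComp m pk j (expAbs F) t x
      ≤ ∫⁻ r in Ioc (0 : ℝ) t, gact m (pert m (stP pk) (fun w y => j w y * expAbs F w y)) r
          (fun u => ∫⁻ y, j u y * expAbs F u y ∂m) (0, x) := by
        refine lintegral_mono fun r => lintegral_mono fun z => ?_
        refine mul_le_mul' ((le_of_eq ?_).trans (le_pert _ _)) le_rfl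
        simp [stP]
    _ ≤ _ := lintegral_mono_set fun r hr => by
        have := hr.2
        simp only [mem_Iio]
        linarith

include hD hF hF0 hm hT hK in
theorem lintegral_truncWeight_le_pert (x : Eu d) {t : ℝ≥0} (ht : 0 < t) {g : Eu d → ℝ≥0∞}
    (hg : Measurable g) (hg1 : ∀ y, g y ≤ 1) (K : ℕ) :
    ∫⁻ ω, truncWeight Z F K t ω * extendZero g (Z.X t ω) ∂(Z.P x) ≤
      gact m (pert m (stP pk) fun w y => j w y * expAbs F w y) t g (0, x) := by
  have hκ := measurable_rate_mul hD (measurable_expAbs hF)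
  have hL := measurable_lmul (μ := m) hT.meas hκ
  have hH := measurable_uncurry_truncWeight hD hF hF0 K
  have hle (s ω) : truncWeight Z F K s ω ≤ (K : ℝ≥0) := min_le_right _ _
  have hfin (s ω) : truncWeight Z F K s ω ≠ ∞ := ne_top_of_le_ne_top ENNReal.coe_ne_top (hle s ω)
  have := isSFiniteKernel_rowKernel (Z := Z) x hfin
  set u := rowKernel Z x (truncWeight Z F K) with hu
  have hui (s : ℝ) {f : Eu d → ℝ≥0∞} (hf : Measurable f) := lintegral_rowKernel (Z := Z) x hH s hf
  have hPx (t : ℝ) : Measurable fun z => stP pk (0, x) (t, z) :=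
    hT.meas.of_uncurry_left.comp measurable_prodMk_left
  have hrd (t : ℝ) : Measurable fun z =>
      rowDens u (lmul m (fun w y => j w y * expAbs F w y) (stP pk)) (t, z) :=
    (measurable_rowDens u hL).comp measurable_prodMk_left
  have hN (t : ℝ) (f : Eu d → ℝ≥0∞) (hf : Measurable f) :
      gact m (stP pk) t f (0, x) + ∫⁻ r in Ioi (0 : ℝ), ∫⁻ w,
        gact m (lmul m (fun w y => j w y * expAbs F w y) (stP pk)) t f (r, w) ∂(u r) =
      ∫⁻ z, f z ∂(m.withDensity fun z => stP pk (0, x) (t, z) +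
        rowDens u (lmul m (fun w y => j w y * expAbs F w y) (stP pk)) (t, z)) := by
    rw [lintegral_withDensity_eq_lintegral_mul _ (by exact (hPx t).add (hrd t)) hf,
      lintegral_rowDens u hL t hf, gact, ← lintegral_add_left (by exact (hPx t).mul hf)]
    simp only [Pi.mul_apply, add_mul]
  have hv : ∀ t : ℝ, 0 < t → ∀ h : Eu d → ℝ≥0∞, Measurable h → ∫⁻ w, h w ∂(u t) ≤
      gact m (stP pk) t h (0, x) + ∫⁻ r in Ioi (0 : ℝ), ∫⁻ w,
        gact m (lmul m (fun w y => j w y * expAbs F w y) (stP pk)) t h (r, w) ∂(u r) := by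
    intro t ht h hh
    rw [hN t h hh]
    -- On paths the inequality is known for bounded g of bounded support, where P_{t-s} g is
    -- continuous. Read as an inequality between two measures, it extends to all h.
    refine lintegral_le_of_bounded (fun g hg hg1 hgb => ?_) h
    lift t to ℝ≥0 using ht.le
    have ht' : 0 < t := by exact_mod_cast ht
    rw [← hN t g hg, hui t hg, ← lintegral_row_eq hD hT (measurable_expAbs hF) hH x t hg,
      Real.toNNReal_coe]
    refine (lintegral_truncWeight_le hD hF hF0 hm x
      (fun t ht => lintegral_jumpOn_expAbs_ne_top hD hF hF0 hT hK x ht) ht' hg hg1 hgb K).trans ?_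
    refine add_le_add_left (le_of_eq ?_) _
    simp [gact, stP]
  have key := hK.lintegral_le_of_forward_le hT hκ u x hv hg hg1 t ht
  rw [hui t hg, Real.toNNReal_coe] at key
  apply key
  have hj : Measurable fun w => ∫⁻ y, j w y * expAbs F w y ∂m := hκ.lintegral_prod_right'
  -- The truncated weight is at most K, so the integrated jump rate of the row is at most K times
  -- the finite compensator; this is the finiteness that the comparison asks for.
  have hc : ∫⁻ r in Ioo (0 : ℝ) t, ∫⁻ w, ∫⁻ y, j w y * expAbs F w y ∂m ∂(u r) ≤
      (K : ℝ≥0) * jumpComp m pk j (expAbs F) t x := by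
    rw [jumpComp, ← lintegral_const_mul' _ _ ENNReal.coe_ne_top]
    refine (lintegral_mono_set Ioo_subset_Ioc_self).trans
      (setLIntegral_mono' measurableSet_Ioc fun r hr => ?_)
    rw [hui r hj]
    have hr' : 0 < r.toNNReal := Real.toNNReal_pos.2 hr.1
    have := hD.trans r.toNNReal hr' x _ hj
    rw [Real.coe_toNNReal _ hr.1.le] at this
    change _ ≤ (K : ℝ≥0) * ∫⁻ z, pk r x z * (∫⁻ y, j z y * expAbs F z y ∂m) ∂m
    rw [← this, ← lintegral_const_mul' _ _ ENNReal.coe_ne_top]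
    exact lintegral_mono fun ω => by gcongr; exact hle _ _
  refine ne_top_of_le_ne_top (ENNReal.mul_ne_top ENNReal.coe_ne_top ?_) hc
  have := lintegral_jumpOn_expAbs_ne_top hD hF hF0 hT hK x ht
  rwa [lintegral_jumpOn hD (measurable_expAbs hF) (expAbs_diag hF0) ht, extendZero_coe] at this

include hD hF hF0 hm hT hK in
-- The bound on the truncated weight does not depend on K, so K → ∞ gives an exponential moment of
-- Σ|F|, localized at the end point. It is the integrability that uniqueness for e^{-A} needs.
theorem lintegral_exp_le_pert (x : Eu d) {t : ℝ≥0} (ht : 0 < t) {g : Eu d → ℝ≥0∞}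
    (hg : Measurable g) :
    ∫⁻ ω, EReal.exp (jumpOn Z (fun w y => ENNReal.ofReal |F w y|) (Ioo 0 t) ω) *
        extendZero g (Z.X t ω) ∂(Z.P x) ≤
      gact m (pert m (stP pk) fun w y => j w y * expAbs F w y) t g (0, x) := by
  have hκ := measurable_rate_mul hD (measurable_expAbs hF)
  have hE (K : ℕ) : Measurable (truncWeight Z F K t) :=
    (measurable_truncWeight hD hF hF0 K t).mono (Z.filt.le _) le_rfl
  have hsup (ω : Ω) : EReal.exp (jumpOn Z (fun w y => ENNReal.ofReal |F w y|) (Ioo 0 t) ω) =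
      ⨆ K, truncWeight Z F K t ω := by
    unfold truncWeight
    rw [← inf_iSup_eq]
    have : ⨆ K : ℕ, (((K : ℝ≥0)) : ℝ≥0∞) = ∞ := by
      simpa using ENNReal.iSup_natCast
    rw [this]
    exact (inf_top_eq _).symm
  have hmono (ω : Ω) : Monotone fun K => truncWeight Z F K t ω := fun K L h =>
    min_le_min le_rfl (by exact_mod_cast h)
  have hle1 {f : Eu d → ℝ≥0∞} (hf : Measurable f) (hf1 : ∀ y, f y ≤ 1) :
      ∫⁻ ω, EReal.exp (jumpOn Z (fun w y => ENNReal.ofReal |F w y|) (Ioo 0 t) ω) *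
        extendZero f (Z.X t ω) ∂(Z.P x) ≤
      gact m (pert m (stP pk) fun w y => j w y * expAbs F w y) t f (0, x) := by
    simp only [hsup, ENNReal.iSup_mul]
    rw [lintegral_iSup (f := fun K ω => truncWeight Z F K t ω * extendZero f (Z.X t ω))
      (fun K => (hE K).mul ((measurable_extendZero hf).comp (measurable_X Z t)))
      (fun K L h ω => mul_le_mul_left (hmono ω h) _)]
    exact iSup_le fun K => lintegral_truncWeight_le_pert hD hF hF0 hm hT hK x ht hf hf1 K
  have hEm : Measurable (Function.uncurry fun (s : ℝ≥0) ω =>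
      EReal.exp (jumpOn Z (fun w y => ENNReal.ofReal |F w y|) (Ioo 0 s) ω)) :=
    Measurable.ereal_exp (measurable_coe_ennreal_ereal.comp
    (measurable_uncurry_jumpOn_Ioo hD (by exact ENNReal.measurable_ofReal.comp (hF.norm))
      (by simp [hF0])))
  have hRm : Measurable fun z =>
      pert m (stP pk) (fun w y => j w y * expAbs F w y) (0, x) ((t : ℝ), z) :=
    (measurable_pert hT hκ).of_uncurry_left.comp measurable_prodMk_left
  have hg' {f : Eu d → ℝ≥0∞} (hf : Measurable f) := lintegral_rowKernel (Z := Z) x hEm t hf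
  have hd {f : Eu d → ℝ≥0∞} (hf : Measurable f) :=
    lintegral_withDensity_eq_lintegral_mul m hRm hf
  simp only [Real.toNNReal_coe] at hg'
  have := lintegral_le_of_bounded (ν₁ := rowKernel Z x (fun (s : ℝ≥0) ω =>
      EReal.exp (jumpOn Z (fun w y => ENNReal.ofReal |F w y|) (Ioo 0 s) ω)) t)
      (ν₂ := m.withDensity fun z =>
        pert m (stP pk) (fun w y => j w y * expAbs F w y) (0, x) ((t : ℝ), z))
      (fun f hf hf1 _ => by
    rw [hg' hf, hd hf]; exact hle1 hf hf1) g
  rwa [hg' hg, hd hg] at this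

include hD hF hF0 hm hT hK in
/-- The Feynman–Kac weight is represented by the difference of the two colours of the perturbation
series. -/
theorem lintegral_expWeight_add_pert {a b : Eu d → Eu d → ℝ≥0∞}
    (ha : Measurable (Function.uncurry a)) (hb : Measurable (Function.uncurry b))
    (hab : ∀ w y, a w y + b w y = expAbs F w y)
    (hab' : ∀ w y, (a w y).toReal - (b w y).toReal = Real.exp (-F w y) - 1)
    (x : Eu d) {t : ℝ≥0} (ht : 0 < t) {g : Eu d → ℝ≥0∞} (hg : Measurable g) (hg1 : ∀ y, g y ≤ 1) :
    ∫⁻ ω, expWeight Z F t ω * extendZero g (Z.X t ω) ∂(Z.P x) +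
        ∫⁻ z, pert (colMeasure m) (colP (stP pk)) (colK (fun w y => j w y * a w y)
          fun w y => j w y * b w y) (0, (x, true)) (t, (z, false)) * g z ∂m =
      ∫⁻ z, pert (colMeasure m) (colP (stP pk)) (colK (fun w y => j w y * a w y)
          fun w y => j w y * b w y) (0, (x, true)) (t, (z, true)) * g z ∂m := by
  have hκ := measurable_rate_mul hD (measurable_expAbs hF)
  have hκa := measurable_rate_mul hD ha
  have hκb := measurable_rate_mul hD hb
  have hsum : (fun w y => j w y * a w y + j w y * b w y) = fun w y => j w y * expAbs F w y := by
    funext w y; rw [← mul_add, hab]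
  have hH := measurable_uncurry_expWeight hD hF hF0
  have := isSFiniteKernel_rowKernel (Z := Z) (H := expWeight Z F) x fun _ _ => ENNReal.ofReal_ne_top
  set u := rowKernel Z x (expWeight Z F) with hu
  have hui (s : ℝ) {f : Eu d → ℝ≥0∞} (hf : Measurable f) := lintegral_rowKernel (Z := Z) x hH s hf
  have hPx (t : ℝ) : Measurable fun z => stP pk (0, x) (t, z) :=
    hT.meas.of_uncurry_left.comp measurable_prodMk_left
  have hN {f : Eu d → Eu d → ℝ≥0∞} (hf : Measurable (Function.uncurry f)) (ν : Measure (Eu d))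
      (t : ℝ) {h : Eu d → ℝ≥0∞} (hh : Measurable h) :
      ∫⁻ y, h y ∂ν + ∫⁻ r in Ioi (0 : ℝ), ∫⁻ w,
        gact m (lmul m (fun w y => j w y * f w y) (stP pk)) t h (r, w) ∂(u r) =
      ∫⁻ z, h z ∂(ν + m.withDensity fun z =>
        rowDens u (lmul m (fun w y => j w y * f w y) (stP pk)) (t, z)) := by
    have hL := measurable_lmul (μ := m) hT.meas (measurable_rate_mul hD hf)
    rw [lintegral_add_measure, lintegral_withDensity_eq_lintegral_mul _ (by
      exact (measurable_rowDens u hL).comp measurable_prodMk_left) hh,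
      lintegral_rowDens u hL t hh]
    rfl
  have hfwd : ∀ t : ℝ, 0 < t → ∀ h : Eu d → ℝ≥0∞, Measurable h →
      ∫⁻ w, h w ∂(u t) + ∫⁻ r in Ioi (0 : ℝ), ∫⁻ w,
        gact m (lmul m (fun w y => j w y * b w y) (stP pk)) t h (r, w) ∂(u r) =
      gact m (stP pk) t h (0, x) + ∫⁻ r in Ioi (0 : ℝ), ∫⁻ w,
        gact m (lmul m (fun w y => j w y * a w y) (stP pk)) t h (r, w) ∂(u r) := by
    intro t ht h hh
    have hgP {h : Eu d → ℝ≥0∞} (hh : Measurable h) : gact m (stP pk) t h (0, x) =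
        ∫⁻ z, h z ∂(m.withDensity fun z => stP pk (0, x) (t, z)) :=
      (lintegral_withDensity_eq_lintegral_mul m (hPx t) hh).symm
    have base (g : Eu d → ℝ≥0∞) (hg : Measurable g) (hg1 : ∀ y, g y ≤ 1)
        (hgb : ∃ n : ℕ, ∀ y, (n : ℝ) ≤ ‖y‖ → g y = 0) :
        ∫⁻ w, g w ∂(u t) + ∫⁻ r in Ioi (0 : ℝ), ∫⁻ w,
          gact m (lmul m (fun w y => j w y * b w y) (stP pk)) t g (r, w) ∂(u r) =
        gact m (stP pk) t g (0, x) + ∫⁻ r in Ioi (0 : ℝ), ∫⁻ w,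
          gact m (lmul m (fun w y => j w y * a w y) (stP pk)) t g (r, w) ∂(u r) := by
      lift t to ℝ≥0 using ht.le
      have ht' : 0 < t := by exact_mod_cast ht
      have h := lintegral_expWeight_add hD hF hF0 hm x
        (fun t ht => lintegral_jumpOn_expAbs_ne_top hD hF hF0 hT hK x ht) ht' hg hg1 hgb ha hb
        hab hab'
      rw [hui t hg, ← lintegral_row_eq hD hT ha hH x t hg, ← lintegral_row_eq hD hT hb hH x t hg,
        Real.toNNReal_coe, h]
      simp [gact, stP]
    rw [hgP hh, hN hb _ t hh, hN ha _ t hh]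
    refine le_antisymm (lintegral_le_of_bounded (fun g hg hg1 hgb => ?_) h)
      (lintegral_le_of_bounded (fun g hg hg1 hgb => ?_) h)
    · rw [← hN hb _ t hg, ← hN ha _ t hg, ← hgP hg]
      exact (base g hg hg1 hgb).le
    · rw [← hN hb _ t hg, ← hN ha _ t hg, ← hgP hg]
      exact (base g hg hg1 hgb).ge
  have key := (hsum ▸ hK : IsKato m (stP pk) (fun w y => j w y * a w y + j w y * b w y)
    t₀ θ B D ρ).lintegral_row_add hT hκa hκb u x hfwd hg hg1 t ht
  rw [hui t hg, Real.toNNReal_coe] at key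
  apply key
  have hj : Measurable fun w => ∫⁻ y, j w y * expAbs F w y ∂m := hκ.lintegral_prod_right'
  -- Since e^{-A} ≤ e^{Σ|F|}, the exponential bound tested on the jump rate gives, after integration
  -- in time, a jump mass known to be finite.
  refine ne_top_of_le_ne_top (jumpMass_ne_top hT hK hκ x t) ?_
  rw [jumpMass, setLIntegral_rmul (measurable_pert hT hκ) hκ]
  have hsum' (w y : Eu d) : j w y * a w y + j w y * b w y = j w y * expAbs F w y := by
    rw [← mul_add, hab]
  simp only [hsum']
  refine (setLIntegral_mono' measurableSet_Ioo fun r hr => ?_).trans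
    (lintegral_mono_set (Ioo_subset_Iio_self (a := (0 : ℝ))))
  have hr' : 0 < r.toNNReal := Real.toNNReal_pos.2 hr.1
  have h1 := lintegral_exp_le_pert hD hF hF0 hm hT hK x hr' hj
  rw [Real.coe_toNNReal _ hr.1.le] at h1
  rw [hui r hj]
  exact (lintegral_mono fun ω => mul_le_mul_left (expWeight_le F _ ω) _).trans h1

end Paths

end

/-! ### Fixed times and signed integrands. -/

section

open ProbabilityTheory

variable {d : ℕ} {Ω : Type*} [mΩ : MeasurableSpace Ω] {Z : HuntProcess (Eu d) Ω}
  {m : Measure (Eu d)} [SFinite m] {pk : ℝ → Eu d → Eu d → ℝ≥0∞} {j : Eu d → Eu d → ℝ≥0∞}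

section Paths

variable (hD : LevyData Z m pk j)

include hD in
/-- There is almost surely no jump at a fixed time. -/
theorem ae_jumpOn_Ioo_eq {f : Eu d → Eu d → ℝ≥0∞} (hf : Measurable (Function.uncurry f))
    (hf0 : ∀ x, f x x = 0) {x : Eu d} {t : ℝ≥0} (ht : 0 < t)
    (hfin : ∫⁻ ω, jumpOn Z f (Ioc 0 t) ω ∂(Z.P x) ≠ ∞) :
    ∀ᵐ ω ∂(Z.P x), jumpOn Z f (Ioo 0 t) ω = jumpOn Z f (Ioc 0 t) ω := by
  have hle (ω) : jumpOn Z f (Ioo 0 t) ω ≤ jumpOn Z f (Ioc 0 t) ω :=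
    jumpOn_mono_set Z Ioo_subset_Ioc_self f ω
  refine ae_eq_of_ae_le_of_lintegral_le (Eventually.of_forall hle)
    (ne_top_of_le_ne_top hfin (lintegral_mono hle))
    ((measurable_jumpOn hD hf hf0 ht).mono (Z.filt.le _) le_rfl).aemeasurable ?_
  rw [lintegral_jumpOn hD hf hf0 ht, extendZero_coe]
  obtain ⟨u, hu, hut, hulim⟩ := exists_seq_strictMono_tendsto' ht
  have hU : Ioo (0 : ℝ) t = ⋃ n, Ioc (0 : ℝ) (u n) := by
    ext s
    simp only [mem_Ioo, mem_iUnion, mem_Ioc]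
    constructor
    · rintro ⟨h0, h1⟩
      have h2 : Tendsto (fun n => (u n : ℝ)) atTop (𝓝 t) := NNReal.tendsto_coe.2 hulim
      obtain ⟨n, hn⟩ := (h2.eventually (lt_mem_nhds h1)).exists
      exact ⟨n, h0, hn.le⟩
    · rintro ⟨n, h0, h1⟩
      exact ⟨h0, h1.trans_lt (by exact_mod_cast (hut n).2)⟩
  have hmono : Monotone fun n => Ioc (0 : ℝ) (u n) := fun n k h =>
    Ioc_subset_Ioc le_rfl (by exact_mod_cast hu.monotone h)
  -- The compensator is an integral in time and does not charge {t}; the means over [0,t) and over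
  -- (0,t] therefore coincide.
  rw [jumpComp, setLIntegral_congr Ioo_ae_eq_Ioc.symm, hU,
    setLIntegral_iUnion_of_directed _ hmono.directed_le]
  refine iSup_le fun n => ?_
  have h := lintegral_jumpOn hD hf hf0 (hut n).1 (x : OnePoint (Eu d))
  rw [extendZero_coe] at h
  rw [← jumpComp, ← h]
  exact lintegral_mono fun ω => jumpOn_mono_set Z (Ioc_subset_Ioo_right (hut n).2) f ω

variable {F : Eu d → Eu d → ℝ} (hF : Measurable (Function.uncurry F))
  (hF0 : ∀ x, F x x = 0)

include hD hF hF0 in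
-- Finiteness of the mean gives absolute summability. The absence of a contribution at t identifies
-- the weight over the strict past with e^{-A_t}.
theorem ae_summable_jumpSum {x : Eu d} {t : ℝ≥0} (ht : 0 < t)
    (hfin : ∫⁻ ω, jumpOn Z (expAbs F) (Ioc 0 t) ω ∂(Z.P x) ≠ ∞) :
    ∀ᵐ ω ∂(Z.P x), (Summable fun s : Ioc (0 : ℝ≥0) t =>
        extendZero₂ F (Function.leftLim (fun u => Z.X u ω) s.1) (Z.X s.1 ω)) ∧
      expWeight Z F t ω = ENNReal.ofReal (Real.exp (-jumpSum Z F t ω)) := by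
  have hm : Measurable (Function.uncurry fun w y => ENNReal.ofReal |F w y|) :=
    ENNReal.measurable_ofReal.comp hF.norm
  have hle (ω) : jumpOn Z (fun w y => ENNReal.ofReal |F w y|) (Ioc 0 t) ω ≤
      jumpOn Z (expAbs F) (Ioc 0 t) ω := jumpOn_mono Z (ofReal_abs_le_expAbs F) _ ω
  have hfin' := ne_top_of_le_ne_top hfin (lintegral_mono hle)
  have hjm := (measurable_jumpOn hD hm (by simp [hF0]) ht).mono (Z.filt.le _) le_rfl
  filter_upwards [ae_lt_top hjm hfin', ae_jumpOn_Ioo_eq hD hm (by simp [hF0]) ht hfin']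
    with ω h1 h2
  have h3 := h1.ne
  rw [jumpOn_ofReal (φ := fun u => |u|) abs_zero] at h3
  have hs := summable_of_tsum_ofReal_abs h3
  have hIoo : jumpOn Z (fun w y => ENNReal.ofReal |F w y|) (Ioo 0 t) ω ≠ ∞ := h2 ▸ h1.ne
  have hpt : jumpAt Z F ω t = 0 := by
    have hd : Disjoint (Ioo 0 t) ({t} : Set ℝ≥0) := by simp
    have h4 : jumpOn Z (fun w y => ENNReal.ofReal |F w y|) (Ioc 0 t) ω =
        jumpOn Z (fun w y => ENNReal.ofReal |F w y|) (Ioo 0 t) ω +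
          jumpOn Z (fun w y => ENNReal.ofReal |F w y|) {t} ω := by
      rw [← jumpOn_union Z hd, Ioo_union_right ht]
    rw [← h2] at h4
    have h5 : jumpOn Z (fun w y => ENNReal.ofReal |F w y|) {t} ω = 0 := by
      have h6 : jumpOn Z (fun w y => ENNReal.ofReal |F w y|) (Ioo 0 t) ω + 0 =
        jumpOn Z (fun w y => ENNReal.ofReal |F w y|) (Ioo 0 t) ω +
          jumpOn Z (fun w y => ENNReal.ofReal |F w y|) {t} ω := by rw [add_zero, ← h4]
      exact ((ENNReal.add_right_inj hIoo).1 h6).symm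
    rw [jumpOn_ofReal (φ := fun u => |u|) abs_zero, ENNReal.tsum_eq_zero] at h5
    have := h5 t
    simpa using this
  refine ⟨?_, ?_⟩
  · exact summable_subtype_iff_indicator.2 hs
  · rw [expWeight_eq hIoo]
    congr 3
    change _ = ∑' s : Ioc (0 : ℝ≥0) t, jumpAt Z F ω s
    rw [tsum_subtype (Ioc 0 t) (jumpAt Z F ω)]
    refine tsum_congr fun s => ?_
    by_cases hst : s = t
    · rw [hst, indicator_of_notMem (by simp), indicator_of_mem (by simp [ht]), hpt]
    · by_cases hs' : s ∈ Ioo 0 t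
      · rw [indicator_of_mem hs', indicator_of_mem (Ioo_subset_Ioc_self hs')]
      · rw [indicator_of_notMem hs', indicator_of_notMem]
        exact fun h => hs' ⟨h.1, lt_of_le_of_ne h.2 hst⟩

theorem ofReal_mul_extendZero {c : ℝ} (hc : 0 ≤ c) (g : Eu d → ℝ) (y : OnePoint (Eu d)) :
    ENNReal.ofReal (c * extendZero g y) =
      ENNReal.ofReal c * extendZero (fun z => ENNReal.ofReal (g z)) y := by
  rw [ENNReal.ofReal_mul hc]
  congr 1
  induction y using OnePoint.rec <;> simp

theorem extendZero_neg (g : Eu d → ℝ) (y : OnePoint (Eu d)) :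
    extendZero (fun z => -g z) y = -extendZero g y := by
  induction y using OnePoint.rec <;> simp

include hD hF hF0 in
/-- Passage from the nonnegative identity to signed integrands. -/
theorem integral_exp_neg_jumpSum {x : Eu d} {t : ℝ≥0} (ht : 0 < t)
    (hfin : ∫⁻ ω, jumpOn Z (expAbs F) (Ioc 0 t) ω ∂(Z.P x) ≠ ∞)
    {Rp Rm : Eu d → ℝ≥0∞} (hRp : Measurable Rp) (hRm : Measurable Rm)
    (hp : ∫⁻ z, Rp z ∂m ≠ ∞) (hm : ∫⁻ z, Rm z ∂m ≠ ∞) (hpt : ∀ z, Rp z ≠ ∞) (hmt : ∀ z, Rm z ≠ ∞)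
    (key : ∀ g : Eu d → ℝ≥0∞, Measurable g → (∀ y, g y ≤ 1) →
      ∫⁻ ω, expWeight Z F t ω * extendZero g (Z.X t ω) ∂(Z.P x) + ∫⁻ z, Rm z * g z ∂m =
        ∫⁻ z, Rp z * g z ∂m)
    {g : Eu d → ℝ} (hg : Measurable g) {K : ℝ} (hgK : ∀ z, |g z| ≤ K) :
    Integrable (fun z => ((Rp z).toReal - (Rm z).toReal) * g z) m ∧
    Integrable (fun ω => Real.exp (-jumpSum Z F t ω) * extendZero g (Z.X t ω)) (Z.P x) ∧
    ∫ z, ((Rp z).toReal - (Rm z).toReal) * g z ∂m =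
      ∫ ω, Real.exp (-jumpSum Z F t ω) * extendZero g (Z.X t ω) ∂(Z.P x) := by
  have hWm : Measurable (Function.uncurry (expWeight Z F)) := measurable_uncurry_expWeight hD hF hF0
  have hWt : Measurable (expWeight Z F t) := hWm.of_uncurry_left
  have hXg {g : Eu d → ℝ} (hg : Measurable g) : Measurable fun ω => extendZero g (Z.X t ω) :=
    (measurable_extendZero hg).comp (measurable_X Z t)
  -- Both sides are integrals of g against measures, so the identity passes from g ≤ 1 to all
  -- nonnegative functions, in particular to the two parts of a signed g.
  have hgen (f : Eu d → ℝ≥0∞) (hf : Measurable f) :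
      ∫⁻ ω, expWeight Z F t ω * extendZero f (Z.X t ω) ∂(Z.P x) + ∫⁻ z, Rm z * f z ∂m =
        ∫⁻ z, Rp z * f z ∂m := by
    have e1 {f : Eu d → ℝ≥0∞} (hf : Measurable f) :
        ∫⁻ ω, expWeight Z F t ω * extendZero f (Z.X t ω) ∂(Z.P x) + ∫⁻ z, Rm z * f z ∂m =
        ∫⁻ z, f z ∂(rowKernel Z x (expWeight Z F) t + m.withDensity Rm) := by
      rw [lintegral_add_measure, lintegral_rowKernel _ hWm _ hf, Real.toNNReal_coe,
        lintegral_withDensity_eq_lintegral_mul _ hRm hf]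
      rfl
    have e2 {f : Eu d → ℝ≥0∞} (hf : Measurable f) :
        ∫⁻ z, Rp z * f z ∂m = ∫⁻ z, f z ∂(m.withDensity Rp) :=
      (lintegral_withDensity_eq_lintegral_mul _ hRp hf).symm
    rw [e1 hf, e2 hf]
    refine le_antisymm (lintegral_le_of_bounded (fun g hg hg1 _ => ?_) f)
      (lintegral_le_of_bounded (fun g hg hg1 _ => ?_) f)
    · rw [← e1 hg, ← e2 hg]; exact (key g hg hg1).le
    · rw [← e1 hg, ← e2 hg]; exact (key g hg hg1).ge
  have hae := ae_summable_jumpSum hD hF hF0 ht hfin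
  have hint {R : Eu d → ℝ≥0∞} (hR : Measurable R) (hRi : ∫⁻ z, R z ∂m ≠ ∞) :
      Integrable (fun z => (R z).toReal * g z) m := by
    refine (integrable_toReal_of_lintegral_ne_top hR.aemeasurable hRi).mul_bdd (c := K)
      hg.aestronglyMeasurable (Eventually.of_forall hgK)
  have hpos {R : Eu d → ℝ≥0∞} (hR : ∀ z, R z ≠ ∞) (g : Eu d → ℝ) (z) :
      ENNReal.ofReal ((R z).toReal * g z) = R z * ENNReal.ofReal (g z) := by
    rw [ENNReal.ofReal_mul ENNReal.toReal_nonneg, ENNReal.ofReal_toReal (hR z)]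
  have hposW (g : Eu d → ℝ) : ∫⁻ ω, ENNReal.ofReal (Real.exp (-jumpSum Z F t ω) *
      extendZero g (Z.X t ω)) ∂(Z.P x) = ∫⁻ ω, expWeight Z F t ω *
        extendZero (fun z => ENNReal.ofReal (g z)) (Z.X t ω) ∂(Z.P x) := by
    refine lintegral_congr_ae ?_
    filter_upwards [hae] with ω hω
    rw [ofReal_mul_extendZero (Real.exp_pos _).le, hω.2]
  have hbd (f : Eu d → ℝ) (hf : ∀ z, f z ≤ K) {R : Eu d → ℝ≥0∞} (hRi : ∫⁻ z, R z ∂m ≠ ∞) :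
      ∫⁻ z, R z * ENNReal.ofReal (f z) ∂m ≠ ∞ := by
    refine ne_top_of_le_ne_top (ENNReal.mul_ne_top hRi ENNReal.ofReal_ne_top)
      (b := (∫⁻ z, R z ∂m) * ENNReal.ofReal K) ?_
    rw [← lintegral_mul_const' _ _ ENNReal.ofReal_ne_top]
    exact lintegral_mono fun z => by gcongr; exact hf z
  have hK1 (z) : g z ≤ K := (le_abs_self _).trans (hgK z)
  have hK2 (z) : -g z ≤ K := (neg_le_abs _).trans (hgK z)
  have g1 := hgen (fun z => ENNReal.ofReal (g z)) (by fun_prop)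
  have g2 := hgen (fun z => ENNReal.ofReal (-g z)) (by fun_prop)
  have f1 := hbd g hK1 hp
  have f2 := hbd (fun z => -g z) hK2 hp
  have w1 := ne_top_of_le_ne_top f1 (g1 ▸ le_self_add)
  have w2 := ne_top_of_le_ne_top f2 (g2 ▸ le_self_add)
  have hWint : Integrable (fun ω => Real.exp (-jumpSum Z F t ω) * extendZero g (Z.X t ω))
      (Z.P x) := by
    refine ⟨?_, ?_⟩
    · refine AEStronglyMeasurable.mul ?_ (hXg hg).aestronglyMeasurable
      refine (hWt.ennreal_toReal.aestronglyMeasurable).congr ?_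
      filter_upwards [hae] with ω hω
      rw [hω.2, ENNReal.toReal_ofReal (Real.exp_pos _).le]
    · rw [hasFiniteIntegral_iff_norm]
      have e (ω : Ω) : ENNReal.ofReal ‖Real.exp (-jumpSum Z F t ω) * extendZero g (Z.X t ω)‖ ≤
          ENNReal.ofReal (Real.exp (-jumpSum Z F t ω) * extendZero g (Z.X t ω)) +
          ENNReal.ofReal (Real.exp (-jumpSum Z F t ω) * extendZero (fun z => -g z) (Z.X t ω)) := by
        rw [extendZero_neg, Real.norm_eq_abs]
        rcases le_total 0 (Real.exp (-jumpSum Z F t ω) * extendZero g (Z.X t ω)) with h | h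
        · rw [abs_of_nonneg h]; exact le_self_add
        · rw [abs_of_nonpos h, mul_neg]; exact le_add_self
      refine lt_of_le_of_lt (lintegral_mono e) ?_
      have hm1 : AEMeasurable (fun ω => ENNReal.ofReal (Real.exp (-jumpSum Z F t ω) *
          extendZero g (Z.X t ω))) (Z.P x) := by
        refine (hWt.mul ((measurable_extendZero (g := fun z => ENNReal.ofReal (g z))
          (by fun_prop)).comp (measurable_X Z t))).aemeasurable.congr ?_
        filter_upwards [hae] with ω hω
        rw [ofReal_mul_extendZero (Real.exp_pos _).le, ← hω.2]
        rfl
      rw [lintegral_add_left' hm1, hposW g, hposW fun z => -g z]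
      exact ENNReal.add_lt_top.2 ⟨w1.lt_top, w2.lt_top⟩
  refine ⟨?_, hWint, ?_⟩
  · simp only [sub_mul]
    exact (hint hRp hp).sub (hint hRm hm)
  · simp only [sub_mul]
    rw [integral_sub (hint hRp hp) (hint hRm hm),
      integral_eq_lintegral_pos_part_sub_lintegral_neg_part (hint hRp hp),
      integral_eq_lintegral_pos_part_sub_lintegral_neg_part (hint hRm hm),
      integral_eq_lintegral_pos_part_sub_lintegral_neg_part hWint]
    simp only [← mul_neg, ← extendZero_neg]
    rw [hposW g, hposW fun z => -g z]
    simp only [hpos hpt, hpos hmt]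
    have hn {R : Eu d → ℝ≥0∞} (hR : ∀ z, R z ≠ ∞) (z) :
        ENNReal.ofReal ((R z).toReal * -g z) = R z * ENNReal.ofReal (-g z) :=
      hpos hR (fun z => -g z) z
    simp only [hn hpt, hn hmt]
    rw [← g1, ← g2, ENNReal.toReal_add w1 (hbd g hK1 hm), ENNReal.toReal_add w2 (hbd _ hK2 hm)]
    ring

end Paths

end

/-! ### Identification of q_n with coloured terms. -/

section

open ProbabilityTheory

section Symmetry

variable {S : Type*} [MeasurableSpace S] {μ : Measure S} [SFinite μ]
  {P : ℝ × S → ℝ × S → ℝ≥0∞} {κ : ℕ → S → S → ℝ≥0∞}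

/-- The terms of the expansion inherit the space-time symmetries of `P` and `κ`. -/
theorem expTerm_symm (e : S ≃ᵐ S) (he : MeasurePreserving e μ μ) (c : ℝ)
    (hPe : ∀ s t x z, P (s + c, e x) (t + c, e z) = P (s, x) (t, z))
    (hκe : ∀ i x y, κ i (e x) (e y) = κ i x y) (n : ℕ) (s t : ℝ) (x z : S) :
    expTerm μ P κ n (s + c, e x) (t + c, e z) = expTerm μ P κ n (s, x) (t, z) := by
  induction n using Nat.strong_induction_on generalizing s x with
  | _ n ih =>
    cases n with
    | zero => rw [expTerm_zero]; exact hPe s t x z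
    | succ n =>
      have hrm : ∀ i (r : ℝ) (y : S), rmul μ P (κ i) (s + c, e x) (r + c, e y) =
          rmul μ P (κ i) (s, x) (r, y) := by
        intro i r y
        unfold rmul
        rw [← he.lintegral_comp_emb e.measurableEmbedding]
        simp only [hPe, hκe]
      have hprod : MeasurePreserving (Prod.map (MeasurableEquiv.addRight c) e : ℝ × S → ℝ × S)
          (volume.prod μ) (volume.prod μ) := (measurePreserving_add_right volume c).prod he
      have hemb : MeasurableEmbedding (Prod.map (MeasurableEquiv.addRight c) e : ℝ × S → ℝ × S) :=
        (MeasurableEquiv.addRight c).measurableEmbedding.prodMap e.measurableEmbedding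
      rw [expTerm_succ, expTerm_succ]
      refine Finset.sum_congr rfl fun i _ => ?_
      unfold kcomp
      rw [← hprod.lintegral_comp_emb hemb]
      refine lintegral_congr fun u => ?_
      obtain ⟨r, y⟩ := u
      have e1 : (Prod.map (MeasurableEquiv.addRight c) e : ℝ × S → ℝ × S) (r, y) =
        (r + c, e y) := rfl
      rw [e1, hrm, ih _ (by omega)]

theorem expTerm_causal (hP : IsTransition μ P) (n : ℕ) (s t : ℝ) (x z : S) (h : t ≤ s) :
    expTerm μ P κ n (s, x) (t, z) = 0 := by
  induction n using Nat.strong_induction_on generalizing s x with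
  | _ n ih =>
    cases n with
    | zero => rw [expTerm_zero]; exact hP.causal s t x z h
    | succ n =>
      rw [expTerm_succ]
      refine Finset.sum_eq_zero fun i _ => ?_
      unfold kcomp
      refine (lintegral_congr fun u => ?_).trans lintegral_zero
      obtain ⟨r, y⟩ := u
      rcases le_or_gt r s with hr | hr
      · simp [rmul, hP.causal s r x _ hr]
      · rw [ih _ (by omega) r y (h.trans hr.le), mul_zero]

end Symmetry

section Real

theorem integrable_of_toReal_sub {T : Type*} [MeasurableSpace T] {ν : Measure T} {U V : T → ℝ≥0∞}
    {f : T → ℝ} (hU : AEMeasurable U ν) (hV : AEMeasurable V ν) (hUi : ∫⁻ v, U v ∂ν ≠ ∞)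
    (hVi : ∫⁻ v, V v ∂ν ≠ ∞) (hf : f =ᵐ[ν] fun v => (U v).toReal - (V v).toReal) :
    Integrable f ν ∧ ∫ v, f v ∂ν = (∫⁻ v, U v ∂ν).toReal - (∫⁻ v, V v ∂ν).toReal := by
  have h1 := integrable_toReal_of_lintegral_ne_top hU hUi
  have h2 := integrable_toReal_of_lintegral_ne_top hV hVi
  refine ⟨(h1.sub h2).congr hf.symm, ?_⟩
  rw [integral_congr_ae hf, integral_sub h1 h2, integral_toReal hU (ae_lt_top' hU hUi),
    integral_toReal hV (ae_lt_top' hV hVi)]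

/-- Absolute convergence on the product space identifies the iterated integral in the recursion with
a single integral. -/
theorem integral_iterated {E : Type*} [MeasurableSpace E] {m : Measure E} [SFinite m] {t : ℝ}
    (ht : 0 ≤ t) {f : ℝ → E → ℝ} {h : ℝ → E → E → ℝ}
    (hi : Integrable (fun v : ℝ × E × E => f v.1 v.2.1 * h v.1 v.2.1 v.2.2)
      ((volume.restrict (Ioc 0 t)).prod (m.prod m))) :
    ∫ s in (0 : ℝ)..t, ∫ w, f s w * (∫ y, h s w y ∂m) ∂m =
      ∫ v : ℝ × E × E, f v.1 v.2.1 * h v.1 v.2.1 v.2.2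
        ∂((volume.restrict (Ioc 0 t)).prod (m.prod m)) := by
  rw [intervalIntegral.integral_of_le ht, integral_prod _ hi]
  refine integral_congr_ae ?_
  filter_upwards [hi.prod_right_ae] with s hs
  rw [integral_prod _ hs]
  simp only [integral_const_mul]

end Real

section Coloured

variable {d : ℕ} (m : Measure (Eu d)) [SFinite m] (pk : ℝ → Eu d → Eu d → ℝ≥0∞)
  (j : Eu d → Eu d → ℝ≥0∞) (a b : ℕ → Eu d → Eu d → ℝ≥0∞)

/-- The coloured terms of order `n` of the Feynman–Kac expansion. -/
noncomputable def fkTerm (n : ℕ) (t : ℝ) (x z : Eu d) (c : Bool) : ℝ≥0∞ :=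
  expTerm (colMeasure m) (colP (stP pk))
    (fun i => colK (fun w y => j w y * a i w y) fun w y => j w y * b i w y) n
    (0, (x, true)) (t, (z, c))

variable {m pk j a b} (hT : IsTransition m (stP pk)) (hj : Measurable (Function.uncurry j))
  (ha : ∀ i, Measurable (Function.uncurry (a i))) (hb : ∀ i, Measurable (Function.uncurry (b i)))

include hj in
theorem measurable_mul_of {f : Eu d → Eu d → ℝ≥0∞} (hf : Measurable (Function.uncurry f)) :
    Measurable (Function.uncurry fun w y => j w y * f w y) := hj.mul hf

theorem colP_shift (c s t : ℝ) (x z : Eu d × Bool) :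
    colP (stP pk) (s + c, x) (t + c, z) = colP (stP pk) (s, x) (t, z) := by
  simp [colP, stP]

/-- A time shift reduces the starting time to 0, and flipping both colours reduces the initial
colour to `true`. Only the elapsed time and the equality of the colours remain. -/
theorem expTerm_eq_fkTerm (n : ℕ) (s t : ℝ) (x z : Eu d) (c c' : Bool) :
    expTerm (colMeasure m) (colP (stP pk))
      (fun i => colK (fun w y => j w y * a i w y) fun w y => j w y * b i w y) n
      (s, (x, c)) (t, (z, c')) = fkTerm m pk j a b n (t - s) x z (c == c') := by
  have e1 := expTerm_symm (μ := colMeasure m) (P := colP (stP pk))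
    (κ := fun i => colK (fun w y => j w y * a i w y) fun w y => j w y * b i w y)
    (MeasurableEquiv.refl _) (MeasurePreserving.id _) s
    (fun s' t x z => colP_shift s s' t x z) (fun i x y => rfl) n 0 (t - s) (x, c) (z, c')
  have e2 := expTerm_symm (μ := colMeasure m) (P := colP (stP pk))
    (κ := fun i => colK (fun w y => j w y * a i w y) fun w y => j w y * b i w y)
    (flipColour (Eu d)) measurePreserving_flipColour 0
    (fun s t x z => by rw [colP_shift]; exact colP_flip s t x.1 z.1 x.2 z.2)
    (fun i x y => colK_flip x.1 y.1 x.2 y.2) n 0 (t - s) (x, true) (z, !c')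
  simp only [zero_add, sub_add_cancel, MeasurableEquiv.refl_apply, add_zero, flipColour_apply,
    Bool.not_true, Bool.not_not] at e1 e2
  rw [e1]
  cases c
  · rw [e2]; cases c' <;> rfl
  · cases c' <;> rfl

include hT hj ha hb in
theorem measurable_fkTerm (n : ℕ) (c : Bool) :
    Measurable fun q : ℝ × Eu d × Eu d => fkTerm m pk j a b n q.1 q.2.1 q.2.2 c :=
  (measurable_expTerm (isTransition_colP hT) (fun i => measurable_colK
    (measurable_mul_of hj (ha i)) (measurable_mul_of hj (hb i))) n).comp
    (f := fun q : ℝ × Eu d × Eu d => (((0, (q.2.1, true)) : ℝ × (Eu d × Bool)),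
      ((q.1, (q.2.2, c)) : ℝ × (Eu d × Bool)))) (by fun_prop)

variable (m pk j a b) in
/-- The contribution to `fkTerm` of a first jump of density `j f`. -/
noncomputable def firstJump (f : Eu d → Eu d → ℝ≥0∞) (k : ℕ) (t : ℝ) (x z : Eu d) (c : Bool) :
    ℝ≥0∞ :=
  ∫⁻ v : ℝ × Eu d × Eu d, pk v.1 x v.2.1 * (j v.2.1 v.2.2 * f v.2.1 v.2.2) *
    fkTerm m pk j a b k (t - v.1) v.2.2 z c ∂((volume.restrict (Ioc 0 t)).prod (m.prod m))

include hT hj ha hb in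
-- The integral over all times reduces to (0, t]: the first factor vanishes before 0 and the second
-- after t.
theorem firstJump_eq {f : Eu d → Eu d → ℝ≥0∞} (hf : Measurable (Function.uncurry f)) (k : ℕ)
    (t : ℝ) (x z : Eu d) (c : Bool) :
    firstJump m pk j a b f k t x z c = ∫⁻ v : ℝ × Eu d,
      rmul m (stP pk) (fun w y => j w y * f w y) (0, x) v *
        fkTerm m pk j a b k (t - v.1) v.2 z c ∂(volume.prod m) := by
  have hE := measurable_fkTerm hT hj ha hb k c
  have hjf := measurable_mul_of hj hf
  have hP : Measurable fun q : ℝ × Eu d => pk (q.1 - 0) x q.2 := hT.meas.of_uncurry_left (x := (0, x))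
  have hP' : Measurable fun q : ℝ × Eu d => pk q.1 x q.2 := by simpa only [sub_zero] using hP
  have hEv : Measurable fun v : ℝ × Eu d => fkTerm m pk j a b k (t - v.1) v.2 z c :=
    hE.comp (f := fun v : ℝ × Eu d => (t - v.1, v.2, z)) (by fun_prop)
  have hmeas : Measurable fun v : ℝ × Eu d × Eu d => pk v.1 x v.2.1 * (j v.2.1 v.2.2 * f v.2.1 v.2.2) *
      fkTerm m pk j a b k (t - v.1) v.2.2 z c :=
    ((hP'.comp (f := fun v : ℝ × Eu d × Eu d => (v.1, v.2.1)) (by fun_prop)).mul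
      (hjf.comp measurable_snd)).mul
      (hEv.comp (f := fun v : ℝ × Eu d × Eu d => (v.1, v.2.2)) (by fun_prop))
  rw [firstJump, lintegral_prod _ hmeas.aemeasurable, lintegral_prod _ (by
    exact ((measurable_rmul hT.meas hjf).of_uncurry_left.mul hEv).aemeasurable),
    ← lintegral_indicator measurableSet_Ioc]
  refine lintegral_congr fun r => ?_
  by_cases hr : r ∈ Ioc 0 t
  · rw [indicator_of_mem hr, lintegral_prod_symm _ (by
      exact (hmeas.comp measurable_prodMk_left).aemeasurable)]
    refine lintegral_congr fun y => ?_
    have h1 : Measurable fun w => pk r x w * (j w y * f w y) :=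
      (hP'.comp measurable_prodMk_left).mul hjf.of_uncurry_right
    simp only [rmul, stP, sub_zero]
    exact lintegral_mul_const _ h1
  · rw [indicator_of_notMem hr]
    refine (lintegral_zero.symm.trans (lintegral_congr fun y => ?_))
    rcases le_or_gt r 0 with h0 | h0
    · simp [rmul, hT.causal 0 r x _ h0]
    · have : t - r ≤ 0 := by
        by_contra h
        exact hr ⟨h0, by linarith⟩
      rw [fkTerm, expTerm_causal (isTransition_colP hT) k 0 (t - r) _ _ this, mul_zero]

theorem fkTerm_zero (t : ℝ) (x z : Eu d) (c : Bool) :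
    fkTerm m pk j a b 0 t x z c = if c then pk t x z else 0 := by
  rw [fkTerm, expTerm_zero]
  cases c <;> simp [colP, stP]

include hT hj ha hb in
-- A first jump from `a i` keeps the colour, so the rest must realize the colour change c; a first
-- jump from `b i` flips it, so the rest must realize the opposite one.
theorem fkTerm_succ (n : ℕ) (t : ℝ) (x z : Eu d) (c : Bool) :
    fkTerm m pk j a b (n + 1) t x z c = ∑ i ∈ Finset.range (n + 1),
      (firstJump m pk j a b (a i) (n - i) t x z c +
        firstJump m pk j a b (b i) (n - i) t x z !c) := by
  rw [fkTerm, expTerm_succ]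
  refine Finset.sum_congr rfl fun i _ => ?_
  have hja := measurable_mul_of hj (ha i)
  have hjb := measurable_mul_of hj (hb i)
  have hC := isTransition_colP hT
  have hE (k : ℕ) (c : Bool) : Measurable fun v : ℝ × Eu d =>
      fkTerm m pk j a b k (t - v.1) v.2 z c :=
    (measurable_fkTerm hT hj ha hb k c).comp (f := fun v : ℝ × Eu d => (t - v.1, v.2, z))
      (by fun_prop)
  unfold kcomp
  rw [lintegral_prod_colMeasure (by
    exact (measurable_rmul hC.meas (measurable_colK hja hjb)).of_uncurry_left.mul
      (measurable_expTerm hC (fun i => measurable_colK (measurable_mul_of hj (ha i))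
        (measurable_mul_of hj (hb i))) (n - i)).of_uncurry_right),
    firstJump_eq hT hj ha hb (ha i), firstJump_eq hT hj ha hb (hb i), ← lintegral_add_left (by
      exact (measurable_rmul hT.meas hja).of_uncurry_left.mul (hE _ _))]
  refine lintegral_congr fun v => ?_
  rw [rmul_col hT.meas hja hjb, rmul_col hT.meas hja hjb, expTerm_eq_fkTerm, expTerm_eq_fkTerm]
  cases c <;> simp

variable (m pk j a b) in
/-- The coloured kernel of the Feynman–Kac semigroup. -/
noncomputable def fkSum (t : ℝ) (x z : Eu d) (c : Bool) : ℝ≥0∞ := ∑' n, fkTerm m pk j a b n t x z c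

include hT hj ha hb in
theorem measurable_fkSum (c : Bool) :
    Measurable fun q : ℝ × Eu d × Eu d => fkSum m pk j a b q.1 q.2.1 q.2.2 c :=
  Measurable.tsum fun n => measurable_fkTerm hT hj ha hb n c

include hT hj ha hb in
-- The perturbation series by number of jumps, regrouped by total Taylor degree.
theorem pert_eq_fkSum (s t : ℝ) (x z : Eu d) (c c' : Bool) :
    pert (colMeasure m) (colP (stP pk))
      (colK (fun w y => j w y * ∑' i, a i w y) fun w y => j w y * ∑' i, b i w y)
      (s, (x, c)) (t, (z, c')) = fkSum m pk j a b (t - s) x z (c == c') := by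
  unfold fkSum
  simp only [← expTerm_eq_fkTerm]
  rw [tsum_expTerm (isTransition_colP hT) (fun i => measurable_colK
    (measurable_mul_of hj (ha i)) (measurable_mul_of hj (hb i)))]
  congr 1
  funext v w
  unfold colK
  split_ifs <;> exact ENNReal.tsum_mul_left.symm

include hT hj ha hb in
theorem fkSum_ck {t s : ℝ} (ht : 0 < t) (hs : 0 < s) (x z : Eu d) (c : Bool) :
    fkSum m pk j a b (t + s) x z c =
      ∫⁻ y, (fkSum m pk j a b t x y true * fkSum m pk j a b s y z c +
        fkSum m pk j a b t x y false * fkSum m pk j a b s y z !c) ∂m := by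
  have hA : Measurable (Function.uncurry fun w y => ∑' i, a i w y) := Measurable.tsum ha
  have hB : Measurable (Function.uncurry fun w y => ∑' i, b i w y) := Measurable.tsum hb
  have hκ := measurable_colK (measurable_mul_of hj hA) (measurable_mul_of hj hB)
  have hC := isTransition_colP hT
  have hR := measurable_pert (μ := colMeasure m) hC hκ
  have h := pert_ck hC hκ 0 t (t + s) (x, true) (z, c) ht (by linarith)
  rw [lintegral_colMeasure (by
    exact (hR.of_uncurry_left.comp measurable_prodMk_left).mul
      (hR.of_uncurry_right.comp measurable_prodMk_left))] at h
  simp only [pert_eq_fkSum hT hj ha hb] at h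
  simp only [sub_zero, add_sub_cancel_left] at h
  cases c <;> exact h

section Signed

variable {α : ℝ} {C : Eu d → Eu d → ℝ} {p : ℝ → Eu d → Eu d → ℝ} {F : Eu d → Eu d → ℝ}
  (hfin : ∀ n t x z c, fkTerm m pk j a b n t x z c ≠ ∞)
  (hp : ∀ t, 0 < t → ∀ x z, (pk t x z).toReal = p t x z) (hpt : ∀ t x z, pk t x z ≠ ∞)
  (hjC : ∀ w y, (j w y).toReal = jumpDensity α C w y) (hjt : ∀ w y, j w y ≠ ∞)
  (hat : ∀ i w y, a i w y ≠ ∞) (hbt : ∀ i w y, b i w y ≠ ∞)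
  (hab : ∀ i w y, (a i w y).toReal - (b i w y).toReal = (-F w y) ^ (i + 1) / (i + 1).factorial)
include hT hj ha hb hfin hp hpt hjC hjt hat hbt hab

/-- Up to sign and factorials the integrand is the product of the differences a - b and (colour
kept) - (colour changed), with a nonnegative factor p j. The four products regroup into U - V, and
the integrals of U and V are finite because they are parts of the terms of order n + 1. -/
theorem integrable_first_jump {n i : ℕ} (hi : i ≤ n) {t : ℝ} (x z : Eu d)
    (ih : ∀ s, 0 < s → ∀ y, (-1 : ℝ) ^ (n - i) * qTerm α C m p F (n - i) s y z /
      ((n - i).factorial : ℝ) = (fkTerm m pk j a b (n - i) s y z true).toReal -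
        (fkTerm m pk j a b (n - i) s y z false).toReal) :
    Integrable (fun v : ℝ × Eu d × Eu d => p v.1 x v.2.1 * (jumpDensity α C v.2.1 v.2.2 *
        F v.2.1 v.2.2 ^ (i + 1) * qTerm α C m p F (n - i) (t - v.1) v.2.2 z))
      ((volume.restrict (Ioc 0 t)).prod (m.prod m)) ∧
    ∫ v : ℝ × Eu d × Eu d, p v.1 x v.2.1 * (jumpDensity α C v.2.1 v.2.2 *
        F v.2.1 v.2.2 ^ (i + 1) * qTerm α C m p F (n - i) (t - v.1) v.2.2 z)
      ∂((volume.restrict (Ioc 0 t)).prod (m.prod m)) =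
      (-1) ^ (n + 1) * ((i + 1).factorial * (n - i).factorial) *
      (((firstJump m pk j a b (a i) (n - i) t x z true).toReal +
        (firstJump m pk j a b (b i) (n - i) t x z false).toReal) -
      ((firstJump m pk j a b (a i) (n - i) t x z false).toReal +
        (firstJump m pk j a b (b i) (n - i) t x z true).toReal)) := by
  set ν := (volume.restrict (Ioc 0 t)).prod (m.prod m) with hν
  have hfj (c : Bool) : firstJump m pk j a b (a i) (n - i) t x z c +
      firstJump m pk j a b (b i) (n - i) t x z (!c) ≠ ∞ := by
    refine ne_top_of_le_ne_top (hfin (n + 1) t x z c) ?_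
    rw [fkTerm_succ hT hj ha hb]
    exact Finset.single_le_sum (f := fun i => firstJump m pk j a b (a i) (n - i) t x z c +
        firstJump m pk j a b (b i) (n - i) t x z !c) (fun _ _ => zero_le)
        (Finset.mem_range.2 (by omega))
  have hP' : Measurable fun q : ℝ × Eu d => pk q.1 x q.2 := by
    have hP : Measurable fun q : ℝ × Eu d => pk (q.1 - 0) x q.2 :=
      hT.meas.of_uncurry_left (x := (0, x))
    simpa only [sub_zero] using hP
  have hmeas {f : Eu d → Eu d → ℝ≥0∞} (hf : Measurable (Function.uncurry f)) (c : Bool) :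
      Measurable fun v : ℝ × Eu d × Eu d => pk v.1 x v.2.1 * (j v.2.1 v.2.2 * f v.2.1 v.2.2) *
        fkTerm m pk j a b (n - i) (t - v.1) v.2.2 z c :=
    ((hP'.comp (f := fun v : ℝ × Eu d × Eu d => (v.1, v.2.1)) (by fun_prop)).mul
      ((measurable_mul_of hj hf).comp measurable_snd)).mul
      ((measurable_fkTerm hT hj ha hb (n - i) c).comp
        (f := fun v : ℝ × Eu d × Eu d => (t - v.1, v.2.2, z)) (by fun_prop))
  have hsum (c : Bool) : ∫⁻ v : ℝ × Eu d × Eu d,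
      (pk v.1 x v.2.1 * (j v.2.1 v.2.2 * a i v.2.1 v.2.2) *
        fkTerm m pk j a b (n - i) (t - v.1) v.2.2 z c +
      pk v.1 x v.2.1 * (j v.2.1 v.2.2 * b i v.2.1 v.2.2) *
        fkTerm m pk j a b (n - i) (t - v.1) v.2.2 z !c) ∂ν =
      firstJump m pk j a b (a i) (n - i) t x z c + firstJump m pk j a b (b i) (n - i) t x z (!c) :=
    lintegral_add_left (hmeas (ha i) c) _
  -- The induction hypothesis and the value of p are available at positive times only; the excluded
  -- end point is null.
  have hpos : ∀ᵐ v ∂ν, 0 < v.1 ∧ 0 < t - v.1 := by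
    have h1 : ∀ᵐ s : ℝ ∂(volume.restrict (Ioc 0 t)), 0 < s ∧ 0 < t - s := by
      rw [← restrict_Ioo_eq_restrict_Ioc]
      filter_upwards [ae_restrict_mem measurableSet_Ioo] with s hs
      exact ⟨hs.1, by linarith [hs.2]⟩
    exact Measure.quasiMeasurePreserving_fst.ae h1
  have key := integrable_of_toReal_sub (ν := ν) (f := fun v : ℝ × Eu d × Eu d =>
      (-1) ^ (n + 1) / (((i + 1).factorial : ℝ) * (n - i).factorial) *
      (p v.1 x v.2.1 * (jumpDensity α C v.2.1 v.2.2 *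
        F v.2.1 v.2.2 ^ (i + 1) * qTerm α C m p F (n - i) (t - v.1) v.2.2 z)))
    ((hmeas (ha i) true).add (hmeas (hb i) false)).aemeasurable
    ((hmeas (ha i) false).add (hmeas (hb i) true)).aemeasurable
    (by exact (hsum true).trans_ne (hfj true)) (by exact (hsum false).trans_ne (hfj false)) (by
      filter_upwards [hpos] with v hv
      have h1 := ih (t - v.1) hv.2 v.2.2
      have h2 := hab i v.2.1 v.2.2
      have hf (c) := hfin (n - i) (t - v.1) v.2.2 z c
      have hx := hpt v.1 x v.2.1
      have hj' := hjt v.2.1 v.2.2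
      have ha' := hat i v.2.1 v.2.2
      have hb' := hbt i v.2.1 v.2.2
      simp only [Pi.add_apply]
      rw [ENNReal.toReal_add, ENNReal.toReal_add]
      · simp only [ENNReal.toReal_mul, hp _ hv.1, hjC]
        have hn1 : ((i + 1).factorial : ℝ) ≠ 0 := by positivity
        have hn2 : ((n - i).factorial : ℝ) ≠ 0 := by positivity
        have hsg : (-1 : ℝ) ^ (n + 1) = (-1) ^ (i + 1) * (-1) ^ (n - i) := by
          rw [← pow_add]; congr 1; omega
        rw [neg_pow] at h2
        calc _ = p v.1 x v.2.1 * jumpDensity α C v.2.1 v.2.2 *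
              ((-1) ^ (i + 1) * F v.2.1 v.2.2 ^ (i + 1) / (i + 1).factorial) *
              ((-1 : ℝ) ^ (n - i) * qTerm α C m p F (n - i) (t - v.1) v.2.2 z /
                ((n - i).factorial : ℝ)) := by
              rw [hsg]; field_simp
          _ = _ := by rw [h1, ← h2]; ring
      all_goals
        refine ENNReal.mul_ne_top (ENNReal.mul_ne_top hx (ENNReal.mul_ne_top hj' ?_)) (hf _)
        assumption)
  have hc : (-1 : ℝ) ^ (n + 1) / (((i + 1).factorial : ℝ) * (n - i).factorial) ≠ 0 := by positivity
  have hfj' {c : Bool} := ENNReal.add_ne_top.1 (hfj c)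
  refine ⟨(integrable_const_mul_iff (isUnit_iff_ne_zero.2 hc) _).1 key.1, ?_⟩
  have h3 := key.2
  rw [integral_const_mul] at h3
  have h4 := hsum true
  have h5 := hsum false
  simp only [Bool.not_true, Bool.not_false] at h4 h5
  simp only [Pi.add_apply] at h3
  have e1 := ENNReal.toReal_add (hfj' (c := true)).1 (hfj' (c := true)).2
  have e2 := ENNReal.toReal_add (hfj' (c := false)).1 (hfj' (c := false)).2
  simp only [Bool.not_true, Bool.not_false] at e1 e2
  rw [h4, h5, e1, e2] at h3
  rw [← h3, ← mul_assoc]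
  have hn1 : ((i + 1).factorial : ℝ) ≠ 0 := by positivity
  have hn2 : ((n - i).factorial : ℝ) ≠ 0 := by positivity
  have h1 : ((-1 : ℝ) ^ (n + 1)) * (-1) ^ (n + 1) = 1 := by
    rw [← mul_pow]; simp
  have h6 : (-1 : ℝ) ^ (n + 1) * (((i + 1).factorial : ℝ) * (n - i).factorial) *
      ((-1) ^ (n + 1) / (((i + 1).factorial : ℝ) * (n - i).factorial)) = 1 := by
    rw [← mul_div_assoc, mul_right_comm, h1, one_mul, div_self (by positivity)]
  rw [h6, one_mul]

/-- The signed terms `q_n` are the differences of the two colours. -/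
theorem qTerm_eq (n : ℕ) {t : ℝ} (ht : 0 < t) (x z : Eu d) :
    (-1 : ℝ) ^ n * qTerm α C m p F n t x z / (n.factorial : ℝ) =
      (fkTerm m pk j a b n t x z true).toReal - (fkTerm m pk j a b n t x z false).toReal := by
  induction n using Nat.strong_induction_on generalizing t x z with
  | _ n ih =>
    cases n with
    | zero => simp [qTerm_zero, fkTerm_zero, hp t ht]
    | succ n =>
      have hfj (i : ℕ) (hi : i ∈ Finset.range (n + 1)) (c : Bool) :=
        ENNReal.add_ne_top.1 (ne_top_of_le_ne_top (hfin (n + 1) t x z c) (by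
          rw [fkTerm_succ hT hj ha hb]
          exact Finset.single_le_sum (f := fun i => firstJump m pk j a b (a i) (n - i) t x z c +
            firstJump m pk j a b (b i) (n - i) t x z !c) (fun _ _ => zero_le) hi))
      have hreal (c : Bool) : (fkTerm m pk j a b (n + 1) t x z c).toReal =
          ∑ i ∈ Finset.range (n + 1), ((firstJump m pk j a b (a i) (n - i) t x z c).toReal +
            (firstJump m pk j a b (b i) (n - i) t x z !c).toReal) := by
        rw [fkTerm_succ hT hj ha hb, ENNReal.toReal_sum fun i hi =>
          ENNReal.add_ne_top.2 (hfj i hi c)]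
        exact Finset.sum_congr rfl fun i hi => ENNReal.toReal_add (hfj i hi c).1 (hfj i hi c).2
      rw [hreal, hreal, ← Finset.sum_sub_distrib, qTerm]
      beta_reduce
      rw [Finset.sum_fin_eq_sum_range, Finset.mul_sum, Finset.sum_div]
      refine Finset.sum_congr rfl fun i hi => ?_
      have hin : i ≤ n := Nat.lt_succ_iff.1 (Finset.mem_range.1 hi)
      rw [dif_pos (Finset.mem_range.1 hi)]
      have hI := integrable_first_jump hT hj ha hb hfin hp hpt hjC hjt hat hbt hab hin (t := t) x z
        (fun s hs y => ih (n - i) (by omega) hs y z)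
      have hit := integral_iterated (m := m) ht.le (f := fun s w => p s x w)
        (h := fun s w y => jumpDensity α C w y * F w y ^ (i + 1) *
          qTerm α C m p F (n - i) (t - s) y z) hI.1
      rw [hit, hI.2]
      -- The binomial coefficient absorbs the two factorials, which are those of the Taylor term and
      -- of the normalized later factor.
      have hch : ((n + 1).choose (i + 1) : ℝ) * (((i + 1).factorial : ℝ) * (n - i).factorial) =
          (n + 1).factorial := by
        have := Nat.choose_mul_factorial_mul_factorial (n := n + 1) (k := i + 1) (by omega)
        rw [show n + 1 - (i + 1) = n - i by omega] at this
        rw [← this]; push_cast; ring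
      have hn : ((n + 1).factorial : ℝ) ≠ 0 := by positivity
      have h1 : ((-1 : ℝ) ^ (n + 1)) * (-1) ^ (n + 1) = 1 := by
        rw [← mul_pow]; simp
      rw [div_eq_iff hn, ← hch]
      simp only [Bool.not_true, Bool.not_false]
      linear_combination ((n + 1).choose (i + 1) : ℝ) *
        (((i + 1).factorial : ℝ) * (n - i).factorial) *
        (((firstJump m pk j a b (a i) (n - i) t x z true).toReal +
        (firstJump m pk j a b (b i) (n - i) t x z false).toReal) -
      ((firstJump m pk j a b (a i) (n - i) t x z false).toReal +
        (firstJump m pk j a b (b i) (n - i) t x z true).toReal)) * h1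

theorem hasSum_qTerm (hsum : ∀ t x z c, fkSum m pk j a b t x z c ≠ ∞) {t : ℝ} (ht : 0 < t)
    (x z : Eu d) : HasSum (fun n : ℕ => (-1 : ℝ) ^ n * qTerm α C m p F n t x z / (n.factorial : ℝ))
      ((fkSum m pk j a b t x z true).toReal - (fkSum m pk j a b t x z false).toReal) := by
  have h (c : Bool) : HasSum (fun n => (fkTerm m pk j a b n t x z c).toReal)
      (fkSum m pk j a b t x z c).toReal := by
    have h1 := ENNReal.summable_toReal (hsum t x z c)
    have h2 := ENNReal.tsum_toReal_eq (f := fun n => fkTerm m pk j a b n t x z c)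
      fun n => hfin n t x z c
    rw [fkSum, h2]
    exact h1.hasSum
  simp only [qTerm_eq hT hj ha hb hfin hp hpt hjC hjt hat hbt hab _ ht]
  exact (h true).sub (h false)

end Signed

include hT hj ha hb in
/-- The Chapman–Kolmogorov identity for the difference of the two colours. -/
theorem fkSum_sub_ck (hsum : ∀ t x z c, fkSum m pk j a b t x z c ≠ ∞) {t s : ℝ} (ht : 0 < t)
    (hs : 0 < s) (x z : Eu d) :
    Integrable (fun y =>
      ((fkSum m pk j a b t x y true).toReal - (fkSum m pk j a b t x y false).toReal) *
      ((fkSum m pk j a b s y z true).toReal - (fkSum m pk j a b s y z false).toReal)) m ∧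
    ∫ y, ((fkSum m pk j a b t x y true).toReal - (fkSum m pk j a b t x y false).toReal) *
      ((fkSum m pk j a b s y z true).toReal - (fkSum m pk j a b s y z false).toReal) ∂m =
      (fkSum m pk j a b (t + s) x z true).toReal - (fkSum m pk j a b (t + s) x z false).toReal := by
  have hm1 (c : Bool) : Measurable fun y => fkSum m pk j a b t x y c :=
    (measurable_fkSum hT hj ha hb c).comp (f := fun y : Eu d => (t, x, y)) (by fun_prop)
  have hm2 (c : Bool) : Measurable fun y => fkSum m pk j a b s y z c :=
    (measurable_fkSum hT hj ha hb c).comp (f := fun y : Eu d => (s, y, z)) (by fun_prop)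
  have hck := fkSum_ck hT hj ha hb ht hs x z
  have h1 := hck true
  have h2 := hck false
  rw [h1, h2]
  refine integrable_of_toReal_sub
    (((hm1 true).mul (hm2 true)).add ((hm1 false).mul (hm2 false))).aemeasurable
    (((hm1 true).mul (hm2 false)).add ((hm1 false).mul (hm2 true))).aemeasurable
    (h1 ▸ hsum _ _ _ _) (h2 ▸ hsum _ _ _ _) (Eventually.of_forall fun y => ?_)
  have hf (c c' : Bool) := ENNReal.mul_ne_top (hsum t x y c) (hsum s y z c')
  simp only [Bool.not_true, Bool.not_false]
  rw [ENNReal.toReal_add (hf _ _) (hf _ _), ENNReal.toReal_add (hf _ _) (hf _ _)]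
  simp only [ENNReal.toReal_mul]
  ring

end Coloured

end

/-! ### The transition density: measurability, continuity, Chapman–Kolmogorov. -/

section

open ProbabilityTheory

variable {d : ℕ}

instance (M : Eu d → ℝ) : SigmaFinite (refMeasure M) := by
  unfold refMeasure
  exact SigmaFinite.withDensity_ofReal _

/-- The transition density as an extended nonnegative function, zero at nonpositive times. -/
noncomputable def densityKernel (p : ℝ → Eu d → Eu d → ℝ) (t : ℝ) (x z : Eu d) : ℝ≥0∞ :=
  if 0 < t then ENNReal.ofReal (p t x z) else 0

/-- The jump intensity as an extended nonnegative function. -/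
noncomputable def jumpKernel (α : ℝ) (C : Eu d → Eu d → ℝ) (w y : Eu d) : ℝ≥0∞ :=
  ENNReal.ofReal (jumpDensity α C w y)

section Reference

variable {M : Eu d → ℝ} {M₀ Mbar : ℝ} (hMb : ∀ x, M₀ ≤ M x ∧ M x ≤ Mbar)
include hMb

theorem refMeasure_le : refMeasure M ≤ ENNReal.ofReal Mbar • volume := by
  rw [← withDensity_const]
  exact withDensity_mono (Eventually.of_forall fun x => ENNReal.ofReal_le_ofReal (hMb x).2)

theorem lintegral_refMeasure_le (f : Eu d → ℝ≥0∞) :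
    ∫⁻ x, f x ∂(refMeasure M) ≤ ENNReal.ofReal Mbar * ∫⁻ x, f x := by
  rw [← smul_eq_mul, ← lintegral_smul_measure]
  exact lintegral_mono' (refMeasure_le hMb) le_rfl

theorem refMeasure_ball_ne_top (r : ℝ) : refMeasure M (Metric.ball 0 r) ≠ ∞ := by
  refine ne_top_of_le_ne_top ?_ (refMeasure_le hMb _)
  rw [Measure.smul_apply, smul_eq_mul]
  exact ENNReal.mul_ne_top ENNReal.ofReal_ne_top measure_ball_lt_top.ne

theorem volume_absolutelyContinuous_refMeasure (hM : Measurable M) (hM₀ : 0 < M₀) :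
    (volume : Measure (Eu d)) ≪ refMeasure M :=
  withDensity_absolutelyContinuous' (by fun_prop) (Eventually.of_forall fun x => by
    have := (hMb x).1
    simp only [ne_eq, ENNReal.ofReal_eq_zero, not_le]
    linarith)

end Reference

section Density

variable {p : ℝ → Eu d → Eu d → ℝ}
  (hpcont : ContinuousOn (fun u : ℝ × Eu d × Eu d => p u.1 u.2.1 u.2.2) (Ioi 0 ×ˢ univ))

include hpcont in
theorem continuousOn_densityKernel :
    ContinuousOn (fun u : ℝ × Eu d × Eu d => densityKernel p u.1 u.2.1 u.2.2) (Ioi 0 ×ˢ univ) := by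
  refine (ENNReal.continuous_ofReal.comp_continuousOn hpcont).congr fun u hu => ?_
  have : 0 < u.1 := hu.1
  simp [densityKernel, this]

include hpcont in
theorem measurable_densityKernel :
    Measurable fun u : ℝ × Eu d × Eu d => densityKernel p u.1 u.2.1 u.2.2 := by
  classical
  have hs : MeasurableSet (Ioi (0 : ℝ) ×ˢ (univ : Set (Eu d × Eu d))) :=
    measurableSet_Ioi.prod MeasurableSet.univ
  have h := (continuousOn_densityKernel hpcont).measurable_piecewise
    (g := fun _ => (0 : ℝ≥0∞)) continuousOn_const hs
  refine (congrArg Measurable ?_).mp h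
  funext u
  by_cases hu : 0 < u.1
  · rw [piecewise_eq_of_mem _ _ _ (show u ∈ Ioi (0 : ℝ) ×ˢ univ from ⟨hu, mem_univ _⟩)]
  · rw [piecewise_eq_of_notMem _ _ _ (fun h => hu h.1)]
    simp [densityKernel, hu]

include hpcont in
theorem continuous_densityKernel {t : ℝ} (ht : 0 < t) :
    Continuous fun u : Eu d × Eu d => densityKernel p t u.1 u.2 :=
  continuousOn_univ.1 ((continuousOn_densityKernel hpcont).comp
    (f := fun u : Eu d × Eu d => (t, u)) (by fun_prop) fun u _ => ⟨ht, mem_univ _⟩)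

variable {α : ℝ} {M₁ M₂ : ℝ} (hα : 0 < α) (hM₁ : 0 < M₁) (hM₂ : 0 < M₂)
  (hpb : ∀ t, 0 < t → ∀ x y,
    M₁ * stableProfile α t x y ≤ p t x y ∧ p t x y ≤ M₂ * stableProfile α t x y)

theorem stableProfile_symm (α t : ℝ) (x y : Eu d) : stableProfile α t x y = stableProfile α t y x := by
  by_cases h : x = y
  · rw [h]
  · simp [stableProfile, h, Ne.symm h, norm_sub_rev]

theorem stableProfile_nonneg {t : ℝ} (ht : 0 < t) (x y : Eu d) : 0 ≤ stableProfile α t x y := by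
  unfold stableProfile
  split_ifs <;> positivity

include hα in
theorem stableProfile_le {t : ℝ} (ht : 0 < t) (x y : Eu d) :
    stableProfile α t x y ≤ t ^ (-((d : ℝ) / α)) := by
  unfold stableProfile
  refine mul_le_of_le_one_right (by positivity) ?_
  refine Real.rpow_le_one ?_ ?_ (by positivity)
  · split_ifs <;> positivity
  · split_ifs
    · exact le_rfl
    · exact min_le_left _ _

include hM₁ hpb in
theorem density_nonneg {t : ℝ} (ht : 0 < t) (x y : Eu d) : 0 ≤ p t x y :=
  (mul_nonneg hM₁.le (stableProfile_nonneg ht x y)).trans (hpb t ht x y).1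

include hα hM₂ hpb in
theorem densityKernel_le {t : ℝ} (ht : 0 < t) (x y : Eu d) :
    densityKernel p t x y ≤ ENNReal.ofReal M₂ * ENNReal.ofReal (t ^ (-((d : ℝ) / α))) := by
  rw [densityKernel, if_pos ht, ← ENNReal.ofReal_mul hM₂.le]
  exact ENNReal.ofReal_le_ofReal ((hpb t ht x y).2.trans
    (mul_le_mul_of_nonneg_left (stableProfile_le hα ht x y) hM₂.le))

include hM₁ hM₂ hpb in
-- The density need not be symmetric, but its two-sided bounds are. This suffices to turn the Kato
-- condition, stated from a starting point, into one towards an end point.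
theorem densityKernel_le_symm (t : ℝ) (x y : Eu d) :
    densityKernel p t x y ≤ ENNReal.ofReal (M₂ / M₁) * densityKernel p t y x := by
  unfold densityKernel
  split_ifs with ht
  · rw [← ENNReal.ofReal_mul (by positivity)]
    refine ENNReal.ofReal_le_ofReal ?_
    have h1 := (hpb t ht x y).2
    have h2 := (hpb t ht y x).1
    rw [stableProfile_symm] at h2
    calc _ ≤ _ := h1
      _ = M₂ / M₁ * (M₁ * stableProfile α t x y) := by field_simp
      _ ≤ _ := by gcongr
  · exact zero_le

/-- The singular profile of the transition density at small times. -/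
noncomputable def profile (d : ℕ) (α r : ℝ) : ℝ≥0∞ := ENNReal.ofReal (r ^ (-((d : ℝ) / α)))

include hα in
theorem profile_anti {a b : ℝ} (ha : 0 < a) (hab : a ≤ b) : profile d α b ≤ profile d α a :=
  ENNReal.ofReal_le_ofReal (Real.rpow_le_rpow_of_nonpos ha hab (by
    rw [Left.neg_nonpos_iff]; positivity))

theorem profile_half {a : ℝ} (ha : 0 < a) :
    profile d α (a / 2) = ENNReal.ofReal (2 ^ ((d : ℝ) / α)) * profile d α a := by
  rw [profile, profile, ← ENNReal.ofReal_mul (by positivity)]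
  congr 1
  rw [Real.div_rpow ha.le (by norm_num), Real.rpow_neg (by norm_num : (0 : ℝ) ≤ 2), div_inv_eq_mul,
    mul_comm]

variable {M : Eu d → ℝ} {M₀ Mbar : ℝ} (hMb : ∀ x, M₀ ≤ M x ∧ M x ≤ Mbar)

include hpcont hα hM₂ hpb hMb in
-- Dominated convergence: near a positive time the density is bounded, and the bounded support of g
-- makes the bound integrable although m is infinite in general.
theorem hasContinuousAction_densityKernel :
    HasContinuousAction (refMeasure M) (densityKernel p) := by
  intro g hg hg1 ⟨n, hn⟩ q₀ hq₀
  have h0 : 0 < q₀.1 := hq₀.1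
  have hnear : ∀ᶠ q in 𝓝[Ioi 0 ×ˢ univ] q₀, q₀.1 / 2 < q.1 := by
    refine nhdsWithin_le_nhds ?_
    exact (continuous_fst.tendsto q₀).eventually (lt_mem_nhds (by linarith))
  refine tendsto_lintegral_filter_of_dominated_convergence
    (fun z => ENNReal.ofReal M₂ * profile d α (q₀.1 / 2) * (Metric.ball 0 n).indicator 1 z)
    (Eventually.of_forall fun q => ?_) ?_ ?_ (Eventually.of_forall fun z => ?_)
  · exact ((measurable_densityKernel hpcont).comp (f := fun z : Eu d => (q.1, q.2, z))
      (by fun_prop)).mul hg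
  · filter_upwards [hnear] with q hq
    refine Eventually.of_forall fun z => ?_
    refine mul_le_mul' ((densityKernel_le hα hM₂ hpb (by linarith) _ _).trans ?_) ?_
    · exact mul_le_mul_right (profile_anti hα (by linarith) hq.le) _
    · by_cases hz : z ∈ Metric.ball (0 : Eu d) n
      · rw [indicator_of_mem hz]; exact hg1 z
      · rw [hn z (by simpa using hz)]; exact zero_le
  · rw [lintegral_const_mul' _ _ (by
      exact ENNReal.mul_ne_top ENNReal.ofReal_ne_top ENNReal.ofReal_ne_top),
      lintegral_indicator_one measurableSet_ball]
    exact ENNReal.mul_ne_top (ENNReal.mul_ne_top ENNReal.ofReal_ne_top ENNReal.ofReal_ne_top)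
      (refMeasure_ball_ne_top hMb _)
  · have h1 : ContinuousWithinAt (fun q : ℝ × Eu d => densityKernel p q.1 q.2 z)
        (Ioi 0 ×ˢ univ) q₀ :=
      ((continuousOn_densityKernel hpcont).comp (f := fun q : ℝ × Eu d => (q.1, q.2, z))
        (by fun_prop) fun q hq => ⟨hq.1, mem_univ _⟩) q₀ hq₀
    exact ENNReal.Tendsto.mul_const h1 (Or.inr (ne_top_of_le_ne_top ENNReal.one_ne_top (hg1 z)))

variable {Ω : Type*} [mΩ : MeasurableSpace Ω] {Z : HuntProcess (Eu d) Ω}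

theorem lintegral_extendZero_of_hasTransitionDensity {m : Measure (Eu d)}
    (hp : HasTransitionDensity Z m p) (hpm : ∀ t x, Measurable (densityKernel p t x))
    {t : ℝ≥0} (ht : 0 < t) (x : Eu d) {h : Eu d → ℝ≥0∞} (hh : Measurable h) :
    ∫⁻ ω, extendZero h (Z.X t ω) ∂(Z.P x) = ∫⁻ z, densityKernel p t x z * h z ∂m := by
  have hX := measurable_X Z t
  have hmeas : ((Z.P x).map (Z.X t)).comap ((↑) : Eu d → OnePoint (Eu d)) =
      m.withDensity (densityKernel p t x) := by
    refine Measure.ext fun B hB => ?_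
    rw [measurableEmbedding_coe.comap_apply,
      Measure.map_apply hX (measurableEmbedding_coe.measurableSet_image.2 hB),
      withDensity_apply _ hB]
    have h1 := hp t ht x B hB
    have h2 : Z.X t ⁻¹' ((↑) '' B) = {ω | ∃ y ∈ B, Z.X t ω = (y : OnePoint (Eu d))} := by
      ext ω
      simp [eq_comm]
    rw [h2, h1]
    refine lintegral_congr fun y => ?_
    have : (0 : ℝ) < t := ht
    simp [densityKernel, this]
  rw [← lintegral_map (measurable_extendZero hh) hX, ← lintegral_comap_coe _ h, hmeas,
    lintegral_withDensity_eq_lintegral_mul _ (hpm t x) hh]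
  rfl

variable {C : Eu d → Eu d → ℝ} {Cbar : ℝ} (hC : Measurable (Function.uncurry C))
  (hCbar : ∀ x y, 2 * C x y ≤ Cbar)

include hC in
theorem measurable_jumpKernel : Measurable (Function.uncurry (jumpKernel α C)) := by
  have h : Measurable fun q : Eu d × Eu d =>
      ENNReal.ofReal (2 * Function.uncurry C q / ‖q.1 - q.2‖ ^ ((d : ℝ) + α)) := by fun_prop
  exact h

include hCbar hMb hα in
-- On `offDiag d n` the intensity is bounded because |w - y| > 1/(n+1), and the targets lie in a
-- ball of finite measure.
theorem jumpRate_offDiag_le (n : ℕ) : ∃ c : ℝ≥0∞, c ≠ ∞ ∧ ∀ w,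
    jumpRate (refMeasure M) (jumpKernel α C) (fun x y => (offDiag d n).indicator 1 (x, y)) w ≤ c := by
  set κ : ℝ≥0∞ := ENNReal.ofReal (|Cbar| / (1 / ((n : ℝ) + 1)) ^ ((d : ℝ) + α)) with hκ
  refine ⟨κ * refMeasure M (Metric.ball 0 (n + 1)), ENNReal.mul_ne_top ENNReal.ofReal_ne_top
    (refMeasure_ball_ne_top hMb _), fun w => ?_⟩
  rw [← lintegral_indicator_one measurableSet_ball, ← lintegral_const_mul' _ _ ENNReal.ofReal_ne_top]
  refine lintegral_mono fun y => ?_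
  by_cases h : (w, y) ∈ offDiag d n
  · have hy : y ∈ Metric.ball (0 : Eu d) (n + 1) := by simpa using h.2.1
    simp only [indicator_of_mem h, indicator_of_mem hy, Pi.one_apply, mul_one]
    refine ENNReal.ofReal_le_ofReal ?_
    have hd : 1 / ((n : ℝ) + 1) ≤ ‖w - y‖ := by rw [← dist_eq_norm]; exact h.2.2.le
    unfold jumpDensity
    have hpow : (1 / ((n : ℝ) + 1)) ^ ((d : ℝ) + α) ≤ ‖w - y‖ ^ ((d : ℝ) + α) :=
      Real.rpow_le_rpow (by positivity) hd (by positivity)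
    have hpos : 0 < (1 / ((n : ℝ) + 1)) ^ ((d : ℝ) + α) := by positivity
    exact div_le_div₀ (abs_nonneg _) ((hCbar w y).trans (le_abs_self _)) hpos hpow
  · simp [indicator_of_notMem h]

include hpcont hα hM₂ hpb hMb hC hCbar in
theorem levyData (hp : HasTransitionDensity Z (refMeasure M) p)
    (hLevy : HasLevySystem Z α C (refMeasure M)) :
    LevyData Z (refMeasure M) (densityKernel p) (jumpKernel α C) where
  pk_meas := measurable_densityKernel hpcont
  pk_zero t x z ht := by simp [densityKernel, not_lt.2 ht]
  j_meas := measurable_jumpKernel hC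
  trans t ht x h hh := lintegral_extendZero_of_hasTransitionDensity hp (fun t x =>
    (measurable_densityKernel hpcont).comp (f := fun z : Eu d => (t, x, z)) (by fun_prop)) ht x hh
  levy f hf hf0 x t ht := by
    have := hLevy f hf hf0 x t ht
    simp only [jumpSum_eq_jumpOn] at this
    exact this
  rate_fin := jumpRate_offDiag_le hα hMb hCbar

include hpcont hα hM₂ hpb hMb in
-- The Markov property gives Chapman–Kolmogorov for m-almost every end point. Both sides are
-- continuous there, and Lebesgue measure is absolutely continuous with respect to m since M ≥ M₀ >
-- 0, so the identity holds everywhere.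
theorem isTransition_densityKernel {j : Eu d → Eu d → ℝ≥0∞} (hM : Measurable M) (hM₀ : 0 < M₀)
    (hD : LevyData Z (refMeasure M) (densityKernel p) j) :
    IsTransition (refMeasure M) (stP (densityKernel p)) where
  meas := (measurable_densityKernel hpcont).comp (f := fun q : (ℝ × Eu d) × (ℝ × Eu d) =>
    (q.2.1 - q.1.1, q.1.2, q.2.2)) (by fun_prop)
  causal s t x z h := hD.pk_zero _ _ _ (by simpa using h)
  mass s t x := pk_mass_le hD (t - s) x
  ck s r t x z hsr hrt := by
    obtain ⟨u, hu⟩ : ∃ u : ℝ≥0, (u : ℝ) = r - s := ⟨⟨r - s, by linarith⟩, rfl⟩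
    obtain ⟨v, hv⟩ : ∃ v : ℝ≥0, (v : ℝ) = t - r := ⟨⟨t - r, by linarith⟩, rfl⟩
    have hu0 : (0 : ℝ) < u := by linarith
    have hv0 : (0 : ℝ) < v := by linarith
    have huv : t - s = ((u + v : ℝ≥0) : ℝ) := by push_cast; linarith
    simp only [stP, huv, ← hu, ← hv]
    have hm1 : Measurable (densityKernel p u x) := measurable_pk_snd hD u x
    have hm2 : Measurable fun q : Eu d × Eu d => densityKernel p v q.1 q.2 :=
      (continuous_densityKernel hpcont hv0).measurable
    have hm3 : Measurable fun q : Eu d × Eu d => densityKernel p u x q.2 * densityKernel p v q.2 q.1 :=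
      (hm1.comp measurable_snd).mul (hm2.comp measurable_swap)
    have hm4 : Measurable fun z => ∫⁻ y, densityKernel p u x y * densityKernel p v y z ∂(refMeasure M) :=
      hm3.lintegral_prod_right'
    have hae : densityKernel p ((u + v : ℝ≥0) : ℝ) x =ᵐ[refMeasure M]
        fun z => ∫⁻ y, densityKernel p u x y * densityKernel p v y z ∂(refMeasure M) := by
      refine ae_eq_of_forall_setLIntegral_eq_of_sigmaFinite (measurable_pk_snd hD _ x) hm4
        fun B hB _ => ?_
      have hBm : Measurable (B.indicator (1 : Eu d → ℝ≥0∞)) := measurable_one.indicator hB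
      have h1 := hD.trans (u + v) (add_pos (show 0 < u from hu0) hv0) x _ hBm
      have h2 := lintegral_markov' Z (x : OnePoint (Eu d)) u v (W := fun _ => 1) measurable_const
        (measurable_extendZero hBm)
      simp only [one_mul, lintegral_transKernel_extendZero hD hBm (show 0 < v from hv0)] at h2
      have hm5 : Measurable fun y => ∫⁻ z, densityKernel p v y z * B.indicator 1 z ∂(refMeasure M) := by
        have : Measurable fun q : Eu d × Eu d => densityKernel p v q.1 q.2 * B.indicator 1 q.2 :=
          hm2.mul (hBm.comp measurable_snd)
        exact this.lintegral_prod_right'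
      rw [hD.trans u hu0 x _ hm5, h1] at h2
      have hind (f : Eu d → ℝ≥0∞) : ∫⁻ z, f z * B.indicator 1 z ∂(refMeasure M) =
          ∫⁻ z in B, f z ∂(refMeasure M) := by
        rw [← lintegral_indicator hB]
        refine lintegral_congr fun z => ?_
        by_cases hz : z ∈ B <;> simp [hz]
      simp only [hind] at h2
      rw [h2, lintegral_lintegral_swap (by exact hm3.aemeasurable)]
      refine lintegral_congr fun y => ?_
      exact (lintegral_const_mul _ (hm2.comp measurable_prodMk_left)).symm
    have hae' := (volume_absolutelyContinuous_refMeasure hMb hM hM₀).ae_le hae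
    have hc1 : Continuous (densityKernel p ((u + v : ℝ≥0) : ℝ) x) :=
      (continuous_densityKernel hpcont (by push_cast; linarith)).comp (f := fun z : Eu d => (x, z))
        (by fun_prop)
    -- Continuity in the end point uses the bound of the second density that is uniform in space,
    -- with the first density of mass at most one as integrable majorant.
    have hc2 : Continuous fun z =>
        ∫⁻ y, densityKernel p u x y * densityKernel p v y z ∂(refMeasure M) := by
      refine continuous_iff_continuousAt.2 fun z₀ => ?_
      refine tendsto_lintegral_filter_of_dominated_convergence
        (fun y => densityKernel p u x y * (ENNReal.ofReal M₂ * profile d α v))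
        (Eventually.of_forall fun z => hm3.comp measurable_prodMk_left)
        (Eventually.of_forall fun z => Eventually.of_forall fun y =>
          mul_le_mul_right (densityKernel_le hα hM₂ hpb hv0 y z) _) ?_
        (Eventually.of_forall fun y => ?_)
      · have hf : ENNReal.ofReal M₂ * profile d α v ≠ ∞ :=
          ENNReal.mul_ne_top ENNReal.ofReal_ne_top ENNReal.ofReal_ne_top
        rw [lintegral_mul_const' _ _ hf]
        exact ENNReal.mul_ne_top (ne_top_of_le_ne_top ENNReal.one_ne_top (pk_mass_le hD u x)) hf
      · refine ENNReal.Tendsto.const_mul ?_ (Or.inr ?_)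
        · exact (((continuous_densityKernel hpcont hv0).comp (f := fun z : Eu d => (y, z))
            (by fun_prop)).tendsto z₀)
        · rw [densityKernel, if_pos hu0]; exact ENNReal.ofReal_ne_top
    exact congrFun ((hc1.ae_eq_iff_eq volume hc2).1 hae') z

end Density

end

/-! ### The Kato hypotheses for the jump density. -/

section

open ProbabilityTheory

section Mass

variable {S : Type*} [MeasurableSpace S] {μ : Measure S} [SFinite μ]

theorem setLIntegral_lmul {a : ℝ × S → ℝ × S → ℝ≥0∞} {κ : S → S → ℝ≥0∞}
    (ha : Measurable (Function.uncurry a)) (hκ : Measurable (Function.uncurry κ)) (v : ℝ × S)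
    (s : ℝ) :
    ∫⁻ w in {w | s < w.1}, lmul μ κ a w v ∂(volume.prod μ) =
      ∫⁻ r in Ioi s, ∫⁻ u, a (r, u) v * ∫⁻ w, κ w u ∂μ ∂μ := by
  have hset : {w : ℝ × S | s < w.1} = Ioi s ×ˢ univ := by ext; simp
  rw [hset, ← Measure.prod_restrict, Measure.restrict_univ, lintegral_prod _ (by
    exact (measurable_lmul ha hκ).of_uncurry_right.aemeasurable)]
  refine lintegral_congr fun r => ?_
  have h1 : Measurable fun u => a (r, u) v := ha.of_uncurry_right.comp measurable_prodMk_left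
  unfold lmul
  rw [lintegral_lintegral_swap (by
    exact (hκ.mul (h1.comp measurable_snd)).aemeasurable)]
  refine lintegral_congr fun u => ?_
  rw [mul_comm]
  exact lintegral_mul_const (a (r, u) v) (f := fun w => κ w u) hκ.of_uncurry_right

end Mass

variable {d : ℕ}

/-- The potential of the jumps of size `F`. -/
noncomputable def jumpPotential (α : ℝ) (F : Eu d → Eu d → ℝ) (x : Eu d) : ℝ≥0∞ :=
  ∫⁻ y, ENNReal.ofReal (|F x y| / ‖x - y‖ ^ ((d : ℝ) + α))

theorem exists_kato_le {p : ℝ → Eu d → Eu d → ℝ} {V : Eu d → ℝ≥0∞} (hV : KatoClass p V)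
    {c θ : ℝ≥0∞} (hc : c ≠ ∞) (hθ : 0 < θ) :
    ∃ t₀ : ℝ, 0 < t₀ ∧ ∀ t ≤ t₀, ∀ x,
      c * ∫⁻ s in Ioc (0 : ℝ) t, ∫⁻ y, ENNReal.ofReal (p s x y) * V y ≤ θ := by
  have h1 := ENNReal.Tendsto.const_mul (a := c) hV (Or.inr hc)
  rw [mul_zero] at h1
  have h2 := (h1.eventually (ge_mem_nhds hθ)).and self_mem_nhdsWithin
  obtain ⟨t₀, h3, h4⟩ := h2.exists
  refine ⟨t₀, h4, fun t ht x => le_trans ?_ h3⟩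
  gcongr
  exact (lintegral_mono_set (Ioc_subset_Ioc le_rfl ht)).trans (le_iSup
    (fun x => ∫⁻ s in Ioc (0 : ℝ) t₀, ∫⁻ y, ENNReal.ofReal (p s x y) * V y) x)

section Kernel

variable {C : Eu d → Eu d → ℝ} {Cbar : ℝ} (hCbar : ∀ x y, 2 * C x y ≤ Cbar) {α : ℝ}
  {F : Eu d → Eu d → ℝ} {L : ℝ} (hL : ∀ x y, |F x y| ≤ L)

theorem exp_sub_one_le {u L : ℝ} (hu : 0 ≤ u) (huL : u ≤ L) : Real.exp u - 1 ≤ Real.exp L * u := by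
  have h1 : Real.exp u - 1 ≤ Real.exp u * u := by
    have := Real.add_one_le_exp (-u)
    have h2 : Real.exp u * Real.exp (-u) = 1 := by rw [← Real.exp_add]; simp
    nlinarith [Real.exp_pos u]
  exact h1.trans (mul_le_mul_of_nonneg_right (Real.exp_le_exp.2 huL) hu)

include hCbar hL in
theorem jumpKernel_mul_expAbs_le (w y : Eu d) :
    jumpKernel α C w y * expAbs F w y ≤ ENNReal.ofReal (|Cbar| * Real.exp L) *
      ENNReal.ofReal (|F w y| / ‖w - y‖ ^ ((d : ℝ) + α)) := by
  have h0 : 0 ≤ Real.exp |F w y| - 1 := by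
    have := Real.add_one_le_exp |F w y|
    have := abs_nonneg (F w y)
    linarith
  rw [jumpKernel, expAbs, ← ENNReal.ofReal_mul' h0, ← ENNReal.ofReal_mul (by positivity)]
  refine ENNReal.ofReal_le_ofReal ?_
  have h1 := exp_sub_one_le (abs_nonneg _) (hL w y)
  have hpow : 0 ≤ ‖w - y‖ ^ ((d : ℝ) + α) := by positivity
  calc jumpDensity α C w y * (Real.exp |F w y| - 1)
      ≤ |Cbar| / ‖w - y‖ ^ ((d : ℝ) + α) * (Real.exp L * |F w y|) := by
        refine mul_le_mul ?_ h1 h0 (by positivity)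
        exact div_le_div_of_nonneg_right ((hCbar w y).trans (le_abs_self _)) hpow
    _ = _ := by ring

variable {M : Eu d → ℝ} {M₀ Mbar : ℝ} (hMb : ∀ x, M₀ ≤ M x ∧ M x ≤ Mbar)

include hCbar hL hMb in
theorem lintegral_jump_right_le (w : Eu d) :
    ∫⁻ y, jumpKernel α C w y * expAbs F w y ∂(refMeasure M) ≤
      ENNReal.ofReal Mbar * (ENNReal.ofReal (|Cbar| * Real.exp L) * jumpPotential α F w) := by
  refine (lintegral_refMeasure_le hMb _).trans ?_
  gcongr
  rw [jumpPotential, ← lintegral_const_mul' _ _ ENNReal.ofReal_ne_top]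
  exact lintegral_mono fun y => jumpKernel_mul_expAbs_le hCbar hL w y

include hCbar hL hMb in
-- Integrating over the starting point of a jump produces the potential of the transposed function;
-- this is where the hypothesis on F(y,x) enters.
theorem lintegral_jump_left_le (y : Eu d) :
    ∫⁻ w, jumpKernel α C w y * expAbs F w y ∂(refMeasure M) ≤
      ENNReal.ofReal Mbar * (ENNReal.ofReal (|Cbar| * Real.exp L) *
        jumpPotential α (fun x y => F y x) y) := by
  refine (lintegral_refMeasure_le hMb _).trans ?_
  gcongr
  rw [jumpPotential, ← lintegral_const_mul' _ _ ENNReal.ofReal_ne_top]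
  refine lintegral_mono fun w => ?_
  rw [norm_sub_rev]
  exact jumpKernel_mul_expAbs_le hCbar hL w y

end Kernel

section Window

theorem setLIntegral_Iio_sub_le {f : ℝ → ℝ≥0∞} (hf : ∀ r ≤ 0, f r = 0) {s t t₀ : ℝ}
    (h : t ≤ s + t₀) : ∫⁻ r in Iio t, f (r - s) ≤ ∫⁻ r in Ioc 0 t₀, f r := by
  rw [← lintegral_indicator measurableSet_Iio, ← lintegral_indicator measurableSet_Ioc,
    ← lintegral_sub_right_eq_self ((Ioc 0 t₀).indicator f) s]
  refine lintegral_mono fun r => ?_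
  by_cases hr : r ∈ Iio t
  · rw [indicator_of_mem hr]
    rcases le_or_gt (r - s) 0 with h0 | h0
    · rw [hf _ h0]; exact zero_le
    · rw [indicator_of_mem]
      exact ⟨h0, by have : r < t := hr; linarith⟩
  · rw [indicator_of_notMem hr]; exact zero_le

theorem setLIntegral_Ioi_sub_le {f : ℝ → ℝ≥0∞} (hf : ∀ r ≤ 0, f r = 0) {s t t₀ : ℝ}
    (h : t ≤ s + t₀) : ∫⁻ r in Ioi s, f (t - r) ≤ ∫⁻ r in Ioc 0 t₀, f r := by
  rw [← lintegral_indicator measurableSet_Ioi, ← lintegral_indicator measurableSet_Ioc,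
    ← lintegral_sub_left_eq_self ((Ioc 0 t₀).indicator f) t]
  refine lintegral_mono fun r => ?_
  by_cases hr : r ∈ Ioi s
  · rw [indicator_of_mem hr]
    rcases le_or_gt (t - r) 0 with h0 | h0
    · rw [hf _ h0]; exact zero_le
    · rw [indicator_of_mem]
      exact ⟨h0, by have : s < r := hr; linarith⟩
  · rw [indicator_of_notMem hr]; exact zero_le

end Window

section Kato

variable {p : ℝ → Eu d → Eu d → ℝ}
  {α : ℝ} {M₁ M₂ : ℝ} (hα : 0 < α) (hM₁ : 0 < M₁) (hM₂ : 0 < M₂)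
  (hpb : ∀ t, 0 < t → ∀ x y,
    M₁ * stableProfile α t x y ≤ p t x y ∧ p t x y ≤ M₂ * stableProfile α t x y)
  {M : Eu d → ℝ} {M₀ Mbar : ℝ} (hMb : ∀ x, M₀ ≤ M x ∧ M x ≤ Mbar)

include hMb in
theorem setLIntegral_density_le {κ : Eu d → ℝ≥0∞} {c : ℝ≥0∞} (hc : c ≠ ∞) {V : Eu d → ℝ≥0∞}
    (hκ : ∀ x, κ x ≤ c * V x) (t : ℝ) (x : Eu d) :
    ∫⁻ s in Ioc (0 : ℝ) t, ∫⁻ y, densityKernel p s x y * κ y ∂(refMeasure M) ≤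
      ENNReal.ofReal Mbar * c * ∫⁻ s in Ioc (0 : ℝ) t, ∫⁻ y, ENNReal.ofReal (p s x y) * V y := by
  rw [← lintegral_const_mul' _ _ (ENNReal.mul_ne_top ENNReal.ofReal_ne_top hc)]
  refine setLIntegral_mono' measurableSet_Ioc fun s hs => ?_
  refine (lintegral_refMeasure_le hMb _).trans ?_
  rw [mul_assoc, ← lintegral_const_mul' _ _ hc]
  refine mul_le_mul_right (lintegral_mono fun y => ?_) _
  rw [densityKernel, if_pos hs.1, mul_left_comm]
  gcongr
  exact hκ y

include hα hM₁ hM₂ hpb hMb in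
theorem exists_isKato {C : Eu d → Eu d → ℝ} {Cbar : ℝ} (hCbar : ∀ x y, 2 * C x y ≤ Cbar)
    (hC : Measurable (Function.uncurry C)) {F : Eu d → Eu d → ℝ}
    (hF : JClass α p F) (hFt : JClass α p fun x y => F y x)
    (hT : IsTransition (refMeasure M) (stP (densityKernel p))) :
    ∃ t₀ θ B D ρ, IsKato (refMeasure M) (stP (densityKernel p))
      (fun w y => jumpKernel α C w y * expAbs F w y) t₀ θ B D ρ := by
  obtain ⟨L, hL⟩ := hF.bounded
  set c : ℝ≥0∞ := ENNReal.ofReal Mbar * ENNReal.ofReal (|Cbar| * Real.exp L) with hc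
  have hct : c ≠ ∞ := ENNReal.mul_ne_top ENNReal.ofReal_ne_top ENNReal.ofReal_ne_top
  set D : ℝ≥0∞ := ENNReal.ofReal (2 ^ ((d : ℝ) / α)) with hD
  -- The minimum meets both smallness conditions, θ ≤ 1/4 and D θ ≤ 1/4. The constant D = 2^(d/α) is
  -- the growth of t^(-d/α) when t is halved.
  set θ : ℝ≥0∞ := min (1 / 4) (1 / 4 / D) with hθ
  have hθ0 : 0 < θ := lt_min (by norm_num) (ENNReal.div_pos (by norm_num) ENNReal.ofReal_ne_top)
  obtain ⟨t₁, ht₁, h1⟩ := exists_kato_le (V := jumpPotential α F) hF.kato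
    (c := ENNReal.ofReal Mbar * c) (ENNReal.mul_ne_top ENNReal.ofReal_ne_top hct) hθ0
  -- The factor M₂ / M₁ pays for exchanging the arguments of the density, and one upper bound of M
  -- is spent on each of the two spatial integrals.
  obtain ⟨t₂, ht₂, h2⟩ := exists_kato_le (V := jumpPotential α fun x y => F y x) hFt.kato
    (c := ENNReal.ofReal (M₂ / M₁) * (ENNReal.ofReal Mbar * c))
    (ENNReal.mul_ne_top ENNReal.ofReal_ne_top (ENNReal.mul_ne_top ENNReal.ofReal_ne_top hct)) hθ0
  have hκ : Measurable (Function.uncurry fun w y => jumpKernel α C w y * expAbs F w y) :=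
    (measurable_jumpKernel hC).mul (measurable_expAbs hF.measurable)
  have h0 (r : ℝ) (hr : r ≤ 0) (x y : Eu d) : densityKernel p r x y = 0 := by
    simp [densityKernel, not_lt.2 hr]
  refine ⟨min t₁ t₂, θ, ENNReal.ofReal M₂, D, profile d α, ⟨lt_min ht₁ ht₂, ?_, ?_, ?_, ?_, ?_, ?_,
    min_le_left _ _, ?_⟩⟩
  · intro s t x hst
    rw [setLIntegral_rmul hT.meas hκ]
    refine (setLIntegral_Iio_sub_le (f := fun r => ∫⁻ z, densityKernel p r x z *
      ∫⁻ y, jumpKernel α C z y * expAbs F z y ∂(refMeasure M) ∂(refMeasure M))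
      (fun r hr => by simp [h0 r hr]) hst).trans ?_
    refine (setLIntegral_density_le hMb hct (fun z => ?_) _ _).trans (h1 _ (min_le_left _ _) x)
    rw [hc, mul_assoc]
    exact lintegral_jump_right_le hCbar hL hMb z
  · intro s t z hst
    rw [setLIntegral_lmul hT.meas hκ]
    refine (setLIntegral_Ioi_sub_le (f := fun r => ∫⁻ u, densityKernel p r u z *
      ∫⁻ w, jumpKernel α C w u * expAbs F w u ∂(refMeasure M) ∂(refMeasure M))
      (fun r hr => by simp [h0 r hr]) hst).trans ?_
    refine le_trans ?_ (h2 _ (min_le_right t₁ t₂) z)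
    rw [mul_assoc]
    refine le_trans ?_ (mul_le_mul_right (setLIntegral_density_le hMb
      (κ := fun u => ∫⁻ w, jumpKernel α C w u * expAbs F w u ∂(refMeasure M)) hct
      (fun u => ?_) _ z) _)
    rotate_left
    · rw [hc, mul_assoc]
      exact lintegral_jump_left_le hCbar hL hMb u
    · rw [← lintegral_const_mul' _ _ ENNReal.ofReal_ne_top]
      refine lintegral_mono fun r => ?_
      rw [← lintegral_const_mul' _ _ ENNReal.ofReal_ne_top]
      refine lintegral_mono fun u => ?_
      rw [← mul_assoc]
      gcongr
      exact densityKernel_le_symm hM₁ hM₂ hpb r u z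
  · intro s t x z hst
    exact densityKernel_le hα hM₂ hpb (by simpa using hst) x z
  · exact fun a b => profile_anti hα
  · exact fun a ha => (profile_half ha).le
  · exact fun a ha => ENNReal.mul_ne_top ENNReal.ofReal_ne_top ENNReal.ofReal_ne_top
  · calc D * θ ≤ D * (1 / 4 / D) := by gcongr; exact min_le_right _ _
      _ ≤ 1 / 4 := ENNReal.mul_div_le

end Kato

end

/-! ### Splitting the Taylor terms of e^{-F} - 1 by sign. -/

section

open ProbabilityTheory

variable {d : ℕ}

/-- The positive part of the term of order `i + 1` of `exp (-F) - 1`. -/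
noncomputable def expPos (F : Eu d → Eu d → ℝ) (i : ℕ) (w y : Eu d) : ℝ≥0∞ :=
  ENNReal.ofReal ((-F w y) ^ (i + 1) / (i + 1).factorial)

/-- The negative part of the term of order `i + 1` of `exp (-F) - 1`. -/
noncomputable def expNeg (F : Eu d → Eu d → ℝ) (i : ℕ) (w y : Eu d) : ℝ≥0∞ :=
  ENNReal.ofReal (-((-F w y) ^ (i + 1) / (i + 1).factorial))

section Taylor

variable {F : Eu d → Eu d → ℝ}

theorem measurable_expPos (hF : Measurable (Function.uncurry F)) (i : ℕ) :
    Measurable (Function.uncurry (expPos F i)) := by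
  have h : Measurable fun q : Eu d × Eu d =>
      ENNReal.ofReal ((-Function.uncurry F q) ^ (i + 1) / (i + 1).factorial) := by fun_prop
  exact h

theorem measurable_expNeg (hF : Measurable (Function.uncurry F)) (i : ℕ) :
    Measurable (Function.uncurry (expNeg F i)) := by
  have h : Measurable fun q : Eu d × Eu d =>
      ENNReal.ofReal (-((-Function.uncurry F q) ^ (i + 1) / (i + 1).factorial)) := by fun_prop
  exact h

theorem hasSum_exp_sub_one (u : ℝ) :
    HasSum (fun i : ℕ => u ^ (i + 1) / ((i + 1).factorial : ℝ)) (Real.exp u - 1) := by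
  have h := NormedSpace.expSeries_div_hasSum_exp u
  rw [← Real.exp_eq_exp_ℝ] at h
  have := (hasSum_nat_add_iff' 1).2 h
  simpa using this

theorem tsum_ofReal_abs_taylor (w y : Eu d) :
    ∑' i : ℕ, ENNReal.ofReal |(-F w y) ^ (i + 1) / ((i + 1).factorial : ℝ)| = expAbs F w y := by
  have h := hasSum_exp_sub_one |F w y|
  rw [expAbs, ← h.tsum_eq, ENNReal.ofReal_tsum_of_nonneg (fun i => by positivity) h.summable]
  refine tsum_congr fun i => ?_
  rw [abs_div, abs_pow, abs_neg, Nat.abs_cast]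

/-- The signs are split in each Taylor term, not in e^{-F} - 1 as a whole, so the total is e^{|F|} -
1, in general larger than |e^{-F} - 1|. This is what keeps the degrees apart for the comparison with
q_n. -/
theorem tsum_expPos_add_tsum_expNeg (w y : Eu d) :
    ∑' i, expPos F i w y + ∑' i, expNeg F i w y = expAbs F w y := by
  rw [← ENNReal.tsum_add, ← tsum_ofReal_abs_taylor]
  refine tsum_congr fun i => ?_
  unfold expPos expNeg
  rcases le_total 0 ((-F w y) ^ (i + 1) / ((i + 1).factorial : ℝ)) with h | h
  · rw [abs_of_nonneg h, ENNReal.ofReal_of_nonpos (by linarith : -_ ≤ (0 : ℝ)), add_zero]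
  · rw [abs_of_nonpos h, ENNReal.ofReal_of_nonpos h, zero_add]

theorem toReal_tsum_expPos_sub (w y : Eu d) :
    (∑' i, expPos F i w y).toReal - (∑' i, expNeg F i w y).toReal = Real.exp (-F w y) - 1 := by
  rw [← (hasSum_exp_sub_one (-F w y)).tsum_eq, tsum_eq_toReal_sub]
  · rfl
  · rw [tsum_ofReal_abs_taylor]; exact ENNReal.ofReal_ne_top

theorem toReal_expPos_sub (i : ℕ) (w y : Eu d) :
    (expPos F i w y).toReal - (expNeg F i w y).toReal =
      (-F w y) ^ (i + 1) / (i + 1).factorial := by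
  unfold expPos expNeg
  rw [ENNReal.toReal_ofReal', ENNReal.toReal_ofReal']
  exact max_zero_sub_max_neg_zero_eq_self _

end Taylor

section Finite

variable {m : Measure (Eu d)} [SFinite m] {pk : ℝ → Eu d → Eu d → ℝ≥0∞} {j : Eu d → Eu d → ℝ≥0∞}
  {a b : ℕ → Eu d → Eu d → ℝ≥0∞} (hT : IsTransition m (stP pk))
  (hj : Measurable (Function.uncurry j)) (ha : ∀ i, Measurable (Function.uncurry (a i)))
  (hb : ∀ i, Measurable (Function.uncurry (b i))) {t₀ : ℝ} {θ B D : ℝ≥0∞} {ρ : ℝ → ℝ≥0∞}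
  (hK : IsKato m (stP pk) (fun w y => j w y * ∑' i, a i w y + j w y * ∑' i, b i w y) t₀ θ B D ρ)
include hT hj ha hb hK

theorem fkSum_ne_top (t : ℝ) (x z : Eu d) (c : Bool) : fkSum m pk j a b t x z c ≠ ∞ := by
  have hA := measurable_mul_of hj (f := fun w y => ∑' i, a i w y) (Measurable.tsum ha)
  have hB := measurable_mul_of hj (f := fun w y => ∑' i, b i w y) (Measurable.tsum hb)
  have h := (hK.col hT.meas hA hB).pert_ne_top (isTransition_colP hT) (measurable_colK hA hB)
    (0, (x, true)) (t, (z, c))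
  rw [pert_eq_fkSum hT hj ha hb, sub_zero] at h
  cases c <;> exact h

theorem lintegral_fkSum_ne_top (t : ℝ) (x : Eu d) (c : Bool) :
    ∫⁻ z, fkSum m pk j a b t x z c ∂m ≠ ∞ := by
  have hA := measurable_mul_of hj (f := fun w y => ∑' i, a i w y) (Measurable.tsum ha)
  have hB := measurable_mul_of hj (f := fun w y => ∑' i, b i w y) (Measurable.tsum hb)
  have hC := isTransition_colP hT
  have hκ := measurable_colK hA hB
  obtain ⟨c₀, hc₀, h⟩ := (hK.col hT.meas hA hB).exists_mass_le hC hκ t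
  refine ne_top_of_le_ne_top hc₀ (le_trans ?_ (h 0 t (x, true) (by simp)))
  rw [lintegral_colMeasure (by
    exact (measurable_pert hC hκ).of_uncurry_left.comp measurable_prodMk_left)]
  refine lintegral_mono fun z => ?_
  simp only [pert_eq_fkSum hT hj ha hb, sub_zero]
  cases c
  · exact le_add_self
  · exact le_self_add

end Finite

end

end JumpFK

/-! ### The Feynman–Kac density. -/

theorem proposition3p5
    {d : ℕ} (hd : 1 ≤ d) (α : ℝ) (hα0 : 0 < α) (hα2 : α < 2)
    -- the reference measure `m(dx) = M(x) dx`
    (M : EuclideanSpace ℝ (Fin d) → ℝ) (hM : Measurable M)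
    (M₀ Mbar : ℝ) (hM₀ : 0 < M₀) (hMbounds : ∀ x, M₀ ≤ M x ∧ M x ≤ Mbar)
    -- the bounded coefficient of the Lévy system
    (C : EuclideanSpace ℝ (Fin d) → EuclideanSpace ℝ (Fin d) → ℝ)
    (hC : Measurable (Function.uncurry C)) (hC0 : ∀ x y, 0 ≤ C x y)
    (Cbar : ℝ) (hCbar : ∀ x y, 2 * C x y ≤ Cbar)
    -- the stable-like process and its transition density
    {Ω : Type*} [MeasurableSpace Ω] (Z : HuntProcess (EuclideanSpace ℝ (Fin d)) Ω)
    (hLevy : HasLevySystem Z α C (refMeasure M))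
    (p : ℝ → EuclideanSpace ℝ (Fin d) → EuclideanSpace ℝ (Fin d) → ℝ)
    (hp : HasTransitionDensity Z (refMeasure M) p)
    (hpcont : ContinuousOn
      (fun u : ℝ × EuclideanSpace ℝ (Fin d) × EuclideanSpace ℝ (Fin d) => p u.1 u.2.1 u.2.2)
      (Ioi 0 ×ˢ univ))
    (M₁ M₂ : ℝ) (hM₁ : 0 < M₁) (hM₂ : 0 < M₂)
    (hpbounds : ∀ t, 0 < t → ∀ x y,
      M₁ * stableProfile α t x y ≤ p t x y ∧ p t x y ≤ M₂ * stableProfile α t x y)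
    -- the jump functional
    (F : EuclideanSpace ℝ (Fin d) → EuclideanSpace ℝ (Fin d) → ℝ)
    (hF : JClass α p F) (hFtilde : JClass α p fun x y => F y x) :
    -- the integrals that define `q_n` and the series that defines `q` converge absolutely
    (∀ n i : ℕ, 1 ≤ i → i ≤ n → ∀ t : ℝ, 0 < t → ∀ x z,
      Integrable
        (fun v : ℝ × EuclideanSpace ℝ (Fin d) × EuclideanSpace ℝ (Fin d) =>
          p v.1 x v.2.1 * (jumpDensity α C v.2.1 v.2.2 * F v.2.1 v.2.2 ^ i *
            qTerm α C (refMeasure M) p F (n - i) (t - v.1) v.2.2 z))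
        ((volume.restrict (Ioc 0 t)).prod ((refMeasure M).prod (refMeasure M)))) ∧
    (∀ t : ℝ, 0 < t → ∀ x z,
      Summable fun n : ℕ =>
        (-1 : ℝ) ^ n * qTerm α C (refMeasure M) p F n t x z / (n.factorial : ℝ)) ∧
    -- `q` is the density of the Feynman–Kac semigroup
    (∀ g : EuclideanSpace ℝ (Fin d) → ℝ, Measurable g → (∃ K, ∀ z, |g z| ≤ K) →
      ∀ t : ℝ≥0, 0 < t → ∀ x : EuclideanSpace ℝ (Fin d),
        Integrable (fun z => qSeries α C (refMeasure M) p F t x z * g z) (refMeasure M) ∧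
        (∀ᵐ ω ∂(Z.P x), Summable fun s : Ioc (0 : ℝ≥0) t =>
          extendZero₂ F (Function.leftLim (fun u => Z.X u ω) s.1) (Z.X s.1 ω)) ∧
        Integrable (fun ω => Real.exp (-jumpSum Z F t ω) * extendZero g (Z.X t ω)) (Z.P x) ∧
        ∫ z, qSeries α C (refMeasure M) p F t x z * g z ∂(refMeasure M) =
          ∫ ω, Real.exp (-jumpSum Z F t ω) * extendZero g (Z.X t ω) ∂(Z.P x)) ∧
    -- the Chapman–Kolmogorov identity
    (∀ t s : ℝ, 0 < t → 0 < s → ∀ x z,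
      Integrable (fun y => qSeries α C (refMeasure M) p F t x y *
        qSeries α C (refMeasure M) p F s y z) (refMeasure M) ∧
      ∫ y, qSeries α C (refMeasure M) p F t x y *
          qSeries α C (refMeasure M) p F s y z ∂(refMeasure M) =
        qSeries α C (refMeasure M) p F (t + s) x z) := by
  have hD := JumpFK.levyData hpcont hα0 hM₂ hpbounds hMbounds hC hCbar hp hLevy
  have hA := JumpFK.hasContinuousAction_densityKernel hpcont hα0 hM₂ hpbounds hMbounds
  have hT := JumpFK.isTransition_densityKernel hpcont hα0 hM₂ hpbounds hMbounds hM hM₀ hD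
  obtain ⟨t₀, θ, B, D, ρ, hK⟩ := JumpFK.exists_isKato hα0 hM₁ hM₂ hpbounds hMbounds hCbar hC hF
    hFtilde hT
  have hj := hD.j_meas
  have ha := JumpFK.measurable_expPos hF.measurable
  have hb := JumpFK.measurable_expNeg hF.measurable
  have hsum : (fun w y => JumpFK.jumpKernel α C w y * ∑' i, JumpFK.expPos F i w y +
      JumpFK.jumpKernel α C w y * ∑' i, JumpFK.expNeg F i w y) =
      fun w y => JumpFK.jumpKernel α C w y * JumpFK.expAbs F w y := by
    funext w y
    rw [← mul_add, JumpFK.tsum_expPos_add_tsum_expNeg]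
  -- The Kato constants found for e^{|F|} - 1 serve the coloured series, since the rates of the two
  -- kinds of jumps add up to this one.
  have hK' := hK
  rw [← hsum] at hK'
  have hfk := JumpFK.fkSum_ne_top hT hj ha hb hK'
  have hmass := JumpFK.lintegral_fkSum_ne_top hT hj ha hb hK'
  have hfin : ∀ n t x z c, JumpFK.fkTerm (refMeasure M) (JumpFK.densityKernel p)
      (JumpFK.jumpKernel α C) (JumpFK.expPos F) (JumpFK.expNeg F) n t x z c ≠ ∞ :=
    fun n t x z c => ne_top_of_le_ne_top (hfk t x z c) (ENNReal.le_tsum n)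
  have hpr : ∀ t, 0 < t → ∀ x z, (JumpFK.densityKernel p t x z).toReal = p t x z := by
    intro t ht x z
    rw [JumpFK.densityKernel, if_pos ht,
      ENNReal.toReal_ofReal (JumpFK.density_nonneg hM₁ hpbounds ht x z)]
  have hpt : ∀ t x z, JumpFK.densityKernel p t x z ≠ ∞ := by
    intro t x z
    unfold JumpFK.densityKernel
    split_ifs
    · exact ENNReal.ofReal_ne_top
    · exact ENNReal.zero_ne_top
  have hjC : ∀ w y, (JumpFK.jumpKernel α C w y).toReal = jumpDensity α C w y := fun w y =>
    ENNReal.toReal_ofReal (div_nonneg (mul_nonneg zero_le_two (hC0 w y)) (by positivity))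
  have hjt : ∀ w y, JumpFK.jumpKernel α C w y ≠ ∞ := fun w y => ENNReal.ofReal_ne_top
  have hat : ∀ i w y, JumpFK.expPos F i w y ≠ ∞ := fun i w y => ENNReal.ofReal_ne_top
  have hbt : ∀ i w y, JumpFK.expNeg F i w y ≠ ∞ := fun i w y => ENNReal.ofReal_ne_top
  have hab := JumpFK.toReal_expPos_sub (F := F)
  have hS {t : ℝ} (ht : 0 < t) (x z : EuclideanSpace ℝ (Fin d)) :=
    JumpFK.hasSum_qTerm hT hj ha hb hfin hpr hpt hjC hjt hat hbt hab hfk ht x z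
  have hq {t : ℝ} (ht : 0 < t) (x z : EuclideanSpace ℝ (Fin d)) := (hS ht x z).tsum_eq
  refine ⟨?_, fun t ht x z => (hS ht x z).summable, ?_, ?_⟩
  · intro n i hi hin t ht x z
    -- The coloured expansion counts orders and powers from zero, so both indices are lowered by
    -- one.
    obtain ⟨n, rfl⟩ : ∃ k, n = k + 1 := ⟨n - 1, by omega⟩
    obtain ⟨i, rfl⟩ : ∃ k, i = k + 1 := ⟨i - 1, by omega⟩
    rw [Nat.add_sub_add_right]
    exact (JumpFK.integrable_first_jump hT hj ha hb hfin hpr hpt hjC hjt hat hbt hab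
      (by omega : i ≤ n) x z fun s hs y => JumpFK.qTerm_eq hT hj ha hb hfin hpr hpt hjC hjt hat
        hbt hab (n - i) hs y z).1
  · intro g hg hgK t ht x
    obtain ⟨K, hgK⟩ := hgK
    have ht' : (0 : ℝ) < t := ht
    have hfinJ := JumpFK.lintegral_jumpOn_expAbs_ne_top hD hF.measurable hF.diagonal hT hK x ht
    have hmz (c : Bool) : Measurable fun z => JumpFK.fkSum (refMeasure M) (JumpFK.densityKernel p)
        (JumpFK.jumpKernel α C) (JumpFK.expPos F) (JumpFK.expNeg F) t x z c :=
      (JumpFK.measurable_fkSum hT hj ha hb c).comp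
        (f := fun z : EuclideanSpace ℝ (Fin d) => ((t : ℝ), x, z)) (by fun_prop)
    -- The comparison is made with a and b summed over all Taylor orders; `pert_eq_fkSum` then
    -- rewrites the two colours as sums of the coloured terms, whose difference is q.
    have key := JumpFK.integral_exp_neg_jumpSum hD hF.measurable hF.diagonal ht hfinJ (hmz true)
      (hmz false) (hmass _ _ _) (hmass _ _ _) (fun z => hfk _ _ _ _) (fun z => hfk _ _ _ _)
      (fun g hg hg1 => by
        have h := JumpFK.lintegral_expWeight_add_pert hD hF.measurable hF.diagonal hA hT hK
          (a := fun w y => ∑' i, JumpFK.expPos F i w y) (b := fun w y => ∑' i, JumpFK.expNeg F i w y)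
          (Measurable.tsum ha) (Measurable.tsum hb) JumpFK.tsum_expPos_add_tsum_expNeg
          JumpFK.toReal_tsum_expPos_sub x ht hg hg1
        simp only [JumpFK.pert_eq_fkSum hT hj ha hb, sub_zero] at h
        exact h) hg hgK
    have hqe : (fun z => qSeries α C (refMeasure M) p F t x z * g z) = fun z =>
        ((JumpFK.fkSum (refMeasure M) (JumpFK.densityKernel p) (JumpFK.jumpKernel α C)
          (JumpFK.expPos F) (JumpFK.expNeg F) t x z true).toReal -
        (JumpFK.fkSum (refMeasure M) (JumpFK.densityKernel p) (JumpFK.jumpKernel α C)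
          (JumpFK.expPos F) (JumpFK.expNeg F) t x z false).toReal) * g z := by
      funext z
      rw [qSeries, hq ht']
    rw [hqe]
    exact ⟨key.1, (JumpFK.ae_summable_jumpSum hD hF.measurable hF.diagonal ht hfinJ).mono
      fun ω hω => hω.1, key.2⟩
  · intro t s ht hs x z
    have h := JumpFK.fkSum_sub_ck hT hj ha hb hfk ht hs x z
    simp only [qSeries, hq ht, hq hs, hq (add_pos ht hs)]
    exact h
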